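/- Let $X$ be a smooth $n$-dimensional manifold without boundary (Hausdorff, second countable), and let $o\subset T^*X$ be the zero section. *Definitions.* Let $\mathsf S=[T^*\mathbb R^n\times[0,1)_h;\,o\times 0]$ be the real blow-up, with front face ff and side face sf (the lift of $h=0$), and let $S^{m,l}(\mathsf S)=\rho_{\rm sf}^{-m}\rho_{\rm ff}^{-l}C_c^\infty(\mathsf S)$, where $m,l\in\mathbb R$. Let $\mathrm{Op}_l(a)$ be the family of operators, $0<h<1$, with Schwartz kernel $(2\pi h)^{-n}\int e^{i(x-y)\cdot\xi/h}\chi(x,y)a(x,\xi,h)\,d\xi$, where $\chi$ is a smooth function of $|x-y|^2$ that equals $1$ near the diagonal and is properly supported. The space $\mathcal R^l(X)$ of residual operators consists of the families $R=(R_h)_{0<h<1}$ of linear operators on $C^\infty(X)$ with properly supported smooth Schwartz kernels $\kappa$ that in local coordinates satisfy $|h^l(h\partial_h)^\alpha\partial_x^\beta\partial_y^\gamma\kappa|\le C_{\alpha\beta\gamma}$ for all $\alpha,\beta,\gamma$, locally uniformly in $x,y$ and in $h\in[0,1)$. The space $\Psi_{2,h}^{m,l}(X;o)$ consists of the families $A=(A_h)_{0<h<1}$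 of linear operators $C^\infty(X)\to C^\infty(X)$ with properly supported Schwartz kernels such that $\phi A\psi=\mathrm{Op}_l(a)+R$, with $a\in S^{m,l}(\mathsf S)$ and $R\in\mathcal R^l(\mathbb R^n)$, in every coordinate chart $U$ and for all $\phi,\psi\in C_c^\infty(U)$, while $\phi A\psi\in\mathcal R^l(X)$ for all $\phi,\psi\in C_c^\infty(X)$ with disjoint supports. For $r\in\mathbb R$ let $S^r([T^*X;o])$ be the space of functions $\rho_{\rm ff}^{-r}f$, where $f\in C^\infty([T^*X;o])$ has fibre-compact support: its support meets the preimage of each compact subset of $X$ in a compact set (for compact $X$ this means compact support). The principal symbol $\sigma_{k,l}(A)$ of $A\in\Psi_{2,h}^{k,l}(X;o)$ is defined near a point over $p\in X$ as $(h^ka)|_{\rm sf}$, where $\phi A\phi=\mathrm{Op}_l(a)+R$ with $a\in S^{k,l}(\mathsf S)$ and $R\in\mathcal R^l(\mathbb R^n)$ in a chart, $\phi=1$ near $p$, and sf is identified with $[T^*\mathbb R^n;o]$ in the canonical coordinates of the chart. *Statement.* For all $k,l,k',l'\in\mathbb R$: 1. The principal symbol is a well-defined linear map $\sigma_{k,l}:\Psi_{2,h}^{k,l}(X;o)\to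 S^{l-k}([T^*X;o])$, independent of all choices. Moreover $\mathcal R^l(X)\subset\Psi_{2,h}^{k,l}(X;o)$, and $\sigma_{k,l}(A+R)=\sigma_{k,l}(A)$ for $A\in\Psi_{2,h}^{k,l}(X;o)$ and $R\in\mathcal R^l(X)$. 2. The principal symbol sequence $$0\to\Psi_{2,h}^{k-1,l}(X;o)\to\Psi_{2,h}^{k,l}(X;o)\xrightarrow{\ \sigma_{k,l}\ }S^{l-k}([T^*X;o])\to0,$$ whose first map is inclusion, is exact. 3. The principal symbol is a homomorphism of $*$-algebras. If $A\in\Psi_{2,h}^{k,l}(X;o)$ and $B\in\Psi_{2,h}^{k',l'}(X;o)$, then $AB\in\Psi_{2,h}^{k+k',l+l'}(X;o)$ and $\sigma_{k+k',l+l'}(AB)=\sigma_{k,l}(A)\,\sigma_{k',l'}(B)$. For every smooth positive density $\mu$ on $X$, the operator $A$ has a formal adjoint $A^*\in\Psi_{2,h}^{k,l}(X;o)$ with respect to $L^2(X,\mu)$, and $\sigma_{k,l}(A^*)=\overline{\sigma_{k,l}(A)}$. 4. If $A\in\Psi_{2,h}^{k,l}(X;o)$ and $B\in\Psi_{2,h}^{k',l'}(X;o)$,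 then $i[A,B]\in\Psi_{2,h}^{k+k'-1,l+l'}(X;o)$ and $$\sigma_{k+k'-1,l+l'}(i[A,B])=\{\sigma_{k,l}(A),\sigma_{k',l'}(B)\},$$ where $\{f,g\}=\sum_j(\partial_{\xi_j}f\,\partial_{x_j}g-\partial_{x_j}f\,\partial_{\xi_j}g)$ in canonical coordinates is the Poisson bracket of the symplectic form lifted from $T^*X$. -/

import Mathlib

open Set Filter Topology MeasureTheory
open scoped Manifold ContDiff

noncomputable section

namespace TwoMicro

/-- The model space `ℝⁿ`. -/
abbrev E (n : ℕ) : Type := EuclideanSpace ℝ (Fin n)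

/-! ## Total symbols, quantization and residual kernels on `ℝⁿ` -/

/-- The polar radius `|(ξ, h)|`. The blow-up `[T^*ℝⁿ × [0,1); o × 0]` is
`{(x, (ω, τ), r) : |ω|² + τ² = 1, τ ≥ 0, r ≥ 0, r τ < 1}` with blow-down map
`(x, (ω, τ), r) ↦ (x, ξ = r ω, h = r τ)`; `r` is a boundary defining function of the
front face and `τ = h / r` one of the side face. -/
def polarRadius {n : ℕ} (ξ : E n) (h : ℝ) : ℝ := Real.sqrt (‖ξ‖ ^ 2 + h ^ 2)

/-- `a ∈ S^{m,l} = ρ_sf^{-m} ρ_ff^{-l} C_c^∞([T^*ℝⁿ × [0,1); o × 0])`, as a function of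
`(x, ξ, h)`, `0 < h < 1`. A smooth function on the blow-up is the restriction of a smooth
function `b` of `(x, ω, τ, r)`; the last clause makes the support compact in `h ∈ [0,1)`. -/
def IsTotalSymbol {n : ℕ} (m l : ℝ) (a : E n × E n × ℝ → ℂ) : Prop :=
  (∃ b : E n × E n × ℝ × ℝ → ℂ, ContDiff ℝ ∞ b ∧ HasCompactSupport b ∧
    ∀ (x ξ : E n) (h : ℝ), 0 < h → h < 1 →
      a (x, ξ, h) =
        (((h / polarRadius ξ h) ^ (-m) * (polarRadius ξ h) ^ (-l) : ℝ) : ℂ) *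
          b (x, (polarRadius ξ h)⁻¹ • ξ, h / polarRadius ξ h, polarRadius ξ h)) ∧
  ∃ h₀ < (1 : ℝ), ∀ (x ξ : E n) (h : ℝ), h₀ ≤ h → h < 1 → a (x, ξ, h) = 0

/-- A smooth cutoff, equal to `1` for `|x - y| ≤ 1` and to `0` for `|x - y|² ≥ 2`. -/
def diagCutoff {n : ℕ} (x y : E n) : ℝ := Real.smoothTransition (2 - ‖x - y‖ ^ 2)

/-- The Schwartz kernel at `(x, y, h)` of the left semiclassical quantization of `a`. -/
def leftKernel {n : ℕ} (a : E n × E n × ℝ → ℂ) : E n × E n × ℝ → ℂ := fun q =>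
  (((2 * Real.pi * q.2.2) ^ n)⁻¹ : ℝ) *
    ∫ ξ : E n, Complex.exp (Complex.I * ((inner ℝ (q.1 - q.2.1) ξ / q.2.2 : ℝ) : ℂ)) *
      ((diagCutoff q.1 q.2.1 : ℝ) : ℂ) * a (q.1, ξ, q.2.2)

/-- `ℝⁿ × ℝⁿ × (0,1)`. -/
def kernelDomain (n : ℕ) : Set (E n × E n × ℝ) := univ ×ˢ univ ×ˢ Ioo (0 : ℝ) 1

/-- The derivative of `F` along `v₁ · ∂_x + v₂ · ∂_y + v₃ h ∂_h`. -/
def bDeriv {n : ℕ} (v : E n × E n × ℝ) (F : E n × E n × ℝ → ℂ) : E n × E n × ℝ → ℂ :=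
  fun q => fderiv ℝ F q (v.1, v.2.1, q.2.2 * v.2.2)

/-- Iterated derivatives along vector fields tangent to `h = 0`. -/
def bDerivs {n : ℕ} (L : List (E n × E n × ℝ)) (F : E n × E n × ℝ → ℂ) :
    E n × E n × ℝ → ℂ :=
  L.foldr bDeriv F

/-- Kernels of residual operators of order `l` on `ℝⁿ`: smooth and properly supported, with
`|h^l (h∂_h)^α ∂_x^β ∂_y^γ F| ≤ C_{αβγ}`, uniformly for `h` in compact subsets of `[0,1)`. -/
structure IsResidualKernel {n : ℕ} (l : ℝ) (F : E n × E n × ℝ → ℂ) : Prop where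
  smooth : ContDiffOn ℝ ∞ F (kernelDomain n)
  proper : ∀ K : Set (E n), IsCompact K → ∀ h₀ < (1 : ℝ), ∃ K' : Set (E n), IsCompact K' ∧
    ∀ (x y : E n) (h : ℝ), 0 < h → h ≤ h₀ → F (x, y, h) ≠ 0 →
      (x ∈ K → y ∈ K') ∧ (y ∈ K → x ∈ K')
  bound : ∀ (L : List (E n × E n × ℝ)), ∀ h₀ < (1 : ℝ), ∃ C : ℝ,
    ∀ (x y : E n) (h : ℝ), 0 < h → h ≤ h₀ → h ^ l * ‖bDerivs L F (x, y, h)‖ ≤ C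

/-! ## Families of operators on a manifold -/

section Manifold

variable (n : ℕ) (X : Type*) [TopologicalSpace X] [ChartedSpace (E n) X]

/-- `C^∞(X)`, complex valued. -/
def smoothFn : Subalgebra ℂ (X → ℂ) where
  carrier := {f | ContMDiff 𝓘(ℝ, E n) 𝓘(ℝ, ℂ) ∞ f}
  mul_mem' {f g} hf hg := by
    have h := (contDiff_fst.mul contDiff_snd : ContDiff ℝ ∞ fun p : ℂ × ℂ => p.1 * p.2)
    exact h.contMDiff.comp (ContMDiff.prodMk_space (f := f) (g := g) hf hg)
  add_mem' hf hg := ContMDiff.add hf hg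
  algebraMap_mem' _ := contMDiff_const

/-- Families `A = (A_h)`, `0 < h < 1`, of linear operators `C^∞(X) → C^∞(X)`, an algebra under
composition for each `h`. -/
abbrev OpFamily : Type _ := Ioo (0 : ℝ) 1 → Module.End ℂ (smoothFn n X)

variable {n X}

/-- Proper support: locally uniformly in `h ∈ [0,1)`, functions supported in a compact set are
mapped to functions supported in a compact set, and the values of `A u` on a compact set depend
only on `u` on a compact set. -/
def ProperlySupported (A : OpFamily n X) : Prop :=
  ∀ K : Set X, IsCompact K → ∀ h₀ < (1 : ℝ), ∃ K' : Set X, IsCompact K' ∧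
    ∀ h : Ioo (0 : ℝ) 1, (h : ℝ) ≤ h₀ → ∀ u : smoothFn n X,
      ((∀ x ∉ K, (u : X → ℂ) x = 0) → ∀ x ∉ K', (A h u : X → ℂ) x = 0) ∧
      ((∀ x ∈ K', (u : X → ℂ) x = 0) → ∀ x ∈ K, (A h u : X → ℂ) x = 0)

/-- `e` is a chart of the smooth structure of `X`. -/
def IsChart (e : OpenPartialHomeomorph X (E n)) : Prop :=
  e ∈ IsManifold.maximalAtlas 𝓘(ℝ, E n) ∞ X

/-- `φ ∈ C_c^∞(U)` for the domain `U` of the chart `e`. -/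
def IsCutoff (e : OpenPartialHomeomorph X (E n)) (φ : smoothFn n X) : Prop :=
  HasCompactSupport (φ : X → ℂ) ∧ tsupport (φ : X → ℂ) ⊆ e.source

/-- `κ` is the Schwartz kernel of `φ A ψ`, in the coordinates `e` on the left and `e'` on the
right and extended by zero to `ℝⁿ × ℝⁿ`. -/
structure IsLocalKernel (A : OpFamily n X) (e e' : OpenPartialHomeomorph X (E n))
    (φ ψ : smoothFn n X) (κ : E n × E n × ℝ → ℂ) : Prop where
  smooth : ContDiffOn ℝ ∞ κ (kernelDomain n)
  supp : ∀ (x y : E n) (h : ℝ), 0 < h → h < 1 → κ (x, y, h) ≠ 0 →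
    x ∈ e '' tsupport (φ : X → ℂ) ∧ y ∈ e' '' tsupport (ψ : X → ℂ)
  eq : ∀ (h : Ioo (0 : ℝ) 1) (u : smoothFn n X), ∀ p ∈ e.source,
    (φ : X → ℂ) p * (A h (ψ * u) : X → ℂ) p =
      ∫ y : E n, κ (e p, y, (h : ℝ)) * (u : X → ℂ) (e'.symm y)

/-- In the chart `e`, `φ A ψ = Op_l(a) + R` with `a ∈ S^{m,l}` and `R` residual of order `l`. -/
def IsLocalSymbol (m l : ℝ) (A : OpFamily n X) (e : OpenPartialHomeomorph X (E n))
    (φ ψ : smoothFn n X) (a : E n × E n × ℝ → ℂ) : Prop :=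
  IsTotalSymbol m l a ∧ ∃ κ : E n × E n × ℝ → ℂ, IsLocalKernel A e e φ ψ κ ∧
    IsResidualKernel l (fun q => κ q - leftKernel a q)

/-- In the charts `e`, `e'`, `φ A ψ` is residual of order `l`. -/
def IsLocallyResidual (l : ℝ) (A : OpFamily n X) (e e' : OpenPartialHomeomorph X (E n))
    (φ ψ : smoothFn n X) : Prop :=
  ∃ κ : E n × E n × ℝ → ℂ, IsLocalKernel A e e' φ ψ κ ∧ IsResidualKernel l κ

/-! ### Helper facts: these conditions are linear -/

lemma isOpen_kernelDomain : IsOpen (kernelDomain n) :=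
  isOpen_univ.prod (isOpen_univ.prod isOpen_Ioo)

lemma mem_kernelDomain {x y : E n} {h : ℝ} (h0 : 0 < h) (h1 : h < 1) :
    (x, y, h) ∈ kernelDomain n := ⟨mem_univ _, mem_univ _, h0, h1⟩

lemma bDeriv_smooth (v : E n × E n × ℝ) {F : E n × E n × ℝ → ℂ}
    (hF : ContDiffOn ℝ ∞ F (kernelDomain n)) :
    ContDiffOn ℝ ∞ (bDeriv v F) (kernelDomain n) := by
  have h1 : ContDiffOn ℝ ∞ (fderiv ℝ F) (kernelDomain n) :=
    hF.fderiv_of_isOpen isOpen_kernelDomain (by simp)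
  refine h1.clm_apply (ContDiff.contDiffOn ?_)
  fun_prop

lemma bDerivs_smooth (L : List (E n × E n × ℝ)) {F : E n × E n × ℝ → ℂ}
    (hF : ContDiffOn ℝ ∞ F (kernelDomain n)) :
    ContDiffOn ℝ ∞ (bDerivs L F) (kernelDomain n) := by
  induction L with
  | nil => exact hF
  | cons v L ih => exact bDeriv_smooth v ih

lemma bDerivs_add (L : List (E n × E n × ℝ)) {F G : E n × E n × ℝ → ℂ}
    (hF : ContDiffOn ℝ ∞ F (kernelDomain n)) (hG : ContDiffOn ℝ ∞ G (kernelDomain n)) :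
    ∀ q ∈ kernelDomain n,
      bDerivs L (fun q => F q + G q) q = bDerivs L F q + bDerivs L G q := by
  induction L with
  | nil => intro q _; rfl
  | cons v L ih =>
    intro q hq
    have hev : bDerivs L (fun q => F q + G q) =ᶠ[𝓝 q] fun q => bDerivs L F q + bDerivs L G q :=
      Filter.eventually_of_mem (isOpen_kernelDomain.mem_nhds hq) ih
    have dF : DifferentiableAt ℝ (bDerivs L F) q :=
      ((bDerivs_smooth L hF).contDiffAt (isOpen_kernelDomain.mem_nhds hq)).differentiableAt
        (by simp)
    have dG : DifferentiableAt ℝ (bDerivs L G) q :=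
      ((bDerivs_smooth L hG).contDiffAt (isOpen_kernelDomain.mem_nhds hq)).differentiableAt
        (by simp)
    change fderiv ℝ (bDerivs L (fun q => F q + G q)) q _ =
      fderiv ℝ (bDerivs L F) q _ + fderiv ℝ (bDerivs L G) q _
    rw [hev.fderiv_eq, fderiv_fun_add dF dG]
    rfl

lemma bDerivs_smul (c : ℂ) (L : List (E n × E n × ℝ)) {F : E n × E n × ℝ → ℂ}
    (hF : ContDiffOn ℝ ∞ F (kernelDomain n)) :
    ∀ q ∈ kernelDomain n, bDerivs L (fun q => c * F q) q = c * bDerivs L F q := by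
  induction L with
  | nil => intro q _; rfl
  | cons v L ih =>
    intro q hq
    have hev : bDerivs L (fun q => c * F q) =ᶠ[𝓝 q] fun q => c * bDerivs L F q :=
      Filter.eventually_of_mem (isOpen_kernelDomain.mem_nhds hq) ih
    have dF : DifferentiableAt ℝ (bDerivs L F) q :=
      ((bDerivs_smooth L hF).contDiffAt (isOpen_kernelDomain.mem_nhds hq)).differentiableAt
        (by simp)
    change fderiv ℝ (bDerivs L (fun q => c * F q)) q _ = c * fderiv ℝ (bDerivs L F) q _
    rw [hev.fderiv_eq, fderiv_const_mul dF]
    rfl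

lemma IsResidualKernel.add {l : ℝ} {F G : E n × E n × ℝ → ℂ}
    (hF : IsResidualKernel l F) (hG : IsResidualKernel l G) :
    IsResidualKernel l (fun q => F q + G q) where
  smooth := hF.smooth.add hG.smooth
  proper K hK h₀ h1 := by
    obtain ⟨K₁, hK₁, H₁⟩ := hF.proper K hK h₀ h1
    obtain ⟨K₂, hK₂, H₂⟩ := hG.proper K hK h₀ h1
    refine ⟨K₁ ∪ K₂, hK₁.union hK₂, fun x y h hh hh0 hne => ?_⟩
    by_cases hz : F (x, y, h) = 0
    · have : G (x, y, h) ≠ 0 := by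
        intro hg; exact hne (by simp [hz, hg])
      obtain ⟨p1, p2⟩ := H₂ x y h hh hh0 this
      exact ⟨fun q => Or.inr (p1 q), fun q => Or.inr (p2 q)⟩
    · obtain ⟨p1, p2⟩ := H₁ x y h hh hh0 hz
      exact ⟨fun q => Or.inl (p1 q), fun q => Or.inl (p2 q)⟩
  bound L h₀ h1 := by
    obtain ⟨C₁, H₁⟩ := hF.bound L h₀ h1
    obtain ⟨C₂, H₂⟩ := hG.bound L h₀ h1
    refine ⟨C₁ + C₂, fun x y h hh hh0 => ?_⟩
    rw [bDerivs_add L hF.smooth hG.smooth _ (mem_kernelDomain hh (hh0.trans_lt h1))]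
    have h2 := norm_add_le (bDerivs L F (x, y, h)) (bDerivs L G (x, y, h))
    have h3 : 0 ≤ h ^ l := Real.rpow_nonneg hh.le l
    calc _ ≤ h ^ l * (‖bDerivs L F (x, y, h)‖ + ‖bDerivs L G (x, y, h)‖) :=
          mul_le_mul_of_nonneg_left h2 h3
      _ ≤ C₁ + C₂ := by
          rw [mul_add]; exact add_le_add (H₁ x y h hh hh0) (H₂ x y h hh hh0)

lemma IsResidualKernel.smul {l : ℝ} {F : E n × E n × ℝ → ℂ} (c : ℂ)
    (hF : IsResidualKernel l F) : IsResidualKernel l (fun q => c * F q) where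
  smooth := contDiffOn_const.mul hF.smooth
  proper K hK h₀ h1 := by
    obtain ⟨K₁, hK₁, H₁⟩ := hF.proper K hK h₀ h1
    exact ⟨K₁, hK₁, fun x y h hh hh0 hne => H₁ x y h hh hh0 (right_ne_zero_of_mul hne)⟩
  bound L h₀ h1 := by
    obtain ⟨C₁, H₁⟩ := hF.bound L h₀ h1
    refine ⟨‖c‖ * C₁, fun x y h hh hh0 => ?_⟩
    rw [bDerivs_smul c L hF.smooth _ (mem_kernelDomain hh (hh0.trans_lt h1)), norm_mul]
    calc _ = ‖c‖ * (h ^ l * ‖bDerivs L F (x, y, h)‖) := by ring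
      _ ≤ _ := mul_le_mul_of_nonneg_left (H₁ x y h hh hh0) (norm_nonneg c)

lemma bDerivs_zero (L : List (E n × E n × ℝ)) :
    bDerivs L (fun _ => (0 : ℂ)) = fun _ => 0 := by
  induction L with
  | nil => rfl
  | cons v L ih =>
    change bDeriv v (bDerivs L fun _ => (0 : ℂ)) = _
    rw [ih]; funext q; simp [bDeriv]

lemma IsResidualKernel.zero (l : ℝ) :
    IsResidualKernel l (fun _ : E n × E n × ℝ => (0 : ℂ)) where
  smooth := contDiffOn_const
  proper _ _ _ _ := ⟨∅, isCompact_empty, fun _ _ _ _ _ hne => absurd rfl hne⟩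
  bound L _ _ := ⟨0, fun _ _ _ _ _ => by simp [bDerivs_zero]⟩

lemma polarRadius_pos (ξ : E n) {h : ℝ} (hh : 0 < h) : 0 < polarRadius ξ h :=
  Real.sqrt_pos.2 (by positivity)

lemma norm_le_polarRadius (ξ : E n) (h : ℝ) : ‖ξ‖ ≤ polarRadius ξ h :=
  Real.le_sqrt_of_sq_le (by nlinarith [sq_nonneg h])

lemma IsTotalSymbol.integrable {m l : ℝ} {a : E n × E n × ℝ → ℂ} (ha : IsTotalSymbol m l a)
    (x y : E n) {h : ℝ} (h0 : 0 < h) (h1 : h < 1) :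
    Integrable (fun ξ : E n => Complex.exp (Complex.I * ((inner ℝ (x - y) ξ / h : ℝ) : ℂ)) *
      ((diagCutoff x y : ℝ) : ℂ) * a (x, ξ, h)) := by
  obtain ⟨⟨b, hb, hbc, hab⟩, -⟩ := ha
  have hr : ∀ ξ : E n, polarRadius ξ h ≠ 0 := fun ξ => (polarRadius_pos ξ h0).ne'
  have hrc : Continuous fun ξ : E n => polarRadius ξ h := by
    unfold polarRadius; fun_prop
  have ha' : (fun ξ : E n => a (x, ξ, h)) = fun ξ =>
      (((h / polarRadius ξ h) ^ (-m) * (polarRadius ξ h) ^ (-l) : ℝ) : ℂ) *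
        b (x, (polarRadius ξ h)⁻¹ • ξ, h / polarRadius ξ h, polarRadius ξ h) :=
    funext fun ξ => hab x ξ h h0 h1
  have hcont : Continuous fun ξ : E n => a (x, ξ, h) := by
    rw [ha']
    have c1 : Continuous fun ξ : E n => h / polarRadius ξ h := continuous_const.div hrc hr
    have c2 : Continuous fun ξ : E n => (h / polarRadius ξ h) ^ (-m) :=
      c1.rpow_const fun ξ => Or.inl (div_ne_zero h0.ne' (hr ξ))
    have c3 : Continuous fun ξ : E n => (polarRadius ξ h) ^ (-l) :=
      hrc.rpow_const fun ξ => Or.inl (hr ξ)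
    have c4 : Continuous fun ξ : E n => (polarRadius ξ h)⁻¹ • ξ :=
      (hrc.inv₀ hr).smul continuous_id
    exact (Complex.continuous_ofReal.comp (c2.mul c3)).mul
      (hb.continuous.comp (continuous_const.prodMk (c4.prodMk (c1.prodMk hrc))))
  obtain ⟨M, hM⟩ := hbc.isCompact.isBounded.exists_norm_le
  have hsupp : HasCompactSupport fun ξ : E n => a (x, ξ, h) := by
    refine HasCompactSupport.intro (isCompact_closedBall (0 : E n) M) fun ξ hξ => ?_
    rw [hab x ξ h h0 h1]
    refine mul_eq_zero_of_right _ (by_contra fun hne => hξ ?_)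
    have h2 := hM _ (subset_tsupport _ hne)
    have h3 : |polarRadius ξ h| ≤ M := by
      simp only [Prod.norm_def, max_le_iff, Real.norm_eq_abs] at h2
      exact h2.2.2.2
    rw [mem_closedBall_zero_iff]
    exact (norm_le_polarRadius ξ h).trans ((le_abs_self _).trans h3)
  refine Continuous.integrable_of_hasCompactSupport ?_ (hsupp.mul_left)
  refine Continuous.mul ?_ hcont
  fun_prop

lemma leftKernel_add {m l : ℝ} {a b : E n × E n × ℝ → ℂ} (ha : IsTotalSymbol m l a)
    (hb : IsTotalSymbol m l b) : ∀ q ∈ kernelDomain n,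
      leftKernel (fun q => a q + b q) q = leftKernel a q + leftKernel b q := by
  rintro ⟨x, y, h⟩ ⟨-, -, h0, h1⟩
  simp only [leftKernel, mul_add]
  rw [integral_add (ha.integrable x y h0 h1) (hb.integrable x y h0 h1), mul_add]

lemma leftKernel_smul (c : ℂ) (a : E n × E n × ℝ → ℂ) (q : E n × E n × ℝ) :
    leftKernel (fun q => c * a q) q = c * leftKernel a q := by
  simp only [leftKernel]
  rw [mul_left_comm, ← integral_const_mul c]
  congr 1
  refine integral_congr_ae (Filter.Eventually.of_forall fun ξ => ?_)
  ring

lemma leftKernel_zero (q : E n × E n × ℝ) : leftKernel (fun _ => 0) q = 0 := by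
  simp [leftKernel]

lemma IsTotalSymbol.add {m l : ℝ} {a b : E n × E n × ℝ → ℂ} (ha : IsTotalSymbol m l a)
    (hb : IsTotalSymbol m l b) : IsTotalSymbol m l (fun q => a q + b q) := by
  obtain ⟨⟨f, hf, hfc, haf⟩, s, hs, has⟩ := ha
  obtain ⟨⟨g, hg, hgc, hbg⟩, t, ht, hbt⟩ := hb
  refine ⟨⟨fun q => f q + g q, hf.add hg, hfc.add hgc, fun x ξ h h0 h1 => ?_⟩,
    max s t, max_lt hs ht, fun x ξ h hle h1 => ?_⟩
  · simp only [haf x ξ h h0 h1, hbg x ξ h h0 h1, mul_add]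
  · simp only [has x ξ h ((le_max_left _ _).trans hle) h1,
      hbt x ξ h ((le_max_right _ _).trans hle) h1, add_zero]

lemma IsTotalSymbol.smul {m l : ℝ} {a : E n × E n × ℝ → ℂ} (c : ℂ)
    (ha : IsTotalSymbol m l a) : IsTotalSymbol m l (fun q => c * a q) := by
  obtain ⟨⟨f, hf, hfc, haf⟩, s, hs, has⟩ := ha
  refine ⟨⟨fun q => c * f q, contDiff_const.mul hf, hfc.mul_left, fun x ξ h h0 h1 => ?_⟩,
    s, hs, fun x ξ h hle h1 => ?_⟩
  · simp only [haf x ξ h h0 h1]; ring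
  · simp only [has x ξ h hle h1, mul_zero]

lemma IsTotalSymbol.zero (m l : ℝ) : IsTotalSymbol m l (fun _ : E n × E n × ℝ => (0 : ℂ)) :=
  ⟨⟨fun _ => 0, contDiff_const, HasCompactSupport.zero, fun _ _ _ _ _ => by simp⟩,
    0, one_pos, fun _ _ _ _ _ => rfl⟩

lemma IsResidualKernel.congr {l : ℝ} {F G : E n × E n × ℝ → ℂ} (hF : IsResidualKernel l F)
    (hFG : ∀ q ∈ kernelDomain n, G q = F q) : IsResidualKernel l G := by
  have key : ∀ L : List (E n × E n × ℝ), ∀ q ∈ kernelDomain n,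
      bDerivs L G q = bDerivs L F q := by
    intro L
    induction L with
    | nil => exact hFG
    | cons v L ih =>
      intro q hq
      change fderiv ℝ (bDerivs L G) q _ = fderiv ℝ (bDerivs L F) q _
      have hev : bDerivs L G =ᶠ[𝓝 q] bDerivs L F :=
        Filter.eventually_of_mem (isOpen_kernelDomain.mem_nhds hq) ih
      rw [hev.fderiv_eq]
  refine ⟨hF.smooth.congr hFG, fun K hK h₀ h1 => ?_, fun L h₀ h1 => ?_⟩
  · obtain ⟨K', hK', H⟩ := hF.proper K hK h₀ h1
    refine ⟨K', hK', fun x y h hh hh0 hne => H x y h hh hh0 ?_⟩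
    rwa [← hFG _ (mem_kernelDomain hh (hh0.trans_lt h1))]
  · obtain ⟨C, H⟩ := hF.bound L h₀ h1
    refine ⟨C, fun x y h hh hh0 => ?_⟩
    rw [key L _ (mem_kernelDomain hh (hh0.trans_lt h1))]
    exact H x y h hh hh0

lemma IsLocalKernel.integrable {A : OpFamily n X} {e e' : OpenPartialHomeomorph X (E n)}
    {φ ψ : smoothFn n X} {κ : E n × E n × ℝ → ℂ} (hκ : IsLocalKernel A e e' φ ψ κ)
    (hψ : IsCutoff e' ψ) (x : E n) (h : Ioo (0 : ℝ) 1) (u : smoothFn n X) :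
    Integrable (fun y : E n => κ (x, y, (h : ℝ)) * (u : X → ℂ) (e'.symm y)) := by
  have hsub : e' '' tsupport (ψ : X → ℂ) ⊆ e'.target := by
    rintro _ ⟨p, hp, rfl⟩; exact e'.map_source (hψ.2 hp)
  have hcpt : IsCompact (e' '' tsupport (ψ : X → ℂ)) :=
    hψ.1.isCompact.image_of_continuousOn (e'.continuousOn.mono hψ.2)
  have hu : Continuous (u : X → ℂ) := ContMDiff.continuous u.2
  have hc : ContinuousOn (fun y : E n => κ (x, y, (h : ℝ)) * (u : X → ℂ) (e'.symm y))
      (e' '' tsupport (ψ : X → ℂ)) := by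
    refine ContinuousOn.mul ?_ (hu.comp_continuousOn (e'.continuousOn_symm.mono hsub))
    refine hκ.smooth.continuousOn.comp (by fun_prop) fun y _ => mem_kernelDomain h.2.1 h.2.2
  refine (integrableOn_iff_integrable_of_support_subset fun y hy => ?_).1
    (hc.integrableOn_compact hcpt)
  exact (hκ.supp x y h h.2.1 h.2.2 (left_ne_zero_of_mul hy)).2

lemma IsLocalKernel.add {A B : OpFamily n X} {e e' : OpenPartialHomeomorph X (E n)}
    {φ ψ : smoothFn n X} {κ κ' : E n × E n × ℝ → ℂ} (hψ : IsCutoff e' ψ)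
    (hκ : IsLocalKernel A e e' φ ψ κ) (hκ' : IsLocalKernel B e e' φ ψ κ') :
    IsLocalKernel (A + B) e e' φ ψ (fun q => κ q + κ' q) where
  smooth := hκ.smooth.add hκ'.smooth
  supp x y h h0 h1 hne := by
    by_cases hz : κ (x, y, h) = 0
    · exact hκ'.supp x y h h0 h1 fun hg => hne (by simp [hz, hg])
    · exact hκ.supp x y h h0 h1 hz
  eq h u p hp := by
    simp only [add_mul]
    rw [integral_add (hκ.integrable hψ _ h u) (hκ'.integrable hψ _ h u), ← hκ.eq h u p hp,
      ← hκ'.eq h u p hp]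
    simp [mul_add]

lemma IsLocalKernel.smul {A : OpFamily n X} {e e' : OpenPartialHomeomorph X (E n)}
    {φ ψ : smoothFn n X} {κ : E n × E n × ℝ → ℂ} (c : ℂ)
    (hκ : IsLocalKernel A e e' φ ψ κ) :
    IsLocalKernel (c • A) e e' φ ψ (fun q => c * κ q) where
  smooth := contDiffOn_const.mul hκ.smooth
  supp x y h h0 h1 hne := hκ.supp x y h h0 h1 (right_ne_zero_of_mul hne)
  eq h u p hp := by
    simp only [mul_assoc]
    rw [integral_const_mul, ← hκ.eq h u p hp]
    simp [mul_left_comm]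

lemma IsLocalKernel.zero (e e' : OpenPartialHomeomorph X (E n)) (φ ψ : smoothFn n X) :
    IsLocalKernel (0 : OpFamily n X) e e' φ ψ (fun _ => 0) where
  smooth := contDiffOn_const
  supp _ _ _ _ _ hne := absurd rfl hne
  eq h u p hp := by simp

lemma ProperlySupported.add {A B : OpFamily n X} (hA : ProperlySupported A)
    (hB : ProperlySupported B) : ProperlySupported (A + B) := by
  intro K hK h₀ h1
  obtain ⟨K₁, hK₁, H₁⟩ := hA K hK h₀ h1
  obtain ⟨K₂, hK₂, H₂⟩ := hB K hK h₀ h1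
  refine ⟨K₁ ∪ K₂, hK₁.union hK₂, fun h hh u => ⟨fun hu x hx => ?_, fun hu x hx => ?_⟩⟩
  · have h3 := (H₁ h hh u).1 hu x fun hx' => hx (Or.inl hx')
    have h4 := (H₂ h hh u).1 hu x fun hx' => hx (Or.inr hx')
    simp [h3, h4]
  · have h3 := (H₁ h hh u).2 (fun y hy => hu y (Or.inl hy)) x hx
    have h4 := (H₂ h hh u).2 (fun y hy => hu y (Or.inr hy)) x hx
    simp [h3, h4]

lemma ProperlySupported.smul {A : OpFamily n X} (c : ℂ) (hA : ProperlySupported A) :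
    ProperlySupported (c • A) := by
  intro K hK h₀ h1
  obtain ⟨K₁, hK₁, H₁⟩ := hA K hK h₀ h1
  refine ⟨K₁, hK₁, fun h hh u => ⟨fun hu x hx => ?_, fun hu x hx => ?_⟩⟩
  · simp [(H₁ h hh u).1 hu x hx]
  · simp [(H₁ h hh u).2 hu x hx]

lemma ProperlySupported.zero : ProperlySupported (0 : OpFamily n X) :=
  fun _ _ _ _ => ⟨∅, isCompact_empty, fun _ _ _ => ⟨fun _ _ _ => by simp, fun _ _ _ => by simp⟩⟩

lemma IsLocallyResidual.add {l : ℝ} {A B : OpFamily n X}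
    {e e' : OpenPartialHomeomorph X (E n)} {φ ψ : smoothFn n X} (hψ : IsCutoff e' ψ)
    (hA : IsLocallyResidual l A e e' φ ψ) (hB : IsLocallyResidual l B e e' φ ψ) :
    IsLocallyResidual l (A + B) e e' φ ψ := by
  obtain ⟨κ, h1, h2⟩ := hA
  obtain ⟨κ', h1', h2'⟩ := hB
  exact ⟨_, h1.add hψ h1', h2.add h2'⟩

lemma IsLocallyResidual.smul {l : ℝ} {A : OpFamily n X}
    {e e' : OpenPartialHomeomorph X (E n)} {φ ψ : smoothFn n X} (c : ℂ)
    (hA : IsLocallyResidual l A e e' φ ψ) : IsLocallyResidual l (c • A) e e' φ ψ := by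
  obtain ⟨κ, h1, h2⟩ := hA
  exact ⟨_, h1.smul c, h2.smul c⟩

lemma IsLocallyResidual.zero (l : ℝ) (e e' : OpenPartialHomeomorph X (E n))
    (φ ψ : smoothFn n X) : IsLocallyResidual l (0 : OpFamily n X) e e' φ ψ :=
  ⟨_, IsLocalKernel.zero e e' φ ψ, IsResidualKernel.zero l⟩

lemma IsLocalSymbol.add {m l : ℝ} {A B : OpFamily n X} {e : OpenPartialHomeomorph X (E n)}
    {φ ψ : smoothFn n X} {a b : E n × E n × ℝ → ℂ} (hψ : IsCutoff e ψ)
    (hA : IsLocalSymbol m l A e φ ψ a) (hB : IsLocalSymbol m l B e φ ψ b) :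
    IsLocalSymbol m l (A + B) e φ ψ (fun q => a q + b q) := by
  obtain ⟨h0, κ, h1, h2⟩ := hA
  obtain ⟨h0', κ', h1', h2'⟩ := hB
  refine ⟨h0.add h0', _, h1.add hψ h1', (h2.add h2').congr fun q hq => ?_⟩
  rw [leftKernel_add h0 h0' q hq]; ring

lemma IsLocalSymbol.smul {m l : ℝ} {A : OpFamily n X} {e : OpenPartialHomeomorph X (E n)}
    {φ ψ : smoothFn n X} {a : E n × E n × ℝ → ℂ} (c : ℂ)
    (hA : IsLocalSymbol m l A e φ ψ a) :
    IsLocalSymbol m l (c • A) e φ ψ (fun q => c * a q) := by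
  obtain ⟨h0, κ, h1, h2⟩ := hA
  refine ⟨h0.smul c, _, h1.smul c, (h2.smul c).congr fun q hq => ?_⟩
  rw [leftKernel_smul]; ring

lemma IsLocalSymbol.zero (m l : ℝ) (e : OpenPartialHomeomorph X (E n)) (φ ψ : smoothFn n X) :
    IsLocalSymbol m l (0 : OpFamily n X) e φ ψ (fun _ => 0) :=
  ⟨IsTotalSymbol.zero m l, _, IsLocalKernel.zero e e φ ψ,
    (IsResidualKernel.zero l).congr fun q _ => by simp [leftKernel_zero]⟩

/-! ### The calculus -/

variable (n X)

/-- The residual operators `R^l(X)`. -/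
def Resid (l : ℝ) : Submodule ℂ (OpFamily n X) where
  carrier := {A | ProperlySupported A ∧
    ∀ e e' : OpenPartialHomeomorph X (E n), IsChart e → IsChart e' →
      ∀ φ ψ : smoothFn n X, IsCutoff e φ → IsCutoff e' ψ → IsLocallyResidual l A e e' φ ψ}
  zero_mem' := ⟨ProperlySupported.zero, fun e e' _ _ φ ψ _ _ => IsLocallyResidual.zero l e e' φ ψ⟩
  add_mem' hA hB := ⟨hA.1.add hB.1, fun e e' he he' φ ψ hφ hψ =>
    (hA.2 e e' he he' φ ψ hφ hψ).add hψ (hB.2 e e' he he' φ ψ hφ hψ)⟩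
  smul_mem' c _ hA := ⟨hA.1.smul c, fun e e' he he' φ ψ hφ hψ =>
    (hA.2 e e' he he' φ ψ hφ hψ).smul c⟩

/-- The operators `Ψ_{2,h}^{m,l}(X; o)`: properly supported, of the form `Op_l(a) + R` when
localized to any chart on both sides, and residual when localized to disjoint supports (it is
enough that the two cutoffs are supported in charts). -/
def Psi (m l : ℝ) : Submodule ℂ (OpFamily n X) where
  carrier := {A | ProperlySupported A ∧
    (∀ e : OpenPartialHomeomorph X (E n), IsChart e →
      ∀ φ ψ : smoothFn n X, IsCutoff e φ → IsCutoff e ψ →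
        ∃ a : E n × E n × ℝ → ℂ, IsLocalSymbol m l A e φ ψ a) ∧
    (∀ e e' : OpenPartialHomeomorph X (E n), IsChart e → IsChart e' →
      ∀ φ ψ : smoothFn n X, IsCutoff e φ → IsCutoff e' ψ →
        Disjoint (tsupport (φ : X → ℂ)) (tsupport (ψ : X → ℂ)) →
          IsLocallyResidual l A e e' φ ψ)}
  zero_mem' := ⟨ProperlySupported.zero, fun e _ φ ψ _ _ => ⟨_, IsLocalSymbol.zero m l e φ ψ⟩,
    fun e e' _ _ φ ψ _ _ _ => IsLocallyResidual.zero l e e' φ ψ⟩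
  add_mem' hA hB := ⟨hA.1.add hB.1,
    fun e he φ ψ hφ hψ => by
      obtain ⟨a, ha⟩ := hA.2.1 e he φ ψ hφ hψ
      obtain ⟨b, hb⟩ := hB.2.1 e he φ ψ hφ hψ
      exact ⟨_, ha.add hψ hb⟩,
    fun e e' he he' φ ψ hφ hψ hd =>
      (hA.2.2 e e' he he' φ ψ hφ hψ hd).add hψ (hB.2.2 e e' he he' φ ψ hφ hψ hd)⟩
  smul_mem' c _ hA := ⟨hA.1.smul c,
    fun e he φ ψ hφ hψ => by
      obtain ⟨a, ha⟩ := hA.2.1 e he φ ψ hφ hψ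
      exact ⟨_, ha.smul c⟩,
    fun e e' he he' φ ψ hφ hψ hd => (hA.2.2 e e' he he' φ ψ hφ hψ hd).smul c⟩

/-! ## Principal symbols -/

/-- The cotangent bundle `T^*X`. -/
abbrev Cotangent : Type _ := Σ x : X, (TangentSpace 𝓘(ℝ, E n) x →L[ℝ] ℝ)

/-- `T^*X \ o`, the interior of the blow-up `[T^*X; o]`. -/
abbrev PuncturedCotangent : Type _ := {p : Cotangent n X // p.2 ≠ 0}

variable {n X}

/-- The covector `∑ ξ_j dx_j` at the point with coordinates `x`, for the chart `e`. -/
def covector (e : OpenPartialHomeomorph X (E n)) (x ξ : E n) : Cotangent n X :=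
  ⟨e.symm x, (innerSL ℝ ξ : E n →L[ℝ] ℝ).comp
    (mfderiv 𝓘(ℝ, E n) 𝓘(ℝ, E n) e (e.symm x) : E n →L[ℝ] E n)⟩

open Classical in
/-- `s` in the canonical coordinates `(x, ξ)` on `T^*X` induced by the chart `e`. Only
`x ∈ e.target`, `ξ ≠ 0` matter; the value on the zero section is a dummy. -/
def inCoords (e : OpenPartialHomeomorph X (E n)) (s : PuncturedCotangent n X → ℂ) :
    E n × E n → ℂ :=
  fun q => if hq : (covector e q.1 q.2).2 ≠ 0 then s ⟨covector e q.1 q.2, hq⟩ else 0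

variable (n X)

/-- The symbol space `S^r([T^*X; o]) = ρ_ff^{-r} C^∞([T^*X; o])` with fibre-compact supports
(supports that meet the preimage of each compact subset of `X` in a compact set), as functions
on the interior `T^*X \ o`. In the coordinates of a chart the blow-up is
`{(x, ω, ρ) : |ω| = 1, ρ ≥ 0}` with `ξ = ρ ω`, and smooth functions on it are restrictions of
smooth functions of `(x, ω, ρ)`. -/
def Sym (r : ℝ) : Submodule ℂ (PuncturedCotangent n X → ℂ) where
  carrier := {s | ∀ e : OpenPartialHomeomorph X (E n), IsChart e →
    ∀ φ : smoothFn n X, IsCutoff e φ →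
      ∃ b : E n × E n × ℝ → ℂ, ContDiff ℝ ∞ b ∧ HasCompactSupport b ∧
        ∀ x ∈ e.target, ∀ ξ : E n, ξ ≠ 0 →
          (φ : X → ℂ) (e.symm x) * inCoords e s (x, ξ) =
            ((‖ξ‖ ^ (-r) : ℝ) : ℂ) * b (x, ‖ξ‖⁻¹ • ξ, ‖ξ‖)}
  zero_mem' e he φ hφ := ⟨fun _ => 0, contDiff_const, HasCompactSupport.zero, fun x _ ξ _ => by
    have : inCoords e (0 : PuncturedCotangent n X → ℂ) (x, ξ) = 0 := by
      simp [inCoords]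
    simp [this]⟩
  add_mem' {s t} hs ht e he φ hφ := by
    obtain ⟨b, hb, hbc, h1⟩ := hs e he φ hφ
    obtain ⟨c, hc, hcc, h2⟩ := ht e he φ hφ
    refine ⟨fun q => b q + c q, hb.add hc, hbc.add hcc, fun x hx ξ hξ => ?_⟩
    have : inCoords e (s + t) (x, ξ) = inCoords e s (x, ξ) + inCoords e t (x, ξ) := by
      simp only [inCoords]; split_ifs <;> simp
    rw [this, mul_add, h1 x hx ξ hξ, h2 x hx ξ hξ, mul_add]
  smul_mem' z s hs e he φ hφ := by
    obtain ⟨b, hb, hbc, h1⟩ := hs e he φ hφ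
    refine ⟨fun q => z * b q, contDiff_const.mul hb, hbc.mul_left, fun x hx ξ hξ => ?_⟩
    have : inCoords e (z • s) (x, ξ) = z * inCoords e s (x, ξ) := by
      simp only [inCoords]; split_ifs <;> simp
    rw [this, mul_left_comm, h1 x hx ξ hξ]; ring

variable {n X}

/-- `s` is the principal symbol of `A` as an operator of order `(k, l)`: whenever
`φ A φ = Op_l(a) + R` in a chart, `s` is the restriction of `h^k a` to the side face over all
points near which `φ = 1`. On the interior of the side face (`h = 0`, `ξ ≠ 0`) the restriction
is the limit as `h → 0` with `(x, ξ)` fixed. -/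
def IsPrincipalSymbol (k l : ℝ) (A : OpFamily n X) (s : PuncturedCotangent n X → ℂ) : Prop :=
  ∀ e : OpenPartialHomeomorph X (E n), IsChart e → ∀ φ : smoothFn n X, IsCutoff e φ →
    ∀ a : E n × E n × ℝ → ℂ, IsLocalSymbol k l A e φ φ a →
      ∀ x ∈ e.target, (∀ᶠ p in 𝓝 (e.symm x), (φ : X → ℂ) p = 1) → ∀ ξ : E n, ξ ≠ 0 →
        Tendsto (fun h : ℝ => ((h ^ k : ℝ) : ℂ) * a (x, ξ, h)) (𝓝[>] 0)
          (𝓝 (inCoords e s (x, ξ)))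

/-- The Poisson bracket `∑_j (∂_{ξ_j} f ∂_{x_j} g - ∂_{x_j} f ∂_{ξ_j} g)` of functions of
canonical coordinates `(x, ξ)`. -/
def poisson (f g : E n × E n → ℂ) : E n × E n → ℂ := fun q =>
  ∑ j : Fin n,
    (fderiv ℝ f q (0, EuclideanSpace.single j 1) * fderiv ℝ g q (EuclideanSpace.single j 1, 0) -
      fderiv ℝ f q (EuclideanSpace.single j 1, 0) * fderiv ℝ g q (0, EuclideanSpace.single j 1))

/-- `t` is the Poisson bracket `{f, g}` on `T^*X \ o`, computed in canonical coordinates. -/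
def IsPoissonBracket (f g t : PuncturedCotangent n X → ℂ) : Prop :=
  ∀ e : OpenPartialHomeomorph X (E n), IsChart e → ∀ x ∈ e.target, ∀ ξ : E n, ξ ≠ 0 →
    inCoords e t (x, ξ) = poisson (inCoords e f) (inCoords e g) (x, ξ)

/-- `μ` is (the measure of) a smooth positive density on `X`. -/
def IsSmoothDensity (n : ℕ) {X : Type*} [TopologicalSpace X] [ChartedSpace (E n) X]
    [MeasurableSpace X] (μ : Measure X) : Prop :=
  ∀ e : OpenPartialHomeomorph X (E n), IsChart e →
    ∃ w : E n → ℝ, ContDiffOn ℝ ∞ w e.target ∧ (∀ x ∈ e.target, 0 < w x) ∧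
      (μ.restrict e.source).map e =
        (volume.restrict e.target).withDensity (fun x => ENNReal.ofReal (w x))

/-- `B` is the formal adjoint of `A` in `L²(X, μ)`. -/
def IsFormalAdjoint [MeasurableSpace X] (μ : Measure X) (A B : OpFamily n X) : Prop :=
  ∀ (h : Ioo (0 : ℝ) 1) (u v : smoothFn n X), HasCompactSupport (u : X → ℂ) →
    HasCompactSupport (v : X → ℂ) →
      ∫ x, (A h u : X → ℂ) x * (starRingEnd ℂ) ((v : X → ℂ) x) ∂μ =
        ∫ x, (u : X → ℂ) x * (starRingEnd ℂ) ((B h v : X → ℂ) x) ∂μ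

end Manifold

end TwoMicro

end

noncomputable section

namespace TwoMicro

set_option linter.unusedSectionVars false

open scoped Real
open Complex (I ofReal_mul ofRealCLM real_smul conjCLE ofReal_one ofReal_ne_zero conj_ofReal
  norm_real I_mul_I conj_conj)
open Real (norm_of_nonneg rpow_nonneg rpow_add norm_eq_abs rpow_neg sqrt_pos
  rpow_natCast sqrt_sq mul_rpow rpow_sub)
open ContinuousLinearMap (fst snd det inl)

notation "KPt" n:max => E n × E n × ℝ
notation "Krn" n:max => E n × E n × ℝ → ℂ
notation "KD" n:max => kernelDomain n
notation "Smooth" => ContDiff ℝ ∞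
notation "SmoothOn" => ContDiffOn ℝ ∞
notation "CSupp" => HasCompactSupport

/-! ## Integrals depending on parameters -/

section ParamIntegral

variable {P T F : Type} [NormedAddCommGroup P] [NormedSpace ℝ P] [NormedAddCommGroup T]
  [NormedSpace ℝ T] [MeasurableSpace T] [BorelSpace T] [SecondCountableTopology T]
  [NormedAddCommGroup F] [NormedSpace ℝ F] {G : P × T → F} {U : Set P} {C : Set T} {p : P}
  {μ : Measure T}

lemma exists_bound_near_compact (hU : IsOpen U)
    (hC : IsCompact C) (hG : ContinuousOn G (U ×ˢ univ)) (hp : p ∈ U) :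
    ∃ ε > 0, ∃ M : ℝ, Metric.ball p ε ⊆ U ∧ ∀ q ∈ Metric.ball p ε, ∀ t ∈ C, ‖G (q, t)‖ ≤ M := by
  have h1 : ∀ t ∈ C, ∃ u ∈ 𝓝 p, ∃ v ∈ 𝓝[C] t, ∃ M : ℝ, ∀ q ∈ u, ∀ s ∈ v, ‖G (q, s)‖ ≤ M := by
    intro t _
    have hc : ContinuousAt G (p, t) :=
      hG.continuousAt ((hU.prod isOpen_univ).mem_nhds ⟨hp, mem_univ _⟩)
    have h2 : ∀ᶠ z in 𝓝 (p, t), ‖G z‖ < ‖G (p, t)‖ + 1 :=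
      hc.norm.eventually (gt_mem_nhds (by linarith))
    rw [nhds_prod_eq] at h2
    obtain ⟨u, hu, v, hv, H⟩ := Filter.mem_prod_iff.1 h2
    exact ⟨u, hu, v, mem_nhdsWithin_of_mem_nhds hv, _, fun q hq s hs => (H ⟨hq, hs⟩ : _ < _).le⟩
  have key : ∃ u ∈ 𝓝 p, ∃ M : ℝ, ∀ q ∈ u, ∀ s ∈ C, ‖G (q, s)‖ ≤ M := by
    refine hC.induction_on (p := fun D => ∃ u ∈ 𝓝 p, ∃ M : ℝ, ∀ q ∈ u, ∀ s ∈ D, ‖G (q, s)‖ ≤ M)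
      ⟨univ, univ_mem, 0, fun _ _ _ hs => absurd hs (notMem_empty _)⟩ ?_ ?_ ?_
    · rintro s t hst ⟨u, hu, M, H⟩
      exact ⟨u, hu, M, fun q hq a ha => H q hq a (hst ha)⟩
    · rintro s t ⟨u, hu, M, H⟩ ⟨u', hu', M', H'⟩
      refine ⟨u ∩ u', inter_mem hu hu', max M M', fun q hq a ha => ?_⟩
      rcases ha with ha | ha
      · exact (H q hq.1 a ha).trans (le_max_left _ _)
      · exact (H' q hq.2 a ha).trans (le_max_right _ _)
    · intro t ht
      obtain ⟨u, hu, v, hv, M, H⟩ := h1 t ht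
      exact ⟨v, hv, u, hu, M, H⟩
  obtain ⟨u, hu, M, H⟩ := key
  obtain ⟨ε, hε, hb⟩ := Metric.mem_nhds_iff.1 (inter_mem hu (hU.mem_nhds hp))
  exact ⟨ε, hε, M, fun q hq => (hb hq).2, fun q hq => H q (hb hq).1⟩

lemma contDiffOn_partial_fderiv (hU : IsOpen U) (hG : SmoothOn G (U ×ˢ univ)) : SmoothOn (fun z : P
    × T => (fderiv ℝ G z).comp (inl ℝ P T)) (U ×ˢ univ) :=
  (hG.fderiv_of_isOpen (hU.prod isOpen_univ) (by simp)).clm_comp contDiffOn_const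

lemma hasFDerivAt_setIntegral [IsFiniteMeasureOnCompacts μ] (hU : IsOpen U) (hC : IsCompact C) (hG :
    SmoothOn G (U ×ˢ univ)) (hp : p ∈ U) : HasFDerivAt (fun p => ∫ t in C, G (p, t) ∂μ) (∫ t in C,
    (fderiv ℝ G (p, t)).comp (inl ℝ P T) ∂μ) p := by
  have hG' := contDiffOn_partial_fderiv hU hG
  obtain ⟨ε, hε, M, hb, hM⟩ := exists_bound_near_compact hU hC hG'.continuousOn hp
  have hmk : ∀ {H : Type} [NormedAddCommGroup H] [NormedSpace ℝ H] {K : P × T → H},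
      ContinuousOn K (U ×ˢ univ) → ∀ q ∈ U, Continuous fun t => K (q, t) := by
    intro H _ _ K hK q hq
    exact continuousOn_univ.1 (hK.comp (by fun_prop) fun t _ => ⟨hq, mem_univ _⟩)
  refine hasFDerivAt_integral_of_dominated_of_fderiv_le (μ := μ.restrict C)
    (F := fun q t => G (q, t)) (s := Metric.ball p ε) (bound := fun _ => M)
    (F' := fun q t => (fderiv ℝ G (q, t)).comp (inl ℝ P T))
    (Metric.ball_mem_nhds p hε) ?_ ?_ ?_ ?_ ?_ ?_
  · filter_upwards [Metric.ball_mem_nhds p hε] with q hq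
    exact ((hmk hG.continuousOn q (hb hq)).continuousOn).aestronglyMeasurable_of_isCompact hC
      hC.measurableSet
  · exact (hmk hG.continuousOn p hp).continuousOn.integrableOn_compact hC
  · exact ((hmk hG'.continuousOn p hp).continuousOn).aestronglyMeasurable_of_isCompact hC
      hC.measurableSet
  · refine (ae_restrict_iff' hC.measurableSet).2 (Eventually.of_forall fun t ht q hq => ?_)
    exact hM q hq t ht
  · exact integrableOn_const hC.measure_lt_top.ne
  · refine Eventually.of_forall fun t q hq => ?_
    have h1 : DifferentiableAt ℝ G (q, t) :=
      (hG.contDiffAt ((hU.prod isOpen_univ).mem_nhds ⟨hb hq, mem_univ _⟩)).differentiableAt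
        (by simp)
    have h2 := h1.hasFDerivAt.comp q (hasFDerivAt_prodMk_left (𝕜 := ℝ) q t)
    exact h2

lemma contDiffOn_setIntegral_aux [IsFiniteMeasureOnCompacts μ] (hU : IsOpen U) (hC : IsCompact C) (k
    : ℕ) : ∀ {F : Type} [NormedAddCommGroup F] [NormedSpace ℝ F] {G : P × T → F}, SmoothOn G (U ×ˢ
    univ) → ContDiffOn ℝ k (fun p => ∫ t in C, G (p, t) ∂μ) U := by
  induction k with
  | zero =>
    intro F _ _ G hG
    exact contDiffOn_zero.2 fun p hp =>
      (hasFDerivAt_setIntegral hU hC hG hp).continuousAt.continuousWithinAt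
  | succ k ih =>
    intro F _ _ G hG
    rw [Nat.cast_succ, contDiffOn_succ_iff_fderiv_of_isOpen hU]
    refine ⟨fun p hp => (hasFDerivAt_setIntegral hU hC hG hp).differentiableAt.differentiableWithinAt,
      by simp, ?_⟩
    exact (ih (contDiffOn_partial_fderiv hU hG)).congr
      fun p hp => (hasFDerivAt_setIntegral hU hC hG hp).fderiv

lemma contDiffOn_setIntegral [IsFiniteMeasureOnCompacts μ] (hU : IsOpen U) (hC : IsCompact C) (hG :
    SmoothOn G (U ×ˢ univ)) : SmoothOn (fun p => ∫ t in C, G (p, t) ∂μ) U :=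
  contDiffOn_infty.2 fun k => contDiffOn_setIntegral_aux hU hC k hG

/-- The parameter `p` ranges over an open set, near each point of which the integrand has a
fixed compact support. -/
def LocCompactSupp (U : Set P) (G : P × T → F) : Prop :=
  ∀ p ∈ U, ∃ C : Set T, IsCompact C ∧ ∀ᶠ q in 𝓝 p, ∀ t ∉ C, G (q, t) = 0

lemma integral_eventuallyEq (h : ∀ᶠ q in 𝓝 p, ∀ t ∉ C, G (q, t) = 0) : (fun q => ∫ t, G (q, t) ∂μ)
    =ᶠ[𝓝 p] fun q => ∫ t in C, G (q, t) ∂μ := by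
  filter_upwards [h] with q hq
  exact (setIntegral_eq_integral_of_forall_compl_eq_zero hq).symm

lemma contDiffOn_integral [IsFiniteMeasureOnCompacts μ] (hU : IsOpen U) (hG : SmoothOn G (U ×ˢ
    univ)) (hs : LocCompactSupp U G) : SmoothOn (fun p => ∫ t, G (p, t) ∂μ) U := by
  intro p hp
  obtain ⟨C, hC, h⟩ := hs p hp
  have h1 : ContDiffAt ℝ ∞ (fun p => ∫ t in C, G (p, t) ∂μ) p :=
    (contDiffOn_setIntegral hU hC hG).contDiffAt (hU.mem_nhds hp)
  exact (h1.congr_of_eventuallyEq (integral_eventuallyEq h)).contDiffWithinAt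

lemma fderiv_integral_apply [IsFiniteMeasureOnCompacts μ] [CompleteSpace F] (hU : IsOpen U) (hG :
    SmoothOn G (U ×ˢ univ)) (hs : LocCompactSupp U G) (hp : p ∈ U) (v : P) : fderiv ℝ (fun p => ∫ t,
    G (p, t) ∂μ) p v = ∫ t, fderiv ℝ G (p, t) (v, 0) ∂μ := by
  obtain ⟨C, hC, h⟩ := hs p hp
  rw [(integral_eventuallyEq h).fderiv_eq,
    (hasFDerivAt_setIntegral hU hC hG hp).fderiv]
  have hG' := contDiffOn_partial_fderiv hU hG
  have hc : Continuous fun t => (fderiv ℝ G (p, t)).comp (inl ℝ P T) :=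
    continuousOn_univ.1 (hG'.continuousOn.comp (f := fun t => (p, t)) (by fun_prop)
      fun t _ => ⟨hp, mem_univ _⟩)
  rw [ContinuousLinearMap.integral_apply (hc.continuousOn.integrableOn_compact hC)]
  have h0 : ∀ t ∉ C, fderiv ℝ G (p, t) (v, 0) = 0 := by
    intro t ht
    have h1 : DifferentiableAt ℝ G (p, t) :=
      (hG.contDiffAt ((hU.prod isOpen_univ).mem_nhds ⟨hp, mem_univ _⟩)).differentiableAt
        (by simp)
    have h2 := h1.hasFDerivAt.comp p (hasFDerivAt_prodMk_left (𝕜 := ℝ) p t)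
    have h3 : (G ∘ fun q => (q, t)) =ᶠ[𝓝 p] fun _ => 0 := by
      filter_upwards [h] with q hq using hq t ht
    have h4 := h2.unique ((hasFDerivAt_const (0 : F) p).congr_of_eventuallyEq h3)
    have h5 := congrArg (fun f : P →L[ℝ] F => f v) h4
    simpa using h5
  rw [← setIntegral_eq_integral_of_forall_compl_eq_zero h0]
  rfl

end ParamIntegral

/-! ## Residual estimates near `h = 0` -/

section Kernels

variable {n : ℕ} {l l' m m' r r' M M' : ℝ} {S S' : Set (E n)} {F G : Krn n} {g : E n → ℂ}
  {f f' : E n × E n → ℂ}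

/-- Near `(x, y)` in `ℝⁿ × ℝⁿ`, as `h → 0+`. -/
def bFilter (x y : E n) : Filter (KPt n) := 𝓝 x ×ˢ 𝓝 y ×ˢ 𝓝[>] 0

/-- `F = O(h^{-l})` locally uniformly. -/
def LBd (l : ℝ) (F : Krn n) : Prop :=
  ∀ x y : E n, F =O[bFilter x y] fun q => q.2.2 ^ (-l)

/-- `LBd` for all derivatives of order at most `k` along fields tangent to `h = 0`. -/
def LBdK (l : ℝ) : ℕ → (Krn n) → Prop
  | 0, F => LBd l F
  | k + 1, F => LBd l F ∧ ∀ v, LBdK l k (bDeriv v F)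

/-- Smooth kernels all of whose derivatives are `O(h^{-l})` locally uniformly. -/
structure LRes (l : ℝ) (F : Krn n) : Prop where
  smooth : SmoothOn F (KD n)
  bd : ∀ k, LBdK l k F

lemma eventually_bFilter_Ioo (x y : E n) {ε : ℝ} (hε : 0 < ε) :
    ∀ᶠ q in bFilter x y, q.2.2 ∈ Ioo 0 ε := by
  have h : ∀ᶠ h in 𝓝[>] (0 : ℝ), h ∈ Ioo 0 ε := Ioo_mem_nhdsGT hε
  exact (h.prod_inr (𝓝 y)).prod_inr (𝓝 x)

/-- Agreement of two kernels for small `h`. -/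
def EqSmall (F G : Krn n) : Prop :=
  ∃ ε > 0, ∀ x y : E n, ∀ h ∈ Ioo 0 ε, F (x, y, h) = G (x, y, h)

lemma EqSmall.symm (h : EqSmall F G) : EqSmall G F :=
  let ⟨ε, hε, H⟩ := h
  ⟨ε, hε, fun x y t ht => (H x y t ht).symm⟩

lemma EqSmall.of_domain (h : ∀ q ∈ KD n, F q = G q) : EqSmall F G :=
  ⟨1, one_pos, fun _ _ _ ht => h _ (mem_kernelDomain ht.1 ht.2)⟩

lemma EqSmall.bDeriv (h : EqSmall F G) (v : KPt n) : EqSmall (bDeriv v F) (bDeriv v G) := by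
  obtain ⟨ε, hε, H⟩ := h
  refine ⟨ε, hε, fun x y t ht => ?_⟩
  have : F =ᶠ[𝓝 (x, y, t)] G := by
    have ho : IsOpen {q : KPt n | q.2.2 ∈ Ioo 0 ε} :=
      isOpen_Ioo.preimage (by fun_prop)
    filter_upwards [ho.mem_nhds (show (x, y, t) ∈ {q : KPt n | q.2.2 ∈ Ioo 0 ε} from ht)]
      with q hq using H _ _ _ hq
  simp only [TwoMicro.bDeriv, this.fderiv_eq]

lemma LBd.congr (hF : LBd l F) (h : EqSmall F G) : LBd l G := by
  obtain ⟨ε, hε, H⟩ := h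
  intro x y
  refine (hF x y).congr' ?_ EventuallyEq.rfl
  filter_upwards [eventually_bFilter_Ioo x y hε] with q hq using H _ _ _ hq

lemma LBdK.congr {k : ℕ} : ∀ {F G : Krn n}, LBdK l k F → EqSmall F G → LBdK l k G := by
  induction k with
  | zero => intro F G hF h; exact LBd.congr hF h
  | succ k ih => intro F G hF h; exact ⟨hF.1.congr h, fun v => ih (hF.2 v) (h.bDeriv v)⟩

lemma LBdK.lBd {k : ℕ} (h : LBdK l k F) : LBd l F := by
  cases k with
  | zero => exact h
  | succ k => exact h.1

lemma LBdK.pred {k : ℕ} : ∀ {F : Krn n}, LBdK l (k + 1) F → LBdK l k F := by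
  induction k with
  | zero => intro F h; exact h.1
  | succ k ih => intro F h; exact ⟨h.1, fun v => ih (h.2 v)⟩

lemma bDeriv_add_eq (v : KPt n) (hF : SmoothOn F (KD n)) (hG : SmoothOn G (KD n)) : ∀ q ∈ KD n,
    bDeriv v (fun q => F q + G q) q = bDeriv v F q + bDeriv v G q :=
  bDerivs_add [v] hF hG

lemma diffAt_KD (hF : SmoothOn F (KD n)) {q : KPt n} (hq : q ∈ KD n) : DifferentiableAt ℝ F q :=
  (hF.contDiffAt (isOpen_kernelDomain.mem_nhds hq)).differentiableAt (by simp)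

lemma bDeriv_mul_eq (v : KPt n) (hF : SmoothOn F (KD n)) (hG : SmoothOn G (KD n)) : ∀ q ∈ KD n,
    bDeriv v (fun q => F q * G q) q = bDeriv v F q * G q + F q * bDeriv v G q := by
  intro q hq
  simp only [bDeriv]
  rw [fderiv_fun_mul (diffAt_KD hF hq)
    (diffAt_KD hG hq)]
  simp
  ring

lemma LBdK.add {k : ℕ} : ∀ {F G : Krn n}, SmoothOn F (KD n) → SmoothOn G (KD n) → LBdK l k F → LBdK
    l k G → LBdK l k (fun q => F q + G q) := by
  induction k with
  | zero => intro F G _ _ hF hG x y; exact (hF x y).add (hG x y)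
  | succ k ih =>
    intro F G sF sG hF hG
    refine ⟨fun x y => (hF.1 x y).add (hG.1 x y), fun v => ?_⟩
    exact (ih (bDeriv_smooth v sF) (bDeriv_smooth v sG) (hF.2 v) (hG.2 v)).congr
      (EqSmall.of_domain (bDeriv_add_eq v sF sG)).symm

lemma LBd.mul (hF : LBd l F) (hG : LBd l' G) : LBd (l + l') (fun q => F q * G q) := by
  intro x y
  refine ((hF x y).mul (hG x y)).congr' EventuallyEq.rfl ?_
  filter_upwards [eventually_bFilter_Ioo x y one_pos] with q hq
  rw [← rpow_add hq.1]; congr 1; ring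

lemma LBdK.mul {k : ℕ} : ∀ {F G : Krn n}, SmoothOn F (KD n) → SmoothOn G (KD n) → LBdK l k F → LBdK
    l' k G → LBdK (l + l') k (fun q => F q * G q) := by
  induction k with
  | zero => intro F G _ _ hF hG; exact LBd.mul hF hG
  | succ k ih =>
    intro F G sF sG hF hG
    refine ⟨hF.1.mul hG.1, fun v => ?_⟩
    have dF := bDeriv_smooth v sF
    have dG := bDeriv_smooth v sG
    exact (LBdK.add (dF.mul sG) (sF.mul dG) (ih dF sG (hF.2 v) hG.pred)
      (ih sF dG hF.pred (hG.2 v))).congr (EqSmall.of_domain (bDeriv_mul_eq v sF sG)).symm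

lemma LRes.add (hF : LRes l F) (hG : LRes l G) : LRes l (fun q => F q + G q) :=
  ⟨hF.smooth.add hG.smooth, fun k => LBdK.add hF.smooth hG.smooth (hF.bd k) (hG.bd k)⟩

lemma LRes.mul (hF : LRes l F) (hG : LRes l' G) : LRes (l + l') (fun q => F q * G q) :=
  ⟨hF.smooth.mul hG.smooth, fun k => LBdK.mul hF.smooth hG.smooth (hF.bd k) (hG.bd k)⟩

lemma LRes.bDeriv (hF : LRes l F) (v : KPt n) : LRes l (bDeriv v F) :=
  ⟨bDeriv_smooth v hF.smooth, fun k => (hF.bd (k + 1)).2 v⟩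

lemma LRes.congr (hF : LRes l F) (h : ∀ q ∈ KD n, G q = F q) : LRes l G :=
  ⟨hF.smooth.congr h, fun k => (hF.bd k).congr (EqSmall.of_domain h).symm⟩

lemma LRes.congr_small (hF : LRes l F) (hG : SmoothOn G (KD n)) (h : EqSmall F G) : LRes l G :=
  ⟨hG, fun k => (hF.bd k).congr h⟩

lemma LBd.of_continuous (hF : Continuous F) : LBd 0 F := by
  intro x y
  have h1 : Tendsto F (bFilter x y) (𝓝 (F (x, y, 0))) := by
    refine (hF.tendsto (x, y, 0)).mono_left ?_
    rw [nhds_prod_eq, nhds_prod_eq]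
    exact Filter.prod_mono le_rfl (Filter.prod_mono le_rfl nhdsWithin_le_nhds)
  simpa using h1.isBigO_one ℝ

lemma LBdK.of_contDiff {k : ℕ} : ∀ {F : Krn n}, Smooth F → LBdK 0 k F := by
  induction k with
  | zero => intro F hF; exact LBd.of_continuous hF.continuous
  | succ k ih =>
    intro F hF
    refine ⟨LBd.of_continuous hF.continuous, fun v => ih ?_⟩
    exact (hF.fderiv_right (by simp)).clm_apply (by fun_prop)

/-- Functions smooth up to and across `h = 0` are residual of order `0`. -/
lemma LRes.of_contDiff (hF : Smooth F) : LRes 0 F :=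
  ⟨hF.contDiffOn, fun _ => LBdK.of_contDiff hF⟩

lemma LRes.zero (l : ℝ) : LRes l (fun _ : KPt n => (0 : ℂ)) := by
  refine ⟨contDiffOn_const, fun k => ?_⟩
  induction k with
  | zero => exact fun x y => Asymptotics.isBigO_zero _ _
  | succ k ih =>
    refine ⟨fun x y => Asymptotics.isBigO_zero _ _, fun v => ?_⟩
    have : TwoMicro.bDeriv v (fun _ : KPt n => (0 : ℂ)) = fun _ => 0 := bDerivs_zero [v]
    rw [this]; exact ih

lemma LRes.mul_contDiff {F g : Krn n} (hF : LRes l F)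
    (hg : Smooth g) : LRes l (fun q => g q * F q) := by
  simpa using (LRes.of_contDiff hg).mul hF

lemma LRes.const_mul (hF : LRes l F) (c : ℂ) :
    LRes l (fun q => c * F q) := hF.mul_contDiff contDiff_const

lemma LRes.neg (hF : LRes l F) : LRes l (fun q => - F q) := by
  simpa using hF.const_mul (-1)

lemma LRes.sub (hF : LRes l F) (hG : LRes l G) : LRes l (fun q => F q - G q) := by
  simpa [sub_eq_add_neg] using hF.add hG.neg

/-- The function `h^s`. -/
def hPow (n : ℕ) (s : ℝ) : Krn n := fun q => ((q.2.2 ^ s : ℝ) : ℂ)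

lemma hPow_smooth (s : ℝ) : SmoothOn (hPow n s) (KD n) := by
  refine ofRealCLM.contDiff.comp_contDiffOn ?_
  intro q hq
  have : ContDiffAt ℝ ∞ (fun q : KPt n => q.2.2 ^ s) q :=
    ContDiffAt.rpow_const_of_ne (by fun_prop) hq.2.2.1.ne'
  exact this.contDiffWithinAt

lemma bDeriv_hPow (s : ℝ) (v : KPt n) :
    ∀ q ∈ KD n, bDeriv v (hPow n s) q = (s * v.2.2 : ℝ) * hPow n s q := by
  intro q hq
  have hq0 : q.2.2 ≠ 0 := hq.2.2.1.ne'
  have h1 : HasFDerivAt (fun q : KPt n => q.2.2 ^ s) _ q :=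
    (hasFDerivAt_id (𝕜 := ℝ) q).snd.snd.rpow_const (p := s) (Or.inl hq0)
  have h2 := ofRealCLM.hasFDerivAt.comp q h1
  have h3 : fderiv ℝ (hPow n s) q = _ := h2.fderiv
  simp only [bDeriv, h3, hPow]
  simp
  rw [← ofReal_mul]
  have : q.2.2 ^ (s - 1) * q.2.2 = q.2.2 ^ s := by
    rw [← Real.rpow_add_one hq0]; congr 1; ring
  rw [← this]; push_cast; ring

lemma LRes.hPow (s : ℝ) : LRes (-s) (hPow n s) := by
  refine ⟨hPow_smooth s, fun k => ?_⟩
  have hb : LBd (-s) (TwoMicro.hPow n s) := by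
    intro x y
    refine Asymptotics.IsBigO.of_bound 1 ?_
    filter_upwards [eventually_bFilter_Ioo x y one_pos] with q hq
    simp [TwoMicro.hPow]
  induction k with
  | zero => exact hb
  | succ k ih =>
    refine ⟨hb, fun v => ?_⟩
    have h1 : LBdK (-s) k (fun q => ((s * v.2.2 : ℝ) : ℂ) * TwoMicro.hPow n s q) := by
      have := LBdK.mul (k := k) (contDiffOn_const (c := ((s * v.2.2 : ℝ) : ℂ))) (hPow_smooth s)
        (LBdK.of_contDiff contDiff_const) ih
      simpa only [zero_add] using this
    exact h1.congr (EqSmall.of_domain (bDeriv_hPow s v)).symm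

lemma LRes.hPow_mul (hF : LRes l F) (s : ℝ) :
    LRes (l - s) (fun q => TwoMicro.hPow n s q * F q) := by
  have := (LRes.hPow (n := n) s).mul hF
  rwa [show -s + l = l - s by ring] at this

lemma LBd.exists_bound (hF : LBd l F) {S : Set (E n × E n)} (hS : IsCompact S) : ∃ C : ℝ, ∃ ε > 0, ∀
    p ∈ S, ∀ h ∈ Ioo 0 ε, ‖F (p.1, p.2, h)‖ ≤ C * h ^ (-l) := by
  refine hS.induction_on
    (p := fun D => ∃ C : ℝ, ∃ ε > 0, ∀ p ∈ D, ∀ h ∈ Ioo 0 ε, ‖F (p.1, p.2, h)‖ ≤ C * h ^ (-l))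
    ⟨0, 1, one_pos, fun _ hp => absurd hp (notMem_empty _)⟩ ?_ ?_ ?_
  · rintro s t hst ⟨C, ε, hε, H⟩
    exact ⟨C, ε, hε, fun p hp => H p (hst hp)⟩
  · rintro s t ⟨C, ε, hε, H⟩ ⟨C', ε', hε', H'⟩
    refine ⟨max C C', min ε ε', lt_min hε hε', fun p hp h hh => ?_⟩
    have h0 : 0 ≤ h ^ (-l) := rpow_nonneg hh.1.le _
    rcases hp with hp | hp
    · exact (H p hp h ⟨hh.1, hh.2.trans_le (min_le_left _ _)⟩).trans
        (mul_le_mul_of_nonneg_right (le_max_left _ _) h0)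
    · exact (H' p hp h ⟨hh.1, hh.2.trans_le (min_le_right _ _)⟩).trans
        (mul_le_mul_of_nonneg_right (le_max_right _ _) h0)
  · rintro ⟨x, y⟩ -
    obtain ⟨C, hC⟩ := (hF x y).bound
    obtain ⟨u, hu, w, hw, H⟩ := Filter.mem_prod_iff.1 hC
    obtain ⟨v, hv, t, ht, H'⟩ := Filter.mem_prod_iff.1 hw
    obtain ⟨ε, hε, hεt⟩ := (mem_nhdsGT_iff_exists_Ioo_subset).1 ht
    refine ⟨u ×ˢ v, mem_nhdsWithin_of_mem_nhds (prod_mem_nhds hu hv), C, ε, hε, ?_⟩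
    rintro ⟨a, b⟩ ⟨ha, hb⟩ h hh
    have h1 : ‖F (a, b, h)‖ ≤ C * ‖h ^ (-l)‖ := @H (a, b, h) ⟨ha, H' ⟨hb, hεt hh⟩⟩
    rwa [norm_of_nonneg (rpow_nonneg hh.1.le _)] at h1

lemma LBd.of_forall_bound (H : ∀ R : ℝ, ∃ C : ℝ, ∃ ε > 0, ∀ x y : E n, ‖x‖ ≤ R → ‖y‖ ≤ R → ∀ h ∈ Ioo
    0 ε, ‖F (x, y, h)‖ ≤ C * h ^ (-l)) : LBd l F := by
  intro x y
  obtain ⟨C, ε, hε, hC⟩ := H (max ‖x‖ ‖y‖ + 1)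
  refine Asymptotics.IsBigO.of_bound C ?_
  have hx : ∀ᶠ a in 𝓝 x, ‖a‖ ≤ max ‖x‖ ‖y‖ + 1 :=
    (continuous_norm.tendsto x).eventually_le_const
      (by linarith [le_max_left ‖x‖ ‖y‖])
  have hy : ∀ᶠ a in 𝓝 y, ‖a‖ ≤ max ‖x‖ ‖y‖ + 1 :=
    (continuous_norm.tendsto y).eventually_le_const
      (by linarith [le_max_right ‖x‖ ‖y‖])
  have hh : ∀ᶠ h in 𝓝[>] (0 : ℝ), h ∈ Ioo 0 ε := Ioo_mem_nhdsGT hε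
  filter_upwards [hx.prod_mk (hy.prod_mk hh)] with q hq
  rw [norm_of_nonneg (rpow_nonneg hq.2.2.1.le _)]
  exact hC _ _ hq.1 hq.2.1 _ hq.2.2

lemma LRes.bDerivs (hF : LRes l F) (L : List (KPt n)) : LRes l (bDerivs L F) := by
  induction L with
  | nil => exact hF
  | cons v L ih => exact ih.bDeriv v

/-- `F` is supported over `S`, for `0 < h < 1`. -/
def SuppOver (S : Set (E n × E n)) (F : Krn n) : Prop :=
  ∀ x y : E n, ∀ h : ℝ, 0 < h → h < 1 → F (x, y, h) ≠ 0 → (x, y) ∈ S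

lemma SuppOver.bDeriv {S : Set (E n × E n)} (hS : IsClosed S)
    (hF : SuppOver S F) (v : KPt n) : SuppOver S (bDeriv v F) := by
  intro x y h h0 h1 hne
  by_contra hxy
  refine hne ?_
  have : F =ᶠ[𝓝 (x, y, h)] fun _ => 0 := by
    have ho : IsOpen {q : KPt n | (q.1, q.2.1) ∈ Sᶜ} :=
      hS.isOpen_compl.preimage (by fun_prop)
    filter_upwards [ho.mem_nhds hxy, isOpen_kernelDomain.mem_nhds (mem_kernelDomain h0 h1)]
      with q hq hq'
    by_contra hF0
    exact hq (hF q.1 q.2.1 q.2.2 hq'.2.2.1 hq'.2.2.2 hF0)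
  simp [TwoMicro.bDeriv, this.fderiv_eq]

lemma SuppOver.bDerivs {S : Set (E n × E n)} (hS : IsClosed S)
    (hF : SuppOver S F) (L : List (KPt n)) : SuppOver S (bDerivs L F) := by
  induction L with
  | nil => exact hF
  | cons v L ih => exact ih.bDeriv hS v

lemma LRes.isResidualKernel (hF : LRes l F)
    {S : Set (E n × E n)} (hS : IsCompact S) (hs : SuppOver S F) : IsResidualKernel l F where
  smooth := hF.smooth
  proper K _ h₀ h1 := by
    refine ⟨Prod.fst '' S ∪ Prod.snd '' S, (hS.image continuous_fst).union
      (hS.image continuous_snd), fun x y h hh hh0 hne => ?_⟩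
    have := hs x y h hh (hh0.trans_lt h1) hne
    exact ⟨fun _ => Or.inr ⟨_, this, rfl⟩, fun _ => Or.inl ⟨_, this, rfl⟩⟩
  bound L h₀ h1 := by
    obtain ⟨C, ε, hε, hC⟩ := ((hF.bDerivs L).bd 0 : LBd l _).exists_bound hS
    have hcont : ContinuousOn (fun q : KPt n => q.2.2 ^ l * ‖TwoMicro.bDerivs L F q‖)
        ((fun q : KPt n => (((q.1, q.2.1) : E n × E n), q.2.2)) ⁻¹'
          (S ×ˢ Icc ε h₀)) := by
      refine ContinuousOn.mul ?_ (ContinuousOn.norm ?_)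
      · refine ContinuousOn.rpow_const (by fun_prop) fun q hq => Or.inl ?_
        exact (hε.trans_le hq.2.1).ne'
      · exact (bDerivs_smooth L hF.smooth).continuousOn.mono fun q hq =>
          mem_kernelDomain (hε.trans_le hq.2.1) (hq.2.2.trans_lt h1)
    have hcpt : IsCompact ((fun q : KPt n => (((q.1, q.2.1) : E n × E n), q.2.2)) ⁻¹'
          (S ×ˢ Icc ε h₀)) :=
      (Homeomorph.prodAssoc (E n) (E n) ℝ).symm.isCompact_preimage.2 (hS.prod isCompact_Icc)
    obtain ⟨D, hD⟩ := hcpt.exists_bound_of_continuousOn hcont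
    refine ⟨max 0 (max C D), fun x y h hh hh0 => ?_⟩
    have hl : 0 ≤ h ^ l := rpow_nonneg hh.le l
    by_cases hxy : (x, y) ∈ S
    · by_cases hhε : h < ε
      · have h2 := hC (x, y) hxy h ⟨hh, hhε⟩
        refine le_trans ?_ ((le_max_left C D).trans (le_max_right _ _))
        calc h ^ l * ‖TwoMicro.bDerivs L F (x, y, h)‖ ≤ h ^ l * (C * h ^ (-l)) :=
              mul_le_mul_of_nonneg_left h2 hl
          _ = C * (h ^ l * h ^ (-l)) := by ring
          _ = C := by rw [← rpow_add hh, add_neg_cancel, Real.rpow_zero, mul_one]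
      · refine le_trans ?_ ((le_max_right C D).trans (le_max_right _ _))
        exact (le_abs_self _).trans (hD (x, y, h) ⟨hxy, not_lt.1 hhε, hh0⟩)
    · have : TwoMicro.bDerivs L F (x, y, h) = 0 := by
        by_contra hne
        exact hxy (hs.bDerivs hS.isClosed L x y h hh (hh0.trans_lt h1) hne)
      simp [this]

lemma IsResidualKernel.lRes (hF : IsResidualKernel l F) : LRes l F := by
  refine ⟨hF.smooth, fun k => ?_⟩
  have hb : ∀ L, LBd l (TwoMicro.bDerivs L F) := by
    intro L
    obtain ⟨C, hC⟩ := hF.bound L (1 / 2) (by norm_num)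
    refine LBd.of_forall_bound fun R => ⟨C, 1 / 2, by norm_num, fun x y _ _ h hh => ?_⟩
    have h1 := hC x y h hh.1 hh.2.le
    rw [rpow_neg hh.1.le, ← div_eq_mul_inv, le_div_iff₀ (Real.rpow_pos_of_pos hh.1 _)]
    linarith
  suffices ∀ L, LBdK l k (TwoMicro.bDerivs L F) from this []
  induction k with
  | zero => exact hb
  | succ k ih => exact fun L => ⟨hb L, fun v => ih (v :: L)⟩

/-! ### Transposition and conjugation -/

/-- The transposed kernel. -/
def swapK (F : Krn n) : Krn n := fun q => F (q.2.1, q.1, q.2.2)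

/-- The conjugate kernel. -/
def conjK (F : Krn n) : Krn n := fun q => (starRingEnd ℂ) (F q)

lemma swapK_smooth (hF : SmoothOn F (KD n)) : SmoothOn (swapK F) (KD n) :=
  hF.comp (f := fun q : KPt n => (q.2.1, q.1, q.2.2)) (by fun_prop)
    fun _ hq => ⟨mem_univ _, mem_univ _, hq.2.2⟩

lemma conjK_smooth (hF : SmoothOn F (KD n)) : SmoothOn (conjK F) (KD n) :=
  conjCLE.contDiff.comp_contDiffOn hF

lemma bDeriv_swapK (v : KPt n) (hF : SmoothOn F (KD n)) : ∀ q ∈ KD n, bDeriv v (swapK F) q = swapK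
    (bDeriv (v.2.1, v.1, v.2.2) F) q := by
  intro q hq
  let T : (KPt n) →L[ℝ] (KPt n) :=
    ((fst ℝ (E n) ℝ).comp (snd ℝ (E n) (E n × ℝ))).prod
      ((fst ℝ (E n) (E n × ℝ)).prod
        ((snd ℝ (E n) ℝ).comp (snd ℝ (E n) (E n × ℝ))))
  have hd : DifferentiableAt ℝ F (T q) :=
    diffAt_KD hF ⟨mem_univ _, mem_univ _, hq.2.2⟩
  have h1 : HasFDerivAt (swapK F) ((fderiv ℝ F (T q)).comp T) q :=
    hd.hasFDerivAt.comp q T.hasFDerivAt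
  simp only [bDeriv, h1.fderiv]
  rfl

lemma bDeriv_conjK (v : KPt n) (hF : SmoothOn F (KD n)) : ∀ q ∈ KD n, bDeriv v (conjK F) q = conjK
    (bDeriv v F) q := by
  intro q hq
  have h1 : HasFDerivAt (conjK F) ((conjCLE : ℂ →L[ℝ] ℂ).comp (fderiv ℝ F q)) q :=
    (conjCLE : ℂ →L[ℝ] ℂ).hasFDerivAt.comp q
      (diffAt_KD hF hq).hasFDerivAt
  simp only [bDeriv, h1.fderiv]
  rfl

lemma LRes.swapK (hF : LRes l F) : LRes l (swapK F) := by
  refine ⟨swapK_smooth hF.smooth, fun k => ?_⟩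
  have hb : ∀ {G : Krn n}, LBd l G → LBd l (TwoMicro.swapK G) := by
    intro G hG x y
    have ht : Tendsto (fun q : KPt n => (q.2.1, q.1, q.2.2)) (bFilter x y)
        (bFilter y x) := by
      refine Tendsto.prodMk ?_ (Tendsto.prodMk tendsto_fst ?_)
      · exact tendsto_fst.comp tendsto_snd
      · exact tendsto_snd.comp tendsto_snd
    exact (hG y x).comp_tendsto ht
  induction k generalizing F with
  | zero => exact hb (hF.bd 0)
  | succ k ih =>
    exact ⟨hb (hF.bd 0), fun v => (ih (hF.bDeriv (v.2.1, v.1, v.2.2))).congr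
      (EqSmall.of_domain (bDeriv_swapK v hF.smooth)).symm⟩

lemma LRes.conjK (hF : LRes l F) : LRes l (conjK F) := by
  refine ⟨conjK_smooth hF.smooth, fun k => ?_⟩
  have hb : ∀ {G : Krn n}, LBd l G → LBd l (TwoMicro.conjK G) := by
    intro G hG x y
    refine Asymptotics.IsBigO.of_norm_left ?_
    simpa [TwoMicro.conjK] using (hG x y).norm_left
  induction k generalizing F with
  | zero => exact hb (hF.bd 0)
  | succ k ih =>
    exact ⟨hb (hF.bd 0), fun v => (ih (hF.bDeriv v)).congr
      (EqSmall.of_domain (bDeriv_conjK v hF.smooth)).symm⟩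

/-! ### Pull-back -/

lemma contDiff_mul_of_tsupport {P : Type*} [NormedAddCommGroup P] [NormedSpace ℝ P]
    {f g : P → ℂ} {U : Set P} (hU : IsOpen U) (hf : SmoothOn f U) (hg : Smooth g)
    (hs : tsupport g ⊆ U) : Smooth fun p => g p * f p := by
  refine contDiff_iff_contDiffAt.2 fun p => ?_
  by_cases hp : p ∈ tsupport g
  · exact hg.contDiffAt.mul (hf.contDiffAt (hU.mem_nhds (hs hp)))
  · have : (fun p => g p * f p) =ᶠ[𝓝 p] fun _ => 0 := by
      filter_upwards [notMem_tsupport_iff_eventuallyEq.1 hp] with q hq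
      simp [hq]
    exact contDiffAt_const.congr_of_eventuallyEq this

/-- The kernel `θ(x,y) F(κ x, κ' y, h)`. -/
def pullK (θ : E n × E n → ℂ) (κ κ' : E n → E n) (F : Krn n) : Krn n :=
  fun q => θ (q.1, q.2.1) * F (κ q.1, κ' q.2.1, q.2.2)

section Pull

variable {κ κ' : E n → E n} {B B' : Set (E n)}

lemma pullK_smooth (hB : IsOpen B) (hB' : IsOpen B') (hκ : SmoothOn κ B) (hκ' : SmoothOn κ' B') {θ :
    E n × E n → ℂ} (hθ : Smooth θ) (hs : tsupport θ ⊆ B ×ˢ B') (hF : SmoothOn F (KD n)) : SmoothOn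
    (pullK θ κ κ' F) (KD n) := by
  intro q hq
  refine ContDiffAt.contDiffWithinAt ?_
  by_cases hp : (q.1, q.2.1) ∈ tsupport θ
  · have hpB := hs hp
    have h1 : ContDiffAt ℝ ∞ (fun q : KPt n => F (κ q.1, κ' q.2.1, q.2.2)) q := by
      have hF' : ContDiffAt ℝ ∞ F (κ q.1, κ' q.2.1, q.2.2) :=
        hF.contDiffAt (isOpen_kernelDomain.mem_nhds ⟨mem_univ _, mem_univ _, hq.2.2⟩)
      have h3 : ContDiffAt ℝ ∞ κ q.1 := hκ.contDiffAt (hB.mem_nhds hpB.1)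
      have h4 : ContDiffAt ℝ ∞ κ' q.2.1 := hκ'.contDiffAt (hB'.mem_nhds hpB.2)
      refine ContDiffAt.comp (f := fun q : KPt n => (κ q.1, κ' q.2.1, q.2.2)) q hF' ?_
      exact (h3.comp q (by fun_prop)).prodMk
        ((h4.comp (f := fun q : KPt n => q.2.1) q (by fun_prop)).prodMk (by fun_prop))
    exact (ContDiff.contDiffAt (hθ.comp (by fun_prop))).mul h1
  · have : pullK θ κ κ' F =ᶠ[𝓝 q] fun _ => 0 := by
      have hc : ContinuousAt (fun q : KPt n => (q.1, q.2.1)) q := by fun_prop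
      filter_upwards [hc.eventually (notMem_tsupport_iff_eventuallyEq.1 hp)] with q hq
      have : θ (q.1, q.2.1) = 0 := hq
      simp [pullK, this]
    exact contDiffAt_const.congr_of_eventuallyEq this

lemma LBd.pullK (hB : IsOpen B) (hB' : IsOpen B') (hκ : SmoothOn κ B) (hκ' : SmoothOn κ' B') {θ : E
    n × E n → ℂ} (hθ : Smooth θ) (hs : tsupport θ ⊆ B ×ˢ B') (hF : LBd l F) : LBd l (pullK θ κ κ' F)
    := by
  intro x y
  have hfst : Tendsto (fun q : KPt n => (q.1, q.2.1)) (bFilter x y) (𝓝 (x, y)) := by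
    rw [nhds_prod_eq]
    exact tendsto_fst.prodMk (tendsto_fst.comp tendsto_snd)
  by_cases hp : (x, y) ∈ tsupport θ
  · have hpB := hs hp
    have hk : Tendsto κ (𝓝 x) (𝓝 (κ x)) := (hκ.continuousOn.continuousAt (hB.mem_nhds hpB.1))
    have hk' : Tendsto κ' (𝓝 y) (𝓝 (κ' y)) :=
      (hκ'.continuousOn.continuousAt (hB'.mem_nhds hpB.2))
    have ht : Tendsto (fun q : KPt n => (κ q.1, κ' q.2.1, q.2.2)) (bFilter x y)
        (bFilter (κ x) (κ' y)) :=
      (hk.comp tendsto_fst).prodMk ((hk'.comp (tendsto_fst.comp tendsto_snd)).prodMk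
        (tendsto_snd.comp tendsto_snd))
    have h1 := (hF (κ x) (κ' y)).comp_tendsto ht
    have h2 : (fun q : KPt n => θ (q.1, q.2.1)) =O[bFilter x y] fun _ => (1 : ℝ) :=
      ((hθ.continuous.tendsto (x, y)).comp hfst).isBigO_one ℝ
    have h3 := h2.mul h1
    simp only [one_mul] at h3
    exact h3
  · refine Asymptotics.IsBigO.congr' (Asymptotics.isBigO_zero _ _) ?_ EventuallyEq.rfl
    filter_upwards [hfst.eventually (notMem_tsupport_iff_eventuallyEq.1 hp)] with q hq
    have : θ (q.1, q.2.1) = 0 := hq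
    simp [TwoMicro.pullK, this]

lemma sum_single_eq (w : E n) : ∑ j : Fin n, w j • (EuclideanSpace.single j (1 : ℝ)) = w := by
  ext i
  simp [Finset.sum_apply, Pi.single_apply]

lemma clm_expand (D : (KPt n) →L[ℝ] ℂ) (a b : E n) (t : ℝ) : D (a, b, t) = (∑ j, (a j : ℂ) * D
    (EuclideanSpace.single j 1, 0, 0)) + (∑ j, (b j : ℂ) * D (0, EuclideanSpace.single j 1, 0)) + D
    (0, 0, t) := by
  have h1 : ((a, b, t) : KPt n) =
      (∑ j, a j • ((EuclideanSpace.single j (1 : ℝ), 0, 0) : KPt n)) +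
      (∑ j, b j • ((0, EuclideanSpace.single j (1 : ℝ), 0) : KPt n)) + (0, 0, t) := by
    refine Prod.ext ?_ (Prod.ext ?_ ?_)
    · simp [Prod.fst_sum, sum_single_eq]
    · simp [Prod.fst_sum, Prod.snd_sum, sum_single_eq]
    · simp [Prod.snd_sum]
  rw [h1, map_add, map_add, map_sum, map_sum]
  simp only [map_smul, real_smul]

/-- The `j`-th component of the derivative of `κ` along `w`. -/
def dcomp (κ : E n → E n) (w : E n) (j : Fin n) (x : E n) : ℂ := ((fderiv ℝ κ x w j : ℝ) : ℂ)

lemma dcomp_smooth (hB : IsOpen B) (hκ : SmoothOn κ B) (w : E n) (j : Fin n) :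
    SmoothOn (dcomp κ w j) B := by
  have h1 : SmoothOn (fun x => fderiv ℝ κ x w) B :=
    (hκ.fderiv_of_isOpen hB (by simp)).clm_apply contDiffOn_const
  exact ofRealCLM.contDiff.comp_contDiffOn
    ((EuclideanSpace.proj (𝕜 := ℝ) j).contDiff.comp_contDiffOn h1)

lemma bDeriv_pullK (hB : IsOpen B) (hB' : IsOpen B') (hκ : SmoothOn κ B) (hκ' : SmoothOn κ' B') {θ :
    E n × E n → ℂ} (hθ : Smooth θ) (hs : tsupport θ ⊆ B ×ˢ B') (hF : SmoothOn F (KD n)) (v : KPt n)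
    : ∀ q ∈ KD n, bDeriv v (pullK θ κ κ' F) q = pullK (fun p => fderiv ℝ θ p (v.1, v.2.1)) κ κ' F q
    + ((∑ j, pullK (fun p => θ p * dcomp κ v.1 j p.1) κ κ' (bDeriv (EuclideanSpace.single j 1, 0, 0)
    F) q) + (∑ j, pullK (fun p => θ p * dcomp κ' v.2.1 j p.2) κ κ' (bDeriv (0, EuclideanSpace.single
    j 1, 0) F) q) + pullK θ κ κ' (bDeriv (0, 0, v.2.2) F) q) := by
  rintro ⟨x, y, h⟩ hq
  by_cases hp : (x, y) ∈ tsupport θ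
  · have hpB := hs hp
    have d1 : HasFDerivAt κ (fderiv ℝ κ x) x :=
      ((hκ.contDiffAt (hB.mem_nhds hpB.1)).differentiableAt (by simp)).hasFDerivAt
    have d2 : HasFDerivAt κ' (fderiv ℝ κ' y) y :=
      ((hκ'.contDiffAt (hB'.mem_nhds hpB.2)).differentiableAt (by simp)).hasFDerivAt
    have d3 : HasFDerivAt F (fderiv ℝ F (κ x, κ' y, h)) (κ x, κ' y, h) :=
      (diffAt_KD hF (q := (κ x, κ' y, h))
        ⟨mem_univ _, mem_univ _, hq.2.2⟩).hasFDerivAt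
    have d4 : HasFDerivAt θ (fderiv ℝ θ (x, y)) (x, y) :=
      (hθ.differentiable (by simp) _).hasFDerivAt
    have i1 := hasFDerivAt_fst (𝕜 := ℝ) (p := ((x, y, h) : KPt n))
    have i2 := (hasFDerivAt_snd (𝕜 := ℝ) (p := ((x, y, h) : KPt n))).fst
    have i3 := (hasFDerivAt_snd (𝕜 := ℝ) (p := ((x, y, h) : KPt n))).snd
    have e1 := HasFDerivAt.comp (x, y, h) d1 i1
    have e2 := HasFDerivAt.comp (f := fun q : KPt n => q.2.1) (x, y, h) d2 i2
    have e3 := HasFDerivAt.comp (x, y, h)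
      (f := fun q : KPt n => (κ q.1, κ' q.2.1, q.2.2)) d3 (e1.prodMk (e2.prodMk i3))
    have e4 := HasFDerivAt.comp (x, y, h)
      (f := fun q : KPt n => (q.1, q.2.1)) d4 (i1.prodMk i2)
    have e5 : HasFDerivAt (pullK θ κ κ' F) _ (x, y, h) := e4.mul e3
    simp only [bDeriv, e5.fderiv, pullK, dcomp]
    simp only [_root_.add_apply, _root_.smul_apply, smul_eq_mul,
      ContinuousLinearMap.comp_apply, ContinuousLinearMap.prod_apply, ContinuousLinearMap.coe_fst',
      ContinuousLinearMap.coe_snd', Function.comp_apply]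
    rw [clm_expand]
    simp only [mul_add, Finset.mul_sum, mul_zero]
    simp only [mul_assoc]
    ring_nf
  · have hz : θ =ᶠ[𝓝 (x, y)] fun _ => 0 := notMem_tsupport_iff_eventuallyEq.1 hp
    have hc : ContinuousAt (fun q : KPt n => (q.1, q.2.1)) (x, y, h) := by fun_prop
    have h1 : pullK θ κ κ' F =ᶠ[𝓝 (x, y, h)] fun _ => 0 := by
      filter_upwards [hc.eventually hz] with q hq
      have : θ (q.1, q.2.1) = 0 := hq
      simp [pullK, this]
    have h2 : θ (x, y) = 0 := hz.self_of_nhds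
    simp [bDeriv, h1.fderiv_eq, pullK, hz.fderiv_eq, h2]

lemma LRes.pullK (hB : IsOpen B) (hB' : IsOpen B') (hκ : SmoothOn κ B) (hκ' : SmoothOn κ' B') {θ : E
    n × E n → ℂ} (hθ : Smooth θ) (hs : tsupport θ ⊆ B ×ˢ B') (hF : LRes l F) : LRes l (pullK θ κ κ'
    F) := by
  refine ⟨pullK_smooth hB hB' hκ hκ' hθ hs hF.smooth, fun k => ?_⟩
  induction k generalizing F θ with
  | zero => exact LBd.pullK hB hB' hκ hκ' hθ hs (hF.bd 0)
  | succ k ih =>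
    refine ⟨LBd.pullK hB hB' hκ hκ' hθ hs (hF.bd 0), fun v => ?_⟩
    have hθ1 : Smooth fun p => fderiv ℝ θ p (v.1, v.2.1) :=
      (hθ.fderiv_right (by simp)).clm_apply contDiff_const
    have hs1 : tsupport (fun p => fderiv ℝ θ p (v.1, v.2.1)) ⊆ B ×ˢ B' :=
      (tsupport_fderiv_apply_subset ℝ _).trans hs
    have hθ2 : ∀ j, Smooth fun p : E n × E n => θ p * dcomp κ v.1 j p.1 := fun j =>
      contDiff_mul_of_tsupport (hB.prod hB')
        ((dcomp_smooth hB hκ v.1 j).comp contDiffOn_fst fun p hp => hp.1) hθ hs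
    have hθ3 : ∀ j, Smooth fun p : E n × E n => θ p * dcomp κ' v.2.1 j p.2 := fun j =>
      contDiff_mul_of_tsupport (hB.prod hB')
        ((dcomp_smooth hB' hκ' v.2.1 j).comp contDiffOn_snd fun p hp => hp.2) hθ hs
    have hs2 : ∀ f : E n × E n → ℂ, tsupport (fun p => θ p * f p) ⊆ B ×ˢ B' := fun f =>
      (tsupport_mul_subset_left).trans hs
    have sm : ∀ {θ : E n × E n → ℂ} {F : Krn n}, Smooth θ →
        tsupport θ ⊆ B ×ˢ B' → LRes l F →
          SmoothOn (TwoMicro.pullK θ κ κ' F) (KD n) :=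
      fun h1 h2 h3 => pullK_smooth hB hB' hκ hκ' h1 h2 h3.smooth
    have hsum : ∀ {G : Fin n → Krn n},
        (∀ j, SmoothOn (G j) (KD n)) → (∀ j, LBdK l k (G j)) →
          LBdK l k fun q => ∑ j, G j q := by
      intro G h1 h2
      have h3 : ∀ s : Finset (Fin n), LBdK l k fun q => ∑ j ∈ s, G j q := by
        intro s
        induction s using Finset.induction_on with
        | empty => simpa using (LRes.zero l).bd k
        | insert a s ha ihs =>
          simp only [Finset.sum_insert ha]
          exact LBdK.add (h1 a) (ContDiffOn.sum fun j _ => h1 j) (h2 a) ihs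
      exact h3 _
    refine LBdK.congr ?_ (EqSmall.of_domain (bDeriv_pullK hB hB' hκ hκ' hθ hs hF.smooth v)).symm
    have t2 := fun j => hF.bDeriv (EuclideanSpace.single j 1, 0, 0)
    have t3 := fun j => hF.bDeriv (0, EuclideanSpace.single j 1, 0)
    refine LBdK.add (sm hθ1 hs1 hF) ?_ (ih hθ1 hs1 hF) (LBdK.add ?_ ?_ (LBdK.add ?_ ?_ ?_ ?_) ?_)
    · exact ((ContDiffOn.sum fun j _ => sm (hθ2 j) (hs2 _) (t2 j)).add
        (ContDiffOn.sum fun j _ => sm (hθ3 j) (hs2 _) (t3 j))).add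
        (sm hθ hs (hF.bDeriv (0, 0, v.2.2)))
    · exact (ContDiffOn.sum fun j _ => sm (hθ2 j) (hs2 _) (t2 j)).add
        (ContDiffOn.sum fun j _ => sm (hθ3 j) (hs2 _) (t3 j))
    · exact sm hθ hs (hF.bDeriv (0, 0, v.2.2))
    · exact ContDiffOn.sum fun j _ => sm (hθ2 j) (hs2 _) (t2 j)
    · exact ContDiffOn.sum fun j _ => sm (hθ3 j) (hs2 _) (t3 j)
    · exact hsum (fun j => sm (hθ2 j) (hs2 _) (t2 j)) fun j => ih (hθ2 j) (hs2 _) (t2 j)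
    · exact hsum (fun j => sm (hθ3 j) (hs2 _) (t3 j)) fun j => ih (hθ3 j) (hs2 _) (t3 j)
    · exact ih hθ hs (hF.bDeriv (0, 0, v.2.2))

end Pull

/-! ### Composition of kernels -/

/-- The kernel of `F g G`, for a function `g` of compact support. -/
def compK (g : E n → ℂ) (F G : Krn n) : Krn n :=
  fun q => ∫ z : E n, F (q.1, z, q.2.2) * g z * G (z, q.2.1, q.2.2)

lemma compK_integrand_smooth (hg : Smooth g) (hF : SmoothOn F (KD n)) (hG : SmoothOn G (KD n)) :
    SmoothOn (fun p : (KPt n) × E n => F (p.1.1, p.2, p.1.2.2) * g p.2 * G (p.2, p.1.2.1, p.1.2.2))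
    (KD n ×ˢ univ) := by
  refine ((hF.comp (f := fun p : (KPt n) × E n => (p.1.1, p.2, p.1.2.2)) ?_ ?_).mul
    ?_).mul (hG.comp (f := fun p : (KPt n) × E n => (p.2, p.1.2.1, p.1.2.2)) ?_ ?_)
  · fun_prop
  · exact fun p hp => ⟨mem_univ _, mem_univ _, hp.1.2.2⟩
  · exact (hg.comp contDiff_snd).contDiffOn
  · fun_prop
  · exact fun p hp => ⟨mem_univ _, mem_univ _, hp.1.2.2⟩

lemma compK_supp (hgc : CSupp g) (F G : Krn n) :
    LocCompactSupp (KD n) (fun p : (KPt n) × E n =>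
      F (p.1.1, p.2, p.1.2.2) * g p.2 * G (p.2, p.1.2.1, p.1.2.2)) := fun _ _ =>
  ⟨tsupport g, hgc, Eventually.of_forall fun q z hz => by
    simp [image_eq_zero_of_notMem_tsupport hz]⟩

lemma compK_smooth (hg : Smooth g) (hgc : CSupp g) (hF : SmoothOn F (KD n)) (hG : SmoothOn G (KD n))
    : SmoothOn (compK g F G) (KD n) :=
  contDiffOn_integral isOpen_kernelDomain (compK_integrand_smooth hg hF hG) (compK_supp hgc F G)

lemma compK_integrable (hg : Smooth g) (hgc : CSupp g) (hF : SmoothOn F (KD n)) (hG : SmoothOn G (KD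
    n)) {q : KPt n} (hq : q ∈ KD n) : Integrable fun z : E n => F (q.1, z, q.2.2) * g z * G (z,
    q.2.1, q.2.2) := by
  have hc : Continuous fun z : E n => F (q.1, z, q.2.2) * g z * G (z, q.2.1, q.2.2) := by
    refine continuousOn_univ.1 ?_
    exact (compK_integrand_smooth hg hF hG).continuousOn.comp
      (f := fun z : E n => (q, z)) (by fun_prop) fun z _ => ⟨hq, mem_univ _⟩
  refine hc.integrable_of_hasCompactSupport ?_
  exact (hgc.mul_left (f := fun z => F (q.1, z, q.2.2))).mul_right

lemma bDeriv_compK (hg : Smooth g) (hgc : CSupp g) (hF : SmoothOn F (KD n)) (hG : SmoothOn G (KD n))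
    (v : KPt n) : ∀ q ∈ KD n, bDeriv v (compK g F G) q = compK g (bDeriv (v.1, 0, v.2.2) F) G q +
    compK g F (bDeriv (0, v.2.1, v.2.2) G) q := by
  rintro ⟨x, y, h⟩ hq
  have h1 := fderiv_integral_apply (μ := (volume : Measure (E n))) isOpen_kernelDomain
    (compK_integrand_smooth hg hF hG) (compK_supp hgc F G) hq (v.1, v.2.1, h * v.2.2)
  have h2 : bDeriv v (compK g F G) (x, y, h) = _ := h1
  rw [h2]
  simp only [compK]
  rw [← integral_add (compK_integrable hg hgc (bDeriv_smooth _ hF) hG hq)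
    (compK_integrable hg hgc hF (bDeriv_smooth _ hG) hq)]
  refine integral_congr_ae (Eventually.of_forall fun z => ?_)
  have d1 : HasFDerivAt F (fderiv ℝ F (x, z, h)) (x, z, h) :=
    (diffAt_KD hF (q := (x, z, h))
      ⟨mem_univ _, mem_univ _, hq.2.2⟩).hasFDerivAt
  have d2 : HasFDerivAt G (fderiv ℝ G (z, y, h)) (z, y, h) :=
    (diffAt_KD hG (q := (z, y, h))
      ⟨mem_univ _, mem_univ _, hq.2.2⟩).hasFDerivAt
  have d3 : HasFDerivAt g (fderiv ℝ g z) z := (hg.differentiable (by simp) _).hasFDerivAt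
  have i0 := hasFDerivAt_fst (𝕜 := ℝ) (p := (((x, y, h), z) : (KPt n) × E n))
  have iz := hasFDerivAt_snd (𝕜 := ℝ) (p := (((x, y, h), z) : (KPt n) × E n))
  have e1 := HasFDerivAt.comp ((x, y, h), z)
    (f := fun p : (KPt n) × E n => (p.1.1, p.2, p.1.2.2)) d1
    (i0.fst.prodMk (iz.prodMk i0.snd.snd))
  have e2 := HasFDerivAt.comp ((x, y, h), z)
    (f := fun p : (KPt n) × E n => (p.2, p.1.2.1, p.1.2.2)) d2
    (iz.prodMk (i0.snd.fst.prodMk i0.snd.snd))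
  have e3 := HasFDerivAt.comp (f := Prod.snd) ((x, y, h), z) d3 iz
  have e4 := (e1.mul e3).mul e2
  have e5 : fderiv ℝ (fun p : (KPt n) × E n =>
      F (p.1.1, p.2, p.1.2.2) * g p.2 * G (p.2, p.1.2.1, p.1.2.2)) ((x, y, h), z) = _ := e4.fderiv
  simp only [e5, bDeriv]
  simp
  ring

lemma LBd.compK (hg : Smooth g) (hgc : CSupp g)
    (hF : LBd l F) (hG : LBd l' G) : LBd (l + l') (compK g F G) := by
  refine LBd.of_forall_bound fun R => ?_
  obtain ⟨C, ε, hε, hC⟩ := hF.exists_bound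
    ((isCompact_closedBall (0 : E n) R).prod (hgc : IsCompact (tsupport g)))
  obtain ⟨C', ε', hε', hC'⟩ := hG.exists_bound
    ((hgc : IsCompact (tsupport g)).prod (isCompact_closedBall (0 : E n) R))
  have hgi : Integrable g := hg.continuous.integrable_of_hasCompactSupport hgc
  refine ⟨C * C' * ∫ z, ‖g z‖, min ε ε', lt_min hε hε', fun x y hx hy h hh => ?_⟩
  have h1 : ‖TwoMicro.compK g F G (x, y, h)‖ ≤ ∫ z, (C * C' * h ^ (-(l + l'))) * ‖g z‖ := by
    refine norm_integral_le_of_norm_le (hgi.norm.const_mul _) (Eventually.of_forall fun z => ?_)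
    by_cases hz : z ∈ tsupport g
    · have b1 := hC (x, z) ⟨by simpa using hx, hz⟩ h ⟨hh.1, hh.2.trans_le (min_le_left _ _)⟩
      have b2 := hC' (z, y) ⟨hz, by simpa using hy⟩ h ⟨hh.1, hh.2.trans_le (min_le_right _ _)⟩
      have e : h ^ (-(l + l')) = h ^ (-l) * h ^ (-l') := by
        rw [← rpow_add hh.1]; congr 1; ring
      rw [norm_mul, norm_mul, e]
      calc ‖F (x, z, h)‖ * ‖g z‖ * ‖G (z, y, h)‖
          = (‖F (x, z, h)‖ * ‖G (z, y, h)‖) * ‖g z‖ := by ring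
        _ ≤ ((C * h ^ (-l)) * (C' * h ^ (-l'))) * ‖g z‖ := by
            refine mul_le_mul_of_nonneg_right ?_ (norm_nonneg _)
            exact mul_le_mul b1 b2 (norm_nonneg _) ((norm_nonneg _).trans b1)
        _ = _ := by ring
    · simp [image_eq_zero_of_notMem_tsupport hz]
  rw [integral_const_mul] at h1
  calc _ ≤ _ := h1
    _ = _ := by ring

lemma LRes.compK (hg : Smooth g) (hgc : CSupp g)
    (hF : LRes l F) (hG : LRes l' G) : LRes (l + l') (compK g F G) := by
  refine ⟨compK_smooth hg hgc hF.smooth hG.smooth, fun k => ?_⟩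
  induction k generalizing F G with
  | zero => exact LBd.compK hg hgc (hF.bd 0) (hG.bd 0)
  | succ k ih =>
    refine ⟨LBd.compK hg hgc (hF.bd 0) (hG.bd 0), fun v => ?_⟩
    refine LBdK.congr ?_ (EqSmall.of_domain (bDeriv_compK hg hgc hF.smooth hG.smooth v)).symm
    exact LBdK.add (compK_smooth hg hgc (hF.bDeriv _).smooth hG.smooth)
      (compK_smooth hg hgc hF.smooth (hG.bDeriv _).smooth) (ih (hF.bDeriv _) hG)
      (ih hF (hG.bDeriv _))

lemma compK_swap (g : E n → ℂ) (F G : Krn n) :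
    swapK (compK g F G) = compK g (swapK G) (swapK F) := by
  funext q
  simp only [swapK, compK]
  refine integral_congr_ae (Eventually.of_forall fun z => ?_)
  ring

/-! ## Amplitudes -/

/-- The Japanese bracket `⟨η⟩`. -/
def jb (η : E n) : ℝ := Real.sqrt (‖η‖ ^ 2 + 1)

lemma jb_pos (η : E n) : 0 < jb η := sqrt_pos.2 (by positivity)

lemma jb_sq (η : E n) : jb η ^ 2 = ‖η‖ ^ 2 + 1 := Real.sq_sqrt (by positivity)

lemma one_le_jb (η : E n) : 1 ≤ jb η := by
  have := jb_sq η; have := jb_pos η; nlinarith [sq_nonneg ‖η‖]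

lemma norm_le_jb (η : E n) : ‖η‖ ≤ jb η := by
  refine Real.le_sqrt_of_sq_le ?_; linarith

lemma contDiff_jb : Smooth (jb : E n → ℝ) := by
  unfold jb
  exact ContDiff.sqrt ((contDiff_norm_sq ℝ).add contDiff_const) fun η => by positivity

lemma hasDerivAt_jb (η w : E n) :
    HasDerivAt (fun t : ℝ => jb (η + t • w)) (inner ℝ η w / jb η) 0 := by
  have h1 : HasDerivAt (fun t : ℝ => η + t • w) w 0 := by
    simpa using ((hasDerivAt_id (0 : ℝ)).smul_const w).const_add η
  have h2 : HasDerivAt (fun t : ℝ => ‖η + t • w‖ ^ 2 + 1) (2 * inner ℝ η w) 0 := by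
    simpa using (h1.norm_sq).add_const 1
  have h3 := h2.sqrt (by positivity)
  refine h3.congr_deriv ?_
  simp only [jb, zero_smul, add_zero]
  field_simp

/-- Position, covector and parameter `(x, y, η, h)`. -/
abbrev Q (n : ℕ) : Type := E n × KPt n

variable {a b c d : Q n → ℂ}

/-- The coordinates on the blow-up, in terms of `η = ξ / h`. -/
def ampPt (q : Q n) : E n × E n × E n × ℝ × ℝ :=
  (q.1, q.2.1, (jb q.2.2.1)⁻¹ • q.2.2.1, (jb q.2.2.1)⁻¹, q.2.2.2 * jb q.2.2.1)

lemma contDiff_ampPt : Smooth (ampPt : Q n → _) := by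
  have h1 : Smooth fun q : Q n => jb q.2.2.1 := contDiff_jb.comp (by fun_prop)
  have h2 : Smooth fun q : Q n => (jb q.2.2.1)⁻¹ := h1.inv fun q => (jb_pos _).ne'
  unfold ampPt
  refine ContDiff.prodMk (by fun_prop) (ContDiff.prodMk (by fun_prop)
    (ContDiff.prodMk (h2.smul (by fun_prop)) (h2.prodMk (ContDiff.mul (by fun_prop) h1))))

/-- The factor `⟨η⟩^m`. -/
def jpow (m : ℝ) (q : Q n) : ℂ := ((jb q.2.2.1 ^ m : ℝ) : ℂ)

lemma contDiff_jpow (m : ℝ) : Smooth (jpow m : Q n → ℂ) := by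
  refine ofRealCLM.contDiff.comp ?_
  exact (contDiff_jb.comp (by fun_prop)).rpow_const_of_ne fun q => (jb_pos _).ne'

lemma jpow_add (m m' : ℝ) (q : Q n) : jpow (m + m') q = jpow m q * jpow m' q := by
  simp only [jpow]
  rw [rpow_add (jb_pos _)]; push_cast; ring

lemma jpow_neg_one (q : Q n) : jpow (-1) q = (((jb q.2.2.1)⁻¹ : ℝ) : ℂ) := by
  simp only [jpow]; rw [Real.rpow_neg_one]

/-- Amplitudes of order `m`: `⟨η⟩^m` times smooth functions on the blow-up. -/
def IsAmp (m : ℝ) (c : Q n → ℂ) : Prop :=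
  ∃ b : E n × E n × E n × ℝ × ℝ → ℂ, Smooth b ∧ ∀ q, c q = jpow m q * b (ampPt q)

/-- `c` is supported in `x ∈ S`, `|h| ⟨η⟩ ≤ M`. -/
def AmpSupp (S : Set (E n)) (M : ℝ) (c : Q n → ℂ) : Prop :=
  ∀ q, c q ≠ 0 → q.1 ∈ S ∧ |q.2.2.2| * jb q.2.2.1 ≤ M

lemma IsAmp.contDiff (hc : IsAmp m c) : Smooth c := by
  obtain ⟨b, hb, h⟩ := hc
  rw [funext h]
  exact (contDiff_jpow m).mul (hb.comp contDiff_ampPt)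

lemma IsAmp.add (hc : IsAmp m c) (hd : IsAmp m d) : IsAmp m (fun q => c q + d q) := by
  obtain ⟨b, hb, h⟩ := hc
  obtain ⟨b', hb', h'⟩ := hd
  exact ⟨_, hb.add hb', fun q => by simp only [h, h']; ring⟩

lemma IsAmp.mul (hc : IsAmp m c) (hd : IsAmp m' d) : IsAmp (m + m') (fun q => c q * d q) := by
  obtain ⟨b, hb, h⟩ := hc
  obtain ⟨b', hb', h'⟩ := hd
  exact ⟨_, hb.mul hb', fun q => by simp only [h, h', jpow_add]; ring⟩

lemma IsAmp.of_contDiff {θ : Krn n} (hθ : Smooth θ) :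
    IsAmp 0 (fun q : Q n => θ (q.1, q.2.1, q.2.2.2)) := by
  refine ⟨fun z => θ (z.1, z.2.1, z.2.2.2.2 * z.2.2.2.1), hθ.comp (by fun_prop), fun q => ?_⟩
  simp [jpow, ampPt, (jb_pos q.2.2.1).ne']

lemma IsAmp.congr_order (hc : IsAmp m c) (h : m = m') : IsAmp m' c :=
  h ▸ hc

lemma IsAmp.mul_contDiff (hc : IsAmp m c) {θ : Krn n}
    (hθ : Smooth θ) : IsAmp m (fun q : Q n => θ (q.1, q.2.1, q.2.2.2) * c q) :=
  ((IsAmp.of_contDiff hθ).mul hc).congr_order (zero_add m)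

lemma IsAmp.const_mul (hc : IsAmp m c) (z : ℂ) : IsAmp m (fun q => z * c q) :=
  hc.mul_contDiff (θ := fun _ => z) contDiff_const

lemma IsAmp.neg (hc : IsAmp m c) : IsAmp m (fun q => - c q) := by
  simpa using hc.const_mul (-1)

lemma IsAmp.sub (hc : IsAmp m c) (hd : IsAmp m d) : IsAmp m (fun q => c q - d q) := by
  simpa [sub_eq_add_neg] using hc.add hd.neg

lemma IsAmp.zero (m : ℝ) : IsAmp m (fun _ : Q n => 0) :=
  ⟨fun _ => 0, contDiff_const, fun q => by simp⟩

lemma IsAmp.sum {ι : Type*} (s : Finset ι) {c : ι → Q n → ℂ}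
    (hc : ∀ i ∈ s, IsAmp m (c i)) : IsAmp m (fun q => ∑ i ∈ s, c i q) := by
  classical
  induction s using Finset.induction_on with
  | empty => simpa using IsAmp.zero m
  | insert a s ha ih =>
    simp only [Finset.sum_insert ha]
    exact (hc a (Finset.mem_insert_self _ _)).add
      (ih fun i hi => hc i (Finset.mem_insert_of_mem hi))

lemma isAmp_jpow (s : ℝ) : IsAmp s (jpow s : Q n → ℂ) :=
  ⟨fun _ => 1, contDiff_const, fun q => by simp⟩

lemma isAmp_inner (v : E n) : IsAmp 1 (fun q : Q n => ((inner ℝ v q.2.2.1 : ℝ) : ℂ)) := by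
  refine ⟨fun z => ((inner ℝ v z.2.2.1 : ℝ) : ℂ), ?_, fun q => ?_⟩
  · have h1 : Smooth fun z : E n × E n × E n × ℝ × ℝ => (inner ℝ v z.2.2.1 : ℝ) :=
      contDiff_const.inner ℝ (by fun_prop)
    exact ofRealCLM.contDiff.comp h1
  · simp only [jpow, ampPt, Real.rpow_one, inner_smul_right]
    rw [← ofReal_mul, mul_inv_cancel_left₀ (jb_pos _).ne']

lemma IsAmp.add_nat (hc : IsAmp m c) (k : ℕ) : IsAmp (m + k) c := by
  obtain ⟨b, hb, h⟩ := hc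
  refine ⟨fun z => (z.2.2.2.1 : ℂ) ^ k * b z, ?_, fun q => ?_⟩
  · have h1 : Smooth fun z : E n × E n × E n × ℝ × ℝ => (z.2.2.2.1 : ℂ) :=
      ofRealCLM.contDiff.comp
        (by fun_prop : Smooth fun z : E n × E n × E n × ℝ × ℝ => z.2.2.2.1)
    exact (h1.pow k).mul hb
  · rw [h, jpow_add]
    have : jpow (k : ℝ) q * ((((jb q.2.2.1)⁻¹ : ℝ)) : ℂ) ^ k = 1 := by
      simp only [jpow, rpow_natCast]
      rw [← Complex.ofReal_pow, ← ofReal_mul, ← mul_pow, mul_inv_cancel₀ (jb_pos _).ne',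
        one_pow, ofReal_one]
    simp only [ampPt] at this ⊢
    rw [mul_assoc, ← mul_assoc (jpow (k : ℝ) q), this, one_mul]

lemma AmpSupp.mono (hc : AmpSupp S M c) (hS : S ⊆ S') (hM : M ≤ M') : AmpSupp S' M' c :=
  fun q hq => ⟨hS (hc q hq).1, (hc q hq).2.trans hM⟩

lemma AmpSupp.add (hc : AmpSupp S M c) (hd : AmpSupp S M d) : AmpSupp S M (fun q => c q + d q) := by
  intro q hq
  by_cases h : c q = 0
  · exact hd q fun h' => hq (by simp [h, h'])
  · exact hc q h

lemma AmpSupp.mul_left (hc : AmpSupp S M c) (d : Q n → ℂ) : AmpSupp S M (fun q => d q * c q) :=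
  fun q hq => hc q (right_ne_zero_of_mul hq)

lemma AmpSupp.mul_right (hc : AmpSupp S M c) (d : Q n → ℂ) : AmpSupp S M (fun q => c q * d q) :=
  fun q hq => hc q (left_ne_zero_of_mul hq)

lemma AmpSupp.sum {ι : Type*} (s : Finset ι) {c : ι → Q n → ℂ}
    (hc : ∀ i ∈ s, AmpSupp S M (c i)) : AmpSupp S M (fun q => ∑ i ∈ s, c i q) := by
  intro q hq
  obtain ⟨i, hi, h⟩ := Finset.exists_ne_zero_of_sum_ne_zero hq
  exact hc i hi q h

lemma AmpSupp.fderiv (hS : IsClosed S)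
    (hc : AmpSupp S M c) (v : Q n → Q n) : AmpSupp S M (fun q => fderiv ℝ c q (v q)) := by
  intro q hq
  by_contra hne
  refine hq ?_
  have hcl : IsClosed {q : Q n | q.1 ∈ S ∧ |q.2.2.2| * jb q.2.2.1 ≤ M} := by
    have h1 : Continuous fun q : Q n => |q.2.2.2| * jb q.2.2.1 :=
      Continuous.mul (Continuous.abs (by fun_prop)) (contDiff_jb.continuous.comp (by fun_prop))
    exact (hS.preimage continuous_fst).inter (isClosed_le h1 continuous_const)
  have : c =ᶠ[𝓝 q] fun _ => 0 := by
    filter_upwards [hcl.isOpen_compl.mem_nhds hne] with p hp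
    by_contra h
    exact hp (hc p h)
  simp [this.fderiv_eq]

/-- Differentiation in the direction of `w` in `η`. -/
def dEta (w : E n) (c : Q n → ℂ) : Q n → ℂ := fun q => fderiv ℝ c q (0, 0, w, 0)

/-- Differentiation in the direction of `w` in `y`. -/
def dY (w : E n) (c : Q n → ℂ) : Q n → ℂ := fun q => fderiv ℝ c q (0, w, 0, 0)

lemma fderiv_amp_line {b : E n × E n × E n × ℝ × ℝ → ℂ} (hb : Smooth b) (h : ∀ q, c q = jpow m q * b
    (ampPt q)) (hc : Smooth c) (x y η : E n) (t v1 : ℝ) (a1 a2 w : E n) : fderiv ℝ c (x, y, η, t)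
    (a1, a2, w, v1) = ((jb η ^ (m - 1) * m * (inner ℝ η w / jb η) : ℝ) : ℂ) * b (ampPt (x, y, η, t))
    + jpow m (x, y, η, t) * fderiv ℝ b (ampPt (x, y, η, t)) (a1, a2, (jb η)⁻¹ • w + (-(inner ℝ η w /
    jb η) / jb η ^ 2) • η, -(inner ℝ η w / jb η) / jb η ^ 2, v1 * jb η + t * (inner ℝ η w / jb η))
    := by
  have hj := hasDerivAt_jb η w
  have hj0 : jb (η + (0 : ℝ) • w) ≠ 0 := (jb_pos _).ne'
  have line : ∀ {G : Type} [NormedAddCommGroup G] [NormedSpace ℝ G] (u d : G),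
      HasDerivAt (fun s : ℝ => u + s • d) d 0 := by
    intro G _ _ u d
    simpa using ((hasDerivAt_id (0 : ℝ)).smul_const d).const_add u
  have l1 : HasDerivAt (fun s : ℝ => c ((x, y, η, t) + s • (a1, a2, w, v1)))
      (fderiv ℝ c (x, y, η, t) (a1, a2, w, v1)) 0 := by
    have h1 : HasFDerivAt c (fderiv ℝ c (x, y, η, t))
        ((x, y, η, t) + (0 : ℝ) • (a1, a2, w, v1)) := by
      simpa using (hc.differentiable (by simp) (x, y, η, t)).hasFDerivAt
    exact h1.comp_hasDerivAt (0 : ℝ) (line (x, y, η, t) (a1, a2, w, v1))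
  have l2 : HasDerivAt (fun s : ℝ => ampPt ((x, y, η, t) + s • (a1, a2, w, v1)))
      (a1, a2, (jb η)⁻¹ • w + (-(inner ℝ η w / jb η) / jb η ^ 2) • η,
          -(inner ℝ η w / jb η) / jb η ^ 2, v1 * jb η + t * (inner ℝ η w / jb η)) 0 := by
    have i1 := hj.inv hj0
    have i2 := i1.smul (line η w)
    have i3 := (line t v1).mul hj
    have i4 := (line x a1).prodMk ((line y a2).prodMk (i2.prodMk (i1.prodMk i3)))
    refine (i4.congr_deriv ?_).congr_of_eventuallyEq (Eventually.of_forall fun s => ?_)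
    · simp
    · simp [ampPt]
  have l3 : HasDerivAt (fun s : ℝ => ((jb (η + s • w) ^ m : ℝ) : ℂ))
      ((jb η ^ (m - 1) * m * (inner ℝ η w / jb η) : ℝ) : ℂ) 0 := by
    have := (hj.rpow_const (p := m) (Or.inl hj0)).ofReal_comp
    refine this.congr_deriv ?_
    simp; ring
  have h1 : HasFDerivAt b (fderiv ℝ b (ampPt (x, y, η, t)))
      (ampPt ((x, y, η, t) + (0 : ℝ) • (a1, a2, w, v1))) := by
    simpa using (hb.differentiable (by simp) (ampPt (x, y, η, t))).hasFDerivAt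
  have l4 := h1.comp_hasDerivAt (0 : ℝ) l2
  have l5 := l3.mul l4
  have e : (fun s : ℝ => c ((x, y, η, t) + s • (a1, a2, w, v1))) =
      fun s : ℝ => ((jb (η + s • w) ^ m : ℝ) : ℂ) *
        b (ampPt ((x, y, η, t) + s • (a1, a2, w, v1))) := by
    funext s; rw [h]; simp [jpow]
  rw [e] at l1
  rw [l1.unique l5]
  simp [jpow]

lemma IsAmp.dEta (hc : IsAmp m c) (w : E n) : IsAmp (m - 1) (dEta w c) := by
  have hcs := hc.contDiff
  obtain ⟨b, hb, h⟩ := hc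
  refine ⟨fun z => ((m * inner ℝ z.2.2.1 w : ℝ) : ℂ) * b z + fderiv ℝ b z
    (0, 0, w - (inner ℝ z.2.2.1 w) • z.2.2.1, -(inner ℝ z.2.2.1 w) * z.2.2.2.1,
      z.2.2.2.2 * inner ℝ z.2.2.1 w), ?_, ?_⟩
  · have hi : Smooth fun z : E n × E n × E n × ℝ × ℝ => (inner ℝ z.2.2.1 w : ℝ) :=
      ContDiff.inner ℝ (by fun_prop) contDiff_const
    refine ((ofRealCLM.contDiff.comp (contDiff_const.mul hi)).mul hb).add ?_
    refine (hb.fderiv_right (by simp)).clm_apply ?_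
    refine contDiff_const.prodMk (contDiff_const.prodMk (ContDiff.prodMk ?_
      (ContDiff.prodMk ?_ ?_)))
    · exact contDiff_const.sub (hi.smul (by fun_prop))
    · exact hi.neg.mul (by fun_prop)
    · exact ContDiff.mul (by fun_prop) hi
  · rintro ⟨x, y, η, t⟩
    have hj := (jb_pos η).ne'
    simp only [TwoMicro.dEta]
    rw [fderiv_amp_line hb h hcs]
    have e1 : jpow m (x, y, η, t) = jpow (m - 1) (x, y, η, t) * (jb η : ℂ) := by
      have := jpow_add (m - 1) 1 (x, y, η, t)
      simpa [jpow] using this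
    have e2 : ∀ v : E n × E n × E n × ℝ × ℝ, (jb η : ℂ) * fderiv ℝ b (ampPt (x, y, η, t)) v =
        fderiv ℝ b (ampPt (x, y, η, t)) (jb η • v) := by
      intro v; rw [map_smul, real_smul]
    rw [e1, mul_assoc (jpow (m - 1) _), e2, mul_add]
    congr 1
    · simp only [jpow, ampPt, inner_smul_left]
      push_cast
      simp
      ring
    · congr 2
      simp only [ampPt, inner_smul_left, Prod.smul_mk, smul_zero, smul_add, smul_smul,
        smul_eq_mul]
      simp only [conj_trivial]
      refine Prod.ext rfl (Prod.ext rfl (Prod.ext ?_ (Prod.ext ?_ ?_)))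
      · simp only [mul_inv_cancel₀ hj, one_smul, sub_eq_add_neg, ← neg_smul]
        congr 2
        field_simp
      · field_simp
      · field_simp
        ring

/-- The amplitude of the derivative of a kernel. -/
def fieldAmp (v : KPt n) (c : Q n → ℂ) : Q n → ℂ :=
  fun q => fderiv ℝ c q (v.1, v.2.1, 0, q.2.2.2 * v.2.2)

lemma IsAmp.fieldAmp (hc : IsAmp m c) (v : KPt n) : IsAmp m (fieldAmp v c) := by
  have hcs := hc.contDiff
  obtain ⟨b, hb, h⟩ := hc
  refine ⟨fun z => fderiv ℝ b z (v.1, v.2.1, 0, 0, z.2.2.2.2 * v.2.2), ?_, ?_⟩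
  · exact (hb.fderiv_right (by simp)).clm_apply (by fun_prop)
  · rintro ⟨x, y, η, t⟩
    simp only [TwoMicro.fieldAmp]
    rw [fderiv_amp_line hb h hcs]
    simp [ampPt]
    left
    congr 5
    ring

lemma IsAmp.dY (hc : IsAmp m c) (w : E n) : IsAmp m (dY w c) := by
  have := hc.fieldAmp (0, w, 0)
  have e : TwoMicro.dY w c = TwoMicro.fieldAmp (0, w, 0) c := by
    funext q; simp [TwoMicro.dY, TwoMicro.fieldAmp]
  rwa [e]

lemma IsAmp.bound (hc : IsAmp m c) (hs : AmpSupp S M c) {K : Set (E n × E n)} (hK : IsCompact K) : ∃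
    C : ℝ, 0 ≤ C ∧ ∀ x y η : E n, ∀ h : ℝ, (x, y) ∈ K → 0 ≤ h → ‖c (x, y, η, h)‖ ≤ C * jb η ^ m :=
    by
  obtain ⟨b, hb, h⟩ := hc
  have hcpt : IsCompact {z : E n × E n × E n × ℝ × ℝ | (z.1, z.2.1) ∈ K ∧
      z.2.2 ∈ Metric.closedBall (0 : E n) 1 ×ˢ Icc (0 : ℝ) 1 ×ˢ Icc (0 : ℝ) M} :=
    (Homeomorph.prodAssoc (E n) (E n) (E n × ℝ × ℝ)).symm.isCompact_preimage.2
      (hK.prod ((isCompact_closedBall (0 : E n) 1).prod (isCompact_Icc.prod isCompact_Icc)))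
  obtain ⟨C, hC⟩ := hcpt.exists_bound_of_continuousOn hb.continuous.continuousOn
  refine ⟨max C 0, le_max_right _ _, fun x y η t hxy ht => ?_⟩
  have hj := jb_pos η
  have hjm : 0 ≤ jb η ^ m := rpow_nonneg hj.le m
  by_cases hne : c (x, y, η, t) = 0
  · rw [hne, norm_zero]; exact mul_nonneg (le_max_right _ _) hjm
  · have hM := (hs _ hne).2
    simp only [abs_of_nonneg ht] at hM
    rw [h, norm_mul, jpow, norm_real, norm_of_nonneg hjm, mul_comm]
    refine mul_le_mul_of_nonneg_right ((hC _ ⟨hxy, ?_, ⟨?_, ?_⟩, ?_, hM⟩).trans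
      (le_max_left _ _)) hjm
    · simp only [ampPt, Metric.mem_closedBall, dist_zero_right, norm_smul, norm_inv,
        norm_of_nonneg hj.le]
      rw [inv_mul_le_one₀ hj]; exact norm_le_jb η
    · exact inv_nonneg.2 hj.le
    · exact inv_le_one_of_one_le₀ (one_le_jb η)
    · exact mul_nonneg ht hj.le

/-! ## Oscillatory kernels -/

/-- The phase factor `e^{i⟨v, η⟩}`. -/
def osc (v η : E n) : ℂ := Complex.exp (I * ((inner ℝ v η : ℝ) : ℂ))

lemma norm_osc (v η : E n) : ‖osc v η‖ = 1 := by
  rw [osc, mul_comm, Complex.norm_exp_ofReal_mul_I]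

lemma contDiff_osc : Smooth fun p : E n × E n => osc p.1 p.2 := by
  refine ContDiff.cexp (contDiff_const.mul (ofRealCLM.contDiff.comp ?_))
  exact ContDiff.inner ℝ contDiff_fst contDiff_snd

/-- The kernel `∫ e^{i⟨x-y,η⟩} c(x,y,η,h) dη`. -/
def kerOf (c : Q n → ℂ) : Krn n :=
  fun q => ∫ η : E n, osc (q.1 - q.2.1) η * c (q.1, q.2.1, η, q.2.2)

lemma kerOf_integrand_contDiff (hc : Smooth c) : Smooth fun p : (KPt n) × E n => osc (p.1.1 -
    p.1.2.1) p.2 * c (p.1.1, p.1.2.1, p.2, p.1.2.2) := by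
  refine ContDiff.mul ?_ (hc.comp (by fun_prop))
  exact contDiff_osc.comp
    (f := fun p : (KPt n) × E n => (p.1.1 - p.1.2.1, p.2)) (by fun_prop)

lemma AmpSupp.locCompactSupp (hs : AmpSupp S M c) : LocCompactSupp (KD n) fun p : (KPt n) × E n =>
    osc (p.1.1 - p.1.2.1) p.2 * c (p.1.1, p.1.2.1, p.2, p.1.2.2) := by
  rintro ⟨x, y, h⟩ ⟨-, -, h0, h1⟩
  refine ⟨Metric.closedBall 0 (M / (h / 2)), isCompact_closedBall _ _, ?_⟩
  have ho : IsOpen {q : KPt n | h / 2 < q.2.2} :=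
    isOpen_lt continuous_const (by fun_prop)
  filter_upwards [ho.mem_nhds (show h / 2 < h by simp only at h0; linarith)] with q hq η hη
  refine mul_eq_zero_of_right _ (by_contra fun hne => hη ?_)
  have h2 := (hs _ hne).2
  simp only at h2 h0
  rw [mem_closedBall_zero_iff, le_div_iff₀ (by linarith)]
  have hq' : h / 2 < q.2.2 := hq
  rw [abs_of_pos (by linarith)] at h2
  calc ‖η‖ * (h / 2) ≤ jb η * q.2.2 :=
        mul_le_mul (norm_le_jb η) hq'.le (by linarith) (jb_pos η).le
    _ ≤ M := by linarith

lemma kerOf_smooth (hc : Smooth c) (hs : AmpSupp S M c) : SmoothOn (kerOf c) (KD n) :=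
  contDiffOn_integral isOpen_kernelDomain (kerOf_integrand_contDiff hc).contDiffOn
    hs.locCompactSupp

lemma AmpSupp.hasCompactSupport (hs : AmpSupp S M c) (x y : E n) {h : ℝ} (h0 : 0 < h) :
    CSupp fun η => c (x, y, η, h) := by
  refine HasCompactSupport.intro (isCompact_closedBall (0 : E n) (M / h)) fun η hη => ?_
  by_contra hne
  refine hη ?_
  have h2 := (hs _ hne).2
  simp only [abs_of_pos h0] at h2
  rw [mem_closedBall_zero_iff, le_div_iff₀ h0]
  calc ‖η‖ * h ≤ jb η * h := mul_le_mul_of_nonneg_right (norm_le_jb η) h0.le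
    _ ≤ M := by linarith

lemma contDiff_osc_right (v : E n) : Smooth (osc v) :=
  contDiff_osc.comp (f := fun η : E n => (v, η)) (by fun_prop)

lemma kerOf_integrable (hc : Smooth c) (hs : AmpSupp S M c) (x y : E n) {h : ℝ}
    (h0 : 0 < h) (v : E n) : Integrable fun η => osc v η * c (x, y, η, h) := by
  refine Continuous.integrable_of_hasCompactSupport ?_ (hs.hasCompactSupport x y h0).mul_left
  exact (contDiff_osc_right v).continuous.mul (hc.continuous.comp (by fun_prop))

lemma kerOf_add (hc : Smooth c) (hs : AmpSupp S M c) (hd : Smooth d) (hs' : AmpSupp S' M' d) : ∀ q ∈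
    KD n, kerOf (fun q => c q + d q) q = kerOf c q + kerOf d q := by
  rintro ⟨x, y, h⟩ hq
  simp only [kerOf, mul_add]
  exact integral_add (kerOf_integrable hc hs x y hq.2.2.1 _)
    (kerOf_integrable hd hs' x y hq.2.2.1 _)

lemma kerOf_const_mul (z : ℂ) (c : Q n → ℂ) (q : KPt n) :
    kerOf (fun q => z * c q) q = z * kerOf c q := by
  simp only [kerOf]
  rw [← integral_const_mul]
  exact integral_congr_ae (Eventually.of_forall fun η => by ring)

lemma kerOf_mul (θ : Krn n) (c : Q n → ℂ) (q : KPt n) :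
    kerOf (fun q => θ (q.1, q.2.1, q.2.2.2) * c q) q = θ q * kerOf c q := by
  simp only [kerOf]
  rw [← integral_const_mul]
  exact integral_congr_ae (Eventually.of_forall fun η => by ring)

lemma kerOf_sub (hc : Smooth c) (hs : AmpSupp S M c) (hd : Smooth d) (hs' : AmpSupp S' M' d) : ∀ q ∈
    KD n, kerOf (fun q => c q - d q) q = kerOf c q - kerOf d q := by
  rintro ⟨x, y, h⟩ hq
  simp only [kerOf, mul_sub]
  exact integral_sub (kerOf_integrable hc hs x y hq.2.2.1 _)
    (kerOf_integrable hd hs' x y hq.2.2.1 _)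

/-- The amplitude of `bDeriv v (kerOf c)`. -/
def derivAmp (v : KPt n) (c : Q n → ℂ) : Q n → ℂ := fun q =>
  I * ((inner ℝ (v.1 - v.2.1) q.2.2.1 : ℝ) : ℂ) * c q + fieldAmp v c q

lemma IsAmp.derivAmp (hc : IsAmp m c) (v : KPt n) : IsAmp (m + 1) (derivAmp v c) := by
  refine IsAmp.add ?_ (by simpa using (hc.fieldAmp v).add_nat 1)
  have := (((isAmp_inner (v.1 - v.2.1)).const_mul I).mul hc)
  exact this.congr_order (add_comm _ _)

lemma AmpSupp.derivAmp (hS : IsClosed S) (hs : AmpSupp S M c) (v : KPt n) :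
    AmpSupp S M (derivAmp v c) :=
  (hs.mul_left _).add (hs.fderiv hS _)

lemma hasFDerivAt_osc (u η : E n) (a w : E n) : fderiv ℝ (fun p : E n × E n => osc p.1 p.2) (u, η)
    (a, w) = I * ((inner ℝ u w + inner ℝ a η : ℝ) : ℂ) * osc u η := by
  have h1 : HasFDerivAt (fun p : E n × E n => (inner ℝ p.1 p.2 : ℝ)) _ (u, η) :=
    (hasFDerivAt_fst (𝕜 := ℝ) (p := ((u, η) : E n × E n))).inner ℝ hasFDerivAt_snd
  have h2 : HasFDerivAt (fun p : E n × E n => ((inner ℝ p.1 p.2 : ℝ) : ℂ)) _ (u, η) :=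
    ofRealCLM.hasFDerivAt.comp (u, η) h1
  have h3 := (h2.const_mul I).cexp
  have h4 : fderiv ℝ (fun p : E n × E n => osc p.1 p.2) (u, η) = _ := h3.fderiv
  rw [h4]
  simp [osc]
  ring

lemma bDeriv_kerOf (hc : Smooth c) (hs : AmpSupp S M c) (v : KPt n) :
    ∀ q ∈ KD n, bDeriv v (kerOf c) q = kerOf (derivAmp v c) q := by
  rintro ⟨x, y, h⟩ hq
  have h1 := fderiv_integral_apply (μ := (volume : Measure (E n))) isOpen_kernelDomain
    (kerOf_integrand_contDiff hc).contDiffOn hs.locCompactSupp hq (v.1, v.2.1, h * v.2.2)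
  have h2 : bDeriv v (kerOf c) (x, y, h) = _ := h1
  rw [h2]
  simp only [kerOf]
  refine integral_congr_ae (Eventually.of_forall fun η => ?_)
  have d1 : HasFDerivAt c (fderiv ℝ c (x, y, η, h)) (x, y, η, h) :=
    (hc.differentiable (by simp) _).hasFDerivAt
  have d2 : HasFDerivAt (fun p : E n × E n => osc p.1 p.2)
      (fderiv ℝ (fun p : E n × E n => osc p.1 p.2) (x - y, η)) (x - y, η) :=
    (contDiff_osc.differentiable (by simp) _).hasFDerivAt
  have i0 := hasFDerivAt_fst (𝕜 := ℝ) (p := (((x, y, h), η) : (KPt n) × E n))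
  have iz := hasFDerivAt_snd (𝕜 := ℝ) (p := (((x, y, h), η) : (KPt n) × E n))
  have e1 := HasFDerivAt.comp ((x, y, h), η)
    (f := fun p : (KPt n) × E n => (p.1.1, p.1.2.1, p.2, p.1.2.2)) d1
    (i0.fst.prodMk (i0.snd.fst.prodMk (iz.prodMk i0.snd.snd)))
  have e2 := HasFDerivAt.comp ((x, y, h), η)
    (f := fun p : (KPt n) × E n => (p.1.1 - p.1.2.1, p.2)) d2
    ((i0.fst.sub i0.snd.fst).prodMk iz)
  have e3 : fderiv ℝ (fun p : (KPt n) × E n =>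
      osc (p.1.1 - p.1.2.1) p.2 * c (p.1.1, p.1.2.1, p.2, p.1.2.2)) ((x, y, h), η) = _ :=
    (e2.mul e1).fderiv
  simp only [e3, derivAmp, fieldAmp]
  simp [hasFDerivAt_osc]
  ring

lemma integrable_jb_rpow (hm : m < -n) : Integrable fun η : E n => jb η ^ m := by
  have h1 : Integrable fun η : E n => (1 + ‖η‖ ^ 2) ^ (-(-m) / 2) :=
    integrable_rpow_neg_one_add_norm_sq (by simp; linarith)
  refine h1.congr (Eventually.of_forall fun η => ?_)
  simp only [jb]
  rw [Real.sqrt_eq_rpow, ← Real.rpow_mul (by positivity), add_comm]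
  congr 1; ring

lemma LBd.kerOf (hm : m < -n) (hc : IsAmp m c) (hs : AmpSupp S M c) : LBd 0 (kerOf c) := by
  refine LBd.of_forall_bound fun R => ?_
  obtain ⟨C, hC0, hC⟩ := hc.bound hs ((isCompact_closedBall (0 : E n) R).prod
    (isCompact_closedBall (0 : E n) R))
  refine ⟨C * ∫ η : E n, jb η ^ m, 1, one_pos, fun x y hx hy h hh => ?_⟩
  rw [neg_zero, Real.rpow_zero, mul_one, ← integral_const_mul]
  refine norm_integral_le_of_norm_le ((integrable_jb_rpow hm).const_mul C)
    (Eventually.of_forall fun η => ?_)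
  rw [norm_mul, norm_osc, one_mul]
  exact hC x y η h ⟨by simpa using hx, by simpa using hy⟩ hh.1.le

lemma LBdK.kerOf {k : ℕ} : ∀ {m : ℝ} {c : Q n → ℂ}, m + k < -n → IsAmp m c →
    AmpSupp univ M c → LBdK 0 k (kerOf c) := by
  induction k with
  | zero => intro m c hm hc hs; exact LBd.kerOf (by simpa using hm) hc hs
  | succ k ih =>
    intro m c hm hc hs
    push_cast at hm
    refine ⟨LBd.kerOf (by have : (0 : ℝ) ≤ k := k.cast_nonneg; linarith) hc hs, fun v => ?_⟩
    exact (ih (by linarith) (hc.derivAmp v) (hs.derivAmp isClosed_univ v)).congr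
      (EqSmall.of_domain (bDeriv_kerOf hc.contDiff hs v)).symm

/-- A kernel that is given by amplitudes of arbitrarily low order is residual. -/
lemma LRes.of_orders (H : ∀ N : ℕ, ∃ c : Q n → ℂ, ∃ M : ℝ, IsAmp (m - N) c ∧ AmpSupp univ M c ∧ ∀ q
    ∈ KD n, F q = kerOf c q) : LRes 0 F := by
  constructor
  · obtain ⟨c, M, hc, hs, h⟩ := H 0
    exact (kerOf_smooth hc.contDiff hs).congr h
  · intro k
    obtain ⟨N, hN⟩ := exists_nat_gt (m + k + n)
    obtain ⟨c, M, hc, hs, h⟩ := H N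
    exact (LBdK.kerOf (by linarith) hc hs).congr (EqSmall.of_domain h).symm

/-- Integration by parts: `kerOf ((y_j - x_j) c) = kerOf (-i ∂_{η_j} c)`. -/
lemma kerOf_coord (hc : Smooth c) (hs : AmpSupp univ M c) (w : E n) : ∀ q ∈ KD n, kerOf (fun q =>
    ((inner ℝ (q.2.1 - q.1) w : ℝ) : ℂ) * c q) q = kerOf (fun q => -I * dEta w c q) q := by
  rintro ⟨x, y, h⟩ hq
  have h0 : 0 < h := hq.2.2.1
  simp only [kerOf]
  have hcd : Smooth fun η => c (x, y, η, h) := hc.comp (by fun_prop)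
  have f1 : ∀ η, fderiv ℝ (fun η => c (x, y, η, h)) η w = dEta w c (x, y, η, h) := by
    intro η
    have d1 : HasFDerivAt c (fderiv ℝ c (x, y, η, h)) (x, y, η, h) :=
      (hc.differentiable (by simp) _).hasFDerivAt
    have := d1.comp (f := fun η => ((x, y, η, h) : Q n)) η
      ((hasFDerivAt_const x η).prodMk ((hasFDerivAt_const y η).prodMk
        ((hasFDerivAt_id (𝕜 := ℝ) η).prodMk (hasFDerivAt_const h η))))
    have e : fderiv ℝ (fun η => c (x, y, η, h)) η = _ := this.fderiv
    rw [e]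
    rfl
  have f2 : ∀ η, fderiv ℝ (osc (x - y)) η w =
      I * ((inner ℝ (x - y) w : ℝ) : ℂ) * osc (x - y) η := by
    intro η
    have d2 : HasFDerivAt (fun p : E n × E n => osc p.1 p.2)
        (fderiv ℝ (fun p : E n × E n => osc p.1 p.2) (x - y, η)) (x - y, η) :=
      (contDiff_osc.differentiable (by simp) _).hasFDerivAt
    have := d2.comp (f := fun η => ((x - y, η) : E n × E n)) η
      ((hasFDerivAt_const (x - y) η).prodMk (hasFDerivAt_id (𝕜 := ℝ) η))
    have e : fderiv ℝ (osc (x - y)) η = _ := this.fderiv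
    rw [e]
    have := hasFDerivAt_osc (x - y) η 0 w
    simpa using this
  have hs' : AmpSupp univ M (dEta w c) := hs.fderiv isClosed_univ _
  have hcs : CSupp fun η => c (x, y, η, h) := hs.hasCompactSupport x y h0
  have hco := (contDiff_osc_right (x - y)).continuous
  have hd : Continuous fun η => fderiv ℝ (fun η => c (x, y, η, h)) η w :=
    (hcd.continuous_fderiv (by simp)).clm_apply continuous_const
  have ho : Continuous fun η => fderiv ℝ (osc (x - y)) η w :=
    ((contDiff_osc_right (x - y)).continuous_fderiv (by simp)).clm_apply continuous_const
  have key := integral_mul_fderiv_eq_neg_fderiv_mul_of_integrable (𝕜 := ℂ) (μ := volume)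
    (f := osc (x - y)) (g := fun η => c (x, y, η, h)) (v := w)
    ((ho.mul hcd.continuous).integrable_of_hasCompactSupport hcs.mul_left)
    ((hco.mul hd).integrable_of_hasCompactSupport (hcs.fderiv_apply (𝕜 := ℝ) w).mul_left)
    ((hco.mul hcd.continuous).integrable_of_hasCompactSupport hcs.mul_left)
    (fun z _ => (contDiff_osc_right (x - y)).differentiable (by simp) z)
    (fun z _ => hcd.differentiable (by simp) z)
  simp only [f1, f2] at key
  have e1 : ∀ η, osc (x - y) η * (-I * dEta w c (x, y, η, h)) =
      -I * (osc (x - y) η * dEta w c (x, y, η, h)) := fun η => by ring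
  simp only [e1]
  rw [integral_const_mul, key, neg_mul_neg, ← integral_const_mul]
  refine integral_congr_ae (Eventually.of_forall fun η => ?_)
  have : (inner ℝ (y - x) w : ℝ) = -(inner ℝ (x - y) w : ℝ) := by
    rw [← inner_neg_left, neg_sub]
  simp only [this]
  push_cast
  linear_combination (-(inner ℝ (x - y) w : ℂ) * osc (x - y) η * c (x, y, η, h)) *
    I_mul_I

/-! ## Borel summation -/

/-- A cutoff function of one variable. -/
def bump1 (s : ℝ) : ℝ := Real.smoothTransition (2 - s ^ 2)

lemma contDiff_bump1 : Smooth bump1 :=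
  Real.smoothTransition.contDiff.comp (by fun_prop)

lemma bump1_eq_one {s : ℝ} (hs : |s| ≤ 1) : bump1 s = 1 := by
  refine Real.smoothTransition.one_of_one_le ?_
  have := sq_abs s; have := abs_nonneg s; nlinarith

lemma bump1_eq_zero {s : ℝ} (hs : 2 ≤ |s|) : bump1 s = 0 := by
  refine Real.smoothTransition.zero_of_nonpos ?_
  have := sq_abs s; nlinarith

lemma hasCompactSupport_bump1 : CSupp bump1 := by
  refine HasCompactSupport.intro (isCompact_closedBall (0 : ℝ) 2) fun s hs => bump1_eq_zero ?_
  simp only [Metric.mem_closedBall, dist_zero_right, norm_eq_abs, not_le] at hs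
  exact hs.le

section Borel

variable {Z : Type} [NormedAddCommGroup Z] [NormedSpace ℝ Z]

lemma exists_bound_iteratedFDeriv {Y : Type*} [NormedAddCommGroup Y] [NormedSpace ℝ Y] {f : Z → Y}
    (hf : Smooth f) (hc : CSupp f) (k : ℕ) : ∃ C, 0 ≤ C ∧ ∀ z, ‖iteratedFDeriv ℝ k f z‖ ≤ C := by
  obtain ⟨C, hC⟩ := (hc.iteratedFDeriv (𝕜 := ℝ) k).exists_bound_of_continuous
    (hf.continuous_iteratedFDeriv (by exact_mod_cast le_top))
  exact ⟨max C 0, le_max_right _ _, fun z => (hC z).trans (le_max_left _ _)⟩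

lemma borel_term_bound (τ : Z →L[ℝ] ℝ) {b : Z → ℂ} (hb : Smooth b) (hc : CSupp b) (p k : ℕ) (hk : k
    < p) : ∃ K, 0 ≤ K ∧ ∀ L : ℝ, 1 ≤ L → ∀ z, ‖iteratedFDeriv ℝ k (fun z => (τ z ^ p * bump1 (L * τ
    z)) • b z) z‖ ≤ L⁻¹ * K := by
  let g : ℝ → ℝ := fun s => s ^ p * bump1 s
  have hg : Smooth g := (contDiff_id.pow p).mul contDiff_bump1
  have hgc : CSupp g := hasCompactSupport_bump1.mul_left
  choose G hG0 hG using fun i => exists_bound_iteratedFDeriv hg hgc i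
  choose B hB0 hB using fun i => exists_bound_iteratedFDeriv hb hc i
  refine ⟨∑ i ∈ Finset.range (k + 1), (k.choose i : ℝ) * (G i * ‖τ‖ ^ i) * B (k - i),
    Finset.sum_nonneg fun i _ => mul_nonneg (mul_nonneg (by positivity)
      (mul_nonneg (hG0 i) (by positivity))) (hB0 _), fun L hL z => ?_⟩
  have hL0 : 0 < L := by linarith
  have e : (fun z => (τ z ^ p * bump1 (L * τ z)) • b z) =
      (L ^ p)⁻¹ • ((g ∘ (L • τ)) • b) := by
    funext z
    simp only [g, Function.comp_apply, Pi.smul_apply, Pi.smul_apply', smul_smul,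
      FunLike.coe_smul, smul_eq_mul]
    congr 1
    rw [mul_pow]; field_simp
  have hgL : Smooth (g ∘ (L • τ)) := hg.comp (L • τ).contDiff
  rw [e, iteratedFDeriv_const_smul_apply
    ((hgL.smul hb).contDiffAt.of_le (by exact_mod_cast le_top)), norm_smul]
  have h1 : ∀ i, ‖iteratedFDeriv ℝ i (g ∘ (L • τ)) z‖ ≤ G i * (L * ‖τ‖) ^ i := by
    intro i
    rw [ContinuousLinearMap.iteratedFDeriv_comp_right (L • τ) hg z (by exact_mod_cast le_top)]
    refine (ContinuousMultilinearMap.norm_compContinuousLinearMap_le _ _).trans ?_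
    rw [Finset.prod_const, Finset.card_univ, Fintype.card_fin, norm_smul,
      norm_of_nonneg hL0.le]
    exact mul_le_mul_of_nonneg_right (hG i _) (by positivity)
  have h2 := norm_iteratedFDeriv_smul_le (𝕜 := ℝ) hgL hb z
    (show (k : WithTop ℕ∞) ≤ ∞ by exact_mod_cast le_top)
  have h3 : ∑ i ∈ Finset.range (k + 1), (k.choose i : ℝ) *
      ‖iteratedFDeriv ℝ i (g ∘ (L • τ)) z‖ * ‖iteratedFDeriv ℝ (k - i) b z‖ ≤
      L ^ k * ∑ i ∈ Finset.range (k + 1), (k.choose i : ℝ) * (G i * ‖τ‖ ^ i) * B (k - i) := by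
    rw [Finset.mul_sum]
    refine Finset.sum_le_sum fun i hi => ?_
    have hik : i ≤ k := Nat.lt_succ_iff.1 (Finset.mem_range.1 hi)
    have h4 : L ^ i ≤ L ^ k := pow_le_pow_right₀ hL hik
    calc _ ≤ (k.choose i : ℝ) * (G i * (L * ‖τ‖) ^ i) * B (k - i) := by
          refine mul_le_mul (mul_le_mul_of_nonneg_left (h1 i) (by positivity)) (hB _ z)
            (norm_nonneg _) ?_
          exact mul_nonneg (by positivity) (mul_nonneg (hG0 i) (by positivity))
      _ = L ^ i * ((k.choose i : ℝ) * (G i * ‖τ‖ ^ i) * B (k - i)) := by rw [mul_pow]; ring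
      _ ≤ _ := mul_le_mul_of_nonneg_right h4 (mul_nonneg (mul_nonneg (by positivity)
          (mul_nonneg (hG0 i) (by positivity))) (hB0 _))
  rw [norm_inv, norm_pow, norm_of_nonneg hL0.le]
  set K := ∑ i ∈ Finset.range (k + 1), (k.choose i : ℝ) * (G i * ‖τ‖ ^ i) * B (k - i) with hK
  have hK0 : 0 ≤ K := Finset.sum_nonneg fun i _ => mul_nonneg (mul_nonneg (by positivity)
      (mul_nonneg (hG0 i) (by positivity))) (hB0 _)
  calc _ ≤ (L ^ p)⁻¹ * (L ^ k * K) :=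
        mul_le_mul_of_nonneg_left (h2.trans h3) (by positivity)
    _ = ((L ^ p)⁻¹ * L ^ k) * K := by ring
    _ ≤ L⁻¹ * K := by
        refine mul_le_mul_of_nonneg_right ?_ hK0
        obtain ⟨d, rfl⟩ := Nat.exists_eq_add_of_lt hk
        have : L ^ (k + d + 1) = L ^ k * (L ^ d * L) := by ring
        rw [this, mul_inv, mul_comm (L ^ k)⁻¹, mul_assoc, inv_mul_cancel₀ (by positivity), mul_one,
          mul_inv]
        have : (L ^ d)⁻¹ ≤ 1 := inv_le_one_of_one_le₀ (one_le_pow₀ hL)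
        calc _ ≤ 1 * L⁻¹ := mul_le_mul_of_nonneg_right this (by positivity)
          _ = _ := one_mul _

lemma exists_borel_scale (τ : Z →L[ℝ] ℝ) {b : Z → ℂ} (hb : Smooth b) (hc : CSupp b) (j : ℕ) : ∃ L :
    ℝ, 1 ≤ L ∧ ∀ p k : ℕ, p ≤ j → k < p → ∀ z, ‖iteratedFDeriv ℝ k (fun z => (τ z ^ p * bump1 (L * τ
    z)) • b z) z‖ ≤ (1 / 2) ^ j := by
  have h1 : ∀ p k : ℕ, ∃ K, 0 ≤ K ∧ (k < p → ∀ L : ℝ, 1 ≤ L → ∀ z,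
      ‖iteratedFDeriv ℝ k (fun z => (τ z ^ p * bump1 (L * τ z)) • b z) z‖ ≤ L⁻¹ * K) := by
    intro p k
    by_cases hk : k < p
    · obtain ⟨K, hK, h⟩ := borel_term_bound τ hb hc p k hk
      exact ⟨K, hK, fun _ => h⟩
    · exact ⟨0, le_rfl, fun h => absurd h hk⟩
  choose K hK0 hK using h1
  set T := ∑ p ∈ Finset.range (j + 1), ∑ k ∈ Finset.range (j + 1), K p k with hT
  have hT0 : 0 ≤ T := Finset.sum_nonneg fun p _ => Finset.sum_nonneg fun k _ => hK0 p k
  refine ⟨max 1 (2 ^ j * T), le_max_left _ _, fun p k hp hk z => ?_⟩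
  refine (hK p k hk _ (le_max_left _ _) z).trans ?_
  have h2 : K p k ≤ T := by
    have a1 : K p k ≤ ∑ k ∈ Finset.range (j + 1), K p k :=
      Finset.single_le_sum (f := fun k => K p k) (fun i _ => hK0 p i)
        (Finset.mem_range.2 (by omega))
    have a2 : ∑ k ∈ Finset.range (j + 1), K p k ≤ T :=
      Finset.single_le_sum (f := fun p => ∑ k ∈ Finset.range (j + 1), K p k)
        (fun i _ => Finset.sum_nonneg fun k _ => hK0 i k) (Finset.mem_range.2 (by omega))
    exact a1.trans a2
  have hL : 0 < max 1 (2 ^ j * T) := lt_of_lt_of_le one_pos (le_max_left _ _)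
  rw [inv_mul_le_iff₀ hL]
  calc K p k ≤ T := h2
    _ = (2 ^ j * T) * (1 / 2) ^ j := by
        rw [one_div, inv_pow]; field_simp
    _ ≤ _ := mul_le_mul_of_nonneg_right (le_max_right _ _) (by positivity)

lemma contDiff_div_pow {φ : ℝ → ℝ} (hφ : Smooth φ) (h0 : φ =ᶠ[𝓝 0] fun _ => 0) (N : ℕ) :
    Smooth fun s => φ s / s ^ N := by
  refine contDiff_iff_contDiffAt.2 fun s => ?_
  by_cases hs : s = 0
  · subst hs
    refine (contDiffAt_const (c := (0 : ℝ))).congr_of_eventuallyEq ?_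
    filter_upwards [h0] with s hs
    simp [hs]
  · exact hφ.contDiffAt.div (contDiff_id.pow N).contDiffAt (pow_ne_zero _ hs)

theorem borel_summation (τ : Z →L[ℝ] ℝ) {b : ℕ → Z → ℂ} (hb : ∀ j, Smooth (b j)) (hc : ∀ j, CSupp (b
    j)) : ∃ B : Z → ℂ, Smooth B ∧ ∀ N : ℕ, ∃ R : Z → ℂ, Smooth R ∧ ∀ z, B z = (∑ j ∈ Finset.range N,
    (τ z ^ j) • b j z) + (τ z ^ N) • R z := by
  choose L hL1 hL using fun j => exists_borel_scale τ (hb j) (hc j) j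
  have hsm : ∀ p j, Smooth fun z => (τ z ^ p * bump1 (L j * τ z)) • b j z := fun p j =>
    ((τ.contDiff.pow p).mul (contDiff_bump1.comp (contDiff_const.mul τ.contDiff))).smul (hb j)
  have htail : ∀ N, Smooth fun z => ∑' i, (τ z ^ i * bump1 (L (i + N) * τ z)) • b (i + N) z := by
    intro N
    refine contDiff_tsum_of_eventually (v := fun _ i => (1 / 2 : ℝ) ^ i) (fun i => hsm i (i + N))
      (fun k _ => summable_geometric_two) fun k _ => ?_
    rw [Nat.cofinite_eq_atTop]
    filter_upwards [eventually_gt_atTop k] with i hi z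
    refine (hL (i + N) i k (by omega) hi z).trans ?_
    exact pow_le_pow_of_le_one (by norm_num) (by norm_num) (by omega)
  have hsum : ∀ z, Summable fun i => (τ z ^ i * bump1 (L i * τ z)) • b i z := by
    intro z
    rw [← summable_nat_add_iff 1]
    refine Summable.of_norm_bounded (g := fun i => (1 / 2 : ℝ) ^ (i + 1))
      ((summable_nat_add_iff 1).2 summable_geometric_two) fun i => ?_
    have := hL (i + 1) (i + 1) 0 le_rfl (by omega) z
    simpa using this
  refine ⟨fun z => ∑' i, (τ z ^ i * bump1 (L i * τ z)) • b i z, by simpa using htail 0,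
    fun N => ?_⟩
  refine ⟨fun z => (∑' i, (τ z ^ i * bump1 (L (i + N) * τ z)) • b (i + N) z) -
    ∑ j ∈ Finset.range N, (((1 - bump1 (L j * τ z)) * τ z ^ j) / τ z ^ N) • b j z, ?_, fun z => ?_⟩
  · refine (htail N).sub (ContDiff.sum fun j _ => ?_)
    have h1 : Smooth fun s : ℝ => (1 - bump1 (L j * s)) * s ^ j :=
      (contDiff_const.sub (contDiff_bump1.comp (contDiff_const.mul contDiff_id))).mul
        (contDiff_id.pow j)
    refine ContDiff.smul (ContDiff.comp (contDiff_div_pow h1 ?_ N) τ.contDiff) (hb j)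
    have hct : Continuous fun s : ℝ => |L j * s| := by fun_prop
    have h2 : ∀ᶠ s in 𝓝 (0 : ℝ), |L j * s| < 1 :=
      hct.continuousAt.eventually_lt_const (by simp)
    filter_upwards [h2] with s hs
    rw [bump1_eq_one hs.le]; simp
  · beta_reduce
    rw [← (hsum z).sum_add_tsum_nat_add N, smul_sub, Finset.smul_sum]
    have e1 : ∑' i, (τ z ^ (i + N) * bump1 (L (i + N) * τ z)) • b (i + N) z =
        (τ z ^ N) • ∑' i, (τ z ^ i * bump1 (L (i + N) * τ z)) • b (i + N) z := by
      rw [← tsum_const_smul'']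
      refine tsum_congr fun i => ?_
      rw [smul_smul]; congr 1; ring
    rw [e1]
    have e2 : ∀ j ∈ Finset.range N, (τ z ^ j * bump1 (L j * τ z)) • b j z = (τ z ^ j) • b j z -
        (τ z ^ N) • (((1 - bump1 (L j * τ z)) * τ z ^ j) / τ z ^ N) • b j z := by
      intro j _
      rw [smul_smul, ← sub_smul]
      congr 1
      by_cases h0 : τ z = 0
      · simp [h0, bump1_eq_one]
      · field_simp; ring
    rw [Finset.sum_congr rfl e2, Finset.sum_sub_distrib]
    abel

end Borel

/-- Independence of `y`. -/
def YIndep (a : Q n → ℂ) : Prop := ∀ x y y' η : E n, ∀ h : ℝ, a (x, y, η, h) = a (x, y', η, h)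

lemma exists_contDiff_cutoff {Z : Type*} [NormedAddCommGroup Z] [NormedSpace ℝ Z] [FiniteDimensional
    ℝ Z] (R : ℝ) : ∃ γ : Z → ℂ, Smooth γ ∧ CSupp γ ∧ (∀ z, ‖z‖ ≤ R → γ z = 1) ∧ ∀ z, γ z ≠ 0 → ‖z‖ ≤
    |R| + 2 := by
  let f : ContDiffBump (0 : Z) := ⟨|R| + 1, |R| + 2, by positivity, by linarith⟩
  refine ⟨fun z => (f z : ℂ), ofRealCLM.contDiff.comp f.contDiff, ?_, fun z hz => ?_,
    fun z hz => ?_⟩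
  · exact f.hasCompactSupport.comp_left (g := fun t : ℝ => (t : ℂ)) (by simp)
  · beta_reduce
    rw [f.one_of_mem_closedBall]
    · simp
    · simp only [Metric.mem_closedBall, dist_zero_right]
      exact hz.trans ((le_abs_self R).trans (by simp [f]))
  · have h1 : f z ≠ 0 := by
      intro h; exact hz (by simp [h])
    have h2 : z ∈ Function.support f := h1
    rw [f.support_eq, mem_ball_zero_iff] at h2
    exact h2.le

theorem exists_amp_sum {a : ℕ → Q n → ℂ} (ha : ∀ j : ℕ, IsAmp (m - j) (a j)) (hS : IsCompact S) (hs
    : ∀ j, AmpSupp S M (a j)) (hy : ∀ j, YIndep (a j)) : ∃ c : Q n → ℂ, IsAmp m c ∧ YIndep c ∧ (∃ S'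
    M', IsCompact S' ∧ AmpSupp S' M' c) ∧ ∀ N : ℕ, IsAmp (m - N) (fun q => c q - ∑ j ∈ Finset.range
    N, a j q) := by
  choose b hb hab using ha
  obtain ⟨R, hR⟩ := hS.isBounded.exists_norm_le
  obtain ⟨γ, hγ, hγc, hγ1, hγs⟩ := exists_contDiff_cutoff (Z := E n × E n × ℝ × ℝ)
    (max (max R 1) M)
  let pt : Q n → E n × E n × ℝ × ℝ := fun q => ((ampPt q).1, (ampPt q).2.2)
  let τ : (E n × E n × ℝ × ℝ) →L[ℝ] ℝ := (fst ℝ ℝ ℝ).comp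
    ((snd ℝ (E n) (ℝ × ℝ)).comp
      (snd ℝ (E n) (E n × ℝ × ℝ)))
  have hτ : ∀ q : Q n, τ (pt q) = (jb q.2.2.1)⁻¹ := fun q => rfl
  let b' : ℕ → E n × E n × ℝ × ℝ → ℂ := fun j z => γ z * b j (z.1, 0, z.2)
  have hb' : ∀ j, Smooth (b' j) := fun j => hγ.mul ((hb j).comp (by fun_prop))
  obtain ⟨B, hB, hBN⟩ := borel_summation τ hb' fun j => hγc.mul_right
  have hphys : ∀ j q, a j q ≠ 0 → γ (pt q) = 1 := by
    intro j q hq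
    have h1 := hs j q hq
    have hj := jb_pos q.2.2.1
    refine hγ1 _ ?_
    simp only [pt, ampPt, Prod.norm_def, max_le_iff]
    refine ⟨?_, ?_, ?_, ?_⟩
    · exact (hR _ h1.1).trans ((le_max_left _ _).trans (le_max_left _ _))
    · rw [norm_smul, norm_inv, norm_of_nonneg hj.le]
      refine le_trans ?_ ((le_max_right R 1).trans (le_max_left _ M))
      rw [inv_mul_le_one₀ hj]; exact norm_le_jb _
    · rw [norm_of_nonneg (inv_nonneg.2 hj.le)]
      exact (inv_le_one_of_one_le₀ (one_le_jb _)).trans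
        ((le_max_right R 1).trans (le_max_left _ M))
    · rw [norm_mul, norm_eq_abs, norm_of_nonneg hj.le]
      exact h1.2.trans (le_max_right _ _)
  have haj : ∀ (j : ℕ) q, jpow (m - j) q * b j ((pt q).1, 0, (pt q).2) = a j q := by
    rintro j ⟨x, y, η, h⟩
    rw [hy j x y 0 η h, hab]
    rfl
  have hγa : ∀ j q, γ (pt q) * a j q = a j q := by
    intro j q
    by_cases h : a j q = 0
    · simp [h]
    · rw [hphys j q h, one_mul]
  have hpow : ∀ (j : ℕ) (q : Q n), jpow m q * ((τ (pt q) ^ j : ℝ) : ℂ) = jpow (m - j) q := by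
    intro j q
    have hj := jb_pos q.2.2.1
    simp only [jpow, hτ]
    rw [← ofReal_mul, rpow_sub hj, rpow_natCast, inv_pow, div_eq_mul_inv]
  refine ⟨fun q => jpow m q * (γ (pt q) * B (pt q)), ⟨fun z => γ (z.1, z.2.2) * B (z.1, z.2.2),
    (hγ.comp (by fun_prop)).mul (hB.comp (by fun_prop)), fun q => rfl⟩, fun x y y' η h => rfl,
    ⟨Metric.closedBall 0 (|max (max R 1) M| + 2), |max (max R 1) M| + 2, isCompact_closedBall _ _,
      fun q hq => ?_⟩, fun N => ?_⟩
  · have h1 := hγs _ (left_ne_zero_of_mul (right_ne_zero_of_mul hq))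
    simp only [pt, ampPt, Prod.norm_def, max_le_iff] at h1
    refine ⟨by simpa using h1.1, ?_⟩
    have h2 := h1.2.2.2
    rwa [norm_mul, norm_eq_abs, norm_of_nonneg (jb_pos _).le] at h2
  · obtain ⟨R', hR', h⟩ := hBN N
    refine ⟨fun z => γ (z.1, z.2.2) * R' (z.1, z.2.2),
      (hγ.comp (by fun_prop)).mul (hR'.comp (by fun_prop)), fun q => ?_⟩
    have e1 : ∀ j, jpow m q * (γ (pt q) * ((τ (pt q) ^ j) • b' j (pt q))) = a j q := by
      intro j
      rw [real_smul]
      calc _ = γ (pt q) * (γ (pt q) * ((jpow m q * ((τ (pt q) ^ j : ℝ) : ℂ)) *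
            b j ((pt q).1, 0, (pt q).2))) := by simp only [b']; ring
        _ = a j q := by rw [hpow, haj, hγa, hγa]
    simp only [h]
    rw [mul_add, mul_add, Finset.mul_sum, Finset.mul_sum, Finset.sum_congr rfl fun j _ => e1 j,
      add_sub_cancel_left, ← hpow, real_smul]
    change _ = jpow m q * ((τ (pt q) ^ N : ℝ) : ℂ) * (γ (pt q) * R' (pt q))
    ring

/-! ## Reduction of amplitudes to left symbols -/

/-- The `j`-th standard basis vector. -/
abbrev bv (j : Fin n) : E n := EuclideanSpace.single j 1

/-- The restriction to the diagonal. -/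
def diagY (c : Q n → ℂ) : Q n → ℂ := fun q => c (q.1, q.1, q.2.2.1, q.2.2.2)

/-- The average over the segment from the diagonal. -/
def avgY (c : Q n → ℂ) : Q n → ℂ := fun q =>
  ∫ t in Icc (0 : ℝ) 1, c (q.1, q.1 + t • (q.2.1 - q.1), q.2.2.1, q.2.2.2)

lemma yIndep_diagY (c : Q n → ℂ) : YIndep (diagY c) := fun _ _ _ _ _ => rfl

lemma IsAmp.diagY (hc : IsAmp m c) : IsAmp m (diagY c) := by
  obtain ⟨b, hb, h⟩ := hc
  exact ⟨fun z => b (z.1, z.1, z.2.2), hb.comp (by fun_prop), fun q => h _⟩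

lemma IsAmp.avgY (hc : IsAmp m c) : IsAmp m (avgY c) := by
  obtain ⟨b, hb, h⟩ := hc
  refine ⟨fun z => ∫ t in Icc (0 : ℝ) 1, b (z.1, z.1 + t • (z.2.1 - z.1), z.2.2), ?_, fun q => ?_⟩
  · have := contDiffOn_setIntegral (μ := (volume : Measure ℝ)) (U := univ)
      (G := fun p : (E n × E n × E n × ℝ × ℝ) × ℝ =>
        b (p.1.1, p.1.1 + p.2 • (p.1.2.1 - p.1.1), p.1.2.2)) isOpen_univ
      (isCompact_Icc (a := (0 : ℝ)) (b := 1)) (hb.comp (by fun_prop)).contDiffOn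
    exact contDiffOn_univ.1 this
  · simp only [TwoMicro.avgY, h]
    rw [← integral_const_mul]
    rfl

lemma AmpSupp.diagY (hs : AmpSupp S M c) : AmpSupp S M (diagY c) := fun q hq =>
  hs (q.1, q.1, q.2.2.1, q.2.2.2) hq

lemma AmpSupp.avgY (hs : AmpSupp S M c) : AmpSupp S M (avgY c) := by
  intro q hq
  by_contra hne
  refine hq ?_
  have : ∀ t : ℝ, c (q.1, q.1 + t • (q.2.1 - q.1), q.2.2.1, q.2.2.2) = 0 := fun t => by
    by_contra h
    exact hne (hs (q.1, q.1 + t • (q.2.1 - q.1), q.2.2.1, q.2.2.2) h)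
  simp only [TwoMicro.avgY, this, integral_zero]

lemma dEta_slice (hc : Smooth c) (w x y η : E n) (h : ℝ) :
    dEta w c (x, y, η, h) = fderiv ℝ (fun η => c (x, y, η, h)) η w := by
  have d1 : HasFDerivAt c (fderiv ℝ c (x, y, η, h)) (x, y, η, h) :=
    (hc.differentiable (by simp) _).hasFDerivAt
  have := d1.comp (f := fun η => ((x, y, η, h) : Q n)) η
    ((hasFDerivAt_const x η).prodMk ((hasFDerivAt_const y η).prodMk
      ((hasFDerivAt_id (𝕜 := ℝ) η).prodMk (hasFDerivAt_const h η))))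
  have e : fderiv ℝ (fun η => c (x, y, η, h)) η = _ := this.fderiv
  rw [e]
  rfl

/-- The amplitude `-i ∑_j ∂_{η_j} ∫₀¹ ∂_{y_j} c(x, x + t(y-x), η, h) dt`. -/
def stepAmp (c : Q n → ℂ) : Q n → ℂ := fun q =>
  ∑ j : Fin n, -I * dEta (bv j) (avgY (dY (bv j) c)) q

lemma IsAmp.stepAmp (hc : IsAmp m c) : IsAmp (m - 1) (stepAmp c) :=
  IsAmp.sum _ fun j _ => ((hc.dY (bv j)).avgY.dEta (bv j)).const_mul _

lemma AmpSupp.stepAmp (hS : IsClosed S) (hs : AmpSupp S M c) : AmpSupp S M (stepAmp c) :=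
  AmpSupp.sum _ fun j _ => (((hs.fderiv hS _ : AmpSupp S M (dY (bv j) c)).avgY).fderiv hS _).mul_left _

lemma taylor_diag (hc : Smooth c) (q : Q n) : c q = diagY c q + ∑ j : Fin n, ((inner ℝ (q.2.1 - q.1)
    (bv j) : ℝ) : ℂ) * avgY (dY (bv j) c) q := by
  obtain ⟨x, y, η, h⟩ := q
  have h1 : ∀ t : ℝ, HasDerivAt (fun t : ℝ => c (x, x + t • (y - x), η, h))
      (dY (y - x) c (x, x + t • (y - x), η, h)) t := by
    intro t
    have d1 : HasFDerivAt c (fderiv ℝ c (x, x + t • (y - x), η, h)) (x, x + t • (y - x), η, h) :=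
      (hc.differentiable (by simp) _).hasFDerivAt
    have d2 : HasDerivAt (fun t : ℝ => ((x, x + t • (y - x), η, h) : Q n)) (0, y - x, 0, 0) t := by
      refine (hasDerivAt_const t x).prodMk (HasDerivAt.prodMk ?_
        ((hasDerivAt_const t η).prodMk (hasDerivAt_const t h)))
      simpa using ((hasDerivAt_id t).smul_const (y - x)).const_add x
    exact d1.comp_hasDerivAt t d2
  have hcont : ∀ w : E n, Continuous fun t : ℝ => dY w c (x, x + t • (y - x), η, h) := by
    intro w
    have : Continuous (dY w c) := (hc.continuous_fderiv (by simp)).clm_apply continuous_const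
    exact this.comp (by fun_prop)
  have h2 := intervalIntegral.integral_eq_sub_of_hasDerivAt (a := 0) (b := 1)
    (fun t _ => h1 t) ((hcont _).intervalIntegrable 0 1)
  have h3 : ∀ q, dY (y - x) c q =
      ∑ j : Fin n, ((inner ℝ (y - x) (bv j) : ℝ) : ℂ) * dY (bv j) c q := by
    intro q
    have : ((0, y - x, 0, 0) : Q n) = ∑ j : Fin n, (inner ℝ (y - x) (bv j) : ℝ) •
        ((0, bv j, 0, 0) : Q n) := by
      refine Prod.ext ?_ (Prod.ext ?_ (Prod.ext ?_ ?_)) <;>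
        simp only [Prod.fst_sum, Prod.snd_sum, Prod.smul_mk, smul_zero, Finset.sum_const_zero]
      have hi : ∀ j : Fin n, (inner ℝ (y - x) (bv j) : ℝ) = (y - x) j := fun j => by
        simp [bv, EuclideanSpace.inner_single_right]
      simp only [hi]
      exact (sum_single_eq (y - x)).symm
    simp only [dY, this, map_sum, map_smul, real_smul]
  simp only [h3, one_smul, zero_smul, add_zero, add_sub_cancel] at h2
  rw [intervalIntegral.integral_of_le zero_le_one, ← integral_Icc_eq_integral_Ioc,
    integral_finsetSum (μ := volume.restrict (Icc (0 : ℝ) 1)) (f := fun (j : Fin n) (t : ℝ) =>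
      ((inner ℝ (y - x) (bv j) : ℝ) : ℂ) * dY (bv j) c (x, x + t • (y - x), η, h)) _ fun j _ =>
      (continuous_const.mul (hcont (bv j))).continuousOn.integrableOn_compact isCompact_Icc] at h2
  simp only [integral_const_mul] at h2
  simp only [diagY, avgY]
  rw [h2]; ring

lemma kerOf_step (hc : IsAmp m c) (hs : AmpSupp univ M c) : ∀ q ∈ KD n,
    kerOf c q = kerOf (diagY c) q + kerOf (stepAmp c) q := by
  intro q hq
  have hj : ∀ j, IsAmp m (avgY (dY (bv j) c)) := fun j => (hc.dY (bv j)).avgY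
  have hsj : ∀ j, AmpSupp univ M (avgY (dY (bv j) c)) := fun j =>
    (hs.fderiv isClosed_univ _ : AmpSupp univ M (dY (bv j) c)).avgY
  have sum_ker : ∀ {f : Fin n → Q n → ℂ}, (∀ j, Smooth (f j)) →
      (∀ j, AmpSupp univ M (f j)) →
      kerOf (fun q => ∑ j, f j q) q = ∑ j, kerOf (f j) q := by
    intro f hf hfs
    simp only [kerOf, Finset.mul_sum]
    exact integral_finsetSum _ fun j _ =>
      kerOf_integrable (hf j) (hfs j) q.1 q.2.1 hq.2.2.1 _
  have hin : Smooth fun q : Q n => q.2.1 - q.1 := by fun_prop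
  have e0 : c = fun q => diagY c q + ∑ j : Fin n, ((inner ℝ (q.2.1 - q.1) (bv j) : ℝ) : ℂ) *
      avgY (dY (bv j) c) q := funext (taylor_diag hc.contDiff)
  have hf : ∀ j : Fin n, Smooth fun q : Q n => ((inner ℝ (q.2.1 - q.1) (bv j) : ℝ) : ℂ) *
      avgY (dY (bv j) c) q := fun j =>
    (ofRealCLM.contDiff.comp (hin.inner ℝ contDiff_const)).mul (hj j).contDiff
  conv_lhs => rw [e0]
  rw [kerOf_add hc.diagY.contDiff hs.diagY (ContDiff.sum fun j _ => hf j)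
    (AmpSupp.sum _ fun j _ => (hsj j).mul_left _) q hq, sum_ker hf fun j => (hsj j).mul_left _]
  congr 1
  rw [Finset.sum_congr rfl fun j _ => kerOf_coord (hj j).contDiff (hsj j) (bv j) q hq]
  exact (sum_ker (fun j => (((hj j).dEta (bv j)).const_mul _).contDiff)
    fun j => ((hsj j).fderiv isClosed_univ _).mul_left _).symm

/-- The second term of the symbol expansion. -/
def subAmp (c : Q n → ℂ) : Q n → ℂ := fun q =>
  ∑ j : Fin n, -I * diagY (dEta (bv j) (dY (bv j) c)) q

lemma diagY_stepAmp (hc : IsAmp m c) : diagY (stepAmp c) = subAmp c := by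
  funext q
  simp only [diagY, stepAmp, subAmp]
  refine Finset.sum_congr rfl fun j _ => ?_
  congr 1
  rw [dEta_slice (hc.dY (bv j)).avgY.contDiff, dEta_slice (hc.dY (bv j)).contDiff]
  congr 2
  funext η
  simp [avgY]

/-- Vanishing for `|x - y| < δ`. -/
def ZeroNearDiag (δ : ℝ) (c : Q n → ℂ) : Prop := ∀ q, ‖q.1 - q.2.1‖ < δ → c q = 0

lemma ZeroNearDiag.stepAmp {δ : ℝ} (hc : IsAmp m c) (h : ZeroNearDiag δ c) :
    ZeroNearDiag δ (stepAmp c) := by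
  have h1 : ∀ w, ZeroNearDiag δ (dY w c) := by
    intro w q hq
    have ho : IsOpen {q : Q n | ‖q.1 - q.2.1‖ < δ} := isOpen_lt (by fun_prop) continuous_const
    have : c =ᶠ[𝓝 q] fun _ => 0 := by
      filter_upwards [ho.mem_nhds hq] with p hp using h p hp
    simp [dY, this.fderiv_eq]
  have h2 : ∀ w, ZeroNearDiag δ (avgY (dY w c)) := by
    rintro w ⟨x, y, η, t⟩ hq
    refine setIntegral_eq_zero_of_forall_eq_zero fun s hs => h1 w _ ?_
    simp only at hq ⊢
    rw [sub_add_cancel_left, norm_neg, norm_smul, norm_of_nonneg hs.1, norm_sub_rev]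
    exact (mul_le_of_le_one_left (norm_nonneg _) hs.2).trans_lt hq
  rintro ⟨x, y, η, t⟩ hq
  refine Finset.sum_eq_zero fun j _ => ?_
  rw [dEta_slice (hc.dY (bv j)).avgY.contDiff]
  have : (fun η => avgY (dY (bv j) c) (x, y, η, t)) = fun _ => 0 :=
    funext fun η => h2 (bv j) (x, y, η, t) hq
  simp [this]

lemma IsAmp.iterate (hc : IsAmp m c) (N : ℕ) : IsAmp (m - N) (TwoMicro.stepAmp^[N] c) := by
  induction N with
  | zero => simpa using hc
  | succ N ih =>
    rw [Function.iterate_succ_apply']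
    exact ih.stepAmp.congr_order (by push_cast; ring)

lemma AmpSupp.iterate (hS : IsClosed S) (hs : AmpSupp S M c) (N : ℕ) :
    AmpSupp S M (TwoMicro.stepAmp^[N] c) := by
  induction N with
  | zero => simpa using hs
  | succ N ih =>
    rw [Function.iterate_succ_apply']
    exact ih.stepAmp hS

lemma kerOf_iterate (hc : IsAmp m c) (hs : AmpSupp univ M c) (N : ℕ) : ∀ q ∈ KD n, kerOf c q = kerOf
    (fun q => ∑ j ∈ Finset.range N, diagY (stepAmp^[j] c) q) q + kerOf (stepAmp^[N] c) q := by
  intro q hq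
  induction N with
  | zero => simp [kerOf]
  | succ N ih =>
    rw [ih, kerOf_step (hc.iterate N) (hs.iterate isClosed_univ N) q hq]
    simp only [Finset.sum_range_succ, Function.iterate_succ_apply']
    rw [kerOf_add (ContDiff.sum fun j _ => (hc.iterate j).diagY.contDiff)
      (AmpSupp.sum _ fun j _ => (hs.iterate isClosed_univ j).diagY) (hc.iterate N).diagY.contDiff
      (hs.iterate isClosed_univ N).diagY q hq]
    ring

/-- Away from the diagonal the kernels are residual. -/
theorem LRes.kerOf_of_zeroNearDiag {δ : ℝ} (hδ : 0 < δ) (hc : IsAmp m c)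
    (hs : AmpSupp univ M c) (h : ZeroNearDiag δ c) : LRes 0 (kerOf c) := by
  refine LRes.of_orders (m := m) fun N =>
    ⟨stepAmp^[N] c, M, hc.iterate N, hs.iterate isClosed_univ N, fun q hq => ?_⟩
  have hz : ∀ j, ZeroNearDiag δ (stepAmp^[j] c) := by
    intro j
    induction j with
    | zero => simpa using h
    | succ j ih =>
      rw [Function.iterate_succ_apply']
      exact ih.stepAmp (hc.iterate j)
  have : (fun q => ∑ j ∈ Finset.range N, diagY (stepAmp^[j] c) q) = fun _ => 0 := by
    funext q
    exact Finset.sum_eq_zero fun j _ => hz j _ (by simpa using hδ)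
  rw [kerOf_iterate hc hs N q hq, this]
  simp [kerOf]

/-- Every amplitude defines the same kernel as a left symbol, modulo residual terms. -/
theorem exists_left_symbol (hc : IsAmp m c) (hS : IsCompact S) (hs : AmpSupp S M c) : ∃ a : Q n → ℂ,
    IsAmp m a ∧ YIndep a ∧ (∃ S' M', IsCompact S' ∧ AmpSupp S' M' a) ∧ LRes 0 (fun q => kerOf c q -
    kerOf a q) ∧ IsAmp (m - 1) (fun q => a q - diagY c q) ∧ IsAmp (m - 2) (fun q => a q - (diagY c q
    + subAmp c q)) := by
  obtain ⟨a, ha, hy, ⟨S', M', hS', hs'⟩, hN⟩ := exists_amp_sum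
    (fun j => (hc.iterate j).diagY) hS (fun j => (hs.iterate hS.isClosed j).diagY)
    fun j => yIndep_diagY _
  have hsu := hs.mono (subset_univ S) le_rfl
  have hsu' := hs'.mono (subset_univ S') le_rfl
  refine ⟨a, ha, hy, ⟨S', M', hS', hs'⟩, ?_, ?_, ?_⟩
  · refine LRes.of_orders (m := m) fun N => ⟨fun q => stepAmp^[N] c q -
      (a q - ∑ j ∈ Finset.range N, diagY (stepAmp^[j] c) q), max M M',
      (hc.iterate N).sub (hN N), ?_, fun q hq => ?_⟩
    · have h1 := (hsu.iterate isClosed_univ N).mono (subset_univ _) (le_max_left M M')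
      have h2 := hsu'.mono (subset_univ _) (le_max_right M M')
      have h3 : AmpSupp univ (max M M')
          (fun q => ∑ j ∈ Finset.range N, diagY (stepAmp^[j] c) q) :=
        AmpSupp.sum _ fun j _ => ((hsu.iterate isClosed_univ j).diagY).mono (subset_univ _)
          (le_max_left M M')
      intro q hq
      by_contra hne
      refine hq ?_
      have z1 := not_imp_comm.1 (h1 q) hne
      have z2 := not_imp_comm.1 (h2 q) hne
      have z3 := not_imp_comm.1 (h3 q) hne
      simp only at z3
      simp [z1, z2, z3]
    · have sm : Smooth fun q => ∑ j ∈ Finset.range N, diagY (stepAmp^[j] c) q :=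
        ContDiff.sum fun j _ => (hc.iterate j).diagY.contDiff
      have ss : AmpSupp univ M fun q => ∑ j ∈ Finset.range N, diagY (stepAmp^[j] c) q :=
        AmpSupp.sum _ fun j _ => (hsu.iterate isClosed_univ j).diagY
      rw [kerOf_iterate hc hsu N q hq]
      have e1 : (fun q => stepAmp^[N] c q -
          (a q - ∑ j ∈ Finset.range N, diagY (stepAmp^[j] c) q)) =
          fun q => (stepAmp^[N] c q + ∑ j ∈ Finset.range N, diagY (stepAmp^[j] c) q) - a q := by
        funext q; ring
      rw [e1, kerOf_sub ((hc.iterate N).contDiff.add sm)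
        ((hsu.iterate isClosed_univ N).add ss) ha.contDiff hsu' q hq,
        kerOf_add (hc.iterate N).contDiff (hsu.iterate isClosed_univ N) sm ss q hq]
      ring
  · simpa using hN 1
  · have := hN 2
    simp only [Finset.sum_range_succ, Finset.sum_range_zero, zero_add, Function.iterate_zero,
      id_eq, Function.iterate_one, diagY_stepAmp hc] at this
    exact_mod_cast this

/-! ## Total symbols and left symbols -/

/-- The kernel `(2π)^{-n} h^{-l} ∫ e^{i⟨x-y,η⟩} c dη`. -/
def qK (l : ℝ) (c : Q n → ℂ) : Krn n := fun q =>
  ((((2 * π) ^ n)⁻¹ : ℝ) : ℂ) * (hPow n (-l) q * kerOf c q)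

lemma polarRadius_smul (η : E n) {h : ℝ} (hh : 0 < h) : polarRadius (h • η) h = h * jb η := by
  rw [polarRadius, jb, norm_smul, norm_of_nonneg hh.le,
    show (h * ‖η‖) ^ 2 + h ^ 2 = h ^ 2 * (‖η‖ ^ 2 + 1) by ring, Real.sqrt_mul (by positivity),
    sqrt_sq hh.le]

lemma leftKernel_scaled (a : Krn n) (x y : E n) {h : ℝ} (hh : 0 < h) : leftKernel a (x, y, h) =
    ((((2 * π) ^ n)⁻¹ : ℝ) : ℂ) * ∫ η : E n, osc (x - y) η * (((diagCutoff x y : ℝ) : ℂ) * a (x, h •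
    η, h)) := by
  have h1 := Measure.integral_comp_smul (volume : Measure (E n)) (fun ξ : E n =>
    Complex.exp (I * ((inner ℝ (x - y) ξ / h : ℝ) : ℂ)) *
      ((diagCutoff x y : ℝ) : ℂ) * a (x, ξ, h)) h
  simp only [leftKernel]
  have e : ∀ η : E n, osc (x - y) η * (((diagCutoff x y : ℝ) : ℂ) * a (x, h • η, h)) =
      Complex.exp (I * ((inner ℝ (x - y) (h • η) / h : ℝ) : ℂ)) *
      ((diagCutoff x y : ℝ) : ℂ) * a (x, h • η, h) := by
    intro η
    rw [osc, inner_smul_right, mul_div_cancel_left₀ _ hh.ne', mul_assoc]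
  simp only [e]
  rw [h1]
  simp only [finrank_euclideanSpace, Fintype.card_fin, real_smul]
  rw [abs_of_pos (by positivity), mul_pow, ← mul_assoc, ← ofReal_mul, mul_inv]

/-- The cutoff function near the diagonal, as a function of `(x, y, h)`. -/
def diagCut (n : ℕ) : Krn n := fun q => ((diagCutoff q.1 q.2.1 : ℝ) : ℂ)

lemma contDiff_diagCut : Smooth (diagCut n) := by
  refine ofRealCLM.contDiff.comp (Real.smoothTransition.contDiff.comp ?_)
  exact contDiff_const.sub (ContDiff.norm_sq ℝ (by fun_prop))

lemma diagCut_zeroNear : ZeroNearDiag 1 fun q => (1 - diagCut n (q.1, q.2.1, q.2.2.2)) * c q := by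
  intro q hq
  have : diagCutoff q.1 q.2.1 = 1 := by
    refine Real.smoothTransition.one_of_one_le ?_
    have := norm_nonneg (q.1 - q.2.1); nlinarith
  simp [diagCut, this]

/-- The amplitude of the left quantization of a total symbol. -/
theorem IsTotalSymbol.exists_amp {a : Krn n} (ha : IsTotalSymbol m l a) : ∃ (c : Q n → ℂ) (S : Set
    (E n)) (M : ℝ), IsAmp (m - l) c ∧ IsCompact S ∧ AmpSupp S M c ∧ (∀ q ∈ KD n, leftKernel a q = qK
    l c q) ∧ ∀ (x ξ : E n) (h : ℝ), 0 < h → h < 1 → hPow n m (x, x, h) * a (x, ξ, h) = hPow n (m -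
    l) (x, x, h) * c (x, x, h⁻¹ • ξ, h) := by
  obtain ⟨⟨b, hb, hbc, hab⟩, -⟩ := ha
  obtain ⟨R, hR⟩ := hbc.isCompact.isBounded.exists_norm_le
  let c : Q n → ℂ := fun q => diagCut n (q.1, q.2.1, q.2.2.2) *
    (jpow (m - l) q * b (q.1, (ampPt q).2.2))
  have hkey : ∀ (x η : E n) (h : ℝ), 0 < h → h < 1 → a (x, h • η, h) =
      hPow n (-l) (x, x, h) * (jpow (m - l) (x, x, η, h) * b (x, (ampPt (x, x, η, h)).2.2)) := by
    intro x η h h0 h1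
    have hj := jb_pos η
    rw [hab x _ h h0 h1, polarRadius_smul η h0]
    have e1 : (h * jb η)⁻¹ • h • η = (jb η)⁻¹ • η := by
      rw [smul_smul]; congr 1; field_simp
    have e2 : h / (h * jb η) = (jb η)⁻¹ := by field_simp
    have e3 : ((jb η)⁻¹ ^ (-m) * (h * jb η) ^ (-l) : ℝ) = h ^ (-l) * jb η ^ (m - l) := by
      rw [Real.inv_rpow hj.le, rpow_neg hj.le, inv_inv, mul_rpow h0.le hj.le,
        rpow_sub hj, rpow_neg hj.le]
      field_simp
    rw [e1, e2, e3]
    simp only [hPow, jpow, ampPt]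
    push_cast
    ring
  refine ⟨c, Metric.closedBall 0 R, R, ?_, isCompact_closedBall _ _, ?_, ?_, ?_⟩
  · refine IsAmp.mul_contDiff ?_ contDiff_diagCut
    exact ⟨fun z => b (z.1, z.2.2), hb.comp (by fun_prop), fun q => rfl⟩
  · intro q hq
    have h1 := hR _ (subset_tsupport _ (right_ne_zero_of_mul (right_ne_zero_of_mul hq)))
    simp only [ampPt, Prod.norm_def, max_le_iff] at h1
    refine ⟨by simpa using h1.1, ?_⟩
    have h2 := h1.2.2.2
    rwa [norm_mul, norm_eq_abs, norm_of_nonneg (jb_pos _).le] at h2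
  · rintro ⟨x, y, h⟩ ⟨-, -, h0, h1⟩
    rw [leftKernel_scaled a x y h0, qK]
    congr 1
    simp only [kerOf]
    rw [← integral_const_mul]
    refine integral_congr_ae (Eventually.of_forall fun η => ?_)
    simp only [hkey x η h h0 h1, c, diagCut]
    simp only [hPow, jpow, ampPt]
    ring
  · intro x ξ h h0 h1
    have := hkey x (h⁻¹ • ξ) h h0 h1
    rw [smul_smul, mul_inv_cancel₀ h0.ne', one_smul] at this
    rw [this]
    have hd : diagCut n (x, x, h) = 1 := by
      simp [diagCut, diagCutoff, Real.smoothTransition.one_of_one_le]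
    simp only [c, hd, one_mul, ← mul_assoc]
    congr 2
    simp only [hPow]
    rw [← ofReal_mul, ← rpow_add h0, sub_eq_add_neg]

lemma qK_smooth (l : ℝ) (hc : Smooth c) (hs : AmpSupp S M c) : SmoothOn (qK l c) (KD n) :=
  contDiffOn_const.mul ((hPow_smooth (-l)).mul (kerOf_smooth hc hs))

lemma LRes.qK_mul (hF : LRes 0 F) (l : ℝ) :
    LRes l (fun q => ((((2 * π) ^ n)⁻¹ : ℝ) : ℂ) * (TwoMicro.hPow n (-l) q * F q)) := by
  have := hF.hPow_mul (-l)
  rw [zero_sub, neg_neg] at this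
  exact this.const_mul _

/-- Left symbols come from total symbols. -/
theorem exists_totalSymbol (hc : IsAmp (m - l) c) (hy : YIndep c) (hS : IsCompact S) (hs : AmpSupp S
    M c) : ∃ a : Krn n, IsTotalSymbol m l a ∧ LRes l (fun q => leftKernel a q - qK l c q) ∧ ∀ (x ξ :
    E n) (h : ℝ), 0 < h → h < 1 / 2 → hPow n m (x, x, h) * a (x, ξ, h) = hPow n (m - l) (x, x, h) *
    c (x, x, h⁻¹ • ξ, h) := by
  have hc' := hc
  obtain ⟨b, hb, hbc⟩ := hc'
  obtain ⟨R, hR⟩ := hS.isBounded.exists_norm_le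
  obtain ⟨γ, hγ, hγc, hγ1, hγs⟩ := exists_contDiff_cutoff (Z := E n × E n × ℝ × ℝ)
    (max (max R 1) M)
  let b' : E n × E n × ℝ × ℝ → ℂ := fun z =>
    (γ z * b (z.1, 0, z.2)) * ((bump1 (2 * (z.2.2.2 * z.2.2.1)) : ℝ) : ℂ)
  have hb' : Smooth b' := by
    refine (hγ.mul (hb.comp (by fun_prop))).mul (ofRealCLM.contDiff.comp
      (contDiff_bump1.comp ?_))
    fun_prop
  let a : Krn n := fun q =>
    (((q.2.2 / polarRadius q.2.1 q.2.2) ^ (-m) * (polarRadius q.2.1 q.2.2) ^ (-l) : ℝ) : ℂ) *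
      b' (q.1, (polarRadius q.2.1 q.2.2)⁻¹ • q.2.1, q.2.2 / polarRadius q.2.1 q.2.2,
        polarRadius q.2.1 q.2.2)
  have hγc' : ∀ x η h, 0 < h → γ (x, (ampPt (x, x, η, h)).2.2) * c (x, x, η, h) =
      c (x, x, η, h) := by
    intro x η h h0
    by_cases hz : c (x, x, η, h) = 0
    · simp [hz]
    · have h1 := hs _ hz
      have hj := jb_pos η
      rw [hγ1, one_mul]
      simp only [ampPt, Prod.norm_def, max_le_iff]
      refine ⟨?_, ?_, ?_, ?_⟩
      · exact (hR _ h1.1).trans ((le_max_left _ _).trans (le_max_left _ _))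
      · rw [norm_smul, norm_inv, norm_of_nonneg hj.le]
        refine le_trans ?_ ((le_max_right R 1).trans (le_max_left _ M))
        rw [inv_mul_le_one₀ hj]; exact norm_le_jb _
      · rw [norm_of_nonneg (inv_nonneg.2 hj.le)]
        exact (inv_le_one_of_one_le₀ (one_le_jb _)).trans
          ((le_max_right R 1).trans (le_max_left _ M))
      · rw [norm_mul, norm_eq_abs, norm_of_nonneg hj.le]
        exact h1.2.trans (le_max_right _ _)
  have hkey : ∀ (x η : E n) (h : ℝ), 0 < h → a (x, h • η, h) =
      hPow n (-l) (x, x, h) * (((bump1 (2 * h) : ℝ) : ℂ) * c (x, x, η, h)) := by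
    intro x η h h0
    have hj := jb_pos η
    have e1 : (h * jb η)⁻¹ • h • η = (jb η)⁻¹ • η := by
      rw [smul_smul]; congr 1; field_simp
    have e2 : h / (h * jb η) = (jb η)⁻¹ := by field_simp
    have e3 : ((jb η)⁻¹ ^ (-m) * (h * jb η) ^ (-l) : ℝ) = h ^ (-l) * jb η ^ (m - l) := by
      rw [Real.inv_rpow hj.le, rpow_neg hj.le, inv_inv, mul_rpow h0.le hj.le,
        rpow_sub hj, rpow_neg hj.le]
      field_simp
    have e4 : h * jb η * (jb η)⁻¹ = h := by field_simp
    have e5 := hγc' x η h h0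
    rw [hy x x 0 η h, hbc] at e5
    rw [hy x x 0 η h, hbc, ← e5]
    simp only [a, b', polarRadius_smul η h0, e1, e2, e3, e4]
    simp only [hPow, jpow, ampPt]
    push_cast
    ring
  refine ⟨a, ⟨⟨b', hb', (hγc.mul_right).mul_right, fun x ξ h _ _ => rfl⟩, 1 - 1 / 100,
    by norm_num, fun x ξ h hh _ => ?_⟩, ?_, ?_⟩
  · have h0 : 0 < h := by linarith
    have := hkey x (h⁻¹ • ξ) h h0
    rw [smul_smul, mul_inv_cancel₀ h0.ne', one_smul] at this
    rw [this]
    have hz : bump1 (2 * h) = 0 := by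
      refine Real.smoothTransition.zero_of_nonpos ?_
      nlinarith
    simp [hz]
  · have hsu := hs.mono (subset_univ S) le_rfl
    let θ : Krn n := fun q => diagCut n q * ((bump1 (2 * q.2.2) : ℝ) : ℂ)
    have hθ : Smooth θ := contDiff_diagCut.mul (ofRealCLM.contDiff.comp
      (contDiff_bump1.comp (by fun_prop)))
    have e1 : ∀ q ∈ KD n, leftKernel a q = θ q * qK l c q := by
      rintro ⟨x, y, h⟩ ⟨-, -, h0, h1⟩
      rw [leftKernel_scaled a x y h0, qK]
      rw [mul_left_comm]
      congr 1
      simp only [kerOf]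
      rw [← mul_assoc, ← integral_const_mul]
      refine integral_congr_ae (Eventually.of_forall fun η => ?_)
      simp only [hkey x η h h0, hy x y x η h, θ, diagCut, hPow]
      ring
    have hoff : LRes 0 (kerOf fun q => (1 - diagCut n (q.1, q.2.1, q.2.2.2)) * c q) :=
      LRes.kerOf_of_zeroNearDiag one_pos
        (hc.mul_contDiff (θ := fun q => 1 - diagCut n q) (contDiff_const.sub contDiff_diagCut))
        (hsu.mul_left _) diagCut_zeroNear
    have h2 : LRes l (fun q => -(((((2 * π) ^ n)⁻¹ : ℝ) : ℂ) *
        (hPow n (-l) q * kerOf (fun q => (1 - diagCut n (q.1, q.2.1, q.2.2.2)) * c q) q))) :=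
      (hoff.qK_mul l).neg
    have hsm : SmoothOn (fun q => leftKernel a q - qK l c q) (KD n) := by
      refine ContDiffOn.congr ((hθ.contDiffOn.mul (qK_smooth l hc.contDiff hsu)).sub
        (qK_smooth l hc.contDiff hsu)) fun q hq => ?_
      rw [e1 q hq]
    refine h2.congr_small hsm ⟨1 / 2, by norm_num, fun x y h hh => ?_⟩
    beta_reduce
    rw [e1 _ (mem_kernelDomain hh.1 (hh.2.trans (by norm_num))),
      kerOf_mul (fun q => 1 - diagCut n q) c]
    have : bump1 (2 * h) = 1 := bump1_eq_one (by rw [abs_of_pos (by linarith [hh.1])]; linarith [hh.2])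
    simp only [θ, this, qK]
    push_cast
    ring
  · intro x ξ h h0 h1
    have := hkey x (h⁻¹ • ξ) h h0
    rw [smul_smul, mul_inv_cancel₀ h0.ne', one_smul] at this
    rw [this]
    have hz : bump1 (2 * h) = 1 := bump1_eq_one (by rw [abs_of_pos (by linarith)]; linarith)
    rw [hz, ofReal_one, one_mul, ← mul_assoc]
    congr 1
    simp only [hPow]
    rw [← ofReal_mul, ← rpow_add h0, sub_eq_add_neg]

/-! ## Fourier inversion -/

lemma osc_add_left (u v η : E n) : osc (u + v) η = osc u η * osc v η := by
  simp only [osc, ← Complex.exp_add, inner_add_left]; congr 1; push_cast; ring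

lemma osc_neg_left (u η : E n) : osc (-u) η = osc u (-η) := by
  simp only [osc, inner_neg_left, inner_neg_right]

/-- `∫ e^{i⟨z,η⟩} f(η) dη`. -/
def oscInt (f : E n → ℂ) (z : E n) : ℂ := ∫ η, osc z η * f η

lemma fourier_eq_oscInt (f : E n → ℂ) (w : E n) :
    FourierTransform.fourier f w = oscInt f (-(2 * π) • w) := by
  rw [Real.fourier_eq']
  refine integral_congr_ae (Eventually.of_forall fun v => ?_)
  simp only [osc, smul_eq_mul, inner_smul_left, real_inner_comm]
  congr 2
  simp
  ring

section Inversion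

variable {f : E n → ℂ}

lemma integrable_fourier (hf : Smooth f) (hfc : CSupp f) :
    Integrable (FourierTransform.fourier f) := by
  have h : (FourierTransform.fourier (hfc.toSchwartzMap hf) : E n → ℂ) =
      FourierTransform.fourier f := by
    rw [SchwartzMap.fourier_coe]; rfl
  rw [← h]
  exact SchwartzMap.integrable _

lemma integrable_oscInt (hf : Smooth f) (hfc : CSupp f) : Integrable (oscInt f) := by
  have h := integrable_fourier hf hfc
  rw [show FourierTransform.fourier f = fun w => oscInt f (-(2 * π) • w) from
    funext (fourier_eq_oscInt f)] at h
  exact (integrable_comp_smul_iff volume (oscInt f)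
    (neg_ne_zero.2 (by positivity : (2 * π) ≠ 0))).1 h

lemma integral_osc_oscInt (hf : Smooth f) (hfc : CSupp f) (v : E n) :
    ∫ z, osc (-z) v * oscInt f z = (((2 * π) ^ n : ℝ) : ℂ) * f v := by
  have h1 := congrFun (hf.continuous.fourierInv_fourier_eq
    (hf.continuous.integrable_of_hasCompactSupport hfc) (integrable_fourier hf hfc)) v
  rw [Real.fourierInv_eq'] at h1
  have h2 := Measure.integral_comp_smul (volume : Measure (E n))
    (fun z => osc (-z) v * oscInt f z) (-(2 * π))
  have e : (fun w : E n => Complex.exp (((2 * π * inner ℝ w v : ℝ) : ℂ) * I) •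
      FourierTransform.fourier f w) =
      fun w => osc (-(-(2 * π) • w)) v * oscInt f (-(2 * π) • w) := by
    funext w
    rw [fourier_eq_oscInt, smul_eq_mul]
    congr 1
    simp only [osc, neg_smul, neg_neg, inner_smul_left]
    congr 1
    simp
    ring
  rw [e, h2] at h1
  rw [← h1]
  simp only [finrank_euclideanSpace, Fintype.card_fin, real_smul, ← mul_assoc,
    ← ofReal_mul]
  have : (2 * π) ^ n * |((-(2 * π)) ^ n)⁻¹| = 1 := by
    rw [abs_inv, abs_pow, abs_neg, abs_of_pos (by positivity : 0 < 2 * π)]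
    exact mul_inv_cancel₀ (by positivity)
  rw [this]; simp

lemma continuous_oscInt (hf : Smooth f) (hfc : CSupp f) : Continuous (oscInt f) := by
  have := contDiffOn_integral (μ := (volume : Measure (E n))) (U := (univ : Set (E n)))
    (G := fun p : E n × E n => osc p.1 p.2 * f p.2) isOpen_univ
    (contDiff_osc.mul (hf.comp contDiff_snd)).contDiffOn
    fun p _ => ⟨tsupport f, hfc, Eventually.of_forall fun q t ht => by
      simp [image_eq_zero_of_notMem_tsupport ht]⟩
  exact (contDiffOn_univ.1 this).continuous

/-- Parseval's formula. -/
lemma integral_oscInt_mul (hf : Smooth f) (hfc : CSupp f) (hg : Smooth g) (hgc : CSupp g) (x y : E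
    n) : ∫ z, oscInt f (x - z) * oscInt g (y - z) = (((2 * π) ^ n : ℝ) : ℂ) * oscInt (fun η => f η *
    g (-η)) (x - y) := by
  have hgi := hg.continuous.integrable_of_hasCompactSupport hgc (μ := (volume : Measure (E n)))
  have hfi := (integrable_oscInt hf hfc).comp_sub_left x
  have hI : Integrable (fun p : E n × E n => osc (y - p.1) p.2 * (oscInt f (x - p.1) * g p.2))
      ((volume : Measure (E n)).prod volume) := by
    refine (hfi.mul_prod hgi).bdd_mul (c := 1) ?_ (Eventually.of_forall fun p => ?_)
    · have : Continuous fun p : E n × E n => osc (y - p.1) p.2 :=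
        contDiff_osc.continuous.comp (f := fun p : E n × E n => (y - p.1, p.2)) (by fun_prop)
      exact this.aestronglyMeasurable
    · rw [norm_osc]
  have h1 : ∀ z, oscInt f (x - z) * oscInt g (y - z) =
      ∫ η, osc (y - z) η * (oscInt f (x - z) * g η) := by
    intro z
    rw [oscInt, oscInt, ← integral_const_mul]
    refine integral_congr_ae (Eventually.of_forall fun η => ?_)
    simp only; ring
  simp only [h1]
  rw [integral_integral_swap hI]
  have h2 : ∀ η, ∫ z, osc (y - z) η * (oscInt f (x - z) * g η) =
      (((2 * π) ^ n : ℝ) : ℂ) * (osc (y - x) η * (f (-η) * g η)) := by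
    intro η
    have h3 := integral_sub_left_eq_self (fun z => osc (y - x + z) η * (oscInt f z * g η))
      (volume : Measure (E n)) x
    have h4 : ∀ z, y - x + (x - z) = y - z := fun z => by abel
    simp only [h4] at h3
    rw [h3]
    have h5 : ∀ z, osc (y - x + z) η * (oscInt f z * g η) =
        (osc (y - x) η * g η) * (osc (-z) (-η) * oscInt f z) := fun z => by
      rw [osc_add_left, osc_neg_left z (-η), neg_neg]; ring
    simp only [h5]
    rw [integral_const_mul, integral_osc_oscInt hf hfc]; ring
  simp only [h2]
  rw [integral_const_mul, oscInt]
  congr 1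
  rw [← integral_neg_eq_self]
  refine integral_congr_ae (Eventually.of_forall fun η => ?_)
  simp only [neg_neg]
  rw [← osc_neg_left, neg_sub]

end Inversion

lemma kerOf_eq_oscInt (c : Q n → ℂ) (x y : E n) (h : ℝ) :
    kerOf c (x, y, h) = oscInt (fun η => c (x, y, η, h)) (x - y) := rfl

lemma slice_contDiff (hc : Smooth c) (x y : E n) (h : ℝ) : Smooth fun η => c (x, y, η, h) :=
  hc.comp (f := fun η : E n => ((x, y, η, h) : Q n)) (by fun_prop)

/-! ## Decay of kernels of left symbols -/

lemma YIndep.mul (ha : YIndep a) (hc : YIndep c) : YIndep fun q => a q * c q :=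
  fun x y y' η h => by simp only [ha x y y' η h, hc x y y' η h]

lemma YIndep.add (ha : YIndep a) (hc : YIndep c) : YIndep fun q => a q + c q :=
  fun x y y' η h => by simp only [ha x y y' η h, hc x y y' η h]

lemma YIndep.const_mul (ha : YIndep a) (z : ℂ) : YIndep fun q => z * a q :=
  fun x y y' η h => by simp only [ha x y y' η h]

lemma yIndep_jpow (s : ℝ) : YIndep (jpow s : Q n → ℂ) := fun _ _ _ _ _ => rfl

lemma yIndep_inner (v : E n) : YIndep fun q : Q n => ((inner ℝ v q.2.2.1 : ℝ) : ℂ) :=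
  fun _ _ _ _ _ => rfl

lemma YIndep.fderiv_eq (ha : YIndep a) (hc : Smooth a) (x y y' η : E n) (h : ℝ)
    (v1 v2 v2' v3 : E n) (t : ℝ) :
    fderiv ℝ a (x, y, η, h) (v1, v2, v3, t) = fderiv ℝ a (x, y', η, h) (v1, v2', v3, t) := by
  have key : ∀ y v2, fderiv ℝ a (x, y, η, h) (v1, v2, v3, t) =
      deriv (fun s : ℝ => a (x + s • v1, (0 : E n), η + s • v3, h + s * t)) 0 := by
    intro y v2
    have d1 : HasFDerivAt a (fderiv ℝ a (x, y, η, h))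
        (x + (0 : ℝ) • v1, y + (0 : ℝ) • v2, η + (0 : ℝ) • v3, h + 0 * t) := by
      simpa using (hc.differentiable (by simp) (x, y, η, h)).hasFDerivAt
    have hl : ∀ u w : E n, HasDerivAt (fun s : ℝ => u + s • w) w 0 := fun u w => by
      simpa using ((hasDerivAt_id (0 : ℝ)).smul_const w).const_add u
    have hr : HasDerivAt (fun s : ℝ => h + s * t) t 0 := by
      simpa using ((hasDerivAt_id (0 : ℝ)).mul_const t).const_add h
    have := d1.comp_hasDerivAt (f := fun s : ℝ =>
      ((x + s • v1, y + s • v2, η + s • v3, h + s * t) : Q n)) 0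
      ((hl x v1).prodMk ((hl y v2).prodMk ((hl η v3).prodMk hr)))
    rw [← this.deriv]
    congr 1
    funext s
    exact ha _ _ _ _ _
  rw [key, key]

lemma YIndep.dEta (ha : YIndep a) (hc : Smooth a) (w : E n) : YIndep (dEta w a) :=
  fun x y y' η h => ha.fderiv_eq hc x y y' η h _ _ _ _ _

lemma YIndep.fieldAmp (ha : YIndep a) (hc : Smooth a) (v : KPt n) : YIndep (fieldAmp v a) :=
  fun x y y' η h => ha.fderiv_eq hc x y y' η h _ _ _ _ _

lemma YIndep.derivAmp (ha : YIndep a) (hc : Smooth a) (v : KPt n) : YIndep (derivAmp v a) :=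
  (((yIndep_inner (v.1 - v.2.1)).const_mul I).mul ha).add (ha.fieldAmp hc v)

lemma YIndep.fieldAmp_eq (ha : YIndep a) (hc : Smooth a) (v1 v2 v2' : E n) (t : ℝ) :
    TwoMicro.fieldAmp (v1, v2, t) a = TwoMicro.fieldAmp (v1, v2', t) a := by
  funext q; exact ha.fderiv_eq hc q.1 q.2.1 q.2.1 q.2.2.1 q.2.2.2 _ _ _ _ _

lemma YIndep.fieldAmp_zero (ha : YIndep a) (hc : Smooth a) (w : E n) (q : Q n) :
    TwoMicro.fieldAmp (0, w, 0) a q = 0 := by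
  rw [ha.fieldAmp_eq hc 0 w 0 0]
  have : ((0, 0, 0, q.2.2.2 * 0) : Q n) = 0 := by simp
  simp only [TwoMicro.fieldAmp, this, map_zero]

lemma YIndep.exists_bound (ha : YIndep a) (hc : IsAmp m a) (hS : IsCompact S) (hs : AmpSupp S M a) :
    ∃ C : ℝ, 0 ≤ C ∧ ∀ x y η : E n, ∀ h : ℝ, 0 ≤ h → ‖a (x, y, η, h)‖ ≤ C * jb η ^ m := by
  obtain ⟨C, hC, H⟩ := hc.bound hs (hS.prod (isCompact_singleton (x := (0 : E n))))
  refine ⟨C, hC, fun x y η h h0 => ?_⟩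
  by_cases hx : x ∈ S
  · rw [ha x y 0 η h]
    exact H x 0 η h ⟨hx, rfl⟩ h0
  · rw [not_imp_comm.1 (hs (x, y, η, h)) (fun h => hx h.1), norm_zero]
    exact mul_nonneg hC (rpow_nonneg (jb_pos η).le _)

lemma norm_kerOf_le (hm : m < -n) (ha : YIndep a) (hc : IsAmp m a) (hS : IsCompact S)
    (hs : AmpSupp S M a) : ∃ C : ℝ, ∀ q ∈ KD n, ‖kerOf a q‖ ≤ C := by
  obtain ⟨C, hC, H⟩ := ha.exists_bound hc hS hs
  refine ⟨∫ η : E n, C * jb η ^ m, fun q hq => ?_⟩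
  refine norm_integral_le_of_norm_le ((integrable_jb_rpow hm).const_mul C)
    (Eventually.of_forall fun η => ?_)
  rw [norm_mul, norm_osc, one_mul]
  exact H _ _ _ _ hq.2.2.1.le

lemma kerOf_coord_iterate (hc : IsAmp m a) (hs : AmpSupp univ M a) (w : E n) (K : ℕ) : ∀ q ∈ KD n,
    ((inner ℝ (q.2.1 - q.1) w : ℝ) : ℂ) ^ K * kerOf a q = (-I) ^ K * kerOf ((dEta w)^[K] a) q := by
  intro q hq
  induction K generalizing a m with
  | zero => simp
  | succ K ih =>
    have h1 := kerOf_coord hc.contDiff hs w q hq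
    rw [kerOf_mul (fun q => ((inner ℝ (q.2.1 - q.1) w : ℝ) : ℂ)) a, kerOf_const_mul] at h1
    rw [pow_succ, mul_assoc, h1, Function.iterate_succ_apply, mul_left_comm,
      ih (hc.dEta w) (hs.fderiv isClosed_univ _), pow_succ]
    ring

lemma dEta_iterate (hc : IsAmp m a) (hS : IsClosed S) (hs : AmpSupp S M a) (ha : YIndep a) (w : E n) (K : ℕ) :
    IsAmp (m - K) ((dEta w)^[K] a) ∧ AmpSupp S M ((dEta w)^[K] a) ∧ YIndep ((dEta w)^[K] a) := by
  induction K with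
  | zero => simpa using ⟨hc, hs, ha⟩
  | succ K ih =>
    rw [Function.iterate_succ_apply']
    exact ⟨(ih.1.dEta w).congr_order (by push_cast; ring), ih.2.1.fderiv hS _,
      ih.2.2.dEta ih.1.contDiff w⟩

lemma norm_le_sum_abs (v : E n) : ‖v‖ ≤ ∑ j, |v j| := by
  conv_lhs => rw [← sum_single_eq v]
  refine (norm_sum_le _ _).trans (Finset.sum_le_sum fun j _ => ?_)
  simp [norm_smul]

lemma norm_pow_le_sum (v : E n) (K : ℕ) : ‖v‖ ^ (K + 1) ≤ n ^ K * ∑ j, |v j| ^ (K + 1) := by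
  have := pow_le_pow_left₀ (norm_nonneg v) (norm_le_sum_abs v) (K + 1)
  refine this.trans ?_
  have h4 := pow_sum_le_card_mul_sum_pow (s := (Finset.univ : Finset (Fin n))) (f := fun j => |v j|)
    (fun j _ => abs_nonneg _) K
  simpa using h4

/-- Kernels of left symbols decay rapidly away from the diagonal. -/
lemma exists_decay (hc : IsAmp m a) (ha : YIndep a) (hS : IsCompact S) (hs : AmpSupp S M a) (K : ℕ)
    (hK : m - (K + 1 : ℕ) < -n) : ∃ C : ℝ, ∀ q ∈ KD n, ‖q.1 - q.2.1‖ ^ (K + 1) * ‖kerOf a q‖ ≤ C :=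
    by
  have hsu := hs.mono (subset_univ S) le_rfl
  have h1 : ∀ j : Fin n, ∃ C : ℝ, ∀ q ∈ KD n,
      |(q.1 - q.2.1) j| ^ (K + 1) * ‖kerOf a q‖ ≤ C := by
    intro j
    obtain ⟨i1, i2, i3⟩ := dEta_iterate hc hS.isClosed hs ha (bv j) (K + 1)
    obtain ⟨C, hC⟩ := norm_kerOf_le hK i3 i1 hS i2
    refine ⟨C, fun q hq => ?_⟩
    have h2 := congrArg norm (kerOf_coord_iterate hc hsu (bv j) (K + 1) q hq)
    simp only [norm_mul, norm_pow, norm_neg, Complex.norm_I, one_pow, one_mul,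
      norm_real, norm_eq_abs] at h2
    have h3 : (inner ℝ (q.2.1 - q.1) (bv j) : ℝ) = -((q.1 - q.2.1) j) := by
      simp [bv, EuclideanSpace.inner_single_right]
    rw [h3, abs_neg] at h2
    rw [h2]
    exact hC q hq
  choose C hC using h1
  refine ⟨n ^ K * ∑ j, C j, fun q hq => ?_⟩
  calc _ ≤ (n ^ K * ∑ j, |(q.1 - q.2.1) j| ^ (K + 1)) * ‖kerOf a q‖ :=
        mul_le_mul_of_nonneg_right (norm_pow_le_sum _ _) (norm_nonneg _)
    _ = n ^ K * ∑ j, |(q.1 - q.2.1) j| ^ (K + 1) * ‖kerOf a q‖ := by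
        rw [mul_assoc, Finset.sum_mul]
    _ ≤ _ := by
        refine mul_le_mul_of_nonneg_left (Finset.sum_le_sum fun j _ => hC j q hq) (by positivity)

lemma le_jb_rpow_of_decay {v : E n} {t C₁ C₂ : ℝ} (ht : 0 ≤ t) (K : ℕ) (h1 : ‖v‖ ≤ 1 → t ≤ C₁)
    (h2 : ‖v‖ ^ K * t ≤ C₂) : t ≤ 2 ^ K * (|C₁| + |C₂|) * jb v ^ (-(K : ℝ)) := by
  have hj := jb_pos v
  rw [rpow_neg hj.le, rpow_natCast, ← div_eq_mul_inv, le_div_iff₀ (by positivity)]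
  have hjs := jb_sq v
  rcases le_or_gt ‖v‖ 1 with hv | hv
  · have hjl : jb v ≤ 2 := by nlinarith [norm_nonneg v]
    calc t * jb v ^ K ≤ |C₁| * 2 ^ K := mul_le_mul ((h1 hv).trans (le_abs_self _))
          (pow_le_pow_left₀ hj.le hjl K) (by positivity) (abs_nonneg _)
      _ ≤ _ := by
        rw [mul_comm]
        exact mul_le_mul_of_nonneg_left (le_add_of_nonneg_right (abs_nonneg _)) (by positivity)
  · have hjl : jb v ≤ 2 * ‖v‖ := by nlinarith [norm_nonneg v]
    calc t * jb v ^ K ≤ t * (2 * ‖v‖) ^ K :=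
          mul_le_mul_of_nonneg_left (pow_le_pow_left₀ hj.le hjl K) ht
      _ = 2 ^ K * (‖v‖ ^ K * t) := by rw [mul_pow]; ring
      _ ≤ 2 ^ K * (|C₁| + |C₂|) := by
        refine mul_le_mul_of_nonneg_left (h2.trans ?_) (by positivity)
        exact (le_abs_self _).trans (le_add_of_nonneg_left (abs_nonneg _))

lemma exists_decay_order (m : ℝ) : ∃ K : ℕ, m - (K + 1 : ℕ) < -n ∧ -((K + 1 : ℕ) : ℝ) < -n := by
  obtain ⟨K, hK⟩ := exists_nat_gt (max (m + n) n)
  have h1 := (le_max_left (m + n) (n : ℝ)).trans_lt hK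
  have h2 := (le_max_right (m + n) (n : ℝ)).trans_lt hK
  exact ⟨K, by push_cast; linarith, by push_cast; linarith⟩

/-! ## Uniqueness of left symbols -/

lemma kerOf_mulEta (ha : YIndep a) (hc : Smooth a) (hs : AmpSupp S M a) (w : E n) : ∀ q ∈ KD n,
    kerOf (fun q => ((inner ℝ w q.2.2.1 : ℝ) : ℂ) * a q) q = I * bDeriv (0, w, 0) (kerOf a) q := by
  intro q hq
  have : derivAmp (0, w, 0) a = fun q => (-I) * (((inner ℝ w q.2.2.1 : ℝ) : ℂ) * a q) := by
    funext q
    simp only [derivAmp, ha.fieldAmp_zero hc w q, zero_sub, inner_neg_left]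
    push_cast; ring
  rw [bDeriv_kerOf hc hs _ q hq, this, kerOf_const_mul]
  linear_combination ((kerOf (fun q => ((inner ℝ w q.2.2.1 : ℝ) : ℂ) * a q) q)) * I_mul_I

lemma LRes.left_symbol_bounded (hR : LRes 0 (kerOf a)) (hc : IsAmp m a) (ha : YIndep a)
    (hS : IsCompact S) (hs : AmpSupp S M a) :
    ∃ C : ℝ, ∃ ε > 0, ∀ x η : E n, ∀ h ∈ Ioo 0 ε, ‖a (x, x, η, h)‖ ≤ C := by
  obtain ⟨K, hK1, hK2⟩ := exists_decay_order (n := n) m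
  obtain ⟨C₂, hC₂⟩ := exists_decay hc ha hS hs K hK1
  have hR0 : LBd 0 (kerOf a) := hR.bd 0
  obtain ⟨C₁, ε, hε, H⟩ := hR0.exists_bound (hS.prod (hS.cthickening (r := 1)))
  let C := 2 ^ (K + 1) * (|C₁| + |C₂|)
  refine ⟨((2 * π) ^ n)⁻¹ * ∫ z : E n, C * jb z ^ (-((K + 1 : ℕ) : ℝ)), min ε 1,
    lt_min hε one_pos, fun x η h hh => ?_⟩
  have hh1 : h < 1 := hh.2.trans_le (min_le_right _ _)
  have hhε : h < ε := hh.2.trans_le (min_le_left _ _)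
  have hint : 0 ≤ ∫ z : E n, C * jb z ^ (-((K + 1 : ℕ) : ℝ)) :=
    integral_nonneg fun z => mul_nonneg (by positivity) (rpow_nonneg (jb_pos z).le _)
  by_cases hx : x ∈ S
  swap
  · rw [not_imp_comm.1 (hs (x, x, η, h)) (fun h => hx h.1), norm_zero]
    positivity
  have h1 := integral_osc_oscInt (slice_contDiff hc.contDiff x x h)
    (hs.hasCompactSupport x x hh.1) η
  have h2 : ∀ z, oscInt (fun η => a (x, x, η, h)) z = kerOf a (x, x - z, h) := by
    intro z
    rw [kerOf_eq_oscInt, sub_sub_cancel]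
    congr 1
    funext η; exact ha _ _ _ _ _
  have h3 : ‖∫ z, osc (-z) η * oscInt (fun η => a (x, x, η, h)) z‖ ≤
      ∫ z : E n, C * jb z ^ (-((K + 1 : ℕ) : ℝ)) := by
    refine norm_integral_le_of_norm_le ((integrable_jb_rpow hK2).const_mul C)
      (Eventually.of_forall fun z => ?_)
    rw [norm_mul, norm_osc, one_mul, h2]
    refine le_jb_rpow_of_decay (norm_nonneg _) (K + 1) (fun hz => ?_) ?_
    · have := H (x, x - z) ⟨hx, Metric.mem_cthickening_of_dist_le (x - z) x 1 S hx
        (by simpa [dist_eq_norm] using hz)⟩ h ⟨hh.1, hhε⟩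
      simpa using this
    · simpa using hC₂ _ (mem_kernelDomain (x := x) (y := x - z) hh.1 hh1)
  rw [h1, norm_mul, norm_real, norm_of_nonneg (by positivity)] at h3
  rwa [le_inv_mul_iff₀ (by positivity)]

lemma LRes.left_symbol_rapid (hR : LRes 0 (kerOf a)) (hc : IsAmp m a) (ha : YIndep a) (hS :
    IsCompact S) (hs : AmpSupp S M a) (w : E n) (N : ℕ) : ∃ C : ℝ, ∃ ε > 0, ∀ x η : E n, ∀ h ∈ Ioo 0
    ε, |inner ℝ w η| ^ N * ‖a (x, x, η, h)‖ ≤ C := by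
  induction N generalizing a m with
  | zero => simpa using hR.left_symbol_bounded hc ha hS hs
  | succ N ih =>
    have hR' : LRes 0 (kerOf fun q => ((inner ℝ w q.2.2.1 : ℝ) : ℂ) * a q) :=
      ((hR.bDeriv (0, w, 0)).const_mul I).congr (kerOf_mulEta ha hc.contDiff hs w)
    obtain ⟨C, ε, hε, H⟩ := ih hR' ((isAmp_inner w).mul hc) ((yIndep_inner w).mul ha)
      (hs.mul_left _)
    refine ⟨C, ε, hε, fun x η h hh => ?_⟩
    have := H x η h hh
    rwa [norm_mul, norm_real, norm_eq_abs, ← mul_assoc, ← pow_succ] at this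

/-- A left symbol with residual kernel has vanishing limit. -/
theorem LRes.left_symbol_tendsto (hR : LRes 0 (kerOf a)) (hc : IsAmp m a) (ha : YIndep a)
    (hS : IsCompact S) (hs : AmpSupp S M a) (s : ℝ) (x ξ : E n) (hξ : ξ ≠ 0) :
    Tendsto (fun h : ℝ => ((h ^ s : ℝ) : ℂ) * a (x, x, h⁻¹ • ξ, h)) (𝓝[>] 0) (𝓝 0) := by
  obtain ⟨N, hN⟩ := exists_nat_gt (-s)
  obtain ⟨C, ε, hε, H⟩ := hR.left_symbol_rapid hc ha hS hs ξ N
  have hξ2 : 0 < ‖ξ‖ ^ 2 := by have := norm_pos_iff.2 hξ; positivity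
  have h1 : Tendsto (fun h : ℝ => h ^ (s + N) * (C / (‖ξ‖ ^ 2) ^ N)) (𝓝[>] 0) (𝓝 0) := by
    have : Tendsto (fun h : ℝ => h ^ (s + N)) (𝓝[>] 0) (𝓝 0) := by
      have hc := (Real.continuousAt_rpow_const 0 (s + N) (Or.inr (by linarith))).tendsto
      rw [Real.zero_rpow (by linarith)] at hc
      exact hc.mono_left nhdsWithin_le_nhds
    simpa using this.mul_const (C / (‖ξ‖ ^ 2) ^ N)
  refine squeeze_zero_norm' ?_ h1
  filter_upwards [Ioo_mem_nhdsGT hε] with h hh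
  have h2 := H x (h⁻¹ • ξ) h hh
  rw [inner_smul_right, real_inner_self_eq_norm_sq, abs_of_pos (by have := hh.1; positivity),
    mul_pow, inv_pow] at h2
  rw [norm_mul, norm_real, norm_of_nonneg (rpow_nonneg hh.1.le _),
    rpow_add hh.1, mul_assoc, rpow_natCast]
  refine mul_le_mul_of_nonneg_left ?_ (rpow_nonneg hh.1.le _)
  rw [mul_div_assoc', le_div_iff₀ (by positivity)]
  have h3 : 0 < h ^ N := pow_pos hh.1 N
  rw [mul_assoc, inv_mul_le_iff₀ h3] at h2
  linarith

/-! ## Transposition of amplitudes -/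

/-- The transposed amplitude. -/
def trA (c : Q n → ℂ) : Q n → ℂ := fun q => c (q.2.1, q.1, -q.2.2.1, q.2.2.2)

lemma jb_neg (η : E n) : jb (-η) = jb η := by simp [jb]

lemma IsAmp.trA (hc : IsAmp m c) : IsAmp m (trA c) := by
  obtain ⟨b, hb, h⟩ := hc
  refine ⟨fun z => b (z.2.1, z.1, -z.2.2.1, z.2.2.2), hb.comp (by fun_prop), fun q => ?_⟩
  simp only [TwoMicro.trA, h, jpow, ampPt, jb_neg, smul_neg]

lemma AmpSupp.trA (hs : AmpSupp univ M c) : AmpSupp univ M (trA c) := by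
  intro q hq
  have := hs (q.2.1, q.1, -q.2.2.1, q.2.2.2) hq
  exact ⟨mem_univ _, by simpa [jb_neg] using this.2⟩

lemma kerOf_trA (c : Q n → ℂ) : kerOf (trA c) = swapK (kerOf c) := by
  funext q
  simp only [kerOf, trA, swapK]
  rw [← integral_neg_eq_self]
  refine integral_congr_ae (Eventually.of_forall fun η => ?_)
  simp only [neg_neg]
  rw [← osc_neg_left, neg_sub]

lemma fieldAmp_mul (ha : Smooth a) (hc : Smooth c) (v : KPt n) (q : Q n) :
    fieldAmp v (fun q => a q * c q) q = fieldAmp v a q * c q + a q * fieldAmp v c q := by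
  have h := ((ha.differentiable (by simp) q).hasFDerivAt.mul
    (hc.differentiable (by simp) q).hasFDerivAt).fderiv
  have h' : fderiv ℝ (fun q => a q * c q) q = _ := h
  simp only [fieldAmp, h']
  simp
  ring

lemma fieldAmp_trA (hc : Smooth c) (v : KPt n) :
    fieldAmp v (trA c) = trA (fieldAmp (v.2.1, v.1, v.2.2) c) := by
  funext q
  have d1 : HasFDerivAt c (fderiv ℝ c (q.2.1, q.1, -q.2.2.1, q.2.2.2))
      (q.2.1, q.1, -q.2.2.1, q.2.2.2) := (hc.differentiable (by simp) _).hasFDerivAt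
  let s := snd ℝ (E n) (KPt n)
  let ss := (snd ℝ (E n) (E n × ℝ)).comp s
  let L : Q n →L[ℝ] Q n := ((fst ℝ (E n) (E n × ℝ)).comp s).prod
    ((fst ℝ (E n) (KPt n)).prod
      ((-(fst ℝ (E n) ℝ).comp ss).prod
        ((snd ℝ (E n) ℝ).comp ss)))
  have := (d1.comp (f := L) q L.hasFDerivAt).fderiv
  have e : fderiv ℝ (trA c) q = _ := this
  simp only [fieldAmp, trA, e]
  simp [L, ss, s]

lemma derivAmp_mul_trA (ha : IsAmp m a) (hya : YIndep a) (hb : IsAmp m' b) (hyb : YIndep b) (v : KPt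
    n) : derivAmp v (fun q => a q * trA b q) = fun q => derivAmp (v.1, 0, v.2.2) a q * trA b q + a q
    * trA (derivAmp (v.2.1, 0, v.2.2) b) q := by
  funext q
  have e1 := hya.fieldAmp_eq ha.contDiff v.1 v.2.1 0 v.2.2
  have e2 := hyb.fieldAmp_eq hb.contDiff v.2.1 v.1 0 v.2.2
  have e3 : trA (derivAmp (v.2.1, 0, v.2.2) b) q =
      -(I * ((inner ℝ v.2.1 q.2.2.1 : ℝ) : ℂ)) * trA b q +
        trA (fieldAmp (v.2.1, 0, v.2.2) b) q := by
    simp only [trA, derivAmp, sub_zero, inner_neg_right]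
    push_cast; ring
  rw [e3]
  simp only [derivAmp, fieldAmp_mul ha.contDiff hb.trA.contDiff, fieldAmp_trA hb.contDiff,
    sub_zero, inner_sub_left]
  rw [← e2, ← e1]
  push_cast; ring

/-! ## Composition with residual kernels -/

lemma bDeriv_slice_right (hF : SmoothOn F (KD n)) (w x z : E n) {h : ℝ} (h0 : 0 < h) (h1 : h < 1) :
    HasFDerivAt (fun z => F (x, z, h)) ((fderiv ℝ F (x, z, h)).comp ((ContinuousLinearMap.inr ℝ (E
    n) (E n × ℝ)).comp (inl ℝ (E n) ℝ))) z ∧ bDeriv (0, w, 0) F (x, z, h) = fderiv ℝ (fun z => F (x,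
    z, h)) z w := by
  have d1 := (diffAt_KD hF (mem_kernelDomain (x := x) (y := z) h0 h1)).hasFDerivAt
  have d2 : HasFDerivAt (fun z : E n => (x, z, h)) _ z := (hasFDerivAt_const x z).prodMk
      ((hasFDerivAt_id (𝕜 := ℝ) z).prodMk (hasFDerivAt_const h z))
  have := d1.comp (f := fun z => ((x, z, h) : KPt n)) z d2
  have e : fderiv ℝ (fun z => F (x, z, h)) z = _ := this.fderiv
  refine ⟨this, ?_⟩
  rw [e]
  simp [bDeriv]

lemma bDeriv_slice_left (hF : SmoothOn F (KD n)) (w z y : E n) {h : ℝ} (h0 : 0 < h) (h1 : h < 1) :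
    DifferentiableAt ℝ (fun z => F (z, y, h)) z ∧ bDeriv (w, 0, 0) F (z, y, h) = fderiv ℝ (fun z =>
    F (z, y, h)) z w := by
  have d1 := (diffAt_KD hF (mem_kernelDomain (x := z) (y := y) h0 h1)).hasFDerivAt
  have d2 : HasFDerivAt (fun z : E n => (z, y, h)) _ z := (hasFDerivAt_id (𝕜 := ℝ) z).prodMk
      ((hasFDerivAt_const y z).prodMk (hasFDerivAt_const h z))
  have := d1.comp (f := fun z => ((z, y, h) : KPt n)) z d2
  have e : fderiv ℝ (fun z => F (z, y, h)) z = _ := this.fderiv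
  refine ⟨this.differentiableAt, ?_⟩
  rw [e]
  simp [bDeriv]

lemma slice_right_contDiff (hF : SmoothOn F (KD n)) (x : E n) {h : ℝ}
    (h0 : 0 < h) (h1 : h < 1) : Smooth fun z => F (x, z, h) :=
  contDiffOn_univ.1 (hF.comp (f := fun z : E n => (x, z, h)) (by fun_prop)
    fun _ _ => mem_kernelDomain h0 h1)

lemma slice_left_contDiff (hF : SmoothOn F (KD n)) (y : E n) {h : ℝ}
    (h0 : 0 < h) (h1 : h < 1) : Smooth fun z => F (z, y, h) :=
  contDiffOn_univ.1 (hF.comp (f := fun z : E n => (z, y, h)) (by fun_prop)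
    fun _ _ => mem_kernelDomain h0 h1)

lemma compK_ibp (hg : Smooth g) (hgc : CSupp g) (hF : SmoothOn F (KD n)) (hG : SmoothOn G (KD n)) (w
    : E n) : ∀ q ∈ KD n, compK g (bDeriv (0, w, 0) F) G q = -(compK (fun z => fderiv ℝ g z w) F G q
    + compK g F (bDeriv (w, 0, 0) G) q) := by
  rintro ⟨x, y, h⟩ hq
  obtain ⟨-, -, h0, h1⟩ := hq
  have hq : (x, y, h) ∈ KD n := mem_kernelDomain h0 h1
  have sF := slice_right_contDiff hF x h0 h1
  have sG := slice_left_contDiff hG y h0 h1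
  have hg' : Smooth fun z => fderiv ℝ g z w :=
    (hg.fderiv_right (m := ∞) (by simp)).clm_apply contDiff_const
  have hgc' : CSupp fun z => fderiv ℝ g z w := hgc.fderiv_apply (𝕜 := ℝ) w
  have sk : Smooth fun z => g z * G (z, y, h) := hg.mul sG
  have hkc : CSupp fun z => g z * G (z, y, h) := hgc.mul_right
  have cF : Continuous fun z => fderiv ℝ (fun z => F (x, z, h)) z w :=
    (sF.continuous_fderiv (by simp)).clm_apply continuous_const
  have ck : Continuous fun z => fderiv ℝ (fun z => g z * G (z, y, h)) z w :=
    (sk.continuous_fderiv (by simp)).clm_apply continuous_const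
  have key := integral_mul_fderiv_eq_neg_fderiv_mul_of_integrable (𝕜 := ℂ) (μ := volume)
    (f := fun z => F (x, z, h)) (g := fun z => g z * G (z, y, h)) (v := w)
    ((cF.mul sk.continuous).integrable_of_hasCompactSupport hkc.mul_left)
    ((sF.continuous.mul ck).integrable_of_hasCompactSupport
      (hkc.fderiv_apply (𝕜 := ℝ) w).mul_left)
    ((sF.continuous.mul sk.continuous).integrable_of_hasCompactSupport hkc.mul_left)
    (fun z _ => sF.differentiable (by simp) z) (fun z _ => sk.differentiable (by simp) z)
  have e1 : ∀ z, fderiv ℝ (fun z => g z * G (z, y, h)) z w =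
      fderiv ℝ g z w * G (z, y, h) + g z * bDeriv (w, 0, 0) G (z, y, h) := by
    intro z
    rw [(bDeriv_slice_left hG w z y h0 h1).2]
    have := ((hg.differentiable (by simp) z).hasFDerivAt.mul
      (sG.differentiable (by simp) z).hasFDerivAt).fderiv
    have e : fderiv ℝ (fun z => g z * G (z, y, h)) z = _ := this
    rw [e]; simp; ring
  have e2 : ∀ z, fderiv ℝ (fun z => F (x, z, h)) z w = bDeriv (0, w, 0) F (x, z, h) :=
    fun z => ((bDeriv_slice_right hF w x z h0 h1).2).symm
  simp only [e1, e2] at key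
  simp only [compK]
  rw [← integral_add (compK_integrable hg' hgc' hF hG hq)
    (compK_integrable hg hgc hF (bDeriv_smooth _ hG) hq)]
  have e3 : ∀ z, bDeriv (0, w, 0) F (x, z, h) * g z * G (z, y, h) =
      bDeriv (0, w, 0) F (x, z, h) * (g z * G (z, y, h)) := fun z => by ring
  simp only [e3]
  rw [← neg_eq_iff_eq_neg, ← key]
  refine integral_congr_ae (Eventually.of_forall fun z => ?_)
  simp only; ring

lemma LBd.add (hF : LBd l F) (hG : LBd l G) : LBd l fun q => F q + G q :=
  fun x y => (hF x y).add (hG x y)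

lemma LBd.const_mul (hF : LBd l F) (z : ℂ) : LBd l fun q => z * F q :=
  fun x y => (hF x y).const_mul_left z

lemma LBd.sum {ι : Type*} (s : Finset ι) {F : ι → Krn n}
    (hF : ∀ i ∈ s, LBd l (F i)) : LBd l fun q => ∑ i ∈ s, F i q :=
  fun x y => by
    have := Asymptotics.IsBigO.sum fun i hi => hF i hi x y
    rwa [show (∑ i ∈ s, F i) = fun q => ∑ i ∈ s, F i q from by funext q; simp] at this

lemma compK_congr_left {F' : Krn n} (h : ∀ q ∈ KD n, F q = F' q) :
    ∀ q ∈ KD n, compK g F G q = compK g F' G q := by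
  intro q hq
  refine integral_congr_ae (Eventually.of_forall fun z => ?_)
  simp only
  rw [h (q.1, z, q.2.2) (mem_kernelDomain hq.2.2.1 hq.2.2.2)]

lemma compK_congr_right {G' : Krn n} (h : ∀ q ∈ KD n, G q = G' q) :
    ∀ q ∈ KD n, compK g F G q = compK g F G' q := by
  intro q hq
  refine integral_congr_ae (Eventually.of_forall fun z => ?_)
  simp only
  rw [h (z, q.2.1, q.2.2) (mem_kernelDomain hq.2.2.1 hq.2.2.2)]

lemma compK_add_left (hg : Smooth g) (hgc : CSupp g) {F' : Krn n} (hF : SmoothOn F (KD n)) (hF' :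
    SmoothOn F' (KD n)) (hG : SmoothOn G (KD n)) : ∀ q ∈ KD n, compK g (fun q => F q + F' q) G q =
    compK g F G q + compK g F' G q := by
  intro q hq
  simp only [compK, add_mul]
  exact integral_add (compK_integrable hg hgc hF hG hq) (compK_integrable hg hgc hF' hG hq)

lemma compK_const_mul_left (z : ℂ) (q : KPt n) :
    compK g (fun q => z * F q) G q = z * compK g F G q := by
  simp only [compK, mul_assoc]
  rw [integral_const_mul]

lemma compK_sum_left (hg : Smooth g) (hgc : CSupp g) {ι : Type*} (s : Finset ι) {F : ι → Krn n} (hF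
    : ∀ i, SmoothOn (F i) (KD n)) (hG : SmoothOn G (KD n)) : ∀ q ∈ KD n, compK g (fun q => ∑ i ∈ s,
    F i q) G q = ∑ i ∈ s, compK g (F i) G q := by
  intro q hq
  simp only [compK, Finset.sum_mul]
  exact integral_finsetSum _ fun i _ => compK_integrable hg hgc (hF i) hG hq

lemma sum_inner_bv_sq (η : E n) : ∑ j : Fin n, (inner ℝ (bv j) η : ℝ) ^ 2 = ‖η‖ ^ 2 := by
  rw [EuclideanSpace.norm_sq_eq]
  refine Finset.sum_congr rfl fun j _ => ?_
  simp [bv, EuclideanSpace.inner_single_left]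

lemma kerOf_split (ha : IsAmp m a) (hs : AmpSupp univ M a) : ∀ q ∈ KD n, kerOf a q = kerOf (fun q =>
    jpow (-2) q * a q) q + ∑ j : Fin n, kerOf (fun q => ((inner ℝ (bv j) q.2.2.1 : ℝ) : ℂ) *
    (((inner ℝ (bv j) q.2.2.1 : ℝ) : ℂ) * (jpow (-2) q * a q))) q := by
  intro q hq
  have h1 := (isAmp_jpow (n := n) (-2)).mul ha
  have i1 : AmpSupp univ M fun q => jpow (-2) q * a q := hs.mul_left _
  have h2 := fun j : Fin n => (isAmp_inner (bv j)).mul ((isAmp_inner (bv j)).mul h1)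
  have i2 := fun j : Fin n => (i1.mul_left fun q => ((inner ℝ (bv j) q.2.2.1 : ℝ) : ℂ)).mul_left
    fun q => ((inner ℝ (bv j) q.2.2.1 : ℝ) : ℂ)
  have e : a = fun q => jpow (-2) q * a q + ∑ j : Fin n, ((inner ℝ (bv j) q.2.2.1 : ℝ) : ℂ) *
        (((inner ℝ (bv j) q.2.2.1 : ℝ) : ℂ) * (jpow (-2) q * a q)) := by
    funext q
    have hj := jb_pos q.2.2.1
    have e1 : ∑ j : Fin n, ((inner ℝ (bv j) q.2.2.1 : ℝ) : ℂ) *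
        (((inner ℝ (bv j) q.2.2.1 : ℝ) : ℂ) * (jpow (-2) q * a q)) =
        ((‖q.2.2.1‖ ^ 2 : ℝ) : ℂ) * (jpow (-2) q * a q) := by
      rw [← sum_inner_bv_sq]
      push_cast
      rw [Finset.sum_mul]
      refine Finset.sum_congr rfl fun j _ => ?_
      ring
    have e2 : jpow (-2) q * ((‖q.2.2.1‖ ^ 2 + 1 : ℝ) : ℂ) = 1 := by
      rw [← jb_sq, jpow, ← ofReal_mul, show (-2 : ℝ) = -((2 : ℕ) : ℝ) by norm_num,
        rpow_neg hj.le, rpow_natCast, inv_mul_cancel₀ (by positivity)]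
      simp
    rw [e1]
    push_cast at e2 ⊢
    linear_combination (-(a q)) * e2
  conv_lhs => rw [e]
  rw [kerOf_add h1.contDiff i1 (ContDiff.sum fun j _ => (h2 j).contDiff)
    (AmpSupp.sum _ fun j _ => i2 j) q hq]
  congr 1
  simp only [kerOf, Finset.mul_sum]
  exact integral_finsetSum _ fun j _ =>
    kerOf_integrable (h2 j).contDiff (i2 j) q.1 q.2.1 hq.2.2.1 _

lemma LBd.compK_kerOf (N : ℕ) (hm : m - N < -n) (ha : IsAmp m a) (hy : YIndep a)
    (hs : AmpSupp univ M a) (hg : Smooth g) (hgc : CSupp g)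
    {R : Krn n} (hR : LRes l R) : LBd l (TwoMicro.compK g (TwoMicro.kerOf a) R) := by
  induction N generalizing m a g R with
  | zero =>
    have := LBd.compK hg hgc (LBd.kerOf (by simpa using hm) ha hs) (hR.bd 0)
    rwa [zero_add] at this
  | succ N ih =>
    push_cast at hm
    have h1 := (isAmp_jpow (n := n) (-2)).mul ha
    have i1 : AmpSupp univ M fun q => jpow (-2) q * a q := hs.mul_left _
    have y1 := (yIndep_jpow (n := n) (-2)).mul hy
    have h2 := fun j : Fin n => (isAmp_inner (bv j)).mul h1
    have i2 := fun j : Fin n => i1.mul_left fun q => ((inner ℝ (bv j) q.2.2.1 : ℝ) : ℂ)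
    have y2 := fun j : Fin n => (yIndep_inner (bv j)).mul y1
    have k2 := fun j : Fin n => kerOf_smooth (h2 j).contDiff (i2 j)
    have k1 := kerOf_smooth h1.contDiff i1
    have hterm : ∀ j : Fin n, LBd l fun q => -I *
        (TwoMicro.compK (fun z => fderiv ℝ g z (bv j)) (TwoMicro.kerOf fun q =>
          ((inner ℝ (bv j) q.2.2.1 : ℝ) : ℂ) * (jpow (-2) q * a q)) R q +
        TwoMicro.compK g (TwoMicro.kerOf fun q =>
          ((inner ℝ (bv j) q.2.2.1 : ℝ) : ℂ) * (jpow (-2) q * a q))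
            (bDeriv (bv j, 0, 0) R) q) := by
      intro j
      refine (LBd.add ?_ ?_).const_mul _
      · exact ih (by linarith) (h2 j) (y2 j) (i2 j)
          ((hg.fderiv_right (m := ∞) (by simp)).clm_apply contDiff_const)
          (hgc.fderiv_apply (𝕜 := ℝ) _) hR
      · exact ih (by linarith) (h2 j) (y2 j) (i2 j) hg hgc (hR.bDeriv _)
    refine ((ih (by linarith) h1 y1 i1 hg hgc hR).add (LBd.sum Finset.univ fun j _ => hterm j)).congr
      (EqSmall.of_domain fun q hq => ?_)
    have e0 : ∀ q ∈ KD n, TwoMicro.kerOf a q =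
        TwoMicro.kerOf (fun q => jpow (-2) q * a q) q + ∑ j : Fin n, I *
          bDeriv (0, bv j, 0) (TwoMicro.kerOf fun q => ((inner ℝ (bv j) q.2.2.1 : ℝ) : ℂ) *
            (jpow (-2) q * a q)) q := by
      intro q hq
      rw [kerOf_split ha hs q hq]
      congr 1
      exact Finset.sum_congr rfl fun j _ => kerOf_mulEta (y2 j) (h2 j).contDiff (i2 j) _ q hq
    have ks : ∀ j : Fin n, SmoothOn (fun q => I *
          bDeriv (0, bv j, 0) (TwoMicro.kerOf fun q => ((inner ℝ (bv j) q.2.2.1 : ℝ) : ℂ) *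
            (jpow (-2) q * a q)) q) (KD n) :=
      fun j => contDiffOn_const.mul (bDeriv_smooth _ (k2 j))
    rw [compK_congr_left e0 q hq, compK_add_left hg hgc k1 (ContDiffOn.sum fun j _ => ks j)
      hR.smooth q hq, compK_sum_left hg hgc _ ks hR.smooth q hq]
    congr 1
    refine Finset.sum_congr rfl fun j _ => ?_
    rw [compK_const_mul_left, compK_ibp hg hgc (k2 j) hR.smooth _ q hq]
    ring

/-- The composition of the kernel of a left symbol and a residual kernel is residual. -/
theorem LRes.kerOf_compK (ha : IsAmp m a) (hy : YIndep a)
    (hs : AmpSupp univ M a) (hg : Smooth g) (hgc : CSupp g)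
    {R : Krn n} (hR : LRes l R) : LRes l (TwoMicro.compK g (TwoMicro.kerOf a) R) := by
  refine ⟨compK_smooth hg hgc (kerOf_smooth ha.contDiff hs) hR.smooth, fun k => ?_⟩
  have bd : ∀ {m : ℝ} {a : Q n → ℂ} {R : Krn n}, IsAmp m a → YIndep a →
      AmpSupp univ M a → LRes l R → LBd l (TwoMicro.compK g (TwoMicro.kerOf a) R) := by
    intro m a R ha hy hs hR
    obtain ⟨N, hN⟩ := exists_nat_gt (m + n)
    exact LBd.compK_kerOf N (by linarith) ha hy hs hg hgc hR
  induction k generalizing m a R with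
  | zero => exact bd ha hy hs hR
  | succ k ih =>
    refine ⟨bd ha hy hs hR, fun v => ?_⟩
    have h1 := ih (ha.derivAmp (v.1, 0, v.2.2)) (hy.derivAmp ha.contDiff _)
      (hs.derivAmp isClosed_univ _) hR
    have h2 := ih ha hy hs (hR.bDeriv (0, v.2.1, v.2.2))
    refine (LBdK.add ?_ ?_ h1 h2).congr (EqSmall.of_domain fun q hq => ?_)
    · exact compK_smooth hg hgc (kerOf_smooth (ha.derivAmp _).contDiff
        (hs.derivAmp isClosed_univ _)) hR.smooth
    · exact compK_smooth hg hgc (kerOf_smooth ha.contDiff hs) (hR.bDeriv _).smooth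
    · rw [bDeriv_compK hg hgc (kerOf_smooth ha.contDiff hs) hR.smooth v q hq,
        compK_congr_left (bDeriv_kerOf ha.contDiff hs _) q hq]

/-! ## Composition of a left and a right symbol -/

/-- The error in the composition of the left symbol `a` and the transpose of `b`. -/
def compErr (g : E n → ℂ) (a b : Q n → ℂ) : Krn n := fun q =>
  (((2 * π) ^ n : ℝ) : ℂ) * kerOf (fun q => a q * trA b q) q -
    compK g (kerOf a) (swapK (kerOf b)) q

lemma compErr_smooth (hg : Smooth g) (hgc : CSupp g) (ha : IsAmp m a) (hs : AmpSupp univ M a) (hb :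
    IsAmp m' b) (hs' : AmpSupp univ M' b) : SmoothOn (compErr g a b) (KD n) :=
  (contDiffOn_const.mul (kerOf_smooth (ha.mul hb.trA).contDiff (hs.mul_right _))).sub
    (compK_smooth hg hgc (kerOf_smooth ha.contDiff hs)
      (swapK_smooth (kerOf_smooth hb.contDiff hs')))

lemma bDeriv_compErr (hg : Smooth g) (hgc : CSupp g) (ha : IsAmp m a) (hya : YIndep a) (hs : AmpSupp
    univ M a) (hb : IsAmp m' b) (hyb : YIndep b) (hs' : AmpSupp univ M' b) (v : KPt n) : ∀ q ∈ KD n,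
    bDeriv v (compErr g a b) q = compErr g (derivAmp (v.1, 0, v.2.2) a) b q + compErr g a (derivAmp
    (v.2.1, 0, v.2.2) b) q := by
  intro q hq
  have ka := kerOf_smooth ha.contDiff hs
  have kb := kerOf_smooth hb.contDiff hs'
  have kab := kerOf_smooth (ha.mul hb.trA).contDiff (hs.mul_right (trA b))
  have kc := compK_smooth hg hgc ka (swapK_smooth kb)
  have d1 := (diffAt_KD kab hq).hasFDerivAt
  have d2 := (diffAt_KD kc hq).hasFDerivAt
  have e : fderiv ℝ (compErr g a b) q = _ :=
    ((d1.const_mul (((2 * π) ^ n : ℝ) : ℂ)).sub d2).fderiv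
  have e1 : bDeriv v (compErr g a b) q = (((2 * π) ^ n : ℝ) : ℂ) *
      bDeriv v (kerOf fun q => a q * trA b q) q -
        bDeriv v (compK g (kerOf a) (swapK (kerOf b))) q := by
    simp only [bDeriv, e]
    simp
  have e3 : ∀ q ∈ KD n, bDeriv (0, v.2.1, v.2.2) (swapK (kerOf b)) q =
      swapK (kerOf (derivAmp (v.2.1, 0, v.2.2) b)) q := by
    intro q hq
    rw [bDeriv_swapK _ kb q hq]
    exact bDeriv_kerOf hb.contDiff hs' _ _ (mem_kernelDomain hq.2.2.1 hq.2.2.2)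
  rw [e1, bDeriv_kerOf (ha.mul hb.trA).contDiff (hs.mul_right _) v q hq,
    derivAmp_mul_trA ha hya hb hyb, bDeriv_compK hg hgc ka (swapK_smooth kb) v q hq,
    compK_congr_left (bDeriv_kerOf ha.contDiff hs _) q hq, compK_congr_right e3 q hq,
    kerOf_add ((ha.derivAmp _).mul hb.trA).contDiff ((hs.derivAmp isClosed_univ _).mul_right _)
      (ha.mul (hb.derivAmp _).trA).contDiff (hs.mul_right _) q hq]
  simp only [compErr]
  ring

lemma exists_compErr_bound {R : ℝ} (hg : Smooth g) (hgc : CSupp g) (hg1 : ∀ z, ‖z‖ ≤ R + 1 → g z =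
    1) (ha : IsAmp m a) (hya : YIndep a) (hS : IsCompact S) (hSR : S ⊆ Metric.closedBall 0 R) (hs :
    AmpSupp S M a) (hb : IsAmp m' b) (hyb : YIndep b) (hS' : IsCompact S') (hSR' : S' ⊆
    Metric.closedBall 0 R) (hs' : AmpSupp S' M' b) : ∃ C, ∀ q ∈ KD n, ‖compErr g a b q‖ ≤ C := by
  obtain ⟨K, hK1, hK2⟩ := exists_decay_order (n := n) m
  obtain ⟨K', hK1', -⟩ := exists_decay_order (n := n) m'
  obtain ⟨C, hC⟩ := exists_decay ha hya hS hs K hK1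
  obtain ⟨C', hC'⟩ := exists_decay hb hyb hS' hs' K' hK1'
  obtain ⟨B, hB⟩ := hgc.exists_bound_of_continuous hg.continuous
  let D := 2 ^ (K + 1) * (|(0 : ℝ)| + |C|)
  have hfar : ∀ x z : E n, ‖x‖ ≤ R → R + 1 < ‖z‖ → 1 < ‖x - z‖ := by
    intro x z hx hz
    have := norm_sub_norm_le z x
    rw [norm_sub_rev] at this
    linarith
  refine ⟨∫ z : E n, D * jb z ^ (-((K + 1 : ℕ) : ℝ)) * (1 + B) * |C'|, ?_⟩
  rintro ⟨x, y, h⟩ ⟨-, -, h0, h1⟩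
  have hq : ∀ x y : E n, (x, y, h) ∈ KD n := fun x y => mem_kernelDomain h0 h1
  let f : E n → ℂ := fun η => a (x, y, η, h)
  let k : E n → ℂ := fun η => b (y, x, η, h)
  have fc : Smooth f := slice_contDiff ha.contDiff x y h
  have kc : Smooth k := slice_contDiff hb.contDiff y x h
  have fs : CSupp f := hs.hasCompactSupport x y h0
  have ks : CSupp k := hs'.hasCompactSupport y x h0
  have ef : ∀ z, kerOf a (x, z, h) = oscInt f (x - z) := by
    intro z; rw [kerOf_eq_oscInt]; congr 1; funext η; exact hya _ _ _ _ _
  have ek : ∀ z, kerOf b (y, z, h) = oscInt k (y - z) := by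
    intro z; rw [kerOf_eq_oscInt]; congr 1; funext η; exact hyb _ _ _ _ _
  have hP := integral_oscInt_mul fc fs kc ks x y
  have hfi : Integrable fun z => oscInt f (x - z) := (integrable_oscInt fc fs).comp_sub_left x
  have hkb : ∀ z, ‖oscInt k z‖ ≤ ∫ η, ‖k η‖ := by
    intro z
    refine norm_integral_le_of_norm_le (kc.continuous.integrable_of_hasCompactSupport ks).norm
      (Eventually.of_forall fun η => ?_)
    rw [norm_mul, norm_osc, one_mul]
  have hI : Integrable fun z => oscInt f (x - z) * oscInt k (y - z) := by
    refine hfi.mul_bdd (c := ∫ η, ‖k η‖) ?_ (Eventually.of_forall fun z => hkb _)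
    exact ((continuous_oscInt kc ks).comp (continuous_const.sub continuous_id)).aestronglyMeasurable
  have ka := kerOf_smooth ha.contDiff hs
  have kb := swapK_smooth (kerOf_smooth hb.contDiff hs')
  have hI2 := compK_integrable (F := kerOf a) (G := swapK (kerOf b)) hg hgc ka kb (hq x y)
  have e : compErr g a b (x, y, h) =
      ∫ z, kerOf a (x, z, h) * (1 - g z) * kerOf b (y, z, h) := by
    have e1 : kerOf (fun q => a q * trA b q) (x, y, h) =
        oscInt (fun η => f η * k (-η)) (x - y) := rfl
    rw [compErr, e1, ← hP, compK, ← integral_sub hI hI2]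
    refine integral_congr_ae (Eventually.of_forall fun z => ?_)
    simp only [swapK, ef, ek]
    ring
  rw [e]
  have hint : Integrable fun z : E n => D * jb (x - z) ^ (-((K + 1 : ℕ) : ℝ)) * (1 + B) * |C'| :=
    ((((integrable_jb_rpow hK2).comp_sub_left x).const_mul D).mul_const _).mul_const _
  refine (norm_integral_le_of_norm_le hint (Eventually.of_forall fun z => ?_)).trans
    (le_of_eq (integral_sub_left_eq_self (fun z : E n =>
      D * jb z ^ (-((K + 1 : ℕ) : ℝ)) * (1 + B) * |C'|) volume x))
  have hB0 : 0 ≤ B := (norm_nonneg _).trans (hB 0)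
  have hD0 : 0 ≤ D * jb (x - z) ^ (-((K + 1 : ℕ) : ℝ)) :=
    mul_nonneg (by positivity) (rpow_nonneg (jb_pos _).le _)
  have hz0 : kerOf a (x, z, h) * (1 - g z) * kerOf b (y, z, h) = 0 ∨
      (‖x‖ ≤ R ∧ ‖y‖ ≤ R ∧ R + 1 < ‖z‖) := by
    by_cases hx : x ∈ S
    · by_cases hy : y ∈ S'
      · rcases le_or_gt ‖z‖ (R + 1) with hz | hz
        · left; rw [hg1 z hz]; ring
        · right; exact ⟨by simpa using hSR hx, by simpa using hSR' hy, hz⟩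
      · left
        have : kerOf b (y, z, h) = 0 := by
          simp only [kerOf]
          rw [integral_eq_zero_of_ae (Eventually.of_forall fun η => ?_)]
          simp only [Pi.zero_apply]
          rw [not_imp_comm.1 (hs' (y, z, η, h)) (fun h => hy h.1), mul_zero]
        rw [this, mul_zero]
    · left
      have : kerOf a (x, z, h) = 0 := by
        simp only [kerOf]
        rw [integral_eq_zero_of_ae (Eventually.of_forall fun η => ?_)]
        simp only [Pi.zero_apply]
        rw [not_imp_comm.1 (hs (x, z, η, h)) (fun h => hx h.1), mul_zero]
      rw [this, zero_mul, zero_mul]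
  rcases hz0 with hz0 | ⟨hx, hy, hz⟩
  · rw [hz0, norm_zero]
    positivity
  · rw [norm_mul, norm_mul]
    refine mul_le_mul (mul_le_mul ?_ ?_ (norm_nonneg _) hD0) ?_ (norm_nonneg _)
      (mul_nonneg hD0 (by positivity))
    · have h2 := hC _ (hq x z)
      simp only at h2
      exact le_jb_rpow_of_decay (C₁ := 0) (norm_nonneg _) (K + 1)
        (fun h => absurd h (not_le.2 (hfar x z hx hz))) h2
    · exact (norm_sub_le _ _).trans (by simpa using hB z)
    · have h3 : 1 ≤ ‖y - z‖ ^ (K' + 1) := one_le_pow₀ (hfar y z hy hz).le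
      have h4 := hC' _ (hq y z)
      simp only at h4
      exact ((le_mul_of_one_le_left (norm_nonneg _) h3).trans h4).trans (le_abs_self _)

/-- The composition of a left and a right symbol, modulo residual kernels. -/
theorem LRes.compErr {R : ℝ} (hg : Smooth g) (hgc : CSupp g) (hg1 : ∀ z, ‖z‖ ≤ R + 1 → g z = 1) (ha
    : IsAmp m a) (hya : YIndep a) (hS : IsCompact S) (hSR : S ⊆ Metric.closedBall 0 R) (hs : AmpSupp
    S M a) (hb : IsAmp m' b) (hyb : YIndep b) (hS' : IsCompact S') (hSR' : S' ⊆ Metric.closedBall 0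
    R) (hs' : AmpSupp S' M' b) : LRes 0 (TwoMicro.compErr g a b) := by
  have hsu := fun {a : Q n → ℂ} (hs : AmpSupp S M a) => hs.mono (subset_univ S) le_rfl
  have hsu' := fun {a : Q n → ℂ} (hs : AmpSupp S' M' a) => hs.mono (subset_univ S') le_rfl
  refine ⟨compErr_smooth hg hgc ha (hsu hs) hb (hsu' hs'), fun k => ?_⟩
  induction k generalizing m m' a b with
  | zero =>
    obtain ⟨C, hC⟩ := exists_compErr_bound hg hgc hg1 ha hya hS hSR hs hb hyb hS' hSR' hs'
    refine LBd.of_forall_bound fun R => ⟨C, 1, one_pos, fun x y _ _ h hh => ?_⟩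
    simpa using hC _ (mem_kernelDomain (x := x) (y := y) hh.1 hh.2)
  | succ k ih =>
    refine ⟨(ih ha hya hs hb hyb hs').lBd, fun v => ?_⟩
    have h1 := ih (ha.derivAmp (v.1, 0, v.2.2)) (hya.derivAmp ha.contDiff _)
      (hs.derivAmp hS.isClosed _) hb hyb hs'
    have h2 := ih ha hya hs (hb.derivAmp (v.2.1, 0, v.2.2)) (hyb.derivAmp hb.contDiff _)
      (hs'.derivAmp hS'.isClosed _)
    refine (LBdK.add ?_ ?_ h1 h2).congr (EqSmall.of_domain fun q hq =>
      (bDeriv_compErr hg hgc ha hya (hsu hs) hb hyb (hsu' hs') v q hq).symm)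
    · exact compErr_smooth hg hgc (ha.derivAmp _) (hsu (hs.derivAmp hS.isClosed _)) hb (hsu' hs')
    · exact compErr_smooth hg hgc ha (hsu hs) (hb.derivAmp _) (hsu' (hs'.derivAmp hS'.isClosed _))

/-! ## Limits of amplitudes -/

/-- `h^r c(x, x, ξ/h, h) → f(x, ξ)` as `h → 0`, for `ξ ≠ 0`. -/
def HasLim (r : ℝ) (c : Q n → ℂ) (f : E n × E n → ℂ) : Prop :=
  ∀ x ξ : E n, ξ ≠ 0 → Tendsto (fun h : ℝ => ((h ^ r : ℝ) : ℂ) * c (x, x, h⁻¹ • ξ, h)) (𝓝[>] 0)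
    (𝓝 (f (x, ξ)))

lemma HasLim.congr_lim (h : HasLim r c f) (hf : ∀ x ξ, ξ ≠ 0 → f (x, ξ) = f' (x, ξ)) :
    HasLim r c f' := fun x ξ hξ => hf x ξ hξ ▸ h x ξ hξ

lemma HasLim.unique (h : HasLim r c f) (h' : HasLim r c f') (x ξ : E n) (hξ : ξ ≠ 0) :
    f (x, ξ) = f' (x, ξ) := tendsto_nhds_unique (h x ξ hξ) (h' x ξ hξ)

lemma HasLim.add (h : HasLim r c f) (h' : HasLim r d f') :
    HasLim r (fun q => c q + d q) fun p => f p + f' p := fun x ξ hξ => by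
  simpa only [mul_add] using (h x ξ hξ).add (h' x ξ hξ)

lemma HasLim.sub (h : HasLim r c f) (h' : HasLim r d f') :
    HasLim r (fun q => c q - d q) fun p => f p - f' p := fun x ξ hξ => by
  simpa only [mul_sub] using (h x ξ hξ).sub (h' x ξ hξ)

lemma HasLim.const_mul (h : HasLim r c f) (z : ℂ) :
    HasLim r (fun q => z * c q) fun p => z * f p := fun x ξ hξ => by
  simpa only [mul_left_comm] using (h x ξ hξ).const_mul z

lemma HasLim.sum {ι : Type*} (s : Finset ι) {c : ι → Q n → ℂ} {f : ι → E n × E n → ℂ}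
    (h : ∀ i, HasLim r (c i) (f i)) :
    HasLim r (fun q => ∑ i ∈ s, c i q) fun p => ∑ i ∈ s, f i p := fun x ξ hξ => by
  simpa only [Finset.mul_sum] using tendsto_finsetSum s fun i _ => h i x ξ hξ

lemma HasLim.mul (h : HasLim r c f) (h' : HasLim r' d f') :
    HasLim (r + r') (fun q => c q * d q) fun p => f p * f' p := fun x ξ hξ => by
  refine ((h x ξ hξ).mul (h' x ξ hξ)).congr' ?_
  filter_upwards [self_mem_nhdsWithin] with t ht
  rw [rpow_add ht]; push_cast; ring

lemma HasLim.congr (h : HasLim r c f) (hd : ∀ x η h, 0 < h → d (x, x, η, h) = c (x, x, η, h)) :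
    HasLim r d f := fun x ξ hξ => (h x ξ hξ).congr' <| by
  filter_upwards [self_mem_nhdsWithin] with t ht
  rw [hd _ _ _ ht]

lemma polarRadius_pos' {ξ : E n} (hξ : ξ ≠ 0) (h : ℝ) : 0 < polarRadius ξ h := by
  have := norm_pos_iff.2 hξ
  exact sqrt_pos.2 (by positivity)

lemma polarRadius_zero (ξ : E n) : polarRadius ξ 0 = ‖ξ‖ := by
  simp [polarRadius]

lemma polarRadius_eq (ξ : E n) {h : ℝ} (hh : 0 < h) : polarRadius ξ h = h * jb (h⁻¹ • ξ) := by
  rw [← polarRadius_smul _ hh, smul_smul, mul_inv_cancel₀ hh.ne', one_smul]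

/-- The amplitude `⟨η⟩^r b(x, y, η/⟨η⟩, 1/⟨η⟩, h⟨η⟩)` in rescaled variables `ξ = hη`. -/
def rescaled (r : ℝ) (b : E n × E n × E n × ℝ × ℝ → ℂ) (p : KPt n) : ℂ :=
  ((polarRadius p.2.1 p.2.2 ^ r : ℝ) : ℂ) * b (p.1, p.1, (polarRadius p.2.1 p.2.2)⁻¹ • p.2.1,
    p.2.2 * (polarRadius p.2.1 p.2.2)⁻¹, polarRadius p.2.1 p.2.2)

lemma rescaled_eq {b : E n × E n × E n × ℝ × ℝ → ℂ} (hc : ∀ q, c q = jpow r q * b (ampPt q))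
    (x ξ : E n) {h : ℝ} (hh : 0 < h) :
    ((h ^ r : ℝ) : ℂ) * c (x, x, h⁻¹ • ξ, h) = rescaled r b (x, ξ, h) := by
  have hj := jb_pos (h⁻¹ • ξ)
  have e1 : (jb (h⁻¹ • ξ))⁻¹ • h⁻¹ • ξ = (polarRadius ξ h)⁻¹ • ξ := by
    rw [smul_smul, polarRadius_eq ξ hh, mul_inv, mul_comm]
  have e2 : (jb (h⁻¹ • ξ))⁻¹ = h * (polarRadius ξ h)⁻¹ := by
    rw [polarRadius_eq ξ hh]; field_simp
  rw [hc, rescaled]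
  simp only [jpow, ampPt, e1]
  rw [← mul_assoc, ← ofReal_mul, ← mul_rpow hh.le hj.le, ← polarRadius_eq ξ hh, e2]

lemma rescaled_contDiffAt {b : E n × E n × E n × ℝ × ℝ → ℂ} (hb : Smooth b)
    (x : E n) {ξ : E n} (hξ : ξ ≠ 0) (h : ℝ) : ContDiffAt ℝ ∞ (rescaled r b) (x, ξ, h) := by
  have hp := polarRadius_pos' hξ h
  have h1 : ContDiffAt ℝ ∞ (fun p : KPt n => polarRadius p.2.1 p.2.2) (x, ξ, h) := by
    refine ContDiffAt.sqrt ?_ ?_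
    · exact ((contDiff_snd.fst.norm_sq ℝ).add (contDiff_snd.snd.pow 2)).contDiffAt
    · have := norm_pos_iff.2 hξ; simp only; positivity
  have h2 : ContDiffAt ℝ ∞ (fun p : KPt n => (polarRadius p.2.1 p.2.2)⁻¹) (x, ξ, h) :=
    h1.inv hp.ne'
  have h3 : ContDiffAt ℝ ∞ (fun p : KPt n => polarRadius p.2.1 p.2.2 ^ r) (x, ξ, h) :=
    h1.rpow_const_of_ne hp.ne'
  refine (ofRealCLM.contDiff.contDiffAt.comp _ h3).mul (hb.contDiffAt.comp _ ?_)
  exact contDiffAt_fst.prodMk (contDiffAt_fst.prodMk ((h2.smul contDiffAt_snd.fst).prodMk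
    ((contDiffAt_snd.snd.mul h2).prodMk h1)))

lemma hasLim_of_eq {b : E n × E n × E n × ℝ × ℝ → ℂ} (hb : Smooth b)
    (hc : ∀ q, c q = jpow r q * b (ampPt q)) :
    HasLim r c fun p => ((‖p.2‖ ^ r : ℝ) : ℂ) * b (p.1, p.1, ‖p.2‖⁻¹ • p.2, 0, ‖p.2‖) := by
  intro x ξ hξ
  have h1 : ContinuousAt (fun h : ℝ => rescaled r b (x, ξ, h)) 0 :=
    (rescaled_contDiffAt hb x hξ 0).continuousAt.comp (f := fun h : ℝ => (x, ξ, h))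
      (by fun_prop)
  have h2 := h1.tendsto.mono_left (nhdsWithin_le_nhds (s := Ioi 0))
  simp only [rescaled, polarRadius_zero, zero_mul] at h2
  refine h2.congr' ?_
  filter_upwards [self_mem_nhdsWithin] with h hh
  exact (rescaled_eq hc x ξ hh).symm

lemma IsAmp.exists_lim (hc : IsAmp r c) : ∃ f, HasLim r c f := by
  obtain ⟨b, hb, h⟩ := hc
  exact ⟨_, hasLim_of_eq hb h⟩

lemma IsAmp.hasLim_zero (hc : IsAmp (r - 1) c) : HasLim r c fun _ => 0 := by
  obtain ⟨f, hf⟩ := hc.exists_lim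
  intro x ξ hξ
  have h1 : Tendsto (fun h : ℝ => (h : ℂ)) (𝓝[>] 0) (𝓝 0) := by
    have := Complex.continuous_ofReal.tendsto 0
    rw [Complex.ofReal_zero] at this
    exact this.mono_left nhdsWithin_le_nhds
  have := h1.mul (hf x ξ hξ)
  rw [zero_mul] at this
  refine this.congr' ?_
  filter_upwards [self_mem_nhdsWithin] with h hh
  have : h ^ r = h * h ^ (r - 1) := by 
    rw [Real.rpow_sub_one (ne_of_gt hh), mul_div_cancel₀ _ (ne_of_gt hh)]
  rw [this]; push_cast; ring

lemma HasLim.of_sub (hd : HasLim r d f) (h : IsAmp (r - 1) fun q => c q - d q) : HasLim r c f := by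
  have := h.hasLim_zero.add hd
  simpa using this

lemma fderiv_rescaled {b : E n × E n × E n × ℝ × ℝ → ℂ} (hb : Smooth b) (hc : ∀ q, c q = jpow r q *
    b (ampPt q)) (hcd : Smooth c) (x : E n) {ξ : E n} (hξ : ξ ≠ 0) {h : ℝ} (hh : 0 < h) (u w : E n)
    : fderiv ℝ (rescaled r b) (x, ξ, h) (u, w, 0) = ((h ^ r : ℝ) : ℂ) * fderiv ℝ c (x, x, h⁻¹ • ξ,
    h) (u, u, h⁻¹ • w, 0) := by
  have hl : ∀ u w : E n, HasDerivAt (fun s : ℝ => u + s • w) w 0 := fun u w => by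
    simpa using ((hasDerivAt_id (0 : ℝ)).smul_const w).const_add u
  have d1 : HasFDerivAt (rescaled r b) (fderiv ℝ (rescaled r b) (x, ξ, h))
      (x + (0 : ℝ) • u, ξ + (0 : ℝ) • w, h) := by
    simpa using ((rescaled_contDiffAt hb x hξ h).differentiableAt (by simp)).hasFDerivAt
  have d2 : HasFDerivAt c (fderiv ℝ c (x, x, h⁻¹ • ξ, h))
      (x + (0 : ℝ) • u, x + (0 : ℝ) • u, h⁻¹ • ξ + (0 : ℝ) • h⁻¹ • w, h) := by
    simpa using (hcd.differentiable (by simp) (x, x, h⁻¹ • ξ, h)).hasFDerivAt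
  have e1 := d1.comp_hasDerivAt (f := fun s : ℝ => (x + s • u, ξ + s • w, h)) 0
    ((hl x u).prodMk ((hl ξ w).prodMk (hasDerivAt_const 0 h)))
  have e2 := (d2.comp_hasDerivAt (f := fun s : ℝ =>
    ((x + s • u, x + s • u, h⁻¹ • ξ + s • h⁻¹ • w, h) : Q n)) 0
    ((hl x u).prodMk ((hl x u).prodMk ((hl (h⁻¹ • ξ) (h⁻¹ • w)).prodMk
      (hasDerivAt_const 0 h))))).const_mul ((h ^ r : ℝ) : ℂ)
  refine e1.unique ?_
  have e3 : (rescaled r b ∘ fun s : ℝ => (x + s • u, ξ + s • w, h)) = fun s : ℝ =>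
      ((h ^ r : ℝ) : ℂ) * (c ∘ fun s : ℝ =>
        ((x + s • u, x + s • u, h⁻¹ • ξ + s • h⁻¹ • w, h) : Q n)) s := by
    funext s
    simp only [Function.comp]
    rw [← rescaled_eq hc _ _ hh, smul_add, smul_comm h⁻¹ s w]
  rw [e3]
  exact e2

lemma HasLim.tendsto_fderiv (hf : HasLim r c f) (hc : IsAmp r c) (x ξ : E n) (hξ : ξ ≠ 0) (u w : E
    n) : Tendsto (fun h : ℝ => ((h ^ r : ℝ) : ℂ) * fderiv ℝ c (x, x, h⁻¹ • ξ, h) (u, u, h⁻¹ • w, 0))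
    (𝓝[>] 0) (𝓝 (fderiv ℝ f (x, ξ) (u, w))) := by
  have hcd := hc.contDiff
  obtain ⟨b, hb, hc⟩ := hc
  have e : f =ᶠ[𝓝 (x, ξ)] fun p => rescaled r b (p.1, p.2, 0) := by
    have : ∀ᶠ p : E n × E n in 𝓝 (x, ξ), p.2 ≠ 0 := continuousAt_snd.eventually_ne hξ
    filter_upwards [this] with p hp
    have := hf.unique (hasLim_of_eq hb hc) p.1 p.2 hp
    simpa [rescaled, polarRadius_zero] using this
  have hR := rescaled_contDiffAt (r := r) hb x hξ 0
  have h1 : fderiv ℝ f (x, ξ) (u, w) = fderiv ℝ (rescaled r b) (x, ξ, 0) (u, w, 0) := by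
    rw [e.fderiv_eq]
    have d1 : HasFDerivAt (rescaled r b) (fderiv ℝ (rescaled r b) (x, ξ, 0)) (x, ξ, 0) :=
      (hR.differentiableAt (by simp)).hasFDerivAt
    have := d1.comp (f := fun p : E n × E n => (p.1, p.2, (0 : ℝ))) (x, ξ)
      (hasFDerivAt_fst.prodMk (hasFDerivAt_snd.prodMk (hasFDerivAt_const (0 : ℝ) (x, ξ))))
    have e : fderiv ℝ (fun p : E n × E n => rescaled r b (p.1, p.2, 0)) (x, ξ) = _ := this.fderiv
    rw [e]
    rfl
  rw [h1]
  have h2 : ContinuousAt (fun h : ℝ => fderiv ℝ (rescaled r b) (x, ξ, h) (u, w, 0)) 0 := by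
    have h3 : ContinuousAt (fderiv ℝ (rescaled r b)) (x, ξ, 0) :=
      (hR.fderiv_right (m := 0) (by simp)).continuousAt
    have h4 : ContinuousAt (fun h : ℝ => fderiv ℝ (rescaled r b) (x, ξ, h)) 0 :=
      ContinuousAt.comp (f := fun h : ℝ => (x, ξ, h)) h3 (by fun_prop)
    exact h4.clm_apply continuousAt_const
  refine (h2.tendsto.mono_left (nhdsWithin_le_nhds (s := Ioi 0))).congr' ?_
  filter_upwards [self_mem_nhdsWithin] with h hh
  exact fderiv_rescaled hb hc hcd x hξ hh u w

lemma HasLim.dEta (hf : HasLim r c f) (hc : IsAmp r c) (w : E n) :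
    HasLim (r - 1) (dEta w c) fun p => fderiv ℝ f p (0, w) := by
  intro x ξ hξ
  refine (hf.tendsto_fderiv hc x ξ hξ 0 w).congr' ?_
  filter_upwards [self_mem_nhdsWithin] with h hh
  have : ((0, 0, h⁻¹ • w, 0) : Q n) = h⁻¹ • (0, 0, w, 0) := by simp
  rw [this, map_smul, real_smul, ← mul_assoc, ← ofReal_mul,
    Real.rpow_sub_one (ne_of_gt hh), div_eq_mul_inv]
  rfl

/-- Differentiation along the diagonal. -/
def dX (w : E n) (c : Q n → ℂ) : Q n → ℂ := fieldAmp (w, w, 0) c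

lemma HasLim.dX (hf : HasLim r c f) (hc : IsAmp r c) (w : E n) :
    HasLim r (dX w c) fun p => fderiv ℝ f p (w, 0) := by
  intro x ξ hξ
  refine (hf.tendsto_fderiv hc x ξ hξ w 0).congr' ?_
  filter_upwards [self_mem_nhdsWithin] with h hh
  simp [TwoMicro.dX, fieldAmp]

/-! ## Kernels with a principal symbol -/

/-- `F` is, up to a residual kernel, the kernel of order `(r + l, l)` of an amplitude with
principal symbol `f`. -/
def HasSym (r l : ℝ) (F : Krn n) (f : E n × E n → ℂ) : Prop :=
  ∃ (c : Q n → ℂ) (S : Set (E n)) (M : ℝ), IsCompact S ∧ IsAmp r c ∧ AmpSupp S M c ∧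
    LRes l (fun q => F q - qK l c q) ∧ HasLim r c f

lemma qK_add (hc : Smooth c) (hs : AmpSupp S M c) (hd : Smooth d) (hs' : AmpSupp S' M' d) : ∀ q ∈ KD
    n, qK l (fun q => c q + d q) q = qK l c q + qK l d q := by
  intro q hq
  simp only [qK]
  rw [kerOf_add hc hs hd hs' q hq]; ring

lemma qK_sub (hc : Smooth c) (hs : AmpSupp S M c) (hd : Smooth d) (hs' : AmpSupp S' M' d) : ∀ q ∈ KD
    n, qK l (fun q => c q - d q) q = qK l c q - qK l d q := by
  intro q hq
  simp only [qK]
  rw [kerOf_sub hc hs hd hs' q hq]; ring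

lemma LRes.of_qK (h : LRes l (qK l c)) : LRes 0 (kerOf c) := by
  have h1 := (h.hPow_mul l).const_mul ((((2 * π) ^ n : ℝ)) : ℂ)
  rw [sub_self] at h1
  refine h1.congr fun q hq => ?_
  have e1 : TwoMicro.hPow n l q * TwoMicro.hPow n (-l) q = 1 := by
    simp only [TwoMicro.hPow]
    rw [← ofReal_mul, ← rpow_add hq.2.2.1]; simp
  have e2 : ((((2 * π) ^ n : ℝ)) : ℂ) * ((((2 * π) ^ n)⁻¹ : ℝ) : ℂ) = 1 := by
    rw [← ofReal_mul, mul_inv_cancel₀ (by positivity)]; simp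
  simp only [qK]
  linear_combination (-(TwoMicro.kerOf c q)) * e1 -
    TwoMicro.hPow n l q * TwoMicro.hPow n (-l) q * TwoMicro.kerOf c q * e2

lemma AmpSupp.union_left (h : AmpSupp S M c) (S' : Set (E n)) (M' : ℝ) :
    AmpSupp (S ∪ S') (max M M') c := h.mono subset_union_left (le_max_left _ _)

lemma AmpSupp.union_right (h : AmpSupp S M c) (S' : Set (E n)) (M' : ℝ) :
    AmpSupp (S' ∪ S) (max M' M) c := h.mono subset_union_right (le_max_right _ _)

lemma AmpSupp.sub (hc : AmpSupp S M c) (hd : AmpSupp S M d) : AmpSupp S M fun q => c q - d q := by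
  have := hc.add (hd.mul_left fun _ => -1)
  simpa [sub_eq_add_neg] using this

lemma HasSym.of_lRes (r : ℝ) (h : LRes l F) : HasSym r l F fun _ => 0 :=
  ⟨fun _ => 0, ∅, 0, isCompact_empty, IsAmp.zero r, fun _ h => absurd rfl h,
    h.congr fun q _ => by simp [qK, kerOf], fun x ξ _ => by simp⟩

lemma HasSym.add_lRes (h : HasSym r l F f) (hR : LRes l (fun q => G q - F q)) : HasSym r l G f := by
  obtain ⟨c, S, M, hS, hc, hs, hr, hl⟩ := h
  exact ⟨c, S, M, hS, hc, hs, (hr.add hR).congr fun q _ => by ring, hl⟩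

lemma HasSym.congr (h : HasSym r l F f) (hR : ∀ q ∈ KD n, G q = F q) : HasSym r l G f :=
  h.add_lRes ((LRes.zero l).congr fun q hq => by rw [hR q hq, sub_self])

lemma HasSym.smooth (h : HasSym r l F f) : SmoothOn F (KD n) := by
  obtain ⟨c, S, M, hS, hc, hs, hr, hl⟩ := h
  exact (hr.smooth.add (qK_smooth l hc.contDiff hs)).congr fun q _ => by ring

lemma HasSym.add (h : HasSym r l F f) (h' : HasSym r l G f') :
    HasSym r l (fun q => F q + G q) fun p => f p + f' p := by
  obtain ⟨c, S, M, hS, hc, hs, hr, hl⟩ := h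
  obtain ⟨c', S', M', hS', hc', hs', hr', hl'⟩ := h'
  refine ⟨_, S ∪ S', max M M', hS.union hS', hc.add hc',
    (hs.union_left S' M').add (hs'.union_right S M), (hr.add hr').congr fun q hq => ?_, hl.add hl'⟩
  rw [qK_add hc.contDiff hs hc'.contDiff hs' q hq]; ring

lemma HasSym.const_mul (h : HasSym r l F f) (z : ℂ) :
    HasSym r l (fun q => z * F q) fun p => z * f p := by
  obtain ⟨c, S, M, hS, hc, hs, hr, hl⟩ := h
  refine ⟨_, S, M, hS, hc.const_mul z, hs.mul_left _, (hr.const_mul z).congr fun q hq => ?_,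
    hl.const_mul z⟩
  simp only [qK, kerOf_const_mul]; ring

lemma HasSym.mul_contDiff (h : HasSym r l F f) {θ : E n × E n → ℂ} (hθ : Smooth θ) :
    HasSym r l (fun q => θ (q.1, q.2.1) * F q) fun p => θ (p.1, p.1) * f p := by
  obtain ⟨c, S, M, hS, hc, hs, hr, hl⟩ := h
  have hθ' : Smooth fun q : KPt n => θ (q.1, q.2.1) := hθ.comp (by fun_prop)
  refine ⟨_, S, M, hS, hc.mul_contDiff hθ', hs.mul_left _,
    (hr.mul_contDiff hθ').congr fun q hq => ?_, fun x ξ hξ => ?_⟩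
  · simp only [qK, kerOf_mul (fun q => θ (q.1, q.2.1)) c]; ring
  · simpa only [mul_left_comm] using (hl x ξ hξ).const_mul (θ (x, x))

lemma HasSym.raise (h : HasSym (r - 1) l F f) : HasSym r l F fun _ => 0 := by
  obtain ⟨c, S, M, hS, hc, hs, hr, hl⟩ := h
  exact ⟨c, S, M, hS, (hc.add_nat 1).congr_order (by push_cast; ring), hs, hr, hc.hasLim_zero⟩

lemma IsAmp.raise (hc : IsAmp (r - 1) c) : IsAmp r c :=
  (hc.add_nat 1).congr_order (by push_cast; ring)

lemma HasLim.diagY (h : HasLim r c f) : HasLim r (diagY c) f := fun x ξ hξ => h x ξ hξ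

/-- The amplitude can be chosen to be a left symbol. -/
lemma HasSym.exists_left (h : HasSym r l F f) : ∃ (a : Q n → ℂ) (S : Set (E n)) (M : ℝ), IsCompact S
    ∧ IsAmp r a ∧ YIndep a ∧ AmpSupp S M a ∧ LRes l (fun q => F q - qK l a q) ∧ HasLim r a f := by
  obtain ⟨c, S, M, hS, hc, hs, hr, hl⟩ := h
  obtain ⟨a, ha, hy, ⟨S', M', hS', hs'⟩, hR, h1, -⟩ := exists_left_symbol hc hS hs
  refine ⟨a, S', M', hS', ha, hy, hs', (hr.add (hR.qK_mul l)).congr fun q hq => ?_,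
    hl.diagY.of_sub h1⟩
  simp only [qK]; ring

lemma HasSym.eq_zero_of_lRes (h : HasSym r l F f) (hF : LRes l F) (x ξ : E n) (hξ : ξ ≠ 0) :
    f (x, ξ) = 0 := by
  obtain ⟨a, S, M, hS, ha, hy, hs, hr, hl⟩ := h.exists_left
  have h1 : LRes l (qK l a) := (hF.sub hr).congr fun q _ => by ring
  exact tendsto_nhds_unique (hl x ξ hξ) (h1.of_qK.left_symbol_tendsto ha hy hS hs r x ξ hξ)

lemma HasSym.unique (h : HasSym r l F f) (h' : HasSym r l F f') (x ξ : E n) (hξ : ξ ≠ 0) :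
    f (x, ξ) = f' (x, ξ) := by
  have h1 := (h.add (h'.const_mul (-1))).congr (G := fun _ => 0) fun q _ => by ring
  have := h1.eq_zero_of_lRes (LRes.zero l) x ξ hξ
  linear_combination this

lemma HasSym.exists_form (h : HasSym r l F f) : ∃ b : Krn n, Smooth b ∧ CSupp b ∧ ∀ x ξ : E n, ξ ≠ 0
    → f (x, ξ) = ((‖ξ‖ ^ r : ℝ) : ℂ) * b (x, ‖ξ‖⁻¹ • ξ, ‖ξ‖) := by
  obtain ⟨c, S, M, hS, hc, hs, hr, hl⟩ := h
  have hc' := hc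
  obtain ⟨b, hb, hcb⟩ := hc'
  obtain ⟨R, hR⟩ := hS.isBounded.exists_norm_le
  obtain ⟨γ, hγ, hγc, hγ1, -⟩ := exists_contDiff_cutoff (Z := KPt n)
    (max (max R 1) M)
  refine ⟨fun z => γ z * b (z.1, z.1, z.2.1, 0, z.2.2), hγ.mul (hb.comp (by fun_prop)),
    hγc.mul_right, fun x ξ hξ => ?_⟩
  have hn := norm_pos_iff.2 hξ
  rw [hl.unique (hasLim_of_eq hb hcb) x ξ hξ]
  have key : x ∈ S ∧ ‖ξ‖ ≤ M ∨ b (x, x, ‖ξ‖⁻¹ • ξ, 0, ‖ξ‖) = 0 := by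
    by_contra hne
    obtain ⟨h1, h2⟩ := not_or.1 hne
    apply h2
    have h3 : f (x, ξ) = 0 := by
      refine tendsto_nhds_unique (hl x ξ hξ) (Tendsto.congr' ?_ tendsto_const_nhds)
      filter_upwards [self_mem_nhdsWithin] with h hh
      have : c (x, x, h⁻¹ • ξ, h) = 0 := by
        by_contra hne
        obtain ⟨h4, h5⟩ := hs _ hne
        refine h1 ⟨h4, le_trans ?_ h5⟩
        simp only
        rw [abs_of_pos hh, ← polarRadius_eq ξ hh]
        exact norm_le_polarRadius ξ h
      rw [this, mul_zero]
    rw [hl.unique (hasLim_of_eq hb hcb) x ξ hξ] at h3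
    simp only [mul_eq_zero] at h3
    rcases h3 with h3 | h3
    · exact absurd h3 (ofReal_ne_zero.2 (Real.rpow_pos_of_pos hn r).ne')
    · exact h3
  rcases key with ⟨h1, h2⟩ | h1
  · beta_reduce
    rw [hγ1, one_mul]
    simp only [Prod.norm_def, max_le_iff]
    refine ⟨(hR _ h1).trans ((le_max_left _ _).trans (le_max_left _ _)), ?_, ?_⟩
    · rw [norm_smul, norm_inv, norm_norm, inv_mul_cancel₀ hn.ne']
      exact (le_max_right R 1).trans (le_max_left _ M)
    · rw [norm_norm]; exact h2.trans (le_max_right _ _)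
  · simp only [h1, mul_zero]

lemma exists_hasSym (r l : ℝ) {b : Krn n} (hb : Smooth b) (hbc : CSupp b) : ∃ F : Krn n, HasSym r l
    F fun p => ((‖p.2‖ ^ r : ℝ) : ℂ) * b (p.1, ‖p.2‖⁻¹ • p.2, ‖p.2‖) := by
  obtain ⟨R, hR⟩ := hbc.isCompact.isBounded.exists_norm_le
  let B : E n × E n × E n × ℝ × ℝ → ℂ := fun z => b (z.1, z.2.2.1, z.2.2.2.2)
  have hB : Smooth B := hb.comp (by fun_prop)
  refine ⟨qK l fun q => jpow r q * B (ampPt q), _, Metric.closedBall 0 R, R,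
    isCompact_closedBall _ _, ⟨B, hB, fun q => rfl⟩, fun q hq => ?_,
    (LRes.zero l).congr fun q _ => sub_self _, hasLim_of_eq hB fun q => rfl⟩
  have h1 := hR _ (subset_tsupport _ (right_ne_zero_of_mul hq))
  simp only [ampPt, Prod.norm_def, max_le_iff] at h1
  refine ⟨by simpa using h1.1, ?_⟩
  have h2 := h1.2.2
  rwa [norm_mul, norm_eq_abs, norm_of_nonneg (jb_pos _).le] at h2

/-! ## Relation with total symbols -/

lemma HasSym.of_totalSymbol {a : Krn n} (ha : IsTotalSymbol m l a) (hR : LRes l fun q => F q -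
    leftKernel a q) : ∃ f, HasSym (m - l) l F f ∧ ∀ x ξ : E n, ξ ≠ 0 → Tendsto (fun h : ℝ => ((h ^ m
    : ℝ) : ℂ) * a (x, ξ, h)) (𝓝[>] 0) (𝓝 (f (x, ξ))) := by
  obtain ⟨c, S, M, hc, hS, hs, hk, hlim⟩ := ha.exists_amp
  obtain ⟨f, hf⟩ := hc.exists_lim
  refine ⟨f, ⟨c, S, M, hS, hc, hs, hR.congr fun q hq => by rw [hk q hq], hf⟩, fun x ξ hξ => ?_⟩
  refine (hf x ξ hξ).congr' ?_
  filter_upwards [Ioo_mem_nhdsGT one_pos] with h hh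
  exact (hlim x ξ h hh.1 hh.2).symm

lemma HasSym.exists_totalSymbol (h : HasSym (m - l) l F f) :
    ∃ a : Krn n, IsTotalSymbol m l a ∧ LRes l fun q => F q - leftKernel a q := by
  obtain ⟨c, S, M, hS, hc, hy, hs, hr, hl⟩ := h.exists_left
  obtain ⟨a, ha, hR, -⟩ := TwoMicro.exists_totalSymbol hc hy hS hs
  exact ⟨a, ha, (hr.sub hR).congr fun q _ => by ring⟩

/-! ## Right symbols -/

lemma exists_localized (hc : IsAmp r c) (hs : AmpSupp univ M c) (hy : ∀ q, c q ≠ 0 → q.2.1 ∈ S) : ∃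
    d : Q n → ℂ, IsAmp r d ∧ AmpSupp (Metric.cthickening 2 S) M d ∧ LRes 0 (fun q => kerOf c q -
    kerOf d q) ∧ ∀ q, ‖q.1 - q.2.1‖ < 1 → d q = c q := by
  refine ⟨fun q => diagCut n (q.1, q.2.1, q.2.2.2) * c q, hc.mul_contDiff contDiff_diagCut,
    fun q hq => ⟨?_, (hs q (right_ne_zero_of_mul hq)).2⟩, ?_, fun q hq => ?_⟩
  · refine Metric.mem_cthickening_of_dist_le q.1 q.2.1 2 S (hy q (right_ne_zero_of_mul hq)) ?_
    rw [dist_eq_norm]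
    by_contra hlt
    refine left_ne_zero_of_mul hq ?_
    have : diagCutoff q.1 q.2.1 = 0 := by
      refine Real.smoothTransition.zero_of_nonpos ?_
      nlinarith [not_le.1 hlt]
    simp [diagCut, this]
  · have h1 : LRes 0 (kerOf fun q => (1 - diagCut n (q.1, q.2.1, q.2.2.2)) * c q) :=
      LRes.kerOf_of_zeroNearDiag one_pos
        (hc.mul_contDiff (θ := fun q => 1 - diagCut n q) (contDiff_const.sub contDiff_diagCut))
        (hs.mul_left _) diagCut_zeroNear
    refine h1.congr fun q _ => ?_
    rw [kerOf_mul (fun q => 1 - diagCut n q) c, kerOf_mul (diagCut n) c]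
    ring
  · have := diagCut_zeroNear (c := c) q hq
    linear_combination -this

/-- Reversal of the sign of the covariable. -/
def negA (c : Q n → ℂ) : Q n → ℂ := fun q => c (q.1, q.2.1, -q.2.2.1, q.2.2.2)

lemma IsAmp.negA (hc : IsAmp r c) : IsAmp r (negA c) := by
  obtain ⟨b, hb, h⟩ := hc
  refine ⟨fun z => b (z.1, z.2.1, -z.2.2.1, z.2.2.2), hb.comp (by fun_prop), fun q => ?_⟩
  simp only [TwoMicro.negA, h, jpow, ampPt, jb_neg, smul_neg]

lemma fderiv_negA (hc : Smooth c) (q : Q n) (v1 v2 v3 : E n) (t : ℝ) : fderiv ℝ (negA c) q (v1, v2,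
    v3, t) = fderiv ℝ c (q.1, q.2.1, -q.2.2.1, q.2.2.2) (v1, v2, -v3, t) := by
  have d1 : HasFDerivAt c (fderiv ℝ c (q.1, q.2.1, -q.2.2.1, q.2.2.2))
      (q.1, q.2.1, -q.2.2.1, q.2.2.2) := (hc.differentiable (by simp) _).hasFDerivAt
  let s := snd ℝ (E n) (KPt n)
  let ss := (snd ℝ (E n) (E n × ℝ)).comp s
  let L : Q n →L[ℝ] Q n := (fst ℝ (E n) (KPt n)).prod
    (((fst ℝ (E n) (E n × ℝ)).comp s).prod
      ((-(fst ℝ (E n) ℝ).comp ss).prod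
        ((snd ℝ (E n) ℝ).comp ss)))
  have e : fderiv ℝ (negA c) q = _ := (d1.comp (f := L) q L.hasFDerivAt).fderiv
  rw [e]
  simp [L, ss, s]

lemma fderiv_trA (hc : Smooth c) (q : Q n) (v1 v2 v3 : E n) (t : ℝ) : fderiv ℝ (trA c) q (v1, v2,
    v3, t) = fderiv ℝ c (q.2.1, q.1, -q.2.2.1, q.2.2.2) (v2, v1, -v3, t) := by
  have d1 : HasFDerivAt c (fderiv ℝ c (q.2.1, q.1, -q.2.2.1, q.2.2.2))
      (q.2.1, q.1, -q.2.2.1, q.2.2.2) := (hc.differentiable (by simp) _).hasFDerivAt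
  let s := snd ℝ (E n) (KPt n)
  let ss := (snd ℝ (E n) (E n × ℝ)).comp s
  let L : Q n →L[ℝ] Q n := ((fst ℝ (E n) (E n × ℝ)).comp s).prod
    ((fst ℝ (E n) (KPt n)).prod
      ((-(fst ℝ (E n) ℝ).comp ss).prod
        ((snd ℝ (E n) ℝ).comp ss)))
  have e : fderiv ℝ (trA c) q = _ := (d1.comp (f := L) q L.hasFDerivAt).fderiv
  rw [e]
  simp [L, ss, s]

lemma dEta_negA (hc : Smooth c) (w : E n) (q : Q n) : dEta w (negA c) q = -negA (dEta w c) q := by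
  rw [dEta, fderiv_negA hc, show ((0, 0, -w, 0) : Q n) = -(0, 0, w, 0) by simp, map_neg]
  rfl

lemma dX_negA (hc : Smooth c) (w : E n) : dX w (negA c) = negA (dX w c) := by
  funext q
  rw [dX, fieldAmp, fderiv_negA hc, neg_zero]
  rfl

lemma dEta_trA (hc : Smooth c) (w : E n) (q : Q n) : dEta w (trA c) q = -trA (dEta w c) q := by
  rw [dEta, fderiv_trA hc, show ((0, 0, -w, 0) : Q n) = -(0, 0, w, 0) by simp, map_neg]
  rfl

lemma dY_trA (hc : Smooth c) (hy : YIndep c) (w : E n) : dY w (trA c) = trA (dX w c) := by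
  funext q
  rw [dY, fderiv_trA hc, neg_zero, hy.fderiv_eq hc _ _ q.1 _ _ _ _ w]
  simp [trA, dX, fieldAmp]

lemma IsAmp.dX (hc : IsAmp r c) (w : E n) : IsAmp r (dX w c) := hc.fieldAmp _

lemma YIndep.dX (hy : YIndep c) (hc : Smooth c) (w : E n) : YIndep (dX w c) :=
  hy.fieldAmp hc _

lemma fderiv_congr_nearDiag (h : ∀ q : Q n, ‖q.1 - q.2.1‖ < 1 → d q = c q) (q : Q n)
    (hq : ‖q.1 - q.2.1‖ < 1) : fderiv ℝ d q = fderiv ℝ c q := by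
  have ho : IsOpen {q : Q n | ‖q.1 - q.2.1‖ < 1} := isOpen_lt (by fun_prop) continuous_const
  refine Filter.EventuallyEq.fderiv_eq ?_
  filter_upwards [ho.mem_nhds hq] with p hp using h p hp

lemma subAmp_congr_nearDiag (h : ∀ q : Q n, ‖q.1 - q.2.1‖ < 1 → d q = c q) :
    subAmp d = subAmp c := by
  funext q
  refine Finset.sum_congr rfl fun j _ => ?_
  congr 1
  simp only [diagY]
  rw [dEta, dEta, fderiv_congr_nearDiag (d := dY (bv j) d) (c := dY (bv j) c)
    (fun p hp => by rw [dY, dY, fderiv_congr_nearDiag h p hp]) _ (by simp)]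

/-- Every left symbol has the same kernel as a right symbol, modulo residual terms. -/
lemma exists_right_symbol (ha : IsAmp r a) (hy : YIndep a) (hS : IsCompact S) (hs : AmpSupp S M a) :
    ∃ (b : Q n → ℂ) (S' : Set (E n)) (M' : ℝ), IsAmp r b ∧ YIndep b ∧ IsCompact S' ∧ AmpSupp S' M' b
    ∧ LRes 0 (fun q => kerOf a q - swapK (kerOf b) q) ∧ IsAmp (r - 1) (fun q => negA b q - a q) ∧
    IsAmp (r - 2) (fun q => negA b q - (a q + ∑ j, I * dEta (bv j) (dX (bv j) a) q)) := by
  have hsu := (hs.mono (subset_univ S) le_rfl).trA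
  obtain ⟨d, hd, hds, hdR, hdn⟩ := exists_localized (S := S) ha.trA hsu fun q hq => (hs _ hq).1
  obtain ⟨b, hb, hyb, ⟨S', M', hS', hs'⟩, hR, h1, h2⟩ := exists_left_symbol hd hS.cthickening hds
  have e1 : negA (diagY d) = a := by
    funext q
    simp only [negA, diagY]
    rw [hdn _ (by simp)]
    simp only [trA, neg_neg]
    exact hy _ _ _ _ _
  have e2 : negA (subAmp d) = fun q => ∑ j, I * dEta (bv j) (dX (bv j) a) q := by
    rw [subAmp_congr_nearDiag hdn]
    funext q
    simp only [negA, subAmp]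
    refine Finset.sum_congr rfl fun j _ => ?_
    rw [dY_trA ha.contDiff hy]
    simp only [diagY]
    rw [dEta_trA (ha.dX _).contDiff]
    simp only [trA, neg_neg]
    rw [((hy.dX ha.contDiff (bv j)).dEta (ha.dX (bv j)).contDiff (bv j)) q.1 q.1 q.2.1 q.2.2.1 q.2.2.2]
    ring
  refine ⟨b, S', M', hb, hyb, hS', hs', ?_, ?_, ?_⟩
  · refine ((hdR.add hR).swapK).congr fun q _ => ?_
    simp only [kerOf_trA, swapK]
    ring
  · have := h1.negA
    have e3 : (fun q => negA b q - a q) = negA fun q => b q - diagY d q := by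
      rw [← e1]; rfl
    rwa [e3]
  · have := h2.negA
    have e3 : (fun q => negA b q - (a q + ∑ j, I * dEta (bv j) (dX (bv j) a) q)) =
        negA fun q => b q - (diagY d q + subAmp d q) := by
      funext q
      have e2' := congrFun e2 q
      have e1' := congrFun e1 q
      beta_reduce at e2'
      rw [← e2', ← e1']; rfl
    rwa [e3]

/-! ## Adjoints -/

lemma HasSym.star (h : HasSym r l F f) :
    HasSym r l (conjK (swapK F)) fun p => (starRingEnd ℂ) (f p) := by
  obtain ⟨a, S, M, hS, ha, hy, hs, hR, hl⟩ := h.exists_left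
  let c : Q n → ℂ := fun q => (starRingEnd ℂ) (a (q.2.1, q.1, q.2.2.1, q.2.2.2))
  have hc : IsAmp r c := by
    obtain ⟨b, hb, h⟩ := ha
    refine ⟨fun z => (starRingEnd ℂ) (b (z.2.1, z.1, z.2.2)),
      conjCLE.contDiff.comp (hb.comp (by fun_prop)), fun q => ?_⟩
    simp only [c, h, map_mul, jpow, ampPt, conj_ofReal]
  have hne : ∀ q, c q ≠ 0 → a (q.2.1, q.1, q.2.2.1, q.2.2.2) ≠ 0 := fun q hq h0 => hq (by simp [c, h0])
  have hcs : AmpSupp univ M c := fun q hq => ⟨mem_univ _, (hs _ (hne q hq)).2⟩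
  obtain ⟨d, hd, hds, hdR, hdn⟩ := exists_localized (S := S) hc hcs fun q hq => (hs _ (hne q hq)).1
  have hk : ∀ q, kerOf c q = conjK (swapK (kerOf a)) q := by
    intro q
    simp only [kerOf, conjK, swapK, c]
    rw [← integral_conj]
    refine integral_congr_ae (Eventually.of_forall fun η => ?_)
    simp only [map_mul]
    congr 1
    rw [osc, osc, ← Complex.exp_conj, map_mul, Complex.conj_I, conj_ofReal,
      ← neg_sub q.1 q.2.1, inner_neg_left]
    congr 1
    push_cast; ring
  refine ⟨d, _, M, hS.cthickening, hd, hds, ((hR.swapK.conjK).add (hdR.qK_mul l)).congr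
    fun q _ => ?_, fun x ξ hξ => ?_⟩
  · simp only [hk, qK, conjK, swapK, map_sub, map_mul, conj_ofReal, hPow]
    ring
  · have h1 := (Complex.continuous_conj.tendsto _).comp (hl x ξ hξ)
    refine h1.congr fun t => ?_
    simp only [Function.comp, map_mul, conj_ofReal]
    rw [hdn _ (by simp)]

/-! ## Composition -/

lemma qK_eq (l : ℝ) (c : Q n → ℂ) (x y : E n) (h : ℝ) : qK l c (x, y, h) =
    (((((2 * π) ^ n)⁻¹ : ℝ) : ℂ) * ((h ^ (-l) : ℝ) : ℂ)) * kerOf c (x, y, h) := by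
  simp only [qK, hPow]; ring

lemma compK_qK_left (g : E n → ℂ) (l : ℝ) (a : Q n → ℂ) (G : Krn n) (q : KPt n) : compK g (qK l a) G
    q = ((((2 * π) ^ n)⁻¹ : ℝ) : ℂ) * (hPow n (-l) q * compK g (kerOf a) G q) := by
  simp only [compK, qK_eq, mul_assoc]
  rw [integral_const_mul, integral_const_mul]
  rfl

lemma compK_qK_right (g : E n → ℂ) (l : ℝ) (a : Q n → ℂ) (F : Krn n) (q : KPt n) : compK g F (swapK
    (qK l a)) q = ((((2 * π) ^ n)⁻¹ : ℝ) : ℂ) * (hPow n (-l) q * compK g F (swapK (kerOf a)) q) :=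
    by
  simp only [compK, swapK, qK_eq]
  rw [← mul_assoc, ← integral_const_mul]
  refine integral_congr_ae (Eventually.of_forall fun z => ?_)
  simp only [hPow]; ring

lemma compK_add_right (hg : Smooth g) (hgc : CSupp g) {G' : Krn n} (hF : SmoothOn F (KD n)) (hG :
    SmoothOn G (KD n)) (hG' : SmoothOn G' (KD n)) : ∀ q ∈ KD n, compK g F (fun q => G q + G' q) q =
    compK g F G q + compK g F G' q := by
  intro q hq
  simp only [compK, mul_add]
  exact integral_add (compK_integrable hg hgc hF hG hq) (compK_integrable hg hgc hF hG' hq)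

lemma LRes.qK_compK (ha : IsAmp r a) (hy : YIndep a) (hs : AmpSupp univ M a) (hg : Smooth g) (hgc :
    CSupp g) {R : Krn n} (hR : LRes l' R) : LRes (l + l') (TwoMicro.compK g (qK l a) R) := by
  have h1 := ((LRes.kerOf_compK ha hy hs hg hgc hR).hPow_mul (-l)).const_mul
    ((((2 * π) ^ n)⁻¹ : ℝ) : ℂ)
  rw [sub_neg_eq_add, add_comm] at h1
  exact h1.congr fun q _ => compK_qK_left g l a R q

lemma compK_eq_sum_left {F' : Krn n} (hg : Smooth g) (hgc : CSupp g) (hF : SmoothOn F (KD n)) (hF' :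
    SmoothOn F' (KD n)) (hG : SmoothOn G (KD n)) : ∀ q ∈ KD n, compK g F G q = compK g F' G q +
    compK g (fun q => F q - F' q) G q := by
  intro q hq
  rw [← compK_add_left hg hgc hF' (hF.sub hF') hG q hq]
  simp

lemma compK_eq_sum_right {G' : Krn n} (hg : Smooth g) (hgc : CSupp g) (hF : SmoothOn F (KD n)) (hG :
    SmoothOn G (KD n)) (hG' : SmoothOn G' (KD n)) : ∀ q ∈ KD n, compK g F G q = compK g F G' q +
    compK g F (fun q => G q - G' q) q := by
  intro q hq
  rw [← compK_add_right hg hgc hF hG' (hG.sub hG') q hq]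
  simp

/-- The composition of a left and a right symbol. -/
theorem lRes_comp_symbols {R : ℝ} (hg : Smooth g) (hgc : CSupp g)
    (hg1 : ∀ z, ‖z‖ ≤ R + 1 → g z = 1) (ha : IsAmp r a) (hya : YIndep a) (hS : IsCompact S)
    (hSR : S ⊆ Metric.closedBall 0 R) (hs : AmpSupp S M a) (hb : IsAmp r' b) (hyb : YIndep b)
    (hS' : IsCompact S') (hSR' : S' ⊆ Metric.closedBall 0 R) (hs' : AmpSupp S' M' b)
    (hF : LRes l fun q => F q - qK l a q) (hG : LRes l' fun q => G q - swapK (qK l' b) q) :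
    LRes (l + l') fun q => compK g F G q - qK (l + l') (fun q => a q * trA b q) q := by
  have hsu := hs.mono (subset_univ S) le_rfl
  have hsu' := hs'.mono (subset_univ S') le_rfl
  have kF' := qK_smooth l ha.contDiff hs
  have kG' := swapK_smooth (qK_smooth l' hb.contDiff hs')
  have kF : SmoothOn F (KD n) := (hF.smooth.add kF').congr fun q _ => by ring
  have kG : SmoothOn G (KD n) := (hG.smooth.add kG').congr fun q _ => by ring
  have h1 := LRes.qK_compK (l := l) ha hya hsu hg hgc hG
  have h2 : LRes (l + l') (compK g (fun q => F q - qK l a q) (swapK (qK l' b))) := by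
    have := (LRes.qK_compK (l := l') hb hyb hsu' hg hgc hF.swapK).swapK
    rw [compK_swap, add_comm] at this
    exact this
  have h3 := LRes.compK hg hgc hF hG
  have h4 : LRes (l + l') fun q => ((((2 * π) ^ n)⁻¹ : ℝ) : ℂ) *
      (hPow n (-l) q * (((((2 * π) ^ n)⁻¹ : ℝ) : ℂ) *
        (hPow n (-l') q * compErr g a b q))) := by
    have := ((((LRes.compErr hg hgc hg1 ha hya hS hSR hs hb hyb hS' hSR' hs').qK_mul l').hPow_mul
      (-l))).const_mul ((((2 * π) ^ n)⁻¹ : ℝ) : ℂ)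
    rwa [sub_neg_eq_add, add_comm] at this
  refine (((h1.add h2).add h3).sub h4).congr fun q hq => ?_
  have e0 := compK_eq_sum_left hg hgc kF kF' kG q hq
  have e1 := compK_eq_sum_right hg hgc kF' kG kG' q hq
  have e2 := compK_eq_sum_right hg hgc hF.smooth kG kG' q hq
  have e3 : compK g (qK l a) (swapK (qK l' b)) q = ((((2 * π) ^ n)⁻¹ : ℝ) : ℂ) *
      (hPow n (-l) q * (((((2 * π) ^ n)⁻¹ : ℝ) : ℂ) *
        (hPow n (-l') q * compK g (kerOf a) (swapK (kerOf b)) q))) := by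
    rw [compK_qK_left, compK_qK_right]
  have e4 : hPow n (-(l + l')) q = hPow n (-l) q * hPow n (-l') q := by
    simp only [hPow]
    rw [← ofReal_mul, ← rpow_add hq.2.2.1]
    congr 2; ring
  have e5 : ((((2 * π) ^ n : ℝ)) : ℂ) * ((((2 * π) ^ n)⁻¹ : ℝ) : ℂ) = 1 := by
    rw [← ofReal_mul, mul_inv_cancel₀ (by positivity)]; simp
  have e6 : qK (l + l') (fun q => a q * trA b q) q = ((((2 * π) ^ n)⁻¹ : ℝ) : ℂ) *
      (hPow n (-l) q * hPow n (-l') q * kerOf (fun q => a q * trA b q) q) := by rw [qK, e4]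
  rw [e0, e1, e2, e3, e6]
  simp only [compErr]
  linear_combination (((((2 * π) ^ n)⁻¹ : ℝ) : ℂ) * hPow n (-l) q *
    hPow n (-l') q * kerOf (fun q => a q * trA b q) q) * e5

lemma HasLim.trA (h : HasLim r (negA c) f) : HasLim r (trA c) f :=
  h.congr fun _ _ _ _ => rfl

/-- The data of a left and a right symbol for a kernel. -/
lemma HasSym.exists_left_right (h : HasSym r l F f) : ∃ (a a' : Q n → ℂ) (S S' : Set (E n)) (M M' :
    ℝ), IsCompact S ∧ IsCompact S' ∧ IsAmp r a ∧ IsAmp r a' ∧ YIndep a ∧ YIndep a' ∧ AmpSupp S M a ∧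
    AmpSupp S' M' a' ∧ LRes l (fun q => F q - qK l a q) ∧ LRes l (fun q => F q - swapK (qK l a') q)
    ∧ HasLim r a f ∧ IsAmp (r - 1) (fun q => negA a' q - a q) ∧ IsAmp (r - 2) (fun q => negA a' q -
    (a q + ∑ j, I * dEta (bv j) (dX (bv j) a) q)) := by
  obtain ⟨a, S, M, hS, ha, hy, hs, hR, hl⟩ := h.exists_left
  obtain ⟨b, S', M', hb, hyb, hS', hs', hR', h1, h2⟩ := exists_right_symbol ha hy hS hs
  refine ⟨a, b, S, S', M, M', hS, hS', ha, hb, hy, hyb, hs, hs', hR,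
    (hR.add (hR'.qK_mul l)).congr fun q _ => ?_, hl, h1, h2⟩
  simp only [qK, swapK, hPow]; ring

theorem HasSym.comp (hF : HasSym r l F f) (hG : HasSym r' l' G f') : ∃ R₀ : ℝ, ∀ g : E n → ℂ, Smooth
    g → CSupp g → (∀ z, ‖z‖ ≤ R₀ → g z = 1) → HasSym (r + r') (l + l') (compK g F G) fun p => f p *
    f' p := by
  obtain ⟨a, -, S, -, M, -, hS, -, ha, -, hya, -, hs, -, hFR, -, hl, -, -⟩ := hF.exists_left_right
  obtain ⟨b, b', -, S', -, M', -, hS', hb, hb', hyb, hyb', -, hs', -, hGR, hl', h1, -⟩ :=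
    hG.exists_left_right
  obtain ⟨R, hR⟩ := (hS.union hS').isBounded.subset_closedBall 0
  refine ⟨R + 1, fun g hg hgc hg1 => ⟨_, S, M, hS, ha.mul hb'.trA, hs.mul_right _,
    lRes_comp_symbols hg hgc hg1 ha hya hS (subset_union_left.trans hR) hs hb' hyb' hS'
      (subset_union_right.trans hR) hs' hFR hGR, hl.mul ((hl'.of_sub h1).trA)⟩⟩

/-! ## Commutators -/

lemma dEta_mul (ha : Smooth a) (hc : Smooth c) (w : E n) (q : Q n) :
    dEta w (fun q => a q * c q) q = dEta w a q * c q + a q * dEta w c q := by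
  have h := ((ha.differentiable (by simp) q).hasFDerivAt.mul
    (hc.differentiable (by simp) q).hasFDerivAt).fderiv
  have h' : fderiv ℝ (fun q => a q * c q) q = _ := h
  simp only [dEta, h']
  simp; ring

lemma dY_mul (ha : Smooth a) (hc : Smooth c) (w : E n) (q : Q n) :
    dY w (fun q => a q * c q) q = dY w a q * c q + a q * dY w c q := by
  have h := ((ha.differentiable (by simp) q).hasFDerivAt.mul
    (hc.differentiable (by simp) q).hasFDerivAt).fderiv
  have h' : fderiv ℝ (fun q => a q * c q) q = _ := h
  simp only [dY, h']
  simp; ring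

lemma YIndep.dY_eq (hy : YIndep a) (ha : Smooth a) (w : E n) (q : Q n) : dY w a q = 0 := by
  have := hy.fderiv_eq ha q.1 q.2.1 q.2.1 q.2.2.1 q.2.2.2 0 w 0 0 0
  rw [dY, this]
  exact map_zero _

lemma fderiv_amp_sub (ha : Smooth a) (hc : Smooth c) (q v : Q n) :
    fderiv ℝ (fun q => a q - c q) q v = fderiv ℝ a q v - fderiv ℝ c q v := by
  rw [fderiv_fun_sub (ha.differentiable (by simp) q) (hc.differentiable (by simp) q)]
  rfl

lemma fderiv_amp_add (ha : Smooth a) (hc : Smooth c) (q v : Q n) :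
    fderiv ℝ (fun q => a q + c q) q v = fderiv ℝ a q v + fderiv ℝ c q v := by
  rw [fderiv_fun_add (ha.differentiable (by simp) q) (hc.differentiable (by simp) q)]
  rfl

lemma dEta_dY_mul_trA (ha : IsAmp r a) (hya : YIndep a) (hb : IsAmp r' b) (hyb : YIndep b) (w x y η
    : E n) (h : ℝ) : dEta w (dY w fun q => a q * trA b q) (x, x, η, h) = dEta w a (x, y, η, h) * dX
    w (negA b) (x, y, η, h) + a (x, y, η, h) * dEta w (dX w (negA b)) (x, y, η, h) := by
  have e1 : dY w (fun q => a q * trA b q) = fun q => a q * trA (dX w b) q := by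
    funext q
    rw [dY_mul ha.contDiff hb.trA.contDiff, hya.dY_eq ha.contDiff, dY_trA hb.contDiff hyb]
    ring
  rw [e1, dEta_mul ha.contDiff (hb.dX w).trA.contDiff, dEta_trA (hb.dX w).contDiff,
    dX_negA hb.contDiff, dEta_negA (hb.dX w).contDiff, hya x x y,
    (hya.dEta ha.contDiff w) x x y]
  simp only [trA, negA]
  rw [(hyb.dX hb.contDiff w) x x y,
    ((hyb.dX hb.contDiff w).dEta (hb.dX w).contDiff w) x x y]

/-- The principal part of the commutator of two left symbols. -/
def bracketAmp (a b : Q n → ℂ) : Q n → ℂ := fun q =>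
  ∑ j, -I * (dEta (bv j) a q * dX (bv j) b q - dX (bv j) a q * dEta (bv j) b q)

lemma IsAmp.bracketAmp (ha : IsAmp r a) (hb : IsAmp r' b) : IsAmp (r + r' - 1) (bracketAmp a b) :=
  IsAmp.sum _ fun j _ => ((((ha.dEta _).mul (hb.dX _)).congr_order (by ring)).sub
    (((ha.dX _).mul (hb.dEta _)).congr_order (by ring))).const_mul _

lemma HasLim.bracketAmp (ha : IsAmp r a) (hb : IsAmp r' b) (hf : HasLim r a f) (hf' : HasLim r' b
    f') : HasLim (r + r' - 1) (bracketAmp a b) fun p => -I * poisson f f' p := by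
  have h1 : ∀ j, HasLim (r + r' - 1) (fun q => -I * (TwoMicro.dEta (bv j) a q *
      TwoMicro.dX (bv j) b q - TwoMicro.dX (bv j) a q * TwoMicro.dEta (bv j) b q)) fun p =>
      -I * (fderiv ℝ f p (0, bv j) * fderiv ℝ f' p (bv j, 0) -
        fderiv ℝ f p (bv j, 0) * fderiv ℝ f' p (0, bv j)) := by
    intro j
    refine HasLim.const_mul (HasLim.sub ?_ ?_) _
    · have := (hf.dEta ha (bv j)).mul (hf'.dX hb (bv j))
      rwa [show r - 1 + r' = r + r' - 1 by ring] at this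
    · have := (hf.dX ha (bv j)).mul (hf'.dEta hb (bv j))
      rwa [show r + (r' - 1) = r + r' - 1 by ring] at this
  refine (HasLim.sum Finset.univ h1).congr_lim fun x ξ _ => ?_
  simp only [poisson, Finset.mul_sum]

lemma commutator_amp (ha : IsAmp r a) (hya : YIndep a) (hb : IsAmp r' b) (hyb : YIndep b) {a' b' : Q
    n → ℂ} (ha' : IsAmp r a') (hya' : YIndep a') (hb' : IsAmp r' b') (hyb' : YIndep b') (h1 : IsAmp
    (r - 1) (fun q => negA a' q - a q)) (h2 : IsAmp (r - 2) (fun q => negA a' q - (a q + ∑ j, I *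
    dEta (bv j) (dX (bv j) a) q))) (k1 : IsAmp (r' - 1) (fun q => negA b' q - b q)) (k2 : IsAmp (r'
    - 2) (fun q => negA b' q - (b q + ∑ j, I * dEta (bv j) (dX (bv j) b) q))) : IsAmp (r + r' - 2)
    fun q => diagY (fun q => a q * trA b' q - b q * trA a' q) q + subAmp (fun q => a q * trA b' q -
    b q * trA a' q) q - bracketAmp a b q := by
  set α : Q n → ℂ := fun q => negA a' q - a q with hα
  set β : Q n → ℂ := fun q => negA b' q - b q with hβ
  have ea : negA a' = fun q => a q + α q := by funext q; simp [hα]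
  have eb : negA b' = fun q => b q + β q := by funext q; simp [hβ]
  have dXadd : ∀ {c d : Q n → ℂ}, Smooth c → Smooth d → ∀ w,
      dX w (fun q => c q + d q) = fun q => dX w c q + dX w d q := by
    intro c d hc hd w; funext q; exact fderiv_amp_add hc hd q _
  have dEadd : ∀ {c d : Q n → ℂ}, Smooth c → Smooth d → ∀ w q,
      dEta w (fun q => c q + d q) q = dEta w c q + dEta w d q :=
    fun hc hd w q => fderiv_amp_add hc hd q _
  have key : (fun q => diagY (fun q => a q * trA b' q - b q * trA a' q) q +
      subAmp (fun q => a q * trA b' q - b q * trA a' q) q - bracketAmp a b q) = fun q =>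
      (a q * (negA b' q - (b q + ∑ j, I * dEta (bv j) (dX (bv j) b) q)) -
      b q * (negA a' q - (a q + ∑ j, I * dEta (bv j) (dX (bv j) a) q))) +
      ∑ j, -I * ((dEta (bv j) a q * dX (bv j) β q + a q * dEta (bv j) (dX (bv j) β) q) -
        (dEta (bv j) b q * dX (bv j) α q + b q * dEta (bv j) (dX (bv j) α) q)) := by
    funext ⟨x, y, η, h⟩
    have e1 : diagY (fun q => a q * trA b' q - b q * trA a' q) (x, y, η, h) =
        a (x, y, η, h) * negA b' (x, y, η, h) - b (x, y, η, h) * negA a' (x, y, η, h) := by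
      simp only [diagY, trA, negA]
      rw [hya x x y, hyb x x y, hya' x x y, hyb' x x y]
    have e2 : ∀ j, diagY (dEta (bv j) (dY (bv j) fun q => a q * trA b' q - b q * trA a' q))
        (x, y, η, h) =
        (dEta (bv j) a (x, y, η, h) * dX (bv j) (negA b') (x, y, η, h) +
        a (x, y, η, h) * dEta (bv j) (dX (bv j) (negA b')) (x, y, η, h)) -
        (dEta (bv j) b (x, y, η, h) * dX (bv j) (negA a') (x, y, η, h) +
        b (x, y, η, h) * dEta (bv j) (dX (bv j) (negA a')) (x, y, η, h)) := by
      intro j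
      rw [← dEta_dY_mul_trA ha hya hb' hyb', ← dEta_dY_mul_trA hb hyb ha' hya']
      have s1 := ha.mul hb'.trA
      have s2 := hb.mul ha'.trA
      have : dY (bv j) (fun q => a q * trA b' q - b q * trA a' q) = fun q =>
          dY (bv j) (fun q => a q * trA b' q) q - dY (bv j) (fun q => b q * trA a' q) q := by
        funext q; exact fderiv_amp_sub s1.contDiff s2.contDiff q _
      rw [this]
      exact fderiv_amp_sub (s1.dY _).contDiff (s2.dY _).contDiff _ _
    simp only [e1, subAmp, e2, bracketAmp]
    have e3 : ∀ j, dX (bv j) (negA b') = fun q => dX (bv j) b q + dX (bv j) β q :=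
      fun j => by rw [eb]; exact dXadd hb.contDiff k1.contDiff _
    have e4 : ∀ j, dX (bv j) (negA a') = fun q => dX (bv j) a q + dX (bv j) α q :=
      fun j => by rw [ea]; exact dXadd ha.contDiff h1.contDiff _
    simp only [e3, e4, dEadd (hb.dX _).contDiff (k1.dX _).contDiff,
      dEadd (ha.dX _).contDiff (h1.dX _).contDiff]
    rw [mul_sub, mul_sub, mul_add, mul_add, Finset.mul_sum, Finset.mul_sum]
    have hsum : ∀ (s1 s2 s3 s4 s5 : Fin n → ℂ), (∀ j, s1 j - s2 j = -s3 j + s4 j + s5 j) →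
        ∑ j, s1 j - ∑ j, s2 j = -∑ j, s3 j + ∑ j, s4 j + ∑ j, s5 j := by
      intro s1 s2 s3 s4 s5 hj
      rw [← Finset.sum_sub_distrib, ← Finset.sum_neg_distrib, ← Finset.sum_add_distrib,
        ← Finset.sum_add_distrib]
      exact Finset.sum_congr rfl fun j _ => hj j
    have := hsum _ _ (fun j => a (x, y, η, h) * (I * dEta (bv j) (dX (bv j) b) (x, y, η, h)))
      (fun j => b (x, y, η, h) * (I * dEta (bv j) (dX (bv j) a) (x, y, η, h)))
      (fun j => -I * ((dEta (bv j) a (x, y, η, h) * dX (bv j) β (x, y, η, h) +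
        a (x, y, η, h) * dEta (bv j) (dX (bv j) β) (x, y, η, h)) -
        (dEta (bv j) b (x, y, η, h) * dX (bv j) α (x, y, η, h) +
          b (x, y, η, h) * dEta (bv j) (dX (bv j) α) (x, y, η, h))))
      (fun j => (by ring : -I *
        ((dEta (bv j) a (x, y, η, h) * (dX (bv j) b (x, y, η, h) + dX (bv j) β (x, y, η, h)) +
          a (x, y, η, h) * (dEta (bv j) (dX (bv j) b) (x, y, η, h) +
            dEta (bv j) (dX (bv j) β) (x, y, η, h))) -
        (dEta (bv j) b (x, y, η, h) * (dX (bv j) a (x, y, η, h) + dX (bv j) α (x, y, η, h)) +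
          b (x, y, η, h) * (dEta (bv j) (dX (bv j) a) (x, y, η, h) +
            dEta (bv j) (dX (bv j) α) (x, y, η, h)))) -
        -I * (dEta (bv j) a (x, y, η, h) * dX (bv j) b (x, y, η, h) -
          dX (bv j) a (x, y, η, h) * dEta (bv j) b (x, y, η, h)) = _))
    linear_combination this
  rw [key]
  refine IsAmp.add (IsAmp.sub ?_ ?_) (IsAmp.sum _ fun j _ => (IsAmp.sub (IsAmp.add ?_ ?_)
    (IsAmp.add ?_ ?_)).const_mul _)
  · exact (ha.mul k2).congr_order (by ring)
  · exact (hb.mul h2).congr_order (by ring)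
  · exact ((ha.dEta _).mul (k1.dX _)).congr_order (by ring)
  · exact (ha.mul ((k1.dX _).dEta _)).congr_order (by ring)
  · exact ((hb.dEta _).mul (h1.dX _)).congr_order (by ring)
  · exact (hb.mul ((h1.dX _).dEta _)).congr_order (by ring)

theorem HasSym.commutator (hF : HasSym r l F f) (hG : HasSym r' l' G f') : ∃ R₀ : ℝ, ∀ g : E n → ℂ,
    Smooth g → CSupp g → (∀ z, ‖z‖ ≤ R₀ → g z = 1) → HasSym (r + r' - 1) (l + l') (fun q => compK g
    F G q - compK g G F q) fun p => -I * poisson f f' p := by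
  obtain ⟨a, a', S₁, S₁', M₁, M₁', hS₁, hS₁', ha, ha', hya, hya', hs₁, hs₁', hF1, hF2, hl, h1, h2⟩ :=
    hF.exists_left_right
  obtain ⟨b, b', S₂, S₂', M₂, M₂', hS₂, hS₂', hb, hb', hyb, hyb', hs₂, hs₂', hG1, hG2, hl', k1, k2⟩ :=
    hG.exists_left_right
  obtain ⟨R, hR⟩ := ((hS₁.union hS₁').union (hS₂.union hS₂')).isBounded.subset_closedBall 0
  refine ⟨R + 1, fun g hg hgc hg1 => ?_⟩
  have hFG := lRes_comp_symbols hg hgc hg1 ha hya hS₁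
    ((subset_union_left.trans subset_union_left).trans hR) hs₁ hb' hyb' hS₂'
    ((subset_union_right.trans subset_union_right).trans hR) hs₂' hF1 hG2
  have hGF := lRes_comp_symbols hg hgc hg1 hb hyb hS₂
    ((subset_union_left.trans subset_union_right).trans hR) hs₂ ha' hya' hS₁'
    ((subset_union_right.trans subset_union_left).trans hR) hs₁' hG1 hF2
  rw [add_comm l' l] at hGF
  have i1 := ha.mul hb'.trA
  have i2 := (hb.mul ha'.trA).congr_order (add_comm r' r)
  have s1 := (hs₁.mul_right (trA b')).union_left S₂ M₂
  have s2 := (hs₂.mul_right (trA a')).union_right S₁ M₁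
  obtain ⟨e, he, hye, ⟨S', M', hS', hs'⟩, hR', -, he2⟩ :=
    exists_left_symbol (i1.sub i2) (hS₁.union hS₂) (s1.sub s2)
  have hcomm := commutator_amp ha hya hb hyb ha' hya' hb' hyb' h1 h2 k1 k2
  have h3 : IsAmp (r + r' - 1 - 1) fun q => e q - bracketAmp a b q := by
    have := he2.add hcomm
    refine (show (fun q => e q - bracketAmp a b q) = _ from ?_) ▸
      (this.congr_order (show r + r' - 2 = r + r' - 1 - 1 by ring))
    funext q; ring
  have h4 : IsAmp (r + r' - 1) e := by
    have := h3.raise.add (ha.bracketAmp hb)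
    refine (show e = _ from ?_) ▸ this
    funext q; ring
  refine ⟨e, S', M', hS', h4, hs', ((hFG.sub hGF).add (hR'.qK_mul (l + l'))).congr
    fun q hq => ?_, (HasLim.bracketAmp ha hb hl hl').of_sub h3⟩
  have := qK_sub (l := l + l') i1.contDiff s1 i2.contDiff s2 q hq
  simp only [qK] at this ⊢
  linear_combination -this

/-! ## Operators with vanishing principal symbol -/

lemma bump1_mem_Icc (s : ℝ) : bump1 s ∈ Icc (0 : ℝ) 1 :=
  ⟨Real.smoothTransition.nonneg _, Real.smoothTransition.le_one _⟩

/-- A smooth function equal to `(1 - τ²)^{-1/2}` for small `τ`. -/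
def sphereScale (τ : ℝ) : ℝ := (Real.sqrt (1 - τ ^ 2 * bump1 (4 * τ)))⁻¹

lemma sphereScale_pos (τ : ℝ) : 0 < 1 - τ ^ 2 * bump1 (4 * τ) := by
  have h1 := bump1_mem_Icc (4 * τ)
  rcases le_or_gt 2 |4 * τ| with h | h
  · rw [bump1_eq_zero h]; norm_num
  · have h2 : τ ^ 2 < 1 := by
      rw [abs_mul, abs_of_pos (by norm_num : (0 : ℝ) < 4)] at h
      have h3 : |τ| < 1 := by linarith
      rw [← sq_abs]; nlinarith [abs_nonneg τ]
    nlinarith [h1.1, h1.2, sq_nonneg τ]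

lemma contDiff_sphereScale : Smooth sphereScale := by
  have h1 : Smooth fun τ : ℝ => 1 - τ ^ 2 * bump1 (4 * τ) :=
    contDiff_const.sub ((contDiff_id.pow 2).mul (contDiff_bump1.comp (by fun_prop)))
  exact (h1.sqrt fun τ => (sphereScale_pos τ).ne').inv
    fun τ => (sqrt_pos.2 (sphereScale_pos τ)).ne'

/-- Hadamard's lemma. -/
lemma exists_div_coord {Z : Type} [NormedAddCommGroup Z] [NormedSpace ℝ Z]
    [FiniteDimensional ℝ Z] {B : Z × ℝ → ℂ} (hB : Smooth B) (h0 : ∀ z, B (z, 0) = 0) :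
    ∃ D : Z × ℝ → ℂ, Smooth D ∧ ∀ z τ, B (z, τ) = τ * D (z, τ) := by
  have hd : Smooth fun p : Z × ℝ => fderiv ℝ B p (0, 1) :=
    (hB.fderiv_right (m := ∞) (by simp)).clm_apply contDiff_const
  refine ⟨fun p => ∫ t in Icc (0 : ℝ) 1, fderiv ℝ B (p.1, t * p.2) (0, 1), ?_, fun z τ => ?_⟩
  · have := contDiffOn_setIntegral (μ := (volume : Measure ℝ)) (U := univ)
      (G := fun q : (Z × ℝ) × ℝ => fderiv ℝ B (q.1.1, q.2 * q.1.2) (0, 1)) isOpen_univ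
      (isCompact_Icc (a := (0 : ℝ)) (b := 1)) (hd.comp (f := fun q : (Z × ℝ) × ℝ =>
        (q.1.1, q.2 * q.1.2)) (by fun_prop)).contDiffOn
    exact contDiffOn_univ.1 this
  · have h1 : ∀ t : ℝ, HasDerivAt (fun t : ℝ => B (z, t * τ))
        (τ * fderiv ℝ B (z, t * τ) (0, 1)) t := by
      intro t
      have d1 : HasFDerivAt B (fderiv ℝ B (z, t * τ)) (z, t * τ) :=
        (hB.differentiable (by simp) _).hasFDerivAt
      have d2 : HasDerivAt (fun t : ℝ => (z, t * τ)) (0, τ) t := by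
        refine (hasDerivAt_const t z).prodMk ?_
        simpa using (hasDerivAt_id t).mul_const τ
      have := d1.comp_hasDerivAt t d2
      have e : ((0, τ) : Z × ℝ) = τ • (0, 1) := by simp
      rw [e, map_smul, real_smul] at this
      exact this
    have hc : Continuous fun t : ℝ => (τ : ℂ) * fderiv ℝ B (z, t * τ) (0, 1) :=
      continuous_const.mul (hd.continuous.comp (f := fun t : ℝ => (z, t * τ)) (by fun_prop))
    have h2 := intervalIntegral.integral_eq_sub_of_hasDerivAt (a := 0) (b := 1)
      (fun t _ => h1 t) (hc.intervalIntegrable 0 1)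
    rw [intervalIntegral.integral_of_le zero_le_one, ← integral_Icc_eq_integral_Ioc,
      integral_const_mul] at h2
    simpa [h0] using h2.symm

theorem HasSym.drop (h : HasSym r l F f) (h0 : ∀ x ξ, ξ ≠ 0 → f (x, ξ) = 0) :
    ∃ f', HasSym (r - 1) l F f' := by
  obtain ⟨a, S, M, hS, ha, hy, hs, hR, hl⟩ := h.exists_left
  obtain ⟨b, hb, hab⟩ := ha
  have hz : ∀ (x ww : E n) (ρ : ℝ), ‖ww‖ = 1 → 0 < ρ → b (x, x, ww, 0, ρ) = 0 := by
    intro x ww ρ hw hρ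
    have hn : ‖ρ • ww‖ = ρ := by rw [norm_smul, hw, mul_one, norm_of_nonneg hρ.le]
    have hne : ρ • ww ≠ 0 := by rw [← norm_pos_iff, hn]; exact hρ
    have h1 := (hl.unique (hasLim_of_eq hb hab) x _ hne).symm.trans (h0 x _ hne)
    simp only [hn, smul_smul, inv_mul_cancel₀ hρ.ne', one_smul, mul_eq_zero] at h1
    rcases h1 with h1 | h1
    · exact absurd h1 (ofReal_ne_zero.2 (Real.rpow_pos_of_pos hρ r).ne')
    · exact h1
  let B : (KPt n) × ℝ → ℂ := fun p => ((bump1 (8 * p.2) : ℝ) : ℂ) *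
    (b (p.1.1, p.1.1, p.1.2.1, p.2, p.1.2.2) -
      b (p.1.1, p.1.1, sphereScale p.2 • p.1.2.1, 0, p.1.2.2))
  have hB : Smooth B := by
    have s1 : Smooth fun p : (KPt n) × ℝ => bump1 (8 * p.2) :=
      contDiff_bump1.comp (by fun_prop)
    have s2 : Smooth fun p : (KPt n) × ℝ => sphereScale p.2 • p.1.2.1 :=
      (contDiff_sphereScale.comp contDiff_snd).smul (by fun_prop)
    refine (ofRealCLM.contDiff.comp s1).mul ((hb.comp (by fun_prop)).sub (hb.comp
      (f := fun p : (KPt n) × ℝ => (p.1.1, p.1.1, sphereScale p.2 • p.1.2.1,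
        (0 : ℝ), p.1.2.2)) ?_))
    exact contDiff_fst.fst.prodMk (contDiff_fst.fst.prodMk (s2.prodMk
      (contDiff_const.prodMk (by fun_prop))))
  obtain ⟨D, hD, hBD⟩ := exists_div_coord hB fun z => by simp [B, sphereScale]
  have hχ : Smooth fun τ : ℝ => (1 - bump1 (8 * τ)) / τ ^ 1 := by
    refine contDiff_div_pow (contDiff_const.sub (contDiff_bump1.comp (by fun_prop))) ?_ 1
    have : Ioo (-(1 / 8) : ℝ) (1 / 8) ∈ 𝓝 (0 : ℝ) := Ioo_mem_nhds (by norm_num) (by norm_num)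
    filter_upwards [this] with τ hτ
    have : bump1 (8 * τ) = 1 := bump1_eq_one (by
      rw [abs_le]; constructor <;> linarith [hτ.1, hτ.2])
    exact sub_eq_zero.2 this.symm
  obtain ⟨R, hRS⟩ := hS.isBounded.exists_norm_le
  obtain ⟨γ, hγ, hγc, hγ1, hγs⟩ := exists_contDiff_cutoff (Z := E n × ℝ) (max R M)
  let b' : E n × E n × E n × ℝ × ℝ → ℂ := fun z => γ (z.1, z.2.2.2.2) *
    (D ((z.1, z.2.2.1, z.2.2.2.2), z.2.2.2.1) +
      (((1 - bump1 (8 * z.2.2.2.1)) / z.2.2.2.1 ^ 1 : ℝ) : ℂ) * b (z.1, z.1, z.2.2))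
  have hb' : Smooth b' := by
    have s1 : Smooth fun z : E n × E n × E n × ℝ × ℝ =>
      (1 - bump1 (8 * z.2.2.2.1)) / z.2.2.2.1 ^ 1 := hχ.comp (by fun_prop)
    exact (hγ.comp (by fun_prop)).mul ((hD.comp (by fun_prop)).add
      ((ofRealCLM.contDiff.comp s1).mul (hb.comp (by fun_prop))))
  let a' : Q n → ℂ := fun q => jpow (r - 1) q * b' (ampPt q)
  have ha' : IsAmp (r - 1) a' := ⟨b', hb', fun q => rfl⟩
  have has' : AmpSupp (Metric.closedBall 0 (|max R M| + 2)) (|max R M| + 2) a' := by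
    intro q hq
    have h1 := hγs _ (left_ne_zero_of_mul (right_ne_zero_of_mul hq))
    simp only [ampPt, Prod.norm_def, max_le_iff] at h1
    refine ⟨by simpa using h1.1, ?_⟩
    have h2 := h1.2
    rwa [norm_mul, norm_eq_abs, norm_of_nonneg (jb_pos _).le] at h2
  have heq : ∀ (x y η : E n) (h : ℝ), 0 < h → a' (x, y, η, h) = a (x, y, η, h) := by
    intro x y η h hh
    have hj := jb_pos η
    set τ := (jb η)⁻¹ with hτ
    set ww := (jb η)⁻¹ • η with hw
    set ρ := h * jb η with hρ
    have hτ0 : τ ≠ 0 := inv_ne_zero hj.ne'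
    have hρ0 : 0 < ρ := by positivity
    have e1 : B ((x, ww, ρ), τ) = ((bump1 (8 * τ) : ℝ) : ℂ) * b (x, x, ww, τ, ρ) := by
      simp only [B]
      by_cases hb0 : bump1 (8 * τ) = 0
      · simp [hb0]
      · have h8 : |8 * τ| < 2 := by
          by_contra hge
          exact hb0 (bump1_eq_zero (not_lt.1 hge))
        have h4 : bump1 (4 * τ) = 1 := by
          refine bump1_eq_one ?_
          rw [abs_mul, abs_of_pos (by norm_num : (0 : ℝ) < 8)] at h8
          rw [abs_mul, abs_of_pos (by norm_num : (0 : ℝ) < 4)]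
          linarith
        have h5 : ‖ww‖ ^ 2 = 1 - τ ^ 2 * bump1 (4 * τ) := by
          rw [h4, hw, norm_smul, norm_inv, norm_of_nonneg hj.le, hτ]
          have := jb_sq η
          field_simp
          linarith
        have h6 : ‖sphereScale τ • ww‖ = 1 := by
          have hp := sqrt_pos.2 (sphereScale_pos τ)
          rw [norm_smul, sphereScale, norm_inv, norm_of_nonneg hp.le, ← h5,
            sqrt_sq (norm_nonneg _)]
          rw [← h5, sqrt_sq (norm_nonneg _)] at hp
          exact inv_mul_cancel₀ hp.ne'
        rw [hz x _ ρ h6 hρ0, sub_zero]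
    rw [hBD] at e1
    have e2 : (τ : ℂ) * (D ((x, ww, ρ), τ) + (((1 - bump1 (8 * τ)) / τ ^ 1 : ℝ) : ℂ) *
        b (x, x, ww, τ, ρ)) = b (x, x, ww, τ, ρ) := by
      have : (τ : ℂ) * (((1 - bump1 (8 * τ)) / τ ^ 1 : ℝ) : ℂ) = 1 - ((bump1 (8 * τ) : ℝ) : ℂ) := by
        rw [← ofReal_mul, pow_one, mul_div_cancel₀ _ hτ0]; push_cast; ring
      rw [mul_add, e1, ← mul_assoc, this]; ring
    have e3 : a (x, y, η, h) = jpow r (x, y, η, h) * b (x, x, ww, τ, ρ) := by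
      rw [hy x y x η h, hab]; rfl
    have e4 : jpow r (x, y, η, h) * (τ : ℂ) = jpow (r - 1) (x, y, η, h) := by
      have := jpow_add r (-1) (x, y, η, h)
      rw [← sub_eq_add_neg] at this
      rw [this, jpow_neg_one]
    have e5 : a' (x, y, η, h) = γ (x, ρ) * a (x, y, η, h) := by
      rw [e3, ← e2, ← mul_assoc (jpow r _), e4]
      simp only [a', b', ampPt]
      ring
    rw [e5]
    by_cases ha0 : a (x, y, η, h) = 0
    · rw [ha0, mul_zero]
    · obtain ⟨h1, h2⟩ := hs _ ha0
      rw [hγ1, one_mul]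
      simp only [Prod.norm_def, max_le_iff]
      refine ⟨(hRS _ h1).trans (le_max_left _ _), ?_⟩
      rw [norm_mul, norm_eq_abs, norm_of_nonneg (jb_pos _).le]
      exact h2.trans (le_max_right _ _)
  obtain ⟨f', hf'⟩ := ha'.exists_lim
  refine ⟨f', a', _, _, isCompact_closedBall _ _, ha', has', hR.congr fun q hq => ?_, hf'⟩
  have : kerOf a' q = kerOf a q :=
    integral_congr_ae (Eventually.of_forall fun η => by simp only [heq _ _ _ _ hq.2.2.1])
  simp only [qK, this]

/-! ## Cutoffs -/

lemma exists_contMDiff_one_near {V : Type*} [NormedAddCommGroup V] [NormedSpace ℝ V]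
    [FiniteDimensional ℝ V] {X : Type*} [TopologicalSpace X] [ChartedSpace V X] [IsManifold 𝓘(ℝ, V)
    ∞ X] [T2Space X] [SigmaCompactSpace X] {K U : Set X} (hK : IsCompact K) (hU : IsOpen U) (hKU : K
    ⊆ U) : ∃ γ : X → ℝ, ContMDiff 𝓘(ℝ, V) 𝓘(ℝ, ℝ) ∞ γ ∧ CSupp γ ∧ tsupport γ ⊆ U ∧ ∀ x ∈ K, ∀ᶠ y in
    𝓝 x, γ y = 1 := by
  have : LocallyCompactSpace X := ChartedSpace.locallyCompactSpace V X
  obtain ⟨L, hL, hKL, hLU⟩ := exists_compact_between hK hU hKU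
  obtain ⟨γ, h1, h0, -⟩ := exists_contMDiffMap_one_nhds_of_subset_interior 𝓘(ℝ, V) (n := ⊤)
    hK.isClosed hKL
  have hs : tsupport γ ⊆ L := closure_minimal (fun x hx => by_contra fun h => hx (h0 x h))
    hL.isClosed
  exact ⟨γ, γ.contMDiff, hL.of_isClosed_subset (isClosed_tsupport _) hs, hs.trans hLU,
    fun x hx => (nhds_le_nhdsSet hx) h1⟩

lemma exists_contDiff_one_near {V : Type*} [NormedAddCommGroup V] [NormedSpace ℝ V]
    [FiniteDimensional ℝ V] {K U : Set V} (hK : IsCompact K) (hU : IsOpen U) (hKU : K ⊆ U) : ∃ γ : V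
    → ℝ, Smooth γ ∧ CSupp γ ∧ tsupport γ ⊆ U ∧ ∀ x ∈ K, ∀ᶠ y in 𝓝 x, γ y = 1 := by
  obtain ⟨γ, h1, h2⟩ := exists_contMDiff_one_near (V := V) hK hU hKU
  exact ⟨γ, h1.contDiff, h2⟩

/-! ## Changes of coordinates -/

lemma contDiff_clm_det : Smooth fun A : E n →L[ℝ] E n => A.det := by
  have h : (fun A : E n →L[ℝ] E n => A.det) = fun A =>
      (Matrix.of fun i j => (A (EuclideanSpace.single j 1)) i).det := by
    funext A
    rw [det, ← LinearMap.det_toMatrix (EuclideanSpace.basisFun (Fin n) ℝ).toBasis]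
    congr 1
  rw [h]
  simp only [Matrix.det_apply]
  refine ContDiff.sum fun σ _ => ContDiff.const_smul _ (contDiff_prod fun i _ => ?_)
  simp only [Matrix.of_apply]
  have h1 : Smooth fun A : E n →L[ℝ] E n => A (EuclideanSpace.single i 1) :=
    contDiff_id.clm_apply contDiff_const
  exact (EuclideanSpace.proj (σ i) : E n →L[ℝ] ℝ).contDiff.comp h1

lemma integral_comp_clm {A : E n →L[ℝ] E n} (hA : IsUnit A) (g : E n → ℂ) :
    ∫ η, g η = ∫ η, ((|A.det| : ℝ) : ℂ) * g (A η) := by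
  obtain ⟨u, rfl⟩ := hA
  have hl : ∀ v, (↑u⁻¹ : E n →L[ℝ] E n) ((u : E n →L[ℝ] E n) v) = v := fun v => by
    have := congrArg (fun T : E n →L[ℝ] E n => T v) u.inv_mul; exact this
  have hr : ∀ v, (u : E n →L[ℝ] E n) ((↑u⁻¹ : E n →L[ℝ] E n) v) = v := fun v => by
    have := congrArg (fun T : E n →L[ℝ] E n => T v) u.mul_inv; exact this
  have h := integral_image_eq_integral_abs_det_fderiv_smul (volume : Measure (E n))
    MeasurableSet.univ (f := (u : E n →L[ℝ] E n)) (f' := fun _ => (u : E n →L[ℝ] E n))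
    (fun x _ => (u : E n →L[ℝ] E n).hasFDerivAt.hasFDerivWithinAt)
    (Function.LeftInverse.injective hl).injOn g
  rw [image_univ, (Function.RightInverse.surjective hr).range_eq, setIntegral_univ,
    setIntegral_univ] at h
  simpa using h

/-- The inverse transpose. -/
def invT (A : E n →L[ℝ] E n) : E n →L[ℝ] E n := Ring.inverse (star A)

lemma isUnit_invT {A : E n →L[ℝ] E n} (hA : IsUnit A) : IsUnit (invT A) :=
  (isUnit_ringInverse (a := star A)).2 hA.star

lemma star_invT {A : E n →L[ℝ] E n} (hA : IsUnit A) (v : E n) : (star A) (invT A v) = v := by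
  have := congrArg (fun T : E n →L[ℝ] E n => T v) (Ring.mul_inverse_cancel _ hA.star)
  exact this

lemma invT_star {A : E n →L[ℝ] E n} (hA : IsUnit A) (v : E n) : invT A (star A v) = v := by
  have := congrArg (fun T : E n →L[ℝ] E n => T v) (Ring.inverse_mul_cancel _ hA.star)
  exact this

lemma inner_invT {A : E n →L[ℝ] E n} (hA : IsUnit A) (v w : E n) :
    inner ℝ (A v) (invT A w) = inner ℝ v w := by
  rw [← ContinuousLinearMap.adjoint_inner_right, ← ContinuousLinearMap.star_eq_adjoint,
    star_invT hA]

lemma contDiff_clm_star : Smooth fun A : E n →L[ℝ] E n => star A :=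
  (starL' ℝ : (E n →L[ℝ] E n) ≃L[ℝ] (E n →L[ℝ] E n)).contDiff

lemma contDiffAt_invT {A : E n →L[ℝ] E n} (hA : IsUnit A) : ContDiffAt ℝ ∞ invT A := by
  obtain ⟨u, hu⟩ := hA.star
  have := contDiffAt_ringInverse ℝ (n := ∞) u
  rw [hu] at this
  exact this.comp A contDiff_clm_star.contDiffAt

lemma abs_det_invT {A : E n →L[ℝ] E n} (hA : IsUnit A) : |(invT A).det| = |A.det|⁻¹ := by
  have h1 : (star A * invT A).det = 1 := by
    rw [invT, Ring.mul_inverse_cancel _ hA.star]; simp [det]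
  have h2 : (star A * invT A).det = (star A).det * (invT A).det := by
    simp [det]
  have h3 : |(star A).det| = |A.det| := by
    rw [det, det, ContinuousLinearMap.star_eq_adjoint,
      ← LinearMap.det_toMatrix (EuclideanSpace.basisFun (Fin n) ℝ).toBasis,
      ← LinearMap.det_toMatrix (EuclideanSpace.basisFun (Fin n) ℝ).toBasis (A : E n →ₗ[ℝ] E n)]
    have h5 := LinearMap.toMatrix_adjoint (EuclideanSpace.basisFun (Fin n) ℝ)
      (EuclideanSpace.basisFun (Fin n) ℝ) (A : E n →ₗ[ℝ] E n)
    rw [← Matrix.det_transpose]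
    congr 2
    have h6 : (LinearMap.toMatrix (EuclideanSpace.basisFun (Fin n) ℝ).toBasis
        (EuclideanSpace.basisFun (Fin n) ℝ).toBasis)
        (ContinuousLinearMap.adjoint A : E n →ₗ[ℝ] E n) = _ := h5
    rw [h6]
    ext i j
    simp
  rw [h2] at h1
  have h4 := congrArg abs h1
  rw [abs_mul, h3, abs_one] at h4
  exact eq_inv_of_mul_eq_one_right h4

/-- The quotient `⟨Aη⟩/⟨η⟩` as a function of `ww = η/⟨η⟩`, `τ = 1/⟨η⟩`. -/
def jbRatio (A : E n →L[ℝ] E n) (ww : E n) (τ : ℝ) : ℝ :=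
  Real.sqrt (‖A ww‖ ^ 2 + τ ^ 2 + (1 - ‖ww‖ ^ 2 - τ ^ 2) ^ 2)

lemma jbRatio_arg_pos {A : E n →L[ℝ] E n} (hA : IsUnit A) (ww : E n) (τ : ℝ) :
    0 < ‖A ww‖ ^ 2 + τ ^ 2 + (1 - ‖ww‖ ^ 2 - τ ^ 2) ^ 2 := by
  by_contra hneg
  have h1 : ‖A ww‖ = 0 := by
    by_contra h; have := (norm_nonneg (A ww)).lt_of_ne' h
    exact hneg (by positivity)
  have h2 : τ = 0 := by
    by_contra h; exact hneg (by positivity)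
  have h3 : ww = 0 := by
    obtain ⟨u, rfl⟩ := hA
    have := congrArg (fun T : E n →L[ℝ] E n => T ww) u.inv_mul
    have h4 : (↑u⁻¹ : E n →L[ℝ] E n) ((u : E n →L[ℝ] E n) ww) = ww := this
    rw [← h4, norm_eq_zero.1 h1, map_zero]
  simp [h2, h3] at hneg

lemma jb_map (A : E n →L[ℝ] E n) (η : E n) :
    jb (A η) = jb η * jbRatio A ((jb η)⁻¹ • η) (jb η)⁻¹ := by
  have hj := jb_pos η
  have e1 : 1 - ‖(jb η)⁻¹ • η‖ ^ 2 - (jb η)⁻¹ ^ 2 = 0 := by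
    rw [norm_smul, norm_inv, norm_of_nonneg hj.le]
    have := jb_sq η
    field_simp
    linarith
  rw [jbRatio, e1, map_smul, norm_smul, norm_inv, norm_of_nonneg hj.le]
  have e2 : ((jb η)⁻¹ * ‖A η‖) ^ 2 + (jb η)⁻¹ ^ 2 + 0 ^ 2 = (jb (A η) / jb η) ^ 2 := by
    rw [div_pow, jb_sq (A η)]; field_simp; ring
  rw [e2, sqrt_sq (div_nonneg (jb_pos _).le hj.le)]
  field_simp

variable {N : Set (E n × E n)} {κ : E n → E n} {Φ : E n × E n → E n →L[ℝ] E n} {θ : E n × E n → ℂ}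

/-- The amplitude in new coordinates. -/
def pullAmp (θ : E n × E n → ℂ) (κ : E n → E n) (Φ : E n × E n → E n →L[ℝ] E n) (c : Q n → ℂ) :
    Q n → ℂ := fun q => θ (q.1, q.2.1) * (((|(invT (Φ (q.1, q.2.1))).det| : ℝ) : ℂ) *
      c (κ q.1, κ q.2.1, invT (Φ (q.1, q.2.1)) q.2.2.1, q.2.2.2))

lemma IsAmp.pullAmp (hN : IsOpen N) (hκ : Smooth κ) (hΦ : Smooth Φ) (hU : ∀ p ∈ N, IsUnit (Φ p)) (hθ
    : Smooth θ) (hθs : tsupport θ ⊆ N) (hc : IsAmp r c) : IsAmp r (pullAmp θ κ Φ c) := by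
  obtain ⟨b, hb, h⟩ := hc
  let Z := E n × E n × E n × ℝ × ℝ
  let A : Z → E n →L[ℝ] E n := fun z => invT (Φ (z.1, z.2.1))
  let jr : Z → ℝ := fun z => jbRatio (A z) z.2.2.1 z.2.2.2.1
  let g : Z → ℂ := fun z => ((|(A z).det| * jr z ^ r : ℝ) : ℂ) *
    b (κ z.1, κ z.2.1, (jr z)⁻¹ • A z z.2.2.1, z.2.2.2.1 * (jr z)⁻¹, z.2.2.2.2 * jr z)
  let U : Set Z := {z | (z.1, z.2.1) ∈ N}
  have hpr : Continuous fun z : Z => (z.1, z.2.1) := by fun_prop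
  have hUo : IsOpen U := hN.preimage hpr
  refine ⟨fun z => θ (z.1, z.2.1) * g z, ?_, fun q => ?_⟩
  · refine contDiff_mul_of_tsupport (f := g) hUo ?_ (hθ.comp (f := fun z : Z => (z.1, z.2.1))
      (by fun_prop)) ?_
    · intro z hz
      refine ContDiffAt.contDiffWithinAt ?_
      have hz' : (z.1, z.2.1) ∈ N := hz
      have c1 : ContDiffAt ℝ ∞ (fun z : Z => Φ (z.1, z.2.1)) z :=
        hΦ.contDiffAt.comp (f := fun z : Z => (z.1, z.2.1)) z
          (by fun_prop)
      have cA : ContDiffAt ℝ ∞ A z := ContDiffAt.comp (g := invT) z (contDiffAt_invT (hU _ hz')) c1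
      have hAu : IsUnit (A z) := isUnit_invT (hU _ hz')
      have hdet : (A z).det ≠ 0 := by
        obtain ⟨u, hu⟩ := hAu
        have h1 : (A z * (↑u⁻¹ : E n →L[ℝ] E n)).det = 1 := by
          rw [← hu, u.mul_inv]; simp [det]
        have h2 : (A z * (↑u⁻¹ : E n →L[ℝ] E n)).det =
            (A z).det * (↑u⁻¹ : E n →L[ℝ] E n).det := by
          simp [det]
        exact left_ne_zero_of_mul (h2.symm.trans h1 ▸ one_ne_zero)
      have cd : ContDiffAt ℝ ∞ (fun z => |(A z).det|) z :=
        (contDiff_clm_det.contDiffAt.comp z cA).abs hdet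
      have cAw : ContDiffAt ℝ ∞ (fun z : Z => A z z.2.2.1) z := cA.clm_apply (by fun_prop)
      have carg : ContDiffAt ℝ ∞ (fun z : Z => ‖A z z.2.2.1‖ ^ 2 + z.2.2.2.1 ^ 2 +
          (1 - ‖z.2.2.1‖ ^ 2 - z.2.2.2.1 ^ 2) ^ 2) z := by
        have n1 : ContDiffAt ℝ ∞ (fun z : Z => ‖z.2.2.1‖ ^ 2) z :=
          ContDiffAt.norm_sq ℝ (by fun_prop)
        have n2 : ContDiffAt ℝ ∞ (fun z : Z => z.2.2.2.1 ^ 2) z := by fun_prop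
        exact ((cAw.norm_sq ℝ).add n2).add (((contDiffAt_const.sub n1).sub n2).pow 2)
      have cN : ContDiffAt ℝ ∞ jr z := carg.sqrt (jbRatio_arg_pos hAu _ _).ne'
      have hN : jr z ≠ 0 := (sqrt_pos.2 (jbRatio_arg_pos hAu _ _)).ne'
      have s1 : ContDiffAt ℝ ∞ (fun z => |(A z).det| * jr z ^ r) z :=
        cd.mul (cN.rpow_const_of_ne hN)
      have k1 : ContDiffAt ℝ ∞ (fun z : Z => κ z.1) z :=
        hκ.contDiffAt.comp z contDiffAt_fst
      have k2 : ContDiffAt ℝ ∞ (fun z : Z => κ z.2.1) z :=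
        hκ.contDiffAt.comp (f := fun z : Z => z.2.1) z (by fun_prop)
      refine (ofRealCLM.contDiff.contDiffAt.comp z s1).mul (hb.contDiffAt.comp z ?_)
      exact k1.prodMk (k2.prodMk (((cN.inv hN).smul cAw).prodMk
        ((ContDiffAt.mul (by fun_prop) (cN.inv hN)).prodMk (ContDiffAt.mul (by fun_prop) cN))))
    · refine (closure_minimal ?_ ((isClosed_tsupport θ).preimage hpr)).trans
        (preimage_mono hθs)
      exact fun z hz => subset_tsupport θ hz
  · by_cases hq : θ (q.1, q.2.1) = 0
    · simp [TwoMicro.pullAmp, hq, ampPt]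
    · have hz : (q.1, q.2.1) ∈ N := hθs (subset_tsupport θ hq)
      have hAu : IsUnit (invT (Φ (q.1, q.2.1))) := isUnit_invT (hU _ hz)
      have hj := jb_pos q.2.2.1
      have hN : 0 < jbRatio (invT (Φ (q.1, q.2.1))) ((jb q.2.2.1)⁻¹ • q.2.2.1) (jb q.2.2.1)⁻¹ :=
        sqrt_pos.2 (jbRatio_arg_pos hAu _ _)
      simp only [TwoMicro.pullAmp, h, g, A, jr, jpow, ampPt]
      rw [jb_map, mul_rpow hj.le hN.le, map_smul, mul_inv, smul_smul, mul_comm (jb _)⁻¹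
        (jbRatio _ _ _)⁻¹, mul_assoc q.2.2.2, mul_comm (jbRatio _ _ _)⁻¹ (jb _)⁻¹]
      push_cast
      rw [mul_comm (jb q.2.2.1)⁻¹ (jbRatio _ _ _)⁻¹]
      ring

lemma AmpSupp.pullAmp (hΦ : Smooth Φ) (hU : ∀ p ∈ N, IsUnit (Φ p)) (hθc : CSupp θ) (hθs : tsupport θ
    ⊆ N) (hs : AmpSupp S M c) : ∃ M', AmpSupp (Prod.fst '' tsupport θ) M' (pullAmp θ κ Φ c) := by
  obtain ⟨C, hC⟩ := hθc.isCompact.exists_bound_of_continuousOn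
    (contDiff_clm_star.continuous.comp hΦ.continuous).continuousOn
  refine ⟨max C 1 * M, fun q hq => ?_⟩
  have h1 : (q.1, q.2.1) ∈ tsupport θ := subset_tsupport θ (left_ne_zero_of_mul hq)
  obtain ⟨-, h2⟩ := hs _ (right_ne_zero_of_mul (right_ne_zero_of_mul hq))
  refine ⟨⟨_, h1, rfl⟩, ?_⟩
  simp only at h2
  set A := invT (Φ (q.1, q.2.1)) with hA
  have h3 : ‖q.2.2.1‖ ≤ max C 1 * ‖A q.2.2.1‖ := by
    conv_lhs => rw [← star_invT (hU _ (hθs h1)) q.2.2.1]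
    refine (ContinuousLinearMap.le_opNorm _ _).trans ?_
    exact mul_le_mul_of_nonneg_right ((hC _ h1).trans (le_max_left _ _)) (norm_nonneg _)
  have h4 : jb q.2.2.1 ≤ max C 1 * jb (A q.2.2.1) := by
    have m1 : (1 : ℝ) ≤ max C 1 := le_max_right _ _
    refine Real.sqrt_le_iff.2 ⟨mul_nonneg (by linarith) (jb_pos _).le, ?_⟩
    rw [mul_pow, jb_sq]
    have := pow_le_pow_left₀ (norm_nonneg _) h3 2
    nlinarith
  calc |q.2.2.2| * jb q.2.2.1 ≤ |q.2.2.2| * (max C 1 * jb (A q.2.2.1)) :=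
        mul_le_mul_of_nonneg_left h4 (abs_nonneg _)
    _ = max C 1 * (|q.2.2.2| * jb (A q.2.2.1)) := by ring
    _ ≤ _ := mul_le_mul_of_nonneg_left h2 (by positivity)

lemma kerOf_pullAmp (hU : ∀ p ∈ N, IsUnit (Φ p)) (hΦκ : ∀ x y, κ x - κ y = Φ (x, y) (x - y)) (hθs :
    tsupport θ ⊆ N) (q : KPt n) : kerOf (pullAmp θ κ Φ c) q = pullK θ κ κ (kerOf c) q := by
  obtain ⟨x, y, h⟩ := q
  simp only [kerOf, pullK, pullAmp]
  by_cases hθ : θ (x, y) = 0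
  · simp [hθ]
  have hz : (x, y) ∈ N := hθs (subset_tsupport θ hθ)
  rw [integral_comp_clm (isUnit_invT (hU _ hz))
    (fun η => osc (κ x - κ y) η * c (κ x, κ y, η, h)), ← integral_const_mul]
  refine integral_congr_ae (Eventually.of_forall fun η => ?_)
  simp only
  have : osc (κ x - κ y) (invT (Φ (x, y)) η) = osc (x - y) η := by
    rw [osc, hΦκ x y, inner_invT (hU _ hz)]; rfl
  rw [this]; ring

theorem HasSym.pull_aux (hN : IsOpen N) (hκ : Smooth κ) (hΦ : Smooth Φ) (hU : ∀ p ∈ N, IsUnit (Φ p))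
    (hΦκ : ∀ x y, κ x - κ y = Φ (x, y) (x - y)) (hθ : Smooth θ) (hθc : CSupp θ) (hθs : tsupport θ ⊆
    N) (h : HasSym r l F f) : ∃ f', HasSym r l (pullK θ κ κ F) f' ∧ (∀ x, (x, x) ∈ N → ∀ ζ : E n, ζ
    ≠ 0 → f' (x, Star.star (Φ (x, x)) ζ) = θ (x, x) * ((|(Φ (x, x)).det|⁻¹ : ℝ) : ℂ) * f (κ x, ζ)) ∧
    ∀ x, θ (x, x) = 0 → ∀ ξ : E n, ξ ≠ 0 → f' (x, ξ) = 0 := by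
  obtain ⟨c, S, M, hS, hc, hs, hR, hl⟩ := h
  have hc' := hc.pullAmp hN hκ hΦ hU hθ hθs
  obtain ⟨M', hs'⟩ := hs.pullAmp (κ := κ) hΦ hU hθc hθs
  obtain ⟨f', hf'⟩ := hc'.exists_lim
  refine ⟨f', ⟨_, _, M', hθc.isCompact.image continuous_fst, hc', hs',
    (hR.pullK isOpen_univ isOpen_univ hκ.contDiffOn hκ.contDiffOn hθ
      (by simp)).congr fun q _ => ?_, hf'⟩, fun x hx ζ hζ => ?_, fun x hx ξ hξ => ?_⟩
  · have h1 := kerOf_pullAmp (c := c) hU hΦκ hθs q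
    simp only [qK, h1, pullK, hPow]
    ring
  · have hz := hx
    have hne : Star.star (Φ (x, x)) ζ ≠ 0 := fun h0 => hζ (by
      rw [← invT_star (hU _ hz) ζ, h0, map_zero])
    refine tendsto_nhds_unique (hf' x _ hne) ?_
    have h1 := (hl (κ x) ζ hζ).const_mul (θ (x, x) * ((|(Φ (x, x)).det|⁻¹ : ℝ) : ℂ))
    refine h1.congr fun t => ?_
    simp only [pullAmp, map_smul, invT_star (hU _ hz), abs_det_invT (hU _ hz)]
    ring
  · refine tendsto_nhds_unique (hf' x ξ hξ) (tendsto_const_nhds.congr fun t => ?_)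
    simp [pullAmp, hx]

lemma LRes.mul_of_disjoint_diag (h : HasSym r l F f) {δ : ℝ} (hδ : 0 < δ) {g : E n × E n → ℂ} (hg :
    Smooth g) (h0 : ∀ x y, ‖x - y‖ < δ → g (x, y) = 0) : LRes l fun q => g (q.1, q.2.1) * F q := by
  obtain ⟨c, S, M, hS, hc, hs, hR, -⟩ := h
  have hg' : Smooth fun q : KPt n => g (q.1, q.2.1) := hg.comp (by fun_prop)
  have h1 : IsAmp r fun q : Q n => g (q.1, q.2.1) * c q := hc.mul_contDiff hg'
  have h2 := LRes.kerOf_of_zeroNearDiag hδ h1 ((hs.mono (subset_univ _) le_rfl).mul_left _)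
    fun q hq => by rw [h0 _ _ hq, zero_mul]
  refine ((hR.mul_contDiff hg').add (h2.qK_mul l)).congr fun q _ => ?_
  have h3 := kerOf_mul (fun q : KPt n => g (q.1, q.2.1)) c q
  simp only [h3, qK]
  ring

/-- Invariance under changes of coordinates. -/
theorem HasSym.pull {U : Set (E n)} (hU : IsOpen U) (hκ : SmoothOn κ U) (hinj : InjOn κ U) (hD : ∀ x
    ∈ U, IsUnit (fderiv ℝ κ x)) (hθ : Smooth θ) (hθc : CSupp θ) (hθs : tsupport θ ⊆ U ×ˢ U) (h :
    HasSym r l F f) : ∃ f', HasSym r l (pullK θ κ κ F) f' ∧ ∀ x ∈ U, ∀ ζ : E n, ζ ≠ 0 → f' (x,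
    Star.star (fderiv ℝ κ x) ζ) = θ (x, x) * ((|(fderiv ℝ κ x).det|⁻¹ : ℝ) : ℂ) * f (κ x, ζ) := by
  set K : Set (E n) := Prod.fst '' tsupport θ ∪ Prod.snd '' tsupport θ with hKdef
  have hK : IsCompact K := (hθc.isCompact.image continuous_fst).union
    (hθc.isCompact.image continuous_snd)
  have hKU : K ⊆ U := by
    rintro x (⟨p, hp, rfl⟩ | ⟨p, hp, rfl⟩)
    exacts [(hθs hp).1, (hθs hp).2]
  have hθK : ∀ p ∈ tsupport θ, p.1 ∈ K ∧ p.2 ∈ K := fun p hp =>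
    ⟨Or.inl ⟨p, hp, rfl⟩, Or.inr ⟨p, hp, rfl⟩⟩
  obtain ⟨γ, hγ, -, hγU, hγ1⟩ := exists_contDiff_one_near hK hU hKU
  obtain ⟨k, hk, hkκ⟩ : ∃ k : E n → E n, Smooth k ∧ ∀ x ∈ K, k =ᶠ[𝓝 x] κ := by
    refine ⟨fun x => γ x • κ x, ?_, fun x hx => ?_⟩
    · refine contDiff_iff_contDiffAt.2 fun x => ?_
      by_cases hx : x ∈ tsupport γ
      · exact hγ.contDiffAt.smul (hκ.contDiffAt (hU.mem_nhds (hγU hx)))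
      · refine (contDiffAt_const (c := 0)).congr_of_eventuallyEq ?_
        filter_upwards [notMem_tsupport_iff_eventuallyEq.1 hx] with y hy
        rw [hy, Pi.zero_apply, zero_smul]
    · filter_upwards [hγ1 x hx] with y hy
      rw [hy, one_smul]
  let Φ : E n × E n → E n →L[ℝ] E n := fun p =>
    ∫ t in Icc (0 : ℝ) 1, fderiv ℝ k (p.2 + t • (p.1 - p.2))
  have hdk : Smooth (fderiv ℝ k) := hk.fderiv_right (m := ∞) (by simp)
  have hΦ : Smooth Φ := contDiffOn_univ.1 <|
    contDiffOn_setIntegral (μ := (volume : Measure ℝ)) (U := univ)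
      (G := fun q : (E n × E n) × ℝ => fderiv ℝ k (q.1.2 + q.2 • (q.1.1 - q.1.2))) isOpen_univ
      (isCompact_Icc (a := (0 : ℝ)) (b := 1)) (hdk.comp (f := fun q : (E n × E n) × ℝ =>
        q.1.2 + q.2 • (q.1.1 - q.1.2)) (by fun_prop)).contDiffOn
  have hΦk : ∀ x y, k x - k y = Φ (x, y) (x - y) := by
    intro x y
    have hline : Continuous fun t : ℝ => fderiv ℝ k (y + t • (x - y)) :=
      hdk.continuous.comp (f := fun t : ℝ => y + t • (x - y)) (by fun_prop)
    have h1 : ∀ t : ℝ, HasDerivAt (fun t : ℝ => k (y + t • (x - y)))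
        (fderiv ℝ k (y + t • (x - y)) (x - y)) t := by
      intro t
      have d1 : HasFDerivAt k (fderiv ℝ k (y + t • (x - y))) (y + t • (x - y)) :=
        (hk.differentiable (by simp) _).hasFDerivAt
      have d2 : HasDerivAt (fun t : ℝ => y + t • (x - y)) (x - y) t := by
        simpa using ((hasDerivAt_id t).smul_const (x - y)).const_add y
      exact d1.comp_hasDerivAt t d2
    have h2 := intervalIntegral.integral_eq_sub_of_hasDerivAt (a := 0) (b := 1)
      (fun t _ => h1 t) ((hline.clm_apply continuous_const).intervalIntegrable 0 1)
    rw [intervalIntegral.integral_of_le zero_le_one, ← integral_Icc_eq_integral_Ioc] at h2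
    rw [ContinuousLinearMap.integral_apply hline.continuousOn.integrableOn_Icc, h2]
    simp
  have hdiag : ∀ x ∈ K, Φ (x, x) = fderiv ℝ κ x := fun x hx => by
    simp [Φ, (hkκ x hx).fderiv_eq]
  let N : Set (E n × E n) := {p | IsUnit (Φ p)}
  have hN : IsOpen N := Units.isOpen.preimage hΦ.continuous
  set D : Set (E n × E n) := tsupport θ ∩ {p | p.1 = p.2} with hDdef
  have hDc : IsCompact D := hθc.isCompact.inter_right (isClosed_eq continuous_fst continuous_snd)
  have hDN : D ⊆ N := by
    rintro ⟨x, y⟩ ⟨hp, rfl : x = y⟩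
    change IsUnit (Φ (x, x))
    rw [hdiag x (hθK _ hp).1]
    exact hD x (hKU (hθK _ hp).1)
  obtain ⟨χ, hχ, -, hχN, hχ1⟩ := exists_contDiff_one_near hDc hN hDN
  have hχ' : Smooth fun p => (χ p : ℂ) := ofRealCLM.contDiff.comp hχ
  have hθ₁s : tsupport (fun p => (χ p : ℂ) * θ p) ⊆ N :=
    (closure_mono fun p hp => by simpa using left_ne_zero_of_mul hp).trans hχN
  have hθ₁c : CSupp fun p => (χ p : ℂ) * θ p := hθc.mul_left
  obtain ⟨f', hf', hff, hff0⟩ := h.pull_aux hN hk hΦ (fun p hp => hp) hΦk (hχ'.mul hθ) hθ₁c hθ₁s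
  let θ₂ : E n × E n → ℂ := fun p => (1 - χ p : ℂ) * θ p
  have hθ₂ : Smooth θ₂ := (contDiff_const.sub hχ').mul hθ
  have hθ₂t : tsupport θ₂ ⊆ tsupport θ := closure_mono fun p hp => right_ne_zero_of_mul hp
  have hθ₂c : IsCompact (tsupport θ₂) := hθc.isCompact.of_isClosed_subset (isClosed_tsupport _) hθ₂t
  have hoff : ∀ p ∈ tsupport θ₂, k p.1 ≠ k p.2 := by
    intro p hp he
    have hpK := hθK p (hθ₂t hp)
    rw [(hkκ _ hpK.1).self_of_nhds, (hkκ _ hpK.2).self_of_nhds] at he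
    have hpD : p ∈ D := ⟨hθ₂t hp, hinj (hKU hpK.1) (hKU hpK.2) he⟩
    refine absurd hp (notMem_tsupport_iff_eventuallyEq.2 ?_)
    filter_upwards [hχ1 p hpD] with q hq
    simp [θ₂, hq]
  obtain ⟨δ, hδ, hδ'⟩ : ∃ δ : ℝ, 0 < δ ∧ ∀ p ∈ tsupport θ₂, δ ≤ ‖k p.1 - k p.2‖ := by
    rcases (tsupport θ₂).eq_empty_or_nonempty with he | hne
    · exact ⟨1, one_pos, by simp [he]⟩
    · obtain ⟨p, hp, hmin⟩ := hθ₂c.exists_isMinOn hne (f := fun p => ‖k p.1 - k p.2‖)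
        (by have := hk.continuous; fun_prop)
      exact ⟨_, norm_pos_iff.2 (sub_ne_zero.2 (hoff p hp)), fun q hq => hmin hq⟩
  let g : E n × E n → ℂ := fun p => ((1 - bump1 (2 * δ⁻¹ ^ 2 * ‖p.1 - p.2‖ ^ 2) : ℝ) : ℂ)
  have hg : Smooth g := by
    refine ofRealCLM.contDiff.comp (contDiff_const.sub (contDiff_bump1.comp ?_))
    exact contDiff_const.mul (ContDiff.norm_sq ℝ (by fun_prop))
  have hg0 : ∀ x y : E n, ‖x - y‖ < δ / 2 → g (x, y) = 0 := by
    intro x y hxy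
    have : bump1 (2 * δ⁻¹ ^ 2 * ‖x - y‖ ^ 2) = 1 := by
      refine bump1_eq_one ?_
      rw [abs_of_nonneg (by positivity), inv_pow, mul_assoc, inv_mul_eq_div, mul_div_assoc',
        div_le_one (by positivity)]
      nlinarith [norm_nonneg (x - y)]
    simp only [g, this, sub_self, Complex.ofReal_zero]
  have hg1 : ∀ x y : E n, δ ≤ ‖x - y‖ → g (x, y) = 1 := by
    intro x y hxy
    have : bump1 (2 * δ⁻¹ ^ 2 * ‖x - y‖ ^ 2) = 0 := by
      refine bump1_eq_zero ?_
      rw [abs_of_nonneg (by positivity), inv_pow, mul_assoc, inv_mul_eq_div, mul_div_assoc',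
        le_div_iff₀ (by positivity)]
      nlinarith
    simp only [g, this, sub_zero, ofReal_one]
  have hres := (LRes.mul_of_disjoint_diag h (half_pos hδ) hg hg0).pullK isOpen_univ isOpen_univ
    hk.contDiffOn hk.contDiffOn hθ₂ (by simp)
  refine ⟨f', hf'.add_lRes (hres.congr fun q _ => ?_), fun x hx ζ hζ => ?_⟩
  · obtain ⟨x, y, t⟩ := q
    simp only [pullK]
    by_cases hp : θ (x, y) = 0
    · simp [θ₂, hp]
    have hpt := subset_tsupport θ hp
    rw [← (hkκ _ (hθK _ hpt).1).self_of_nhds, ← (hkκ _ (hθK _ hpt).2).self_of_nhds]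
    by_cases hp2 : θ₂ (x, y) = 0
    · have : θ (x, y) = χ (x, y) * θ (x, y) := by
        linear_combination hp2
      rw [hp2, zero_mul, ← this, sub_self]
    · rw [hg1 _ _ (hδ' _ (subset_tsupport θ₂ hp2))]
      simp only [θ₂]
      ring
  · by_cases hp : θ (x, x) = 0
    · rw [hp, zero_mul, zero_mul]
      refine hff0 x (by simp [hp]) _ fun h0 => hζ ?_
      rw [← invT_star (hD x hx) ζ, h0, map_zero]
    · have hpt := subset_tsupport θ hp
      have hxN : (x, x) ∈ N := hDN ⟨hpt, rfl⟩
      have hxK := (hθK _ hpt).1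
      have := hff x hxN ζ hζ
      rw [hdiag x hxK, (hχ1 _ ⟨hpt, rfl⟩).self_of_nhds, (hkκ x hxK).self_of_nhds] at this
      simpa using this

end Kernels

variable {n : ℕ} {X : Type*} [TopologicalSpace X] [ChartedSpace (E n) X]
  [IsManifold 𝓘(ℝ, E n) ∞ X] [T2Space X] [SecondCountableTopology X] {r r' k k' l l' m : ℝ}
  {A B C D : OpFamily n X} {e e' e₀ e₁ e₁' : OpenPartialHomeomorph X (E n)}
  {φ φ₁ ψ α β χ χ' θ ρ u v : smoothFn n X} {κ κ' F G : Krn n} {f f' f₁ : E n × E n → ℂ}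
  {g : E n → ℂ} {s t : PuncturedCotangent n X → ℂ}

/-! ## Functions in charts -/

open Classical in
/-- The coordinate expression of a function, extended by zero. -/
def extE (e : OpenPartialHomeomorph X (E n)) (u : X → ℂ) : E n → ℂ :=
  fun x => if x ∈ e.target then u (e.symm x) else 0

open Classical in
/-- The function with given coordinate expression, extended by zero. -/
def extX (e : OpenPartialHomeomorph X (E n)) (g : E n → ℂ) : X → ℂ :=
  fun p => if p ∈ e.source then g (e p) else 0

lemma extE_apply {x : E n} (hx : x ∈ e.target) (u : X → ℂ) : extE e u x = u (e.symm x) :=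
  if_pos hx

lemma extE_map {p : X} (hp : p ∈ e.source) (u : X → ℂ) : extE e u (e p) = u p := by
  rw [extE_apply (e.map_source hp), e.left_inv hp]

lemma extX_apply {p : X} (hp : p ∈ e.source) (g : E n → ℂ) : extX e g p = g (e p) :=
  if_pos hp

lemma extX_symm {x : E n} (hx : x ∈ e.target) (g : E n → ℂ) : extX e g (e.symm x) = g x := by
  rw [extX_apply (e.map_target hx), e.right_inv hx]

lemma extE_ne_zero {x : E n} {u : X → ℂ} (h : extE e u x ≠ 0) :
    x ∈ e.target ∧ u (e.symm x) ≠ 0 := by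
  rw [extE] at h
  split_ifs at h with hx
  exacts [⟨hx, h⟩, absurd rfl h]

lemma extX_ne_zero {p : X} (h : extX e g p ≠ 0) : p ∈ e.source ∧ g (e p) ≠ 0 := by
  rw [extX] at h
  split_ifs at h with hx
  exacts [⟨hx, h⟩, absurd rfl h]

lemma IsCutoff.isCompact_image (hφ : IsCutoff e φ) : IsCompact (e '' tsupport φ.1) :=
  hφ.1.isCompact.image_of_continuousOn (e.continuousOn.mono hφ.2)

lemma IsCutoff.image_subset (hφ : IsCutoff e φ) : e '' tsupport φ.1 ⊆ e.target := by
  rintro _ ⟨p, hp, rfl⟩; exact e.map_source (hφ.2 hp)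

lemma extE_ne_zero_mem {x : E n} {u : X → ℂ} (h : extE e u x ≠ 0) : x ∈ e '' tsupport u :=
  ⟨e.symm x, subset_tsupport _ (extE_ne_zero h).2, e.right_inv (extE_ne_zero h).1⟩

lemma IsCutoff.tsupport_extE (hφ : IsCutoff e φ) : tsupport (extE e φ.1) ⊆ e '' tsupport φ.1 :=
  closure_minimal (fun _ hx => extE_ne_zero_mem hx) hφ.isCompact_image.isClosed

lemma IsCutoff.hasCompactSupport_extE (hφ : IsCutoff e φ) : CSupp (extE e φ.1) :=
  hφ.isCompact_image.of_isClosed_subset (isClosed_tsupport _) hφ.tsupport_extE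

lemma IsCutoff.of_subset (hφ : IsCutoff e φ) (h : tsupport α.1 ⊆ tsupport φ.1) : IsCutoff e α :=
  ⟨hφ.1.isCompact.of_isClosed_subset (isClosed_tsupport _) h, h.trans hφ.2⟩

lemma tsupport_mul_left (α β : smoothFn n X) :
    tsupport ((α * β : smoothFn n X) : X → ℂ) ⊆ tsupport α.1 :=
  closure_mono fun _ hp => left_ne_zero_of_mul hp

lemma tsupport_mul_right (α β : smoothFn n X) :
    tsupport ((α * β : smoothFn n X) : X → ℂ) ⊆ tsupport β.1 :=
  closure_mono fun _ hp => right_ne_zero_of_mul hp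

lemma IsCutoff.mul_left (hφ : IsCutoff e φ) (α : smoothFn n X) : IsCutoff e (α * φ) :=
  hφ.of_subset (tsupport_mul_right _ _)

lemma IsCutoff.mul_right (hφ : IsCutoff e φ) (α : smoothFn n X) : IsCutoff e (φ * α) :=
  hφ.of_subset (tsupport_mul_left _ _)

lemma contMDiff_coe (u : smoothFn n X) : ContMDiff 𝓘(ℝ, E n) 𝓘(ℝ, ℂ) ∞ u.1 := u.2

lemma IsChart.contDiffOn_symm (he : IsChart e) (u : smoothFn n X) :
    SmoothOn (fun x => u.1 (e.symm x)) e.target :=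
  ((contMDiff_coe u).comp_contMDiffOn (contMDiffOn_symm_of_mem_maximalAtlas he)).contDiffOn

lemma IsCutoff.contDiff_extE (he : IsChart e) (hφ : IsCutoff e φ) : Smooth (extE e φ.1) := by
  refine contDiff_iff_contDiffAt.2 fun x => ?_
  by_cases hx : x ∈ e.target
  · refine ((he.contDiffOn_symm φ).contDiffAt (e.open_target.mem_nhds hx)).congr_of_eventuallyEq ?_
    filter_upwards [e.open_target.mem_nhds hx] with y hy using extE_apply hy _
  · refine (contDiffAt_const (c := 0)).congr_of_eventuallyEq ?_
    filter_upwards [hφ.isCompact_image.isClosed.isOpen_compl.mem_nhds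
      fun h => hx (hφ.image_subset h)] with y hy
    by_contra h
    exact hy (extE_ne_zero_mem h)

lemma transition_contDiffOn (he : IsChart e) (he₁ : IsChart e₁) :
    SmoothOn (fun x => e (e₁.symm x)) (e₁.target ∩ e₁.symm ⁻¹' e.source) := by
  refine ContMDiffOn.contDiffOn ?_
  exact (contMDiffOn_of_mem_maximalAtlas he).comp
    ((contMDiffOn_symm_of_mem_maximalAtlas he₁).mono inter_subset_left) fun x hx => hx.2

lemma isOpen_transition (e e₁ : OpenPartialHomeomorph X (E n)) :
    IsOpen (e₁.target ∩ e₁.symm ⁻¹' e.source) :=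
  e₁.isOpen_inter_preimage_symm e.open_source

lemma transition_injOn (e e₁ : OpenPartialHomeomorph X (E n)) :
    InjOn (fun x => e (e₁.symm x)) (e₁.target ∩ e₁.symm ⁻¹' e.source) := by
  intro x hx y hy h
  exact e₁.symm.injOn hx.1 hy.1 (e.injOn hx.2 hy.2 h)

lemma transition_isUnit (he : IsChart e) (he₁ : IsChart e₁) {x : E n} (hx : x ∈ e₁.target ∩ e₁.symm
    ⁻¹' e.source) : IsUnit (fderiv ℝ (fun x => e (e₁.symm x)) x) := by
  have hy : e (e₁.symm x) ∈ e.target ∩ e.symm ⁻¹' e₁.source := by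
    refine ⟨e.map_source hx.2, ?_⟩
    rw [mem_preimage, e.left_inv hx.2]
    exact e₁.map_target hx.1
  have d1 : DifferentiableAt ℝ (fun x => e (e₁.symm x)) x :=
    ((transition_contDiffOn he he₁).contDiffAt ((isOpen_transition e e₁).mem_nhds hx)).differentiableAt
      (by simp)
  have d2 : DifferentiableAt ℝ (fun x => e₁ (e.symm x)) (e (e₁.symm x)) :=
    ((transition_contDiffOn he₁ he).contDiffAt
      ((isOpen_transition e₁ e).mem_nhds hy)).differentiableAt (by simp)
  have d1' : DifferentiableAt ℝ (fun x => e (e₁.symm x)) (e₁ (e.symm (e (e₁.symm x)))) := by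
    rwa [e.left_inv hx.2, e₁.right_inv hx.1]
  have h1 : (fderiv ℝ (fun x => e₁ (e.symm x)) (e (e₁.symm x))).comp
      (fderiv ℝ (fun x => e (e₁.symm x)) x) = ContinuousLinearMap.id ℝ (E n) := by
    rw [← fderiv_comp (f := fun x => e (e₁.symm x)) x d2 d1, ← fderiv_id (x := x)]
    refine Filter.EventuallyEq.fderiv_eq ?_
    filter_upwards [(isOpen_transition e e₁).mem_nhds hx] with y hy
    simp [e.left_inv hy.2, e₁.right_inv hy.1]
  have h2 := mul_eq_one_comm.1
    (congrArg (fun T : E n →L[ℝ] E n => (T : Module.End ℝ (E n))) h1)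
  refine ⟨⟨_, fderiv ℝ (fun x => e₁ (e.symm x)) (e (e₁.symm x)), ?_, h1⟩, rfl⟩
  ext v : 1
  exact congrArg (fun T : Module.End ℝ (E n) => T v) h2

lemma contMDiff_extX (he : IsChart e) (hg : Smooth g) (hgc : CSupp g) (hgs : tsupport g ⊆ e.target)
    : ContMDiff 𝓘(ℝ, E n) 𝓘(ℝ, ℂ) ∞ (extX e g) := by
  intro p
  by_cases hp : p ∈ e.source
  · have h1 : ContMDiffAt 𝓘(ℝ, E n) 𝓘(ℝ, ℂ) ∞ (fun p => g (e p)) p :=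
      hg.contMDiff.contMDiffAt.comp p ((contMDiffOn_of_mem_maximalAtlas he).contMDiffAt
        (e.open_source.mem_nhds hp))
    refine h1.congr_of_eventuallyEq ?_
    filter_upwards [e.open_source.mem_nhds hp] with q hq using extX_apply hq _
  · have hK : IsCompact (e.symm '' tsupport g) :=
      hgc.isCompact.image_of_continuousOn (e.continuousOn_symm.mono hgs)
    refine (contMDiffAt_const (c := 0)).congr_of_eventuallyEq ?_
    filter_upwards [hK.isClosed.isOpen_compl.mem_nhds (x := p) (by
      rintro ⟨x, hx, rfl⟩; exact hp (e.map_target (hgs hx)))] with q hq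
    by_contra h
    obtain ⟨h1, h2⟩ := extX_ne_zero h
    exact hq ⟨e q, subset_tsupport _ h2, e.left_inv h1⟩

/-! ## Uniqueness and restriction of local kernels -/

lemma eq_of_integral_eq {k : E n → ℂ} (he : IsChart e) (hk : Smooth k)
    (hkc : CSupp k) (hks : tsupport k ⊆ e.target)
    (h : ∀ u : smoothFn n X, ∫ y, k y * u.1 (e.symm y) = 0) (y : E n) : k y = 0 := by
  have hstar : Smooth fun y => (starRingEnd ℂ) (k y) :=
    conjCLE.contDiff.comp hk
  have hsub : tsupport (fun y => (starRingEnd ℂ) (k y)) ⊆ tsupport k :=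
    closure_mono fun y hy => by simpa using hy
  have hc := hkc.isCompact.of_isClosed_subset (isClosed_tsupport _) hsub
  have h1 := h ⟨_, contMDiff_extX he hstar hc (hsub.trans hks)⟩
  have h2 : ∀ y, k y * extX e (fun y => (starRingEnd ℂ) (k y)) (e.symm y) =
      ((‖k y‖ ^ 2 : ℝ) : ℂ) := by
    intro y
    by_cases hy : k y = 0
    · simp [hy]
    · rw [extX_symm (hks (subset_tsupport _ hy)), Complex.mul_conj, Complex.normSq_eq_norm_sq]
  simp only [h2, integral_complex_ofReal] at h1
  have h3 : Continuous fun y => ‖k y‖ ^ 2 := hk.continuous.norm.pow 2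
  have h4 : CSupp fun y => ‖k y‖ ^ 2 :=
    hkc.comp_left (g := fun z : ℂ => ‖z‖ ^ 2) (by simp)
  have h5 := (integral_eq_zero_iff_of_nonneg (fun y => by positivity)
    (h3.integrable_of_hasCompactSupport h4)).1 (Complex.ofReal_eq_zero.1 h1)
  have h6 := congrFun ((h3.ae_eq_iff_eq volume continuous_const).1 h5) y
  exact norm_eq_zero.1 (pow_eq_zero_iff two_ne_zero |>.1 h6)

lemma IsLocalKernel.slice (hκ : IsLocalKernel A e e' φ ψ κ) (hψ : IsCutoff e' ψ) (x : E n) {h : ℝ}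
    (h0 : 0 < h) (h1 : h < 1) : Smooth (fun y => κ (x, y, h)) ∧ tsupport (fun y => κ (x, y, h)) ⊆ e'
    '' tsupport ψ.1 :=
  ⟨slice_right_contDiff hκ.smooth x h0 h1, closure_minimal
    (fun y hy => (hκ.supp x y h h0 h1 hy).2) hψ.isCompact_image.isClosed⟩

/-- Local kernels are determined by the operator, for each `h`. -/
lemma IsLocalKernel.unique_at (he' : IsChart e') {φ' ψ' : smoothFn n X} (hφ : IsCutoff e φ) (hφ' :
    IsCutoff e φ') (hψ : IsCutoff e' ψ) (hψ' : IsCutoff e' ψ') (hκ : IsLocalKernel A e e' φ ψ κ)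
    (hκ' : IsLocalKernel B e e' φ' ψ' κ') (h : Ioo (0 : ℝ) 1) (H : ∀ (u : smoothFn n X) (p : X), φ.1
    p * (A h (ψ * u)).1 p = φ'.1 p * (B h (ψ' * u)).1 p) (x y : E n) : κ (x, y, h) = κ' (x, y, h) :=
    by
  by_cases hx : x ∈ e.target
  · obtain ⟨s1, t1⟩ := hκ.slice hψ x h.2.1 h.2.2
    obtain ⟨s2, t2⟩ := hκ'.slice hψ' x h.2.1 h.2.2
    have hsub : tsupport (fun y => κ (x, y, (h : ℝ)) - κ' (x, y, h)) ⊆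
        e' '' tsupport ψ.1 ∪ e' '' tsupport ψ'.1 := by
      refine closure_minimal (fun y hy => ?_)
        (hψ.isCompact_image.isClosed.union hψ'.isCompact_image.isClosed)
      by_cases h1 : κ (x, y, (h : ℝ)) = 0
      · refine Or.inr (t2 (subset_tsupport _ fun h2 : κ' (x, y, (h : ℝ)) = 0 => hy ?_))
        simp only [h1, h2, sub_zero]
      · exact Or.inl (t1 (subset_tsupport _ h1))
    have := eq_of_integral_eq he' (s1.sub s2)
      ((hψ.isCompact_image.union hψ'.isCompact_image).of_isClosed_subset (isClosed_tsupport _) hsub)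
      (hsub.trans (union_subset hψ.image_subset hψ'.image_subset)) (fun u => ?_) y
    · exact sub_eq_zero.1 this
    · have e1 := hκ.eq h u (e.symm x) (e.map_target hx)
      have e2 := hκ'.eq h u (e.symm x) (e.map_target hx)
      rw [e.right_inv hx] at e1 e2
      simp only [sub_mul]
      rw [integral_sub (hκ.integrable hψ x h u) (hκ'.integrable hψ' x h u), ← e1, ← e2, H, sub_self]
  · have k1 : κ (x, y, h) = 0 := by_contra fun hne =>
      hx (hφ.image_subset (hκ.supp x y h h.2.1 h.2.2 hne).1)
    have k2 : κ' (x, y, h) = 0 := by_contra fun hne =>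
      hx (hφ'.image_subset (hκ'.supp x y h h.2.1 h.2.2 hne).1)
    rw [k1, k2]

lemma IsLocalKernel.unique (he' : IsChart e') (hφ : IsCutoff e φ) (hψ : IsCutoff e' ψ)
    (hκ : IsLocalKernel A e e' φ ψ κ) (hκ' : IsLocalKernel A e e' φ ψ κ') :
    ∀ q ∈ KD n, κ q = κ' q := fun q hq =>
  hκ.unique_at he' hφ hφ hψ hψ hκ' ⟨q.2.2, hq.2.2⟩ (fun _ _ => rfl) q.1 q.2.1

lemma IsLocalKernel.congr (hκ : IsLocalKernel A e e' φ ψ κ)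
    (h : ∀ q ∈ KD n, κ' q = κ q) : IsLocalKernel A e e' φ ψ κ' where
  smooth := hκ.smooth.congr h
  supp x y t h0 h1 hne := hκ.supp x y t h0 h1 (by rwa [← h _ (mem_kernelDomain h0 h1)])
  eq t u p hp := by
    rw [hκ.eq t u p hp]
    congr 1; funext y
    rw [h _ (mem_kernelDomain t.2.1 t.2.2)]

lemma IsLocalKernel.congr_op {φ' ψ' : smoothFn n X} (hκ : IsLocalKernel A e e' φ ψ κ) (hs : tsupport
    φ.1 ⊆ tsupport φ'.1) (hs' : tsupport ψ.1 ⊆ tsupport ψ'.1) (H : ∀ (h : Ioo (0 : ℝ) 1) (u :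
    smoothFn n X) (p : X), p ∈ e.source → φ'.1 p * (B h (ψ' * u)).1 p = φ.1 p * (A h (ψ * u)).1 p) :
    IsLocalKernel B e e' φ' ψ' κ where
  smooth := hκ.smooth
  supp x y t h0 h1 hne := (hκ.supp x y t h0 h1 hne).imp (fun h => image_mono hs h)
    fun h => image_mono hs' h
  eq t u p hp := by rw [H t u p hp, hκ.eq t u p hp]

/-- The kernel of `α (φ A ψ) β`. -/
lemma IsLocalKernel.restrict (he : IsChart e) (he' : IsChart e') (hα : IsCutoff e α) (hβ : IsCutoff
    e' β) (hψ : IsCutoff e' ψ) (h1 : α * φ = α) (h2 : ψ * β = β) (hκ : IsLocalKernel A e e' φ ψ κ) :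
    IsLocalKernel A e e' α β fun q => (extE e α.1 q.1 * extE e' β.1 q.2.1) * κ q where
  smooth := by
    have s1 : Smooth fun q : KPt n =>
        extE e α.1 q.1 * extE e' β.1 q.2.1 :=
      ((hα.contDiff_extE he).comp contDiff_fst).mul ((hβ.contDiff_extE he').comp (by fun_prop))
    exact s1.contDiffOn.mul hκ.smooth
  supp x y t h0 h1 hne := ⟨extE_ne_zero_mem (left_ne_zero_of_mul (left_ne_zero_of_mul hne)),
    extE_ne_zero_mem (right_ne_zero_of_mul (left_ne_zero_of_mul hne))⟩
  eq t u p hp := by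
    have e1 := hκ.eq t (β * u) p hp
    rw [← mul_assoc ψ, h2] at e1
    have e2 : α.1 p = α.1 p * φ.1 p :=
      (congrFun (congrArg Subtype.val h1) p).symm
    rw [e2, mul_assoc, e1, ← integral_const_mul]
    congr 1; funext y
    by_cases hne : κ (e p, y, t) = 0
    · simp [hne]
    · have hy := hψ.image_subset (hκ.supp _ y t t.2.1 t.2.2 hne).2
      rw [extE_map hp, extE_apply hy]
      simp only [MulMemClass.coe_mul, Pi.mul_apply]
      ring

lemma exists_cutoff {K U : Set X} (hK : IsCompact K) (hU : IsOpen U) (hKU : K ⊆ U) : ∃ χ : smoothFn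
    n X, CSupp χ.1 ∧ tsupport χ.1 ⊆ U ∧ ∀ x ∈ K, ∀ᶠ y in 𝓝 x, χ.1 y = 1 := by
  have : LocallyCompactSpace X := ChartedSpace.locallyCompactSpace (E n) X
  obtain ⟨γ, h1, h2, h3, h4⟩ := exists_contMDiff_one_near (V := E n) hK hU hKU
  have hs : tsupport (fun x => (γ x : ℂ)) ⊆ tsupport γ :=
    closure_mono fun x hx => by simpa using hx
  refine ⟨⟨fun x => (γ x : ℂ), ofRealCLM.contDiff.contMDiff.comp h1⟩,
    h2.isCompact.of_isClosed_subset (isClosed_tsupport _) hs, hs.trans h3, fun x hx => ?_⟩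
  filter_upwards [h4 x hx] with y hy
  simp [hy]

lemma mul_eq_of_eq_one (h : ∀ x ∈ tsupport φ.1, χ.1 x = 1) : χ * φ = φ := by
  refine Subtype.ext (funext fun x => ?_)
  simp only [MulMemClass.coe_mul, Pi.mul_apply]
  by_cases hx : φ.1 x = 0
  · rw [hx, mul_zero]
  · rw [h x (subset_tsupport _ hx), one_mul]

lemma eq_one_of_mul_eq (h : χ * φ = φ) : ∀ x ∈ tsupport φ.1, χ.1 x = 1 := by
  refine closure_minimal (fun x hx => ?_) (isClosed_eq (contMDiff_coe χ).continuous continuous_const)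
  have h1 : χ.1 x * φ.1 x = φ.1 x := congrFun (congrArg Subtype.val h) x
  exact mul_right_cancel₀ hx (h1.trans (one_mul _).symm)

lemma tsupport_subset_of_mul_eq (h : χ * φ = φ) : tsupport φ.1 ⊆ tsupport χ.1 := by
  conv_lhs => rw [← h]
  exact tsupport_mul_left χ φ

/-- A cutoff equal to one near a compact subset of an open set contained in a chart domain. -/
lemma exists_isCutoff {K U : Set X} (hK : IsCompact K) (hU : IsOpen U) (hKU : K ⊆ U) (hUe : U ⊆
    e.source) : ∃ χ : smoothFn n X, IsCutoff e χ ∧ tsupport χ.1 ⊆ U ∧ ∀ x ∈ K, ∀ᶠ y in 𝓝 x, χ.1 y =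
    1 :=
  let ⟨χ, h1, h2, h3⟩ := exists_cutoff hK hU hKU
  ⟨χ, ⟨h1, h2.trans hUe⟩, h2, h3⟩

/-! ## Changes of charts -/

/-- The weight in the transformation law of kernels. -/
def trWeight (e₁ e' e₁' : OpenPartialHomeomorph X (E n)) (χ χ' : smoothFn n X) :
    E n × E n → ℂ := fun p => extE e₁ χ.1 p.1 * (extE e₁' χ'.1 p.2 *
      ((|(fderiv ℝ (fun x => e' (e₁'.symm x)) p.2).det| : ℝ) : ℂ))

lemma abs_det_pos {T : E n →L[ℝ] E n} (hT : IsUnit T) : 0 < |T.det| := by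
  obtain ⟨u, rfl⟩ := hT
  have h1 : ((u : E n →L[ℝ] E n) * (↑u⁻¹ : E n →L[ℝ] E n)).det = 1 := by
    rw [u.mul_inv]; simp [det]
  have h2 : ((u : E n →L[ℝ] E n) * (↑u⁻¹ : E n →L[ℝ] E n)).det =
      (u : E n →L[ℝ] E n).det * (↑u⁻¹ : E n →L[ℝ] E n).det :=
    LinearMap.det_comp _ _
  exact abs_pos.2 (left_ne_zero_of_mul (h2.symm.trans h1 ▸ one_ne_zero))

lemma trWeight_contDiff (he₁ : IsChart e₁) (he' : IsChart e') (he₁' : IsChart e₁') (hχ : IsCutoff e₁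
    χ) (hχ' : IsCutoff e₁' χ') (hχ'' : IsCutoff e' χ') : Smooth (trWeight e₁ e' e₁' χ χ') := by
  have h1 : SmoothOn (fun y => (((|(fderiv ℝ (fun x => e' (e₁'.symm x)) y).det| : ℝ) : ℂ)))
      (e₁'.target ∩ e₁'.symm ⁻¹' e'.source) := by
    refine ofRealCLM.contDiff.comp_contDiffOn fun y hy => ?_
    have d1 := ((transition_contDiffOn he' he₁').fderiv_of_isOpen (m := ∞)
      (isOpen_transition e' e₁') (by simp)).contDiffAt ((isOpen_transition e' e₁').mem_nhds hy)
    exact ((contDiff_clm_det.contDiffAt.comp y d1).abs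
      (abs_pos.1 (abs_det_pos (transition_isUnit he' he₁' hy)))).contDiffWithinAt
  have h2 := contDiff_mul_of_tsupport (isOpen_transition e' e₁') h1 (hχ'.contDiff_extE he₁')
    (hχ'.tsupport_extE.trans (by
      rintro _ ⟨p, hp, rfl⟩
      exact ⟨e₁'.map_source (hχ'.2 hp), by
        rw [mem_preimage, e₁'.left_inv (hχ'.2 hp)]; exact hχ''.2 hp⟩))
  exact ((hχ.contDiff_extE he₁).comp contDiff_fst).mul (h2.comp contDiff_snd)

lemma trWeight_tsupport (hχ : IsCutoff e₁ χ) (hχ' : IsCutoff e₁' χ') : tsupport (trWeight e₁ e' e₁'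
    χ χ') ⊆ (e₁ '' tsupport χ.1) ×ˢ (e₁' '' tsupport χ'.1) :=
  closure_minimal (fun _ hp => ⟨extE_ne_zero_mem (left_ne_zero_of_mul hp),
    extE_ne_zero_mem (left_ne_zero_of_mul (right_ne_zero_of_mul hp))⟩)
    (hχ.isCompact_image.isClosed.prod hχ'.isCompact_image.isClosed)

lemma trWeight_hasCompactSupport (hχ : IsCutoff e₁ χ) (hχ' : IsCutoff e₁' χ') :
    CSupp (trWeight e₁ e' e₁' χ χ') :=
  (hχ.isCompact_image.prod hχ'.isCompact_image).of_isClosed_subset (isClosed_tsupport _)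
    (trWeight_tsupport hχ hχ')

lemma image_subset_transition (h1 : IsCutoff e₁ χ) (h2 : IsCutoff e χ) :
    e₁ '' tsupport χ.1 ⊆ e₁.target ∩ e₁.symm ⁻¹' e.source := by
  rintro _ ⟨p, hp, rfl⟩
  exact ⟨e₁.map_source (h1.2 hp), by
    rw [mem_preimage, e₁.left_inv (h1.2 hp)]; exact h2.2 hp⟩

/-- The transformation law of kernels under changes of charts on both sides. -/
lemma IsLocalKernel.transfer (he : IsChart e) (he' : IsChart e') (he₁ : IsChart e₁) (he₁' : IsChart
    e₁') (hχ : IsCutoff e χ) (hχ₁ : IsCutoff e₁ χ) (hχ' : IsCutoff e' χ') (hχ₁' : IsCutoff e₁' χ')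
    (h1 : χ * φ = φ) (h2 : χ' * ψ = ψ) (hκ : IsLocalKernel A e e' φ ψ κ) : IsLocalKernel A e₁ e₁' φ
    ψ (pullK (trWeight e₁ e' e₁' χ χ') (fun x => e (e₁.symm x)) (fun x => e' (e₁'.symm x)) κ) where
  smooth := pullK_smooth (isOpen_transition e e₁) (isOpen_transition e' e₁')
    (transition_contDiffOn he he₁) (transition_contDiffOn he' he₁')
    (trWeight_contDiff he₁ he' he₁' hχ₁ hχ₁' hχ')
    ((trWeight_tsupport hχ₁ hχ₁').trans (prod_mono (image_subset_transition hχ₁ hχ)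
      (image_subset_transition hχ₁' hχ'))) hκ.smooth
  supp x y t h0 ht hne := by
    obtain ⟨hx, hx'⟩ := extE_ne_zero (left_ne_zero_of_mul (left_ne_zero_of_mul hne))
    obtain ⟨hy, hy'⟩ := extE_ne_zero
      (left_ne_zero_of_mul (right_ne_zero_of_mul (left_ne_zero_of_mul hne)))
    obtain ⟨⟨p, hp, hpx⟩, q, hq, hqy⟩ := hκ.supp _ _ t h0 ht (right_ne_zero_of_mul hne)
    have hp' := hχ.2 (tsupport_subset_of_mul_eq h1 hp)
    have hq' := hχ'.2 (tsupport_subset_of_mul_eq h2 hq)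
    refine ⟨⟨p, hp, ?_⟩, q, hq, ?_⟩
    · rw [e.injOn hp' (hχ.2 (subset_tsupport _ hx')) hpx, e₁.right_inv hx]
    · rw [e'.injOn hq' (hχ'.2 (subset_tsupport _ hy')) hqy, e₁'.right_inv hy]
  eq t u p hp := by
    have hsφ := tsupport_subset_of_mul_eq h1
    have hsψ := tsupport_subset_of_mul_eq h2
    by_cases hpe : p ∈ e.source
    · have hχp : φ.1 p = χ.1 p * φ.1 p :=
        (congrFun (congrArg Subtype.val h1) p).symm
      rw [hχp, mul_assoc, hκ.eq t u p hpe]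
      set Bs := e₁'.target ∩ e₁'.symm ⁻¹' e'.source with hBs
      set k : E n → E n := fun x => e' (e₁'.symm x) with hk
      have c1 : ∫ y, κ (e p, y, t) * u.1 (e'.symm y) =
          ∫ y in k '' Bs, κ (e p, y, t) * u.1 (e'.symm y) := by
        refine (setIntegral_eq_integral_of_forall_compl_eq_zero fun y hy => ?_).symm
        by_contra hne
        obtain ⟨-, q, hq, rfl⟩ := hκ.supp _ y t t.2.1 t.2.2 (left_ne_zero_of_mul hne)
        have hq1 := hχ₁'.2 (hsψ hq)
        refine hy ⟨e₁' q, ⟨e₁'.map_source hq1, ?_⟩, ?_⟩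
        · rw [mem_preimage, e₁'.left_inv hq1]; exact hχ'.2 (hsψ hq)
        · simp only [hk, e₁'.left_inv hq1]
      have c2 := integral_image_eq_integral_abs_det_fderiv_smul (volume : Measure (E n))
        (isOpen_transition e' e₁').measurableSet (f := k) (f' := fderiv ℝ k)
        (fun x hx => (((transition_contDiffOn he' he₁').contDiffAt
          ((isOpen_transition e' e₁').mem_nhds hx)).differentiableAt
            (by simp)).hasFDerivAt.hasFDerivWithinAt)
        (transition_injOn e' e₁') (fun y => κ (e p, y, t) * u.1 (e'.symm y))
      rw [c1, c2, ← integral_const_mul, ← setIntegral_eq_integral_of_forall_compl_eq_zero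
        (s := Bs) (f := fun y => pullK (trWeight e₁ e' e₁' χ χ') (fun x => e (e₁.symm x)) k κ
          (e₁ p, y, t) * u.1 (e₁'.symm y))]
      · refine setIntegral_congr_fun (isOpen_transition e' e₁').measurableSet fun y hy => ?_
        simp only [pullK, trWeight, extE_map hp, e₁.left_inv hp, real_smul]
        have hy2 : e'.symm (k y) = e₁'.symm y := e'.left_inv hy.2
        rw [hy2]
        by_cases hne : κ (e p, k y, t) = 0
        · simp only [hne, mul_zero, zero_mul]
        · obtain ⟨-, q, hq, hqy⟩ := hκ.supp _ _ t t.2.1 t.2.2 hne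
          have hqy' : q = e₁'.symm y := e'.injOn (hχ'.2 (hsψ hq)) hy.2 hqy
          rw [extE_apply hy.1, ← hqy', eq_one_of_mul_eq h2 q hq]
          ring
      · intro y hy
        by_contra hne
        obtain ⟨hy1, hy2⟩ := extE_ne_zero (left_ne_zero_of_mul (right_ne_zero_of_mul
          (left_ne_zero_of_mul (left_ne_zero_of_mul hne))))
        exact hy ⟨hy1, hχ'.2 (subset_tsupport _ hy2)⟩
    · have hφ0 : φ.1 p = 0 := by
        by_contra hne; exact hpe (hχ.2 (hsφ (subset_tsupport _ hne)))
      have hχ0 : χ.1 p = 0 := by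
        by_contra hne; exact hpe (hχ.2 (subset_tsupport _ hne))
      simp [pullK, trWeight, extE_map hp, hφ0, hχ0]

/-! ## Residual and symbolic local kernels -/

/-- `φ A ψ` is residual in the charts `e`, `e'`. -/
def ResAt (l : ℝ) (A : OpFamily n X) (e e' : OpenPartialHomeomorph X (E n))
    (φ ψ : smoothFn n X) : Prop := ∃ κ, IsLocalKernel A e e' φ ψ κ ∧ LRes l κ

/-- `φ A ψ` has symbol `f` in the chart `e`. -/
def SymAt (r l : ℝ) (A : OpFamily n X) (e : OpenPartialHomeomorph X (E n))
    (φ ψ : smoothFn n X) (f : E n × E n → ℂ) : Prop :=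
  ∃ κ, IsLocalKernel A e e φ ψ κ ∧ HasSym r l κ f

lemma resAt_iff (hφ : IsCutoff e φ) (hψ : IsCutoff e' ψ) :
    ResAt l A e e' φ ψ ↔ IsLocallyResidual l A e e' φ ψ := by
  refine ⟨fun ⟨κ, h1, h2⟩ => ⟨κ, h1, h2.isResidualKernel
    (hφ.isCompact_image.prod hψ.isCompact_image) fun x y h h0 ht hne => ?_⟩,
    fun ⟨κ, h1, h2⟩ => ⟨κ, h1, h2.lRes⟩⟩
  exact h1.supp x y h h0 ht hne

lemma IsLocalSymbol.symAt {a : Krn n} (h : IsLocalSymbol m l A e φ ψ a) : ∃ f, SymAt (m - l) l A e φ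
    ψ f ∧ ∀ x ξ : E n, ξ ≠ 0 → Tendsto (fun h : ℝ => ((h ^ m : ℝ) : ℂ) * a (x, ξ, h)) (𝓝[>] 0) (𝓝 (f
    (x, ξ))) := by
  obtain ⟨ha, κ, hκ, hR⟩ := h
  obtain ⟨f, hf, hl⟩ := HasSym.of_totalSymbol ha hR.lRes
  exact ⟨f, ⟨κ, hκ, hf⟩, hl⟩

lemma SymAt.exists_localSymbol (hφ : IsCutoff e φ) (hψ : IsCutoff e ψ)
    (h : SymAt (m - l) l A e φ ψ f) : ∃ a, IsLocalSymbol m l A e φ ψ a := by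
  obtain ⟨κ, hκ, hf⟩ := h
  obtain ⟨a, ha, hR⟩ := hf.exists_totalSymbol
  obtain ⟨⟨b, hb, hbc, hab⟩, -⟩ := id ha
  have hK := hbc.isCompact.image (continuous_fst (X := E n))
  refine ⟨a, ha, κ, hκ, hR.isResidualKernel ((hφ.isCompact_image.prod hψ.isCompact_image).union
    (hK.prod (hK.cthickening (r := 2)))) fun x y t h0 ht hne => ?_⟩
  by_cases hz : κ (x, y, t) = 0
  · right
    have h1 : leftKernel a (x, y, t) ≠ 0 := fun h0 => hne (by simp only [hz, h0, sub_zero])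
    have h2 : ∃ ξ, ((diagCutoff x y : ℝ) : ℂ) * a (x, ξ, t) ≠ 0 := by
      by_contra! hall
      refine h1 ?_
      simp [leftKernel, mul_assoc, hall]
    obtain ⟨ξ, hξ⟩ := h2
    have hx : x ∈ Prod.fst '' tsupport b := by
      have := right_ne_zero_of_mul hξ
      rw [hab x ξ t h0 ht] at this
      exact ⟨_, subset_tsupport _ (right_ne_zero_of_mul this), rfl⟩
    refine ⟨hx, Metric.mem_cthickening_of_dist_le y x 2 _ hx ?_⟩
    have h3 : diagCutoff x y ≠ 0 := by simpa using left_ne_zero_of_mul hξ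
    have h4 : 0 < 2 - ‖x - y‖ ^ 2 := by
      by_contra hle
      exact h3 (Real.smoothTransition.zero_of_nonpos (not_lt.1 hle))
    rw [dist_comm, dist_eq_norm]
    nlinarith [norm_nonneg (x - y)]
  · exact Or.inl (hκ.supp x y t h0 ht hz)

lemma extE_prod_contDiff (he : IsChart e) (he' : IsChart e') (hα : IsCutoff e α) (hβ : IsCutoff e'
    β) : Smooth fun p : E n × E n => extE e α.1 p.1 * extE e' β.1 p.2 :=
  ((hα.contDiff_extE he).comp contDiff_fst).mul ((hβ.contDiff_extE he').comp contDiff_snd)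

lemma SymAt.restrict (he : IsChart e) (hα : IsCutoff e α) (hβ : IsCutoff e β) (hψ : IsCutoff e ψ)
    (h1 : α * φ = α) (h2 : ψ * β = β) (h : SymAt r l A e φ ψ f) : SymAt r l A e α β fun p => (extE e
    α.1 p.1 * extE e β.1 p.1) * f p := by
  obtain ⟨κ, hκ, hR⟩ := h
  exact ⟨_, hκ.restrict he he hα hβ hψ h1 h2,
    hR.mul_contDiff (extE_prod_contDiff he he hα hβ)⟩

lemma SymAt.restrict_res (he : IsChart e) (hα : IsCutoff e α) (hβ : IsCutoff e β) (hψ : IsCutoff e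
    ψ) (h1 : α * φ = α) (h2 : ψ * β = β) (h : SymAt r l A e φ ψ f) (hd : Disjoint (tsupport α.1)
    (tsupport β.1)) : ResAt l A e e α β := by
  obtain ⟨κ, hκ, hR⟩ := h
  have hd' : Disjoint (e '' tsupport α.1) (e '' tsupport β.1) := by
    refine Set.disjoint_left.2 ?_
    rintro _ ⟨p, hp, rfl⟩ ⟨q, hq, hqp⟩
    exact Set.disjoint_left.1 hd hp (e.injOn (hβ.2 hq) (hα.2 hp) hqp ▸ hq)
  obtain ⟨δ, hδ, hdist⟩ := Metric.exists_pos_forall_lt_edist hα.isCompact_image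
    hβ.isCompact_image.isClosed hd'
  refine ⟨_, hκ.restrict he he hα hβ hψ h1 h2, LRes.mul_of_disjoint_diag hR
    (NNReal.coe_pos.2 hδ) (extE_prod_contDiff he he hα hβ) fun x y hxy => ?_⟩
  by_contra hne
  have := hdist x (extE_ne_zero_mem (left_ne_zero_of_mul hne)) y
    (extE_ne_zero_mem (right_ne_zero_of_mul hne))
  rw [edist_nndist, ENNReal.coe_lt_coe, nndist_eq_nnnorm] at this
  exact absurd hxy (not_lt.2 (NNReal.coe_lt_coe.2 this).le)

lemma ResAt.transfer (he : IsChart e) (he' : IsChart e') (he₁ : IsChart e₁)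
    (he₁' : IsChart e₁') (hφ : IsCutoff e φ) (hφ₁ : IsCutoff e₁ φ) (hψ : IsCutoff e' ψ)
    (hψ₁ : IsCutoff e₁' ψ) (h : ResAt l A e e' φ ψ) : ResAt l A e₁ e₁' φ ψ := by
  obtain ⟨κ, hκ, hR⟩ := h
  obtain ⟨χ, hχ, hχs, hχ1⟩ := exists_isCutoff (e := e) hφ.1 (e.open_source.inter e₁.open_source)
    (subset_inter hφ.2 hφ₁.2) inter_subset_left
  obtain ⟨χ', hχ', hχs', hχ1'⟩ := exists_isCutoff (e := e') hψ.1
    (e'.open_source.inter e₁'.open_source) (subset_inter hψ.2 hψ₁.2) inter_subset_left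
  have hχ₁ : IsCutoff e₁ χ := ⟨hχ.1, hχs.trans inter_subset_right⟩
  have hχ₁' : IsCutoff e₁' χ' := ⟨hχ'.1, hχs'.trans inter_subset_right⟩
  refine ⟨_, hκ.transfer he he' he₁ he₁' hχ hχ₁ hχ' hχ₁'
    (mul_eq_of_eq_one fun x hx => (hχ1 x hx).self_of_nhds)
    (mul_eq_of_eq_one fun x hx => (hχ1' x hx).self_of_nhds), ?_⟩
  exact hR.pullK (isOpen_transition e e₁) (isOpen_transition e' e₁')
    (transition_contDiffOn he he₁) (transition_contDiffOn he' he₁')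
    (trWeight_contDiff he₁ he' he₁' hχ₁ hχ₁' hχ')
    ((trWeight_tsupport hχ₁ hχ₁').trans (prod_mono (image_subset_transition hχ₁ hχ)
      (image_subset_transition hχ₁' hχ')))

lemma SymAt.transfer (he : IsChart e) (he₁ : IsChart e₁) (hφ : IsCutoff e φ) (hφ₁ : IsCutoff e₁ φ)
    (hψ : IsCutoff e ψ) (hψ₁ : IsCutoff e₁ ψ) (h : SymAt r l A e φ ψ f) {p : X} (hp : p ∈ e.source)
    (hp₁ : p ∈ e₁.source) : ∃ f₁, SymAt r l A e₁ φ ψ f₁ ∧ ∀ ζ, ζ ≠ 0 → f₁ (e₁ p, star (fderiv ℝ (fun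
    x => e (e₁.symm x)) (e₁ p)) ζ) = f (e p, ζ) := by
  obtain ⟨κ, hκ, hR⟩ := h
  obtain ⟨χ, hχ, hχs, hχ1⟩ := exists_isCutoff (e := e) (K := tsupport φ.1 ∪
    tsupport ψ.1 ∪ {p}) ((hφ.1.isCompact.union hψ.1.isCompact).union isCompact_singleton)
    (e.open_source.inter e₁.open_source)
    (union_subset (union_subset (subset_inter hφ.2 hφ₁.2) (subset_inter hψ.2 hψ₁.2))
      (singleton_subset_iff.2 ⟨hp, hp₁⟩)) inter_subset_left
  have hχ₁ : IsCutoff e₁ χ := ⟨hχ.1, hχs.trans inter_subset_right⟩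
  have hx : e₁ p ∈ e₁.target ∩ e₁.symm ⁻¹' e.source :=
    ⟨e₁.map_source hp₁, by rw [mem_preimage, e₁.left_inv hp₁]; exact hp⟩
  obtain ⟨f₁, hf₁, hff⟩ := HasSym.pull (isOpen_transition e e₁) (transition_contDiffOn he he₁)
    (transition_injOn e e₁) (fun x hx => transition_isUnit he he₁ hx)
    (trWeight_contDiff he₁ he he₁ hχ₁ hχ₁ hχ) (trWeight_hasCompactSupport hχ₁ hχ₁)
    ((trWeight_tsupport hχ₁ hχ₁).trans (prod_mono (image_subset_transition hχ₁ hχ)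
      (image_subset_transition hχ₁ hχ))) hR
  refine ⟨f₁, ⟨_, hκ.transfer he he he₁ he₁ hχ hχ₁ hχ hχ₁
    (mul_eq_of_eq_one fun x hx => (hχ1 x (Or.inl (Or.inl hx))).self_of_nhds)
    (mul_eq_of_eq_one fun x hx => (hχ1 x (Or.inl (Or.inr hx))).self_of_nhds), hf₁⟩,
    fun ζ hζ => ?_⟩
  rw [hff _ hx ζ hζ]
  have h1 : χ.1 p = 1 := (hχ1 p (Or.inr rfl)).self_of_nhds
  have h2 := (abs_det_pos (transition_isUnit he he₁ hx)).ne'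
  simp only [trWeight, extE_map hp₁, h1, one_mul, e₁.left_inv hp₁]
  rw [← ofReal_mul, mul_inv_cancel₀ h2, ofReal_one, one_mul]

/-! ## Covectors -/

lemma mdifferentiableAt_chart (he : IsChart e) {p : X} (hp : p ∈ e.source) :
    MDifferentiableAt 𝓘(ℝ, E n) 𝓘(ℝ, E n) e p :=
  ((contMDiffOn_of_mem_maximalAtlas he).contMDiffAt (e.open_source.mem_nhds hp)).mdifferentiableAt
    (by simp)

lemma mdifferentiableAt_chart_symm (he : IsChart e) {x : E n} (hx : x ∈ e.target) :
    MDifferentiableAt 𝓘(ℝ, E n) 𝓘(ℝ, E n) e.symm x :=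
  ((contMDiffOn_symm_of_mem_maximalAtlas he).contMDiffAt
    (e.open_target.mem_nhds hx)).mdifferentiableAt (by simp)

lemma covector_map {p : X} (hp : p ∈ e.source) (ξ : E n) : covector e (e p) ξ =
    ⟨p, (innerSL ℝ ξ : E n →L[ℝ] ℝ).comp (mfderiv 𝓘(ℝ, E n) 𝓘(ℝ, E n) e p : E n →L[ℝ] E n)⟩ := by
  rw [covector, e.left_inv hp]

lemma covector_transition (he : IsChart e) (he₁ : IsChart e₁) {p : X} (hp : p ∈ e.source) (hp₁ : p ∈
    e₁.source) (ζ : E n) : covector e₁ (e₁ p) (star (fderiv ℝ (fun x => e (e₁.symm x)) (e₁ p)) ζ) =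
    covector e (e p) ζ := by
  have hx : e₁ p ∈ e₁.target ∩ e₁.symm ⁻¹' e.source :=
    ⟨e₁.map_source hp₁, by rw [mem_preimage, e₁.left_inv hp₁]; exact hp⟩
  have d1 : DifferentiableAt ℝ (fun x => e (e₁.symm x)) (e₁ p) :=
    ((transition_contDiffOn he he₁).contDiffAt
      ((isOpen_transition e e₁).mem_nhds hx)).differentiableAt (by simp)
  have h1 : mfderiv 𝓘(ℝ, E n) 𝓘(ℝ, E n) e p =
      (mfderiv 𝓘(ℝ, E n) 𝓘(ℝ, E n) (fun x => e (e₁.symm x)) (e₁ p)).comp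
        (mfderiv 𝓘(ℝ, E n) 𝓘(ℝ, E n) e₁ p) := by
    rw [← mfderiv_comp p d1.mdifferentiableAt (mdifferentiableAt_chart he₁ hp₁)]
    refine Filter.EventuallyEq.mfderiv_eq ?_
    filter_upwards [e₁.open_source.mem_nhds hp₁] with q hq
    simp [e₁.left_inv hq]
  rw [covector_map hp, covector_map hp₁, h1, mfderiv_eq_fderiv]
  congr 1
  ext v
  exact ContinuousLinearMap.adjoint_inner_left (fderiv ℝ (fun x => e (e₁.symm x)) (e₁ p))
    (mfderiv 𝓘(ℝ, E n) 𝓘(ℝ, E n) e₁ p v : E n) ζ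

lemma mfderiv_chart_inverse (he : IsChart e) {p : X} (hp : p ∈ e.source) : ∃ S : E n →L[ℝ] E n, (∀
    v, (mfderiv 𝓘(ℝ, E n) 𝓘(ℝ, E n) e p : E n →L[ℝ] E n) (S v) = v) ∧ ∀ v, S ((mfderiv 𝓘(ℝ, E n)
    𝓘(ℝ, E n) e p : E n →L[ℝ] E n) v) = v := by
  let D : E n →L[ℝ] E n := mfderiv 𝓘(ℝ, E n) 𝓘(ℝ, E n) e p
  let S : E n →L[ℝ] E n := mfderiv 𝓘(ℝ, E n) 𝓘(ℝ, E n) e.symm (e p)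
  have d2 : MDifferentiableAt 𝓘(ℝ, E n) 𝓘(ℝ, E n) e.symm (e p) :=
    mdifferentiableAt_chart_symm he (e.map_source hp)
  have h1 : ∀ v, D (S v) = v := by
    intro v
    have h2 : mfderiv 𝓘(ℝ, E n) 𝓘(ℝ, E n) (e ∘ e.symm) (e p) =
        (mfderiv 𝓘(ℝ, E n) 𝓘(ℝ, E n) e (e.symm (e p))).comp
          (mfderiv 𝓘(ℝ, E n) 𝓘(ℝ, E n) e.symm (e p)) :=
      mfderiv_comp _ (by rw [e.left_inv hp]; exact mdifferentiableAt_chart he hp) d2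
    have h3 : mfderiv 𝓘(ℝ, E n) 𝓘(ℝ, E n) (e ∘ e.symm) (e p) =
        mfderiv 𝓘(ℝ, E n) 𝓘(ℝ, E n) id (e p) := by
      refine Filter.EventuallyEq.mfderiv_eq ?_
      filter_upwards [e.open_target.mem_nhds (e.map_source hp)] with y hy
      simp [e.right_inv hy]
    rw [h3, mfderiv_id] at h2
    have h4 := congrArg (fun T : E n →L[ℝ] E n => T v) h2
    have h5 : ∀ q, q = p → ((mfderiv 𝓘(ℝ, E n) 𝓘(ℝ, E n) e q : E n →L[ℝ] E n)) = D := by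
      rintro q rfl; rfl
    have h6 : (mfderiv 𝓘(ℝ, E n) 𝓘(ℝ, E n) e (e.symm (e p)) : E n →L[ℝ] E n) (S v) = v := h4.symm
    rwa [h5 _ (e.left_inv hp)] at h6
  have h2 : (D : Module.End ℝ (E n)) * (S : Module.End ℝ (E n)) = 1 := LinearMap.ext h1
  have h3 := mul_eq_one_comm.1 h2
  exact ⟨S, h1, fun v => congrArg (fun T : Module.End ℝ (E n) => T v) h3⟩

lemma exists_covector_eq (he : IsChart e) (P : PuncturedCotangent n X) (hp : P.1.1 ∈ e.source) :
    ∃ ξ : E n, ξ ≠ 0 ∧ covector e (e P.1.1) ξ = P.1 := by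
  obtain ⟨⟨p, L⟩, hL⟩ := P
  obtain ⟨S, -, hS⟩ := mfderiv_chart_inverse he hp
  let L' : E n →L[ℝ] ℝ := L
  have hξ : ∀ v, inner ℝ ((InnerProductSpace.toDual ℝ (E n)).symm (L'.comp S)) v = L' (S v) :=
    fun v => by rw [InnerProductSpace.toDual_symm_apply]; rfl
  refine ⟨(InnerProductSpace.toDual ℝ (E n)).symm (L'.comp S), fun h0 => hL ?_, ?_⟩
  · have h1 : L' = 0 := by
      ext v
      calc L' v = L' (S _) := (congrArg L' (hS v)).symm
        _ = _ := (hξ _).symm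
        _ = 0 := by rw [h0]; exact inner_zero_left _
    exact h1
  · rw [covector_map hp]
    congr 1
    ext v
    exact (hξ _).trans (congrArg L' (hS v))

lemma covector_ne_zero (he : IsChart e) {x ξ : E n} (hx : x ∈ e.target) (hξ : ξ ≠ 0) :
    (covector e x ξ).2 ≠ 0 := by
  obtain ⟨S, hS, -⟩ := mfderiv_chart_inverse he (e.map_target hx)
  intro h0
  have h1 := congrArg (fun T : E n →L[ℝ] ℝ => T (S ξ)) h0
  have h2 : inner ℝ ξ ((mfderiv 𝓘(ℝ, E n) 𝓘(ℝ, E n) e (e.symm x) : E n →L[ℝ] E n) (S ξ)) =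
      (0 : ℝ) := h1
  rw [hS, inner_self_eq_zero] at h2
  exact hξ h2

lemma inCoords_eq {x ξ : E n} {P : PuncturedCotangent n X} (h : covector e x ξ = P.1)
    (s : PuncturedCotangent n X → ℂ) : inCoords e s (x, ξ) = s P := by
  have hne : (covector e x ξ).2 ≠ 0 := h ▸ P.2
  rw [inCoords, dif_pos hne]
  exact congrArg s (Subtype.ext h)

lemma exists_inCoords_eq (he : IsChart e) {x ξ : E n} (hx : x ∈ e.target) (hξ : ξ ≠ 0) :
    ∃ P : PuncturedCotangent n X, P.1 = covector e x ξ ∧ ∀ s, inCoords e s (x, ξ) = s P :=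
  ⟨⟨_, covector_ne_zero he hx hξ⟩, rfl, fun s => inCoords_eq rfl s⟩

/-! ## The principal symbol -/

lemma SymAt.unique (he : IsChart e) (hφ : IsCutoff e φ) (hψ : IsCutoff e ψ) (h : SymAt r l A e φ ψ
    f) (h' : SymAt r l A e φ ψ f') (x ξ : E n) (hξ : ξ ≠ 0) : f (x, ξ) = f' (x, ξ) := by
  obtain ⟨κ, hκ, hf⟩ := h
  obtain ⟨κ', hκ', hf'⟩ := h'
  exact hf.unique (hf'.congr (hκ.unique he hφ hψ hκ')) x ξ hξ

lemma SymAt.invariant (he : IsChart e) (he₁ : IsChart e₁) (hφ : IsCutoff e φ) (hφ₁ : IsCutoff e₁ φ₁)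
    (h : SymAt r l A e φ φ f) (h₁ : SymAt r l A e₁ φ₁ φ₁ f₁) {p : X} (hp : p ∈ e.source) (hp₁ : p ∈
    e₁.source) (h1 : ∀ᶠ q in 𝓝 p, φ.1 q = 1) (h1₁ : ∀ᶠ q in 𝓝 p, φ₁.1 q = 1) {ζ : E n} (hζ : ζ ≠ 0)
    : f₁ (e₁ p, star (fderiv ℝ (fun x => e (e₁.symm x)) (e₁ p)) ζ) = f (e p, ζ) := by
  obtain ⟨U, hU, hUo, hpU⟩ := eventually_nhds_iff.1 (h1.and h1₁)
  obtain ⟨χ, hχ, hχU, hχ1⟩ := exists_isCutoff (e := e) (K := {p}) isCompact_singleton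
    (hUo.inter (e.open_source.inter e₁.open_source))
    (singleton_subset_iff.2 ⟨hpU, hp, hp₁⟩) (fun x hx => hx.2.1)
  have hχ₁ : IsCutoff e₁ χ := ⟨hχ.1, hχU.trans fun x hx => hx.2.2⟩
  have hm : φ * χ = χ := mul_eq_of_eq_one fun x hx => (hU x (hχU hx).1).1
  have hm₁ : φ₁ * χ = χ := mul_eq_of_eq_one fun x hx => (hU x (hχU hx).1).2
  have k := h.restrict he hχ hχ hφ (by rw [mul_comm, hm]) hm
  have k₁ := h₁.restrict he₁ hχ₁ hχ₁ hφ₁ (by rw [mul_comm, hm₁]) hm₁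
  obtain ⟨f₂, hf₂, hff⟩ := k.transfer he he₁ hχ hχ₁ hχ hχ₁ hp hp₁
  have hx : e₁ p ∈ e₁.target ∩ e₁.symm ⁻¹' e.source :=
    ⟨e₁.map_source hp₁, by rw [mem_preimage, e₁.left_inv hp₁]; exact hp⟩
  have hne : star (fderiv ℝ (fun x => e (e₁.symm x)) (e₁ p)) ζ ≠ 0 := fun h0 => hζ (by
    rw [← invT_star (transition_isUnit he he₁ hx) ζ, h0, map_zero])
  have h2 := k₁.unique he₁ hχ₁ hχ₁ hf₂ (e₁ p) _ hne
  rw [hff ζ hζ] at h2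
  simpa [extE_map hp, extE_map hp₁, (hχ1 p rfl).self_of_nhds] using h2

/-- `s` is the principal symbol of `A`. -/
def SymbolOf (r l : ℝ) (A : OpFamily n X) (s : PuncturedCotangent n X → ℂ) : Prop :=
  ∀ e : OpenPartialHomeomorph X (E n), IsChart e → ∀ φ : smoothFn n X, IsCutoff e φ →
    ∀ f, SymAt r l A e φ φ f → ∀ x ∈ e.target, (∀ᶠ p in 𝓝 (e.symm x), φ.1 p = 1) →
      ∀ ξ : E n, ξ ≠ 0 → inCoords e s (x, ξ) = f (x, ξ)

/-- `A` has a symbol when localized to a chart. -/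
def IsSymbolic (r l : ℝ) (A : OpFamily n X) : Prop :=
  ∀ e : OpenPartialHomeomorph X (E n), IsChart e → ∀ φ ψ : smoothFn n X, IsCutoff e φ →
    IsCutoff e ψ → ∃ f, SymAt r l A e φ ψ f

/-- `A` is residual when localized to disjoint sets. -/
def IsResidualOff (l : ℝ) (A : OpFamily n X) : Prop :=
  ∀ e e' : OpenPartialHomeomorph X (E n), IsChart e → IsChart e' →
    ∀ φ ψ : smoothFn n X, IsCutoff e φ → IsCutoff e' ψ →
      Disjoint (tsupport φ.1) (tsupport ψ.1) → ResAt l A e e' φ ψ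

lemma mem_psi_iff : A ∈ Psi n X k l ↔
    ProperlySupported A ∧ IsSymbolic (k - l) l A ∧ IsResidualOff l A := by
  refine ⟨fun ⟨h1, h2, h3⟩ => ⟨h1, fun e he φ ψ hφ hψ => ?_, fun e e' he he' φ ψ hφ hψ hd =>
    (resAt_iff hφ hψ).2 (h3 e e' he he' φ ψ hφ hψ hd)⟩, fun ⟨h1, h2, h3⟩ => ⟨h1,
    fun e he φ ψ hφ hψ => ?_, fun e e' he he' φ ψ hφ hψ hd =>
    (resAt_iff hφ hψ).1 (h3 e e' he he' φ ψ hφ hψ hd)⟩⟩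
  · obtain ⟨a, ha⟩ := h2 e he φ ψ hφ hψ
    obtain ⟨f, hf, -⟩ := ha.symAt
    exact ⟨f, hf⟩
  · obtain ⟨f, hf⟩ := h2 e he φ ψ hφ hψ
    exact hf.exists_localSymbol hφ hψ

/-- A cutoff near a point of a chart domain. -/
lemma exists_isCutoff_point {p : X} (hp : p ∈ e.source) :
    ∃ χ : smoothFn n X, IsCutoff e χ ∧ ∀ᶠ q in 𝓝 p, χ.1 q = 1 :=
  let ⟨χ, h1, _, h3⟩ := exists_isCutoff (e := e) (K := {p}) isCompact_singleton e.open_source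
    (singleton_subset_iff.2 hp) subset_rfl
  ⟨χ, h1, h3 p rfl⟩

lemma isChart_chartAt (p : X) : IsChart (chartAt (E n) p) :=
  IsManifold.chart_mem_maximalAtlas p

lemma SymbolOf.of_forall (h : ∀ e : OpenPartialHomeomorph X (E n), IsChart e → ∀ φ : smoothFn n X,
    IsCutoff e φ → ∃ f, SymAt r l A e φ φ f ∧ ∀ x ∈ e.target, (∀ᶠ p in 𝓝 (e.symm x), φ.1 p = 1) → ∀
    ξ : E n, ξ ≠ 0 → inCoords e s (x, ξ) = f (x, ξ)) : SymbolOf r l A s := by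
  intro e he φ hφ f hf x hx h1 ξ hξ
  obtain ⟨f', hf', h2⟩ := h e he φ hφ
  rw [h2 x hx h1 ξ hξ, hf.unique he hφ hφ hf' x ξ hξ]

lemma exists_symbolOf (hA : IsSymbolic r l A) : ∃ s, SymbolOf r l A s := by
  have key : ∀ P : PuncturedCotangent n X, ∃ v : ℂ, ∀ e : OpenPartialHomeomorph X (E n),
      IsChart e → ∀ φ : smoothFn n X, IsCutoff e φ → ∀ f, SymAt r l A e φ φ f →
        P.1.1 ∈ e.source → (∀ᶠ p in 𝓝 P.1.1, φ.1 p = 1) → ∀ ξ : E n,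
          covector e (e P.1.1) ξ = P.1 → ξ ≠ 0 → f (e P.1.1, ξ) = v := by
    intro P
    have hp := mem_chart_source (E n) P.1.1
    have he := isChart_chartAt (n := n) P.1.1
    obtain ⟨χ, hχ, hχ1⟩ := exists_isCutoff_point (n := n) hp
    obtain ⟨f₀, hf₀⟩ := hA _ he χ χ hχ hχ
    obtain ⟨ζ, hζ, hζP⟩ := exists_covector_eq he P hp
    refine ⟨f₀ (chartAt (E n) P.1.1 P.1.1, ζ), fun e he' φ hφ f hf hpe h1 ξ hξP hξ => ?_⟩
    have h2 := hf₀.invariant he he' hχ hφ hf hp hpe hχ1 h1 hζ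
    have h3 : covector e (e P.1.1) ξ = covector e (e P.1.1)
        (star (fderiv ℝ (fun x => chartAt (E n) P.1.1 (e.symm x)) (e P.1.1)) ζ) := by
      rw [covector_transition he he' hp hpe, hξP, hζP]
    rw [covector_map hpe, covector_map hpe] at h3
    obtain ⟨S, hS, -⟩ := mfderiv_chart_inverse he' hpe
    have h4 := eq_of_heq (Sigma.mk.inj h3).2
    rw [← h2]
    congr 2
    refine ext_inner_right ℝ fun v => ?_
    have h5 := congrArg (fun T : E n →L[ℝ] ℝ => T (S v)) h4
    have h6 : ∀ w : E n, ((innerSL ℝ w : E n →L[ℝ] ℝ).comp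
        (mfderiv 𝓘(ℝ, E n) 𝓘(ℝ, E n) e P.1.1 : E n →L[ℝ] E n)) (S v) = inner ℝ w v :=
      fun w => congrArg (inner ℝ w) (hS v)
    exact (h6 _).symm.trans (h5.trans (h6 _))
  choose s hs using key
  refine ⟨s, fun e he φ hφ f hf x hx h1 ξ hξ => ?_⟩
  obtain ⟨P, hP, hPs⟩ := exists_inCoords_eq he hx hξ
  have h2 : P.1.1 = e.symm x := congrArg Sigma.fst hP
  have h3 := hs P e he φ hφ f hf (h2 ▸ e.map_target hx) (h2 ▸ h1) ξ
    (by rw [h2, e.right_inv hx, hP]) hξ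
  rw [hPs, ← h3, h2, e.right_inv hx]

lemma SymbolOf.apply (hA : IsSymbolic r l A) (hs : SymbolOf r l A s) (he : IsChart e)
    (hφ : IsCutoff e φ) (hψ : IsCutoff e ψ) (hf : SymAt r l A e φ ψ f) (x ξ : E n) (hξ : ξ ≠ 0) :
    f (x, ξ) = extE e φ.1 x * extE e ψ.1 x * inCoords e s (x, ξ) := by
  by_cases hx : x ∈ e.target
  · obtain ⟨χ, hχ, -, hχ1⟩ := exists_isCutoff (e := e) (K := tsupport φ.1 ∪
      tsupport ψ.1 ∪ {e.symm x}) ((hφ.1.isCompact.union hψ.1.isCompact).union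
      isCompact_singleton) e.open_source (union_subset (union_subset hφ.2 hψ.2)
      (singleton_subset_iff.2 (e.map_target hx))) subset_rfl
    obtain ⟨f', hf'⟩ := hA e he χ χ hχ hχ
    have h1 : χ * φ = φ := mul_eq_of_eq_one fun x hx => (hχ1 x (Or.inl (Or.inl hx))).self_of_nhds
    have h2 : χ * ψ = ψ := mul_eq_of_eq_one fun x hx => (hχ1 x (Or.inl (Or.inr hx))).self_of_nhds
    rw [hf.unique he hφ hψ (hf'.restrict he hφ hψ hχ (by rw [mul_comm, h1]) h2) x ξ hξ,
      hs e he χ hχ f' hf' x hx (hχ1 _ (Or.inr rfl)) ξ hξ]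
  · obtain ⟨χ, hχ, -, hχ1⟩ := exists_isCutoff (e := e) (K := tsupport φ.1 ∪
      tsupport ψ.1) (hφ.1.isCompact.union hψ.1.isCompact) e.open_source
      (union_subset hφ.2 hψ.2) subset_rfl
    obtain ⟨f', hf'⟩ := hA e he χ χ hχ hχ
    have h1 : χ * φ = φ := mul_eq_of_eq_one fun x hx => (hχ1 x (Or.inl hx)).self_of_nhds
    have h2 : χ * ψ = ψ := mul_eq_of_eq_one fun x hx => (hχ1 x (Or.inr hx)).self_of_nhds
    rw [hf.unique he hφ hψ (hf'.restrict he hφ hψ hχ (by rw [mul_comm, h1]) h2) x ξ hξ]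
    simp [extE, hx]

lemma SymbolOf.unique (hA : IsSymbolic r l A) (hs : SymbolOf r l A s) (ht : SymbolOf r l A t) :
    s = t := by
  funext P
  have hp := mem_chart_source (E n) P.1.1
  have he := isChart_chartAt (n := n) P.1.1
  obtain ⟨χ, hχ, hχ1⟩ := exists_isCutoff_point (n := n) hp
  obtain ⟨f, hf⟩ := hA _ he χ χ hχ hχ
  obtain ⟨ζ, hζ, hζP⟩ := exists_covector_eq he P hp
  have hx := (chartAt (E n) P.1.1).map_source hp
  rw [← (chartAt (E n) P.1.1).left_inv hp] at hχ1
  rw [← inCoords_eq hζP s, ← inCoords_eq hζP t, hs _ he χ hχ f hf _ hx hχ1 ζ hζ,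
    ht _ he χ hχ f hf _ hx hχ1 ζ hζ]

lemma SymAt.add (hψ : IsCutoff e ψ) (h : SymAt r l A e φ ψ f) (h' : SymAt r l B e φ ψ f') :
    SymAt r l (A + B) e φ ψ fun p => f p + f' p :=
  let ⟨_, h1, h2⟩ := h
  let ⟨_, h1', h2'⟩ := h'
  ⟨_, h1.add hψ h1', h2.add h2'⟩

lemma SymAt.smul (z : ℂ) (h : SymAt r l A e φ ψ f) : SymAt r l (z • A) e φ ψ fun p => z * f p :=
  let ⟨_, h1, h2⟩ := h
  ⟨_, h1.smul z, h2.const_mul z⟩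

lemma ResAt.symAt (h : ResAt l A e e φ ψ) : SymAt r l A e φ ψ fun _ => 0 :=
  let ⟨_, h1, h2⟩ := h
  ⟨_, h1, .of_lRes r h2⟩

lemma SymbolOf.add (hA : IsSymbolic r l A) (hB : IsSymbolic r l B) (hs : SymbolOf r l A s)
    (ht : SymbolOf r l B t) : SymbolOf r l (A + B) (s + t) := by
  refine .of_forall fun e he φ hφ => ?_
  obtain ⟨f, hf⟩ := hA e he φ φ hφ hφ
  obtain ⟨f', hf'⟩ := hB e he φ φ hφ hφ
  refine ⟨_, hf.add hφ hf', fun x hx h1 ξ hξ => ?_⟩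
  obtain ⟨P, -, hP⟩ := exists_inCoords_eq he hx hξ
  rw [← hs e he φ hφ f hf x hx h1 ξ hξ, ← ht e he φ hφ f' hf' x hx h1 ξ hξ, hP, hP, hP]
  rfl

lemma SymbolOf.smul (z : ℂ) (hA : IsSymbolic r l A) (hs : SymbolOf r l A s) :
    SymbolOf r l (z • A) (z • s) := by
  refine .of_forall fun e he φ hφ => ?_
  obtain ⟨f, hf⟩ := hA e he φ φ hφ hφ
  refine ⟨_, hf.smul z, fun x hx h1 ξ hξ => ?_⟩
  obtain ⟨P, -, hP⟩ := exists_inCoords_eq he hx hξ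
  rw [← hs e he φ hφ f hf x hx h1 ξ hξ, hP, hP]
  rfl

lemma SymbolOf.mem_sym (hA : IsSymbolic (k - l) l A) (hs : SymbolOf (k - l) l A s) :
    s ∈ Sym n X (l - k) := by
  intro e he φ hφ
  obtain ⟨χ, hχ, -, hχ1⟩ := exists_isCutoff (e := e) hφ.1.isCompact e.open_source hφ.2 subset_rfl
  have h1 : χ * φ = φ := mul_eq_of_eq_one fun x hx => (hχ1 x hx).self_of_nhds
  obtain ⟨f, κ, hκ, hf⟩ := hA e he φ χ hφ hχ
  obtain ⟨b, hb, hbc, hfb⟩ := hf.exists_form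
  refine ⟨b, hb, hbc, fun x hx ξ hξ => ?_⟩
  rw [neg_sub, ← hfb x ξ hξ, hs.apply hA he hφ hχ ⟨κ, hκ, hf⟩ x ξ hξ, extE_apply hx, extE_apply hx]
  have h2 : χ.1 (e.symm x) * φ.1 (e.symm x) = φ.1 (e.symm x) :=
    congrFun (congrArg Subtype.val h1) _
  linear_combination (-inCoords e s (x, ξ)) * h2

lemma isPrincipalSymbol_iff (hA : IsSymbolic (k - l) l A) :
    IsPrincipalSymbol k l A s ↔ SymbolOf (k - l) l A s := by
  constructor
  · intro h
    refine .of_forall fun e he φ hφ => ?_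
    obtain ⟨f, hf⟩ := hA e he φ φ hφ hφ
    obtain ⟨a, ha⟩ := hf.exists_localSymbol hφ hφ
    obtain ⟨f', hf', hl⟩ := ha.symAt
    exact ⟨f', hf', fun x hx h1 ξ hξ => tendsto_nhds_unique (h e he φ hφ a ha x hx h1 ξ hξ)
      (hl x ξ hξ)⟩
  · intro h e he φ hφ a ha x hx h1 ξ hξ
    obtain ⟨f, hf, hl⟩ := ha.symAt
    rw [h e he φ hφ f hf x hx h1 ξ hξ]
    exact hl x ξ hξ

/-! ## Residual operators and operators of lower order -/

lemma resid_le_psi : Resid n X l ≤ Psi n X k l := fun _ hA =>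
  mem_psi_iff.2 ⟨hA.1, fun e he φ ψ hφ hψ =>
    ⟨_, ((resAt_iff hφ hψ).2 (hA.2 e e he he φ ψ hφ hψ)).symAt⟩,
    fun e e' he he' φ ψ hφ hψ _ => (resAt_iff hφ hψ).2 (hA.2 e e' he he' φ ψ hφ hψ)⟩

lemma inCoords_zero (x ξ : E n) : inCoords e (0 : PuncturedCotangent n X → ℂ) (x, ξ) = 0 := by
  simp [inCoords]

lemma SymbolOf.of_resid (hA : A ∈ Resid n X l) : SymbolOf r l A 0 :=
  .of_forall fun e he φ hφ =>
    ⟨_, ((resAt_iff hφ hφ).2 (hA.2 e e he he φ φ hφ hφ)).symAt, fun _ _ _ _ _ => inCoords_zero _ _⟩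

lemma SymAt.raise (h : SymAt (r - 1) l A e φ ψ f) : SymAt r l A e φ ψ fun _ => 0 :=
  let ⟨_, h1, h2⟩ := h
  ⟨_, h1, h2.raise⟩

lemma psi_mono : Psi n X (k - 1) l ≤ Psi n X k l := fun A hA => by
  obtain ⟨h1, h2, h3⟩ := mem_psi_iff.1 hA
  rw [sub_right_comm] at h2
  refine mem_psi_iff.2 ⟨h1, fun e he φ ψ hφ hψ => ?_, h3⟩
  obtain ⟨f, hf⟩ := h2 e he φ ψ hφ hψ
  exact ⟨_, hf.raise⟩

lemma SymbolOf.of_mem_psi_sub_one (hA : A ∈ Psi n X (k - 1) l) : SymbolOf (k - l) l A 0 := by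
  obtain ⟨h1, h2, h3⟩ := mem_psi_iff.1 hA
  rw [sub_right_comm] at h2
  refine .of_forall fun e he φ hφ => ?_
  obtain ⟨f, hf⟩ := h2 e he φ φ hφ hφ
  exact ⟨_, hf.raise, fun _ _ _ _ _ => inCoords_zero _ _⟩

lemma mem_psi_sub_one (hA : A ∈ Psi n X k l) (hs : SymbolOf (k - l) l A 0) :
    A ∈ Psi n X (k - 1) l := by
  obtain ⟨h1, h2, h3⟩ := mem_psi_iff.1 hA
  refine mem_psi_iff.2 ⟨h1, fun e he φ ψ hφ hψ => ?_, h3⟩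
  obtain ⟨f, κ, hκ, hf⟩ := h2 e he φ ψ hφ hψ
  obtain ⟨f', hf'⟩ := hf.drop fun x ξ hξ => by
    rw [hs.apply h2 he hφ hψ ⟨κ, hκ, hf⟩ x ξ hξ, inCoords_zero, mul_zero]
  rw [sub_right_comm]
  exact ⟨f', κ, hκ, hf'⟩

/-! ## Composition of local kernels -/

lemma HasSym.compK_lRes (hF : HasSym r l F f) (hG : LRes l' G) (hg : Smooth g)
    (hgc : CSupp g) : LRes (l + l') (compK g F G) := by
  obtain ⟨a, S, M, hS, ha, hy, hs, hR, -⟩ := hF.exists_left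
  have hs' := hs.mono (subset_univ _) le_rfl
  exact ((LRes.qK_compK ha hy hs' hg hgc hG (l := l)).add (hR.compK hg hgc hG)).congr
    (compK_eq_sum_left hg hgc hF.smooth (qK_smooth l ha.contDiff hs) hG.smooth)

lemma LRes.compK_hasSym (hF : LRes l F) (hG : HasSym r l' G f) (hg : Smooth g)
    (hgc : CSupp g) : LRes (l + l') (TwoMicro.compK g F G) := by
  obtain ⟨-, a, -, S, -, M, -, hS, -, ha, -, hy, -, hs, -, hR, -⟩ := hG.exists_left_right
  have hs' := hs.mono (subset_univ _) le_rfl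
  have h1 := (LRes.qK_compK ha hy hs' hg hgc hF.swapK (l := l')).swapK
  rw [compK_swap, add_comm] at h1
  exact (h1.add (hF.compK hg hgc hR)).congr (compK_eq_sum_right hg hgc hF.smooth hG.smooth
    (swapK_smooth (qK_smooth l' ha.contDiff hs)))

/-- Multiplication by a function. -/
def mulOp (χ : smoothFn n X) : OpFamily n X := fun _ => LinearMap.mulLeft ℂ χ

lemma mulOp_apply (χ u : smoothFn n X) (h : Ioo (0 : ℝ) 1) :
    (A * mulOp χ * B) h u = A h (χ * B h u) := rfl

lemma IsLocalKernel.comp (hθ : IsCutoff e₁ θ) (hψ : IsCutoff e' ψ) (hg : Smooth g) (hgc : CSupp g)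
    (hg1 : ∀ z ∈ e₁ '' tsupport θ.1, g z = 1) (hA : IsLocalKernel A e e₁ φ θ κ) (hB : IsLocalKernel
    B e₁ e' χ ψ κ') : IsLocalKernel (A * mulOp (θ * χ) * B) e e' φ ψ (compK g κ κ') where
  smooth := compK_smooth hg hgc hA.smooth hB.smooth
  supp x y t h0 h1 hne := by
    obtain ⟨z, hz⟩ : ∃ z, κ (x, z, t) * g z * κ' (z, y, t) ≠ 0 := by
      by_contra! hall
      exact hne (by simp [compK, hall])
    exact ⟨(hA.supp x z t h0 h1 (left_ne_zero_of_mul (left_ne_zero_of_mul hz))).1,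
      (hB.supp z y t h0 h1 (right_ne_zero_of_mul hz)).2⟩
  eq t u p hp := by
    rw [mulOp_apply, mul_assoc θ, hA.eq t (χ * B t (ψ * u)) p hp]
    have h1 : ∀ z, κ (e p, z, t) * ((χ * B t (ψ * u) : smoothFn n X) : X → ℂ) (e₁.symm z) =
        ∫ y, κ (e p, z, t) * g z * κ' (z, y, t) * u.1 (e'.symm y) := by
      intro z
      by_cases hz : κ (e p, z, t) = 0
      · simp [hz]
      · have hz1 := (hA.supp _ _ _ t.2.1 t.2.2 hz).2
        have hz2 := hθ.image_subset hz1
        have h2 := hB.eq t u (e₁.symm z) (e₁.map_target hz2)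
        rw [e₁.right_inv hz2] at h2
        rw [hg1 z hz1]
        simp only [mul_one, mul_assoc]
        rw [integral_const_mul, ← h2]
        rfl
    have hK := hgc.isCompact.prod hψ.isCompact_image
    have hint : Integrable (fun w : E n × E n => κ (e p, w.1, t) * g w.1 * κ' (w.1, w.2, t) *
        u.1 (e'.symm w.2)) (volume.prod volume) := by
      refine (integrableOn_iff_integrable_of_support_subset (s := tsupport g ×ˢ
        (e' '' tsupport ψ.1)) fun w hw => ⟨subset_tsupport _ (right_ne_zero_of_mul
          (left_ne_zero_of_mul (left_ne_zero_of_mul hw))), (hB.supp _ _ _ t.2.1 t.2.2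
          (right_ne_zero_of_mul (left_ne_zero_of_mul hw))).2⟩).1
        (ContinuousOn.integrableOn_compact hK ?_)
      have c1 : Continuous fun w : E n × E n => κ (e p, w.1, t) :=
        hA.smooth.continuousOn.comp_continuous (by fun_prop) fun _ => mem_kernelDomain t.2.1 t.2.2
      have c2 : Continuous fun w : E n × E n => κ' (w.1, w.2, t) :=
        hB.smooth.continuousOn.comp_continuous (by fun_prop) fun _ => mem_kernelDomain t.2.1 t.2.2
      have c3 : ContinuousOn (fun w : E n × E n => u.1 (e'.symm w.2))
          (tsupport g ×ˢ (e' '' tsupport ψ.1)) :=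
        (contMDiff_coe u).continuous.comp_continuousOn (e'.continuousOn_symm.comp
          continuousOn_snd fun w hw => hψ.image_subset hw.2)
      exact ((c1.mul (hg.continuous.comp continuous_fst)).mul c2).continuousOn.mul c3
    simp only [h1]
    rw [integral_integral_swap hint]
    simp only [integral_mul_const]
    rfl

lemma exists_one_on (R : ℝ) {K : Set (E n)} (hK : IsCompact K) : ∃ g : E n → ℂ, Smooth g ∧
    CSupp g ∧ (∀ z ∈ K, g z = 1) ∧ ∀ z, ‖z‖ ≤ R → g z = 1 := by
  obtain ⟨C, hC⟩ := hK.isBounded.exists_norm_le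
  obtain ⟨g, h1, h2, h3, -⟩ := exists_contDiff_cutoff (Z := E n) (max C R)
  exact ⟨g, h1, h2, fun z hz => h3 z ((hC z hz).trans (le_max_left _ _)),
    fun z hz => h3 z (hz.trans (le_max_right _ _))⟩

lemma ResAt.comp (hθ : IsCutoff e₁ θ) (hψ : IsCutoff e' ψ) (hA : ResAt l A e e₁ φ θ)
    (hB : ResAt l' B e₁ e' χ ψ) : ResAt (l + l') (A * mulOp (θ * χ) * B) e e' φ ψ := by
  obtain ⟨κ, h1, h2⟩ := hA
  obtain ⟨κ', h1', h2'⟩ := hB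
  obtain ⟨g, hg, hgc, hg1, -⟩ := exists_one_on 0 hθ.isCompact_image
  exact ⟨_, h1.comp hθ hψ hg hgc hg1 h1', h2.compK hg hgc h2'⟩

lemma SymAt.comp_res (hθ : IsCutoff e θ) (hψ : IsCutoff e' ψ) (hA : SymAt r l A e φ θ f)
    (hB : ResAt l' B e e' χ ψ) : ResAt (l + l') (A * mulOp (θ * χ) * B) e e' φ ψ := by
  obtain ⟨κ, h1, h2⟩ := hA
  obtain ⟨κ', h1', h2'⟩ := hB
  obtain ⟨g, hg, hgc, hg1, -⟩ := exists_one_on 0 hθ.isCompact_image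
  exact ⟨_, h1.comp hθ hψ hg hgc hg1 h1', h2.compK_lRes h2' hg hgc⟩

lemma ResAt.comp_sym (hθ : IsCutoff e' θ) (hψ : IsCutoff e' ψ) (hA : ResAt l A e e' φ θ)
    (hB : SymAt r l' B e' χ ψ f) : ResAt (l + l') (A * mulOp (θ * χ) * B) e e' φ ψ := by
  obtain ⟨κ, h1, h2⟩ := hA
  obtain ⟨κ', h1', h2'⟩ := hB
  obtain ⟨g, hg, hgc, hg1, -⟩ := exists_one_on 0 hθ.isCompact_image
  exact ⟨_, h1.comp hθ hψ hg hgc hg1 h1', h2.compK_hasSym h2' hg hgc⟩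

lemma SymAt.comp (hχ : IsCutoff e χ) (hA : SymAt r l A e χ χ f) (hB : SymAt r' l' B e χ χ f') :
    SymAt (r + r') (l + l') (A * mulOp (χ * χ) * B) e χ χ fun p => f p * f' p := by
  obtain ⟨κ, h1, h2⟩ := hA
  obtain ⟨κ', h1', h2'⟩ := hB
  obtain ⟨R, hR⟩ := h2.comp h2'
  obtain ⟨g, hg, hgc, hg1, hgR⟩ := exists_one_on R hχ.isCompact_image
  exact ⟨_, h1.comp hχ hχ hg hgc hg1 h1', hR g hg hgc hgR⟩

lemma SymAt.commutator (hχ : IsCutoff e χ) (hA : SymAt r l A e χ χ f) (hB : SymAt r' l' B e χ χ f')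
    : SymAt (r + r' - 1) (l + l') (A * mulOp (χ * χ) * B + (-1 : ℂ) • (B * mulOp (χ * χ) * A)) e χ χ
    fun p => -I * poisson f f' p := by
  obtain ⟨κ, h1, h2⟩ := hA
  obtain ⟨κ', h1', h2'⟩ := hB
  obtain ⟨R, hR⟩ := h2.commutator h2'
  obtain ⟨g, hg, hgc, hg1, hgR⟩ := exists_one_on R hχ.isCompact_image
  exact ⟨_, (h1.comp hχ hχ hg hgc hg1 h1').add hχ ((h1'.comp hχ hχ hg hgc hg1 h1).smul (-1)),
    (hR g hg hgc hgR).congr fun q _ => by ring⟩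

/-! ## Partitions of unity and gluing -/

/-- A partition of unity by cutoffs. -/
lemma exists_partition (n : ℕ) (X : Type*) [TopologicalSpace X] [ChartedSpace (E n) X] [IsManifold
    𝓘(ℝ, E n) ∞ X] [T2Space X] [SecondCountableTopology X] : ∃ ρ : X → smoothFn n X, (∀ i, IsCutoff
    (chartAt (E n) i) (ρ i)) ∧ LocallyFinite (fun i => tsupport (ρ i).1) ∧ (∀ K : Set X, IsCompact K
    → ∃ s : Finset X, (∀ p ∈ K, ∑ i ∈ s, (ρ i).1 p = 1) ∧ ∀ i ∉ s, Disjoint (tsupport (ρ i).1) K) ∧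
    ∃ v : smoothFn n X, ∀ p, v.1 p * ∑ᶠ i, (ρ i).1 p * (ρ i).1 p = 1 := by
  have : LocallyCompactSpace X := ChartedSpace.locallyCompactSpace (E n) X
  have h1 : ∀ i : X, ∃ V : Set X, IsOpen V ∧ i ∈ V ∧ IsCompact (closure V) ∧
      closure V ⊆ (chartAt (E n) i).source := fun i => by
    obtain ⟨V, hV, hiV, hVs, hVc⟩ := exists_open_between_and_isCompact_closure
      (isCompact_singleton (x := i)) (chartAt (E n) i).open_source
      (singleton_subset_iff.2 (mem_chart_source (E n) i))
    exact ⟨V, hV, hiV rfl, hVc, hVs⟩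
  choose V hV hiV hVc hVs using h1
  obtain ⟨ρ, hρ⟩ := SmoothPartitionOfUnity.exists_isSubordinate 𝓘(ℝ, E n) isClosed_univ V hV
    fun i _ => mem_iUnion.2 ⟨i, hiV i⟩
  let σ : X → smoothFn n X := fun i => ⟨fun p => (ρ i p : ℂ),
    ofRealCLM.contDiff.contMDiff.comp (ρ i).contMDiff⟩
  have hσ : ∀ i, tsupport (σ i : X → ℂ) ⊆ tsupport (ρ i) := fun i =>
    closure_mono fun p hp h0 => hp (by simp [σ, show ρ i p = 0 from h0])
  have hlf : LocallyFinite fun i => tsupport (σ i : X → ℂ) :=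
    ρ.locallyFinite.closure.subset hσ
  refine ⟨σ, fun i => ⟨(hVc i).of_isClosed_subset (isClosed_tsupport _) ((hσ i).trans
    ((hρ i).trans subset_closure)), (hσ i).trans ((hρ i).trans (subset_closure.trans (hVs i)))⟩,
    hlf, fun K hK => ⟨(hlf.finite_nonempty_inter_compact hK).toFinset, fun p hp => ?_,
      fun i hi => ?_⟩, ?_⟩
  · have h2 := ρ.sum_eq_one (mem_univ p)
    rw [finsum_eq_sum_of_support_subset] at h2
    · change ∑ i ∈ _, ((ρ i p : ℝ) : ℂ) = 1
      rw [← Complex.ofReal_sum, h2, ofReal_one]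
    · intro i hi
      simp only [Finite.coe_toFinset, mem_ofPred_eq]
      exact ⟨p, subset_tsupport _ (ofReal_ne_zero.2 hi), hp⟩
  · simp only [Finite.mem_toFinset, mem_ofPred_eq, not_nonempty_iff_eq_empty] at hi
    exact disjoint_iff_inter_eq_empty.2 hi
  · have hfin : ∀ p, Function.HasFiniteSupport fun i => ρ i p * ρ i p := fun p =>
      (ρ.locallyFinite.point_finite p).subset fun i hi => left_ne_zero_of_mul hi
    have hq : ContMDiff 𝓘(ℝ, E n) 𝓘(ℝ, ℝ) ∞ fun p => ∑ᶠ i, ρ i p * ρ i p :=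
      contMDiff_finsum (fun i => (ρ i).contMDiff.mul (ρ i).contMDiff)
        (ρ.locallyFinite.subset fun i p hp => left_ne_zero_of_mul hp)
    have hpos : ∀ p, ∑ᶠ i, ρ i p * ρ i p ≠ 0 := fun p => by
      obtain ⟨i, hi⟩ := ρ.exists_pos_of_mem (mem_univ p)
      exact (finsum_pos (f := fun i => ρ i p * ρ i p) (fun i => mul_self_nonneg _) ⟨i, mul_pos hi hi⟩ (hfin p)).ne'
    refine ⟨⟨fun p => ((∑ᶠ i, ρ i p * ρ i p : ℝ)⁻¹ : ℝ),
      ofRealCLM.contDiff.contMDiff.comp (hq.inv₀ hpos)⟩, fun p => ?_⟩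
    have h2 := Complex.ofRealHom.toAddMonoidHom.map_finsum (hfin p)
    simp only [RingHom.toAddMonoidHom_eq_coe, AddMonoidHom.coe_coe, Complex.ofRealHom_eq_coe,
      ofReal_mul] at h2
    change ((_ : ℝ) : ℂ) * ∑ᶠ i, (ρ i p : ℂ) * (ρ i p : ℂ) = 1
    rw [← h2, ← ofReal_mul, inv_mul_cancel₀ (hpos p), ofReal_one]

lemma ResAt.add (hψ : IsCutoff e' ψ) (hA : ResAt l A e e' φ ψ) (hB : ResAt l B e e' φ ψ) :
    ResAt l (A + B) e e' φ ψ :=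
  let ⟨_, h1, h2⟩ := hA
  let ⟨_, h1', h2'⟩ := hB
  ⟨_, h1.add hψ h1', h2.add h2'⟩

lemma ResAt.smul (z : ℂ) (hA : ResAt l A e e' φ ψ) : ResAt l (z • A) e e' φ ψ :=
  let ⟨_, h1, h2⟩ := hA
  ⟨_, h1.smul z, h2.const_mul z⟩

lemma ResAt.sum {ι : Type*} (s : Finset ι) {C : ι → OpFamily n X} (hψ : IsCutoff e' ψ)
    (h : ∀ i ∈ s, ResAt l (C i) e e' φ ψ) : ResAt l (∑ i ∈ s, C i) e e' φ ψ := by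
  classical
  induction s using Finset.induction_on with
  | empty => exact ⟨_, IsLocalKernel.zero e e' φ ψ, LRes.zero l⟩
  | insert i s hi ih =>
    rw [Finset.sum_insert hi]
    exact (h i (Finset.mem_insert_self _ _)).add hψ
      (ih fun j hj => h j (Finset.mem_insert_of_mem hj))

/-- Being residual is local in `h`. -/
lemma ResAt.of_local (he' : IsChart e') (hφ : IsCutoff e φ) (hψ : IsCutoff e' ψ) (H : ∀ h₀ < (1 :
    ℝ), ∃ C, ResAt l C e e' φ ψ ∧ ∀ h : Ioo (0 : ℝ) 1, (h : ℝ) ≤ h₀ → ∀ (u : smoothFn n X) (p : X),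
    φ.1 p * (C h (ψ * u)).1 p = φ.1 p * (A h (ψ * u)).1 p) : ResAt l A e e' φ ψ := by
  choose C hC hCA using H
  choose K hK hR using hC
  let top : ℝ → ℝ := fun h => if h < 1 then (1 + h) / 2 else 0
  have htop : ∀ h, top h < 1 := fun h => by
    simp only [top]; split_ifs <;> linarith
  have hle : ∀ h < 1, h ≤ top h := fun h hh => by
    simp only [top, if_pos hh]; linarith
  let κ : Krn n := fun q => K (top q.2.2) (htop _) q
  have hκ : ∀ h₀ (h1 : h₀ < 1) (x y : E n) (h : Ioo (0 : ℝ) 1), (h : ℝ) ≤ h₀ →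
      κ (x, y, h) = K h₀ h1 (x, y, h) := fun h₀ h1 x y h hh =>
    (hK _ (htop h)).unique_at he' hφ hφ hψ hψ (hK h₀ h1) h (fun u p => by
      rw [hCA _ _ h (hle h h.2.2), hCA _ _ h hh]) x y
  have hs : SmoothOn κ (KD n) := by
    rintro ⟨x, y, h⟩ hq
    have h1 := hle h hq.2.2.2
    have h2 : h < top (top h) := (hle _ (htop h)).trans_lt' (by
      simp only [top, if_pos hq.2.2.2]; linarith [hq.2.2.2])
    refine (((hK _ (htop (top h))).smooth.contDiffAt (isOpen_kernelDomain.mem_nhds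
      hq)).congr_of_eventuallyEq ?_).contDiffWithinAt
    filter_upwards [isOpen_kernelDomain.mem_nhds hq, (isOpen_lt (continuous_snd.comp
      continuous_snd) continuous_const).mem_nhds (show (x, y, h).2.2 < top (top h) from h2)]
      with q hq' hlt
    exact hκ _ _ q.1 q.2.1 ⟨q.2.2, hq'.2.2⟩ (le_of_lt hlt)
  refine ⟨κ, ⟨hs, fun x y h h0 h1 hne => (hK _ _).supp x y h h0 h1 hne, fun h u p hp => ?_⟩,
    (hR (1 / 2) (by norm_num)).congr_small hs ⟨1 / 2, by norm_num, fun x y h hh => ?_⟩⟩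
  · rw [← hCA (top h) (htop h) h (hle h h.2.2), (hK _ (htop h)).eq h u p hp]
  · exact (hκ _ _ x y ⟨h, hh.1, hh.2.trans (by norm_num)⟩ hh.2.le).symm

/-! ## Products -/

lemma mulOp_sum {ι : Type*} (s : Finset ι) (c : ι → smoothFn n X) :
    A * mulOp (∑ i ∈ s, c i) * B = ∑ i ∈ s, A * mulOp (c i) * B := by
  have : mulOp (∑ i ∈ s, c i) = ∑ i ∈ s, mulOp (c i) := by
    funext h
    rw [Finset.sum_apply]
    exact map_sum (LinearMap.mul ℂ (smoothFn n X)) c s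
  rw [this, Finset.mul_sum, Finset.sum_mul]

lemma disjoint_of_eventually_zero {S : Set X} (h : ∀ x ∈ S, ∀ᶠ y in 𝓝 x, θ.1 y = 0) :
    Disjoint (tsupport θ.1) S :=
  Set.disjoint_right.2 fun x hx => notMem_tsupport_iff_eventuallyEq.2 (h x hx)

lemma resAt_middle_of_compact (he : IsChart e) (he' : IsChart e') (hA : IsResidualOff l A) (hB :
    IsResidualOff l' B) (hφ : IsCutoff e φ) (hψ : IsCutoff e' ψ) (hθ : CSupp θ.1) (h1 : Disjoint
    (tsupport θ.1) (tsupport φ.1)) (h2 : Disjoint (tsupport θ.1) (tsupport ψ.1)) : ResAt (l + l') (A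
    * mulOp θ * B) e e' φ ψ := by
  obtain ⟨ρ, hρ, -, hK, -⟩ := exists_partition n X
  obtain ⟨s, hs, -⟩ := hK _ hθ.isCompact
  have h3 : θ = ∑ i ∈ s, ρ i * θ := by
    rw [← Finset.sum_mul]
    refine (mul_eq_of_eq_one fun x hx => ?_).symm
    rw [AddSubmonoidClass.coe_finsetSum, Finset.sum_apply]
    exact hs x hx
  rw [h3, mulOp_sum]
  refine .sum s hψ fun i _ => ?_
  have hc := (hρ i).mul_right θ
  have hsub := tsupport_mul_right (ρ i) θ
  obtain ⟨χ, hχ, hχU, hχ1⟩ := exists_isCutoff (e := chartAt (E n) i) hc.1.isCompact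
    ((chartAt (E n) i).open_source.inter (isClosed_tsupport ψ.1).isOpen_compl)
    (subset_inter hc.2 fun x hx => Set.disjoint_left.1 h2 (hsub hx)) inter_subset_left
  have h4 := ResAt.comp hc hψ (hA _ _ he (isChart_chartAt i) φ _ hφ hc (h1.mono_left hsub).symm)
    (hB _ _ (isChart_chartAt i) he' χ ψ hχ hψ
      (Set.disjoint_left.2 fun x hx => (hχU hx).2))
  rwa [mul_comm _ χ, mul_eq_of_eq_one fun x hx => (hχ1 x hx).self_of_nhds] at h4

lemma resAt_middle (he : IsChart e) (he' : IsChart e') (hp : ProperlySupported A) (hA :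
    IsResidualOff l A) (hB : IsResidualOff l' B) (hφ : IsCutoff e φ) (hψ : IsCutoff e' ψ) (h1 : ∀ x
    ∈ tsupport φ.1, ∀ᶠ y in 𝓝 x, θ.1 y = 0) (h2 : ∀ x ∈ tsupport ψ.1, ∀ᶠ y in 𝓝 x, θ.1 y = 0) :
    ResAt (l + l') (A * mulOp θ * B) e e' φ ψ := by
  refine .of_local he' hφ hψ fun h₀ hh₀ => ?_
  obtain ⟨K, hK, hAK⟩ := hp _ hφ.1.isCompact h₀ hh₀
  obtain ⟨η, hη, -, hη1⟩ := exists_cutoff (n := n) hK isOpen_univ (subset_univ K)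
  have hs := tsupport_mul_right η θ
  refine ⟨A * mulOp (η * θ) * B, resAt_middle_of_compact he he' hA hB hφ hψ
    (hη.isCompact.of_isClosed_subset (isClosed_tsupport _) (tsupport_mul_left η θ))
    ((disjoint_of_eventually_zero h1).mono_left hs)
    ((disjoint_of_eventually_zero h2).mono_left hs), fun h hh u p => ?_⟩
  rw [mulOp_apply, mulOp_apply]
  by_cases hp : φ.1 p = 0
  · rw [hp, zero_mul, zero_mul]
  congr 1
  have h3 := (hAK h hh (η * θ * B h (ψ * u) - θ * B h (ψ * u))).2 (fun x hx => by
    simp [(hη1 x hx).self_of_nhds]) p (subset_tsupport _ hp)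
  rw [map_sub] at h3
  exact sub_eq_zero.1 h3

lemma ProperlySupported.mul (hA : ProperlySupported A) (hB : ProperlySupported B) :
    ProperlySupported (A * B) := by
  intro K hK h₀ h1
  obtain ⟨K₁, hK₁, H₁⟩ := hB K hK h₀ h1
  obtain ⟨K₂, hK₂, H₂⟩ := hA K₁ hK₁ h₀ h1
  obtain ⟨K₃, hK₃, H₃⟩ := hA K hK h₀ h1
  obtain ⟨K₄, hK₄, H₄⟩ := hB K₃ hK₃ h₀ h1
  exact ⟨K₂ ∪ K₄, hK₂.union hK₄, fun h hh u =>
    ⟨fun hu x hx => (H₂ h hh _).1 ((H₁ h hh u).1 hu) x fun h => hx (Or.inl h),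
      (H₃ h hh _).2 ∘ fun hu => (H₄ h hh u).2 fun x hx => hu x (Or.inr hx)⟩⟩

lemma mul_eq_add_mulOp (χ : smoothFn n X) : A * B = A * mulOp χ * B + A * mulOp (1 - χ) * B := by
  have : mulOp χ + mulOp (1 - χ) = (1 : OpFamily n X) := by
    funext h
    refine LinearMap.ext fun u => ?_
    change χ * u + (1 - χ) * u = u
    ring
  rw [← add_mul, ← mul_add, this, mul_one]

lemma IsResidualOff.mul (hp : ProperlySupported A) (hA : IsSymbolic r l A) (hA' : IsResidualOff l A)
    (hB : IsSymbolic r' l' B) (hB' : IsResidualOff l' B) : IsResidualOff (l + l') (A * B) := by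
  intro e e' he he' φ ψ hφ hψ hd
  obtain ⟨α, hα, hαU, hα1⟩ := exists_isCutoff (e := e) hφ.1.isCompact
    (e.open_source.inter (isClosed_tsupport ψ.1).isOpen_compl)
    (subset_inter hφ.2 fun x hx => Set.disjoint_left.1 hd hx) inter_subset_left
  obtain ⟨β, hβ, hβU, hβ1⟩ := exists_isCutoff (e := e') hψ.1.isCompact
    (e'.open_source.inter (isClosed_tsupport φ.1).isOpen_compl)
    (subset_inter hψ.2 fun x hx => Set.disjoint_right.1 hd hx) inter_subset_left
  rw [mul_eq_add_mulOp (α * α), show (1 - α * α : smoothFn n X) = ∑ i : Fin 2,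
    ![β * β, 1 - α * α - β * β] i by simp, mulOp_sum, Fin.sum_univ_two]
  obtain ⟨f, hf⟩ := hA e he φ α hφ hα
  obtain ⟨f', hf'⟩ := hB e' he' β ψ hβ hψ
  have dα : Disjoint (tsupport α.1) (tsupport ψ.1) :=
    Set.disjoint_left.2 fun x hx => (hαU hx).2
  have dβ : Disjoint (tsupport β.1) (tsupport φ.1) :=
    Set.disjoint_left.2 fun x hx => (hβU hx).2
  refine (hf.comp_res hα hψ (hB' e e' he he' α ψ hα hψ dα)).add hψ
    (((hA' e e' he he' φ β hφ hβ dβ.symm).comp_sym hβ hψ hf').add hψ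
      (resAt_middle he he' hp hA' hB' hφ hψ (fun x hx => ?_) fun x hx => ?_))
  · filter_upwards [hα1 x hx, notMem_tsupport_iff_eventuallyEq.1 (Set.disjoint_right.1 dβ hx)]
      with y h1 h2
    simp [h1, h2]
  · filter_upwards [hβ1 x hx, notMem_tsupport_iff_eventuallyEq.1 (Set.disjoint_right.1 dα hx)]
      with y h1 h2
    simp [h1, h2]

lemma resAt_one_sub (he : IsChart e) (hp : ProperlySupported A) (hA : IsResidualOff l A) (hB :
    IsResidualOff l' B) (hφ : IsCutoff e φ) (hψ : IsCutoff e ψ) (h1 : ∀ x ∈ tsupport φ.1 ∪ tsupport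
    ψ.1, ∀ᶠ y in 𝓝 x, χ.1 y = 1) : ResAt (l + l') (A * mulOp (1 - χ * χ) * B) e e φ ψ := by
  have h2 : ∀ x ∈ tsupport φ.1 ∪ tsupport ψ.1,
      ∀ᶠ y in 𝓝 x, ((1 - χ * χ : smoothFn n X) : X → ℂ) y = 0 := fun x hx => by
    filter_upwards [h1 x hx] with y hy
    simp [hy]
  exact resAt_middle he he hp hA hB hφ hψ (fun x hx => h2 x (Or.inl hx)) fun x hx => h2 x (Or.inr hx)

section

variable (he : IsChart e) (hpA : ProperlySupported A) (hpB : ProperlySupported B)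
  (hA : IsResidualOff l A) (hB : IsResidualOff l' B) (hφ : IsCutoff e φ) (hψ : IsCutoff e ψ)
  (hχ : IsCutoff e χ)
  (h1 : ∀ x ∈ tsupport φ.1 ∪ tsupport ψ.1, ∀ᶠ y in 𝓝 x, χ.1 y = 1)
  (hf : SymAt r l A e χ χ f) (hf' : SymAt r' l' B e χ χ f')

lemma SymAt.add_res (hψ : IsCutoff e ψ) (h : SymAt r l A e φ ψ f) (h' : ResAt l B e e φ ψ) :
    SymAt r l (A + B) e φ ψ f := by
  simpa only [add_zero] using h.add hψ h'.symAt

include he hpA hA hB hφ hψ hχ h1 hf hf' in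
lemma SymAt.mul : SymAt (r + r') (l + l') (A * B) e φ ψ fun p =>
    (extE e φ.1 p.1 * extE e ψ.1 p.1) * (f p * f' p) := by
  have m1 : χ * φ = φ := mul_eq_of_eq_one fun x hx => (h1 x (Or.inl hx)).self_of_nhds
  have m2 : χ * ψ = ψ := mul_eq_of_eq_one fun x hx => (h1 x (Or.inr hx)).self_of_nhds
  rw [mul_eq_add_mulOp (χ * χ)]
  exact ((hf.comp hχ hf').restrict he hφ hψ hχ (by rw [mul_comm, m1]) m2).add_res hψ
    (resAt_one_sub he hpA hA hB hφ hψ h1)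

include he hpA hpB hA hB hφ hψ hχ h1 hf hf' in
lemma SymAt.bracket : SymAt (r + r' - 1) (l + l') (I • (A * B - B * A)) e φ ψ fun p =>
    (extE e φ.1 p.1 * extE e ψ.1 p.1) * poisson f f' p := by
  have m1 : χ * φ = φ := mul_eq_of_eq_one fun x hx => (h1 x (Or.inl hx)).self_of_nhds
  have m2 : χ * ψ = ψ := mul_eq_of_eq_one fun x hx => (h1 x (Or.inr hx)).self_of_nhds
  have h2 := (resAt_one_sub he hpB hB hA hφ hψ h1).smul (-1)
  rw [add_comm l' l] at h2
  have h3 := (((hf.commutator hχ hf').restrict he hφ hψ hχ (by rw [mul_comm, m1]) m2).add_res hψ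
    ((resAt_one_sub he hpA hA hB hφ hψ h1).add hψ h2)).smul I
  have e1 : A * B - B * A = A * mulOp (χ * χ) * B + (-1 : ℂ) • (B * mulOp (χ * χ) * A) +
      (A * mulOp (1 - χ * χ) * B + (-1 : ℂ) • (B * mulOp (1 - χ * χ) * A)) := by
    have hn : ∀ C : OpFamily n X, (-1 : ℂ) • C = -C := fun C => neg_one_smul ℂ C
    rw [mul_eq_add_mulOp (A := A) (χ * χ), mul_eq_add_mulOp (A := B) (χ * χ), hn, hn]
    abel
  rw [e1]
  convert h3 using 2 with p
  linear_combination (extE e φ.1 p.1 * extE e ψ.1 p.1 * poisson f f' p) *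
    I_mul_I

end

/-! ## Products and commutators of operators -/

/-- A large cutoff in a chart. -/
lemma exists_large_cutoff (hφ : IsCutoff e φ) (hψ : IsCutoff e ψ) : ∃ χ : smoothFn n X,
    IsCutoff e χ ∧ ∀ x ∈ tsupport φ.1 ∪ tsupport ψ.1, ∀ᶠ y in 𝓝 x, χ.1 y = 1 :=
  let ⟨χ, h1, _, h3⟩ := exists_isCutoff (e := e) (hφ.1.isCompact.union hψ.1.isCompact)
    e.open_source (union_subset hφ.2 hψ.2) subset_rfl
  ⟨χ, h1, h3⟩

lemma mem_tsupport_of_eventually {x : X} (h : ∀ᶠ y in 𝓝 x, φ.1 y = 1) : x ∈ tsupport φ.1 :=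
  subset_tsupport _ fun h0 => one_ne_zero (h.self_of_nhds.symm.trans h0)

theorem mul_mem_psi (hA : A ∈ Psi n X k l) (hB : B ∈ Psi n X k' l') :
    A * B ∈ Psi n X (k + k') (l + l') := by
  obtain ⟨a1, a2, a3⟩ := mem_psi_iff.1 hA
  obtain ⟨b1, b2, b3⟩ := mem_psi_iff.1 hB
  refine mem_psi_iff.2 ⟨a1.mul b1, fun e he φ ψ hφ hψ => ?_, a3.mul a1 a2 b2 b3⟩
  obtain ⟨χ, hχ, h1⟩ := exists_large_cutoff hφ hψ
  obtain ⟨f, hf⟩ := a2 e he χ χ hχ hχ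
  obtain ⟨f', hf'⟩ := b2 e he χ χ hχ hχ
  rw [add_sub_add_comm]
  exact ⟨_, SymAt.mul he a1 a3 b3 hφ hψ hχ h1 hf hf'⟩

theorem SymbolOf.mul (hA : A ∈ Psi n X k l) (hB : B ∈ Psi n X k' l') (hs : SymbolOf (k - l) l A s)
    (ht : SymbolOf (k' - l') l' B t) : SymbolOf (k + k' - (l + l')) (l + l') (A * B) (s * t) := by
  obtain ⟨a1, a2, a3⟩ := mem_psi_iff.1 hA
  obtain ⟨b1, b2, b3⟩ := mem_psi_iff.1 hB
  rw [add_sub_add_comm]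
  refine .of_forall fun e he φ hφ => ?_
  obtain ⟨χ, hχ, h1⟩ := exists_large_cutoff hφ hφ
  obtain ⟨f, hf⟩ := a2 e he χ χ hχ hχ
  obtain ⟨f', hf'⟩ := b2 e he χ χ hχ hχ
  refine ⟨_, SymAt.mul he a1 a3 b3 hφ hφ hχ h1 hf hf', fun x hx hφ1 ξ hξ => ?_⟩
  have hχ1 := h1 _ (Or.inl (mem_tsupport_of_eventually hφ1))
  obtain ⟨P, -, hP⟩ := exists_inCoords_eq he hx hξ
  simp only [extE_apply hx, hφ1.self_of_nhds, one_mul, ← hs e he χ hχ f hf x hx hχ1 ξ hξ,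
    ← ht e he χ hχ f' hf' x hx hχ1 ξ hξ, hP, Pi.mul_apply]

theorem commutator_mem_psi (hA : A ∈ Psi n X k l) (hB : B ∈ Psi n X k' l') :
    I • (A * B - B * A) ∈ Psi n X (k + k' - 1) (l + l') := by
  obtain ⟨a1, a2, a3⟩ := mem_psi_iff.1 hA
  obtain ⟨b1, b2, b3⟩ := mem_psi_iff.1 hB
  have e1 : A * B - B * A = A * B + (-1 : ℂ) • (B * A) := by
    have hn : (-1 : ℂ) • (B * A) = -(B * A) := neg_one_smul ℂ (B * A)
    rw [hn]; abel
  refine mem_psi_iff.2 ⟨e1 ▸ ((a1.mul b1).add ((b1.mul a1).smul _)).smul _,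
    fun e he φ ψ hφ hψ => ?_, fun e e' he he' φ ψ hφ hψ hd => e1 ▸ ((a3.mul a1 a2 b2 b3 e e' he
      he' φ ψ hφ hψ hd).add hψ (ResAt.smul (-1) (add_comm l l' ▸ b3.mul b1 b2 a2 a3 e e' he he'
        φ ψ hφ hψ hd))).smul _⟩
  obtain ⟨χ, hχ, h1⟩ := exists_large_cutoff hφ hψ
  obtain ⟨f, hf⟩ := a2 e he χ χ hχ hχ
  obtain ⟨f', hf'⟩ := b2 e he χ χ hχ hχ
  rw [sub_right_comm, add_sub_add_comm]
  exact ⟨_, SymAt.bracket he a1 b1 a3 b3 hφ hψ hχ h1 hf hf'⟩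

theorem SymbolOf.commutator (hA : A ∈ Psi n X k l) (hB : B ∈ Psi n X k' l') (hs : SymbolOf (k - l) l
    A s) (ht : SymbolOf (k' - l') l' B t) {u : PuncturedCotangent n X → ℂ} (hu : SymbolOf (k + k' -
    1 - (l + l')) (l + l') (I • (A * B - B * A)) u) : IsPoissonBracket s t u := by
  obtain ⟨a1, a2, a3⟩ := mem_psi_iff.1 hA
  obtain ⟨b1, b2, b3⟩ := mem_psi_iff.1 hB
  intro e he x hx ξ hξ
  obtain ⟨φ, hφ, hφ1⟩ := exists_isCutoff_point (n := n) (e.map_target hx)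
  obtain ⟨χ, hχ, h1⟩ := exists_large_cutoff hφ hφ
  obtain ⟨f, hf⟩ := a2 e he χ χ hχ hχ
  obtain ⟨f', hf'⟩ := b2 e he χ χ hχ hχ
  have hb := SymAt.bracket he a1 b1 a3 b3 hφ hφ hχ h1 hf hf'
  rw [sub_right_comm, add_sub_add_comm] at hu
  rw [hu e he φ hφ _ hb x hx hφ1 ξ hξ]
  have key : ∀ᶠ q in 𝓝 (x, ξ), q.1 ∈ e.target ∧ (∀ᶠ p in 𝓝 (e.symm q.1), χ.1 p = 1) ∧ q.2 ≠ 0 := by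
    refine ((continuous_fst.tendsto (x, ξ)).eventually (e.open_target.mem_nhds hx)).and
      (((continuous_fst.tendsto (x, ξ)).eventually
        (p := fun y => ∀ᶠ p in 𝓝 (e.symm y), χ.1 p = 1) ?_).and
        ((continuous_snd.tendsto (x, ξ)).eventually (isOpen_ne.mem_nhds hξ)))
    exact (e.continuousAt_symm hx).eventually
      (h1 _ (Or.inl (mem_tsupport_of_eventually hφ1))).eventually_nhds
  have k1 : inCoords e s =ᶠ[𝓝 (x, ξ)] f := by
    filter_upwards [key] with q hq using hs e he χ hχ f hf q.1 hq.1 hq.2.1 q.2 hq.2.2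
  have k2 : inCoords e t =ᶠ[𝓝 (x, ξ)] f' := by
    filter_upwards [key] with q hq using ht e he χ hχ f' hf' q.1 hq.1 hq.2.1 q.2 hq.2.2
  simp only [extE_apply hx, hφ1.self_of_nhds, one_mul, poisson, k1.fderiv_eq, k2.fderiv_eq]

/-! ## Operators with a given kernel in charts -/

/-- The operator with kernel `φ F ψ` in the charts `e`, `e'`. -/
def IsKernelOp (D : OpFamily n X) (e e' : OpenPartialHomeomorph X (E n)) (φ ψ : smoothFn n X)
    (F : Krn n) : Prop :=
  ∀ (h : Ioo (0 : ℝ) 1) (u : smoothFn n X) (p : X),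
    (D h u).1 p = φ.1 p * ∫ y, F (e p, y, h) * extE e' (ψ * u).1 y

lemma exists_kernelOp (he : IsChart e) (he' : IsChart e') (hφ : IsCutoff e φ) (hψ : IsCutoff e' ψ)
    (hF : SmoothOn F (KD n)) : ∃ D, IsKernelOp D e e' φ ψ F := by
  have hψu : ∀ u, IsCutoff e' (ψ * u) := hψ.mul_right
  let G : Ioo (0 : ℝ) 1 → smoothFn n X → E n → ℂ := fun h u x =>
    extE e φ.1 x * ∫ y, F (x, y, h) * extE e' (ψ * u).1 y
  have hG : ∀ h u, Smooth (G h u) := fun h u => by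
    have h1 := compK_smooth ((hψu u).contDiff_extE he') (hψu u).hasCompactSupport_extE hF
      (contDiffOn_const (c := (1 : ℂ)))
    have h2 := h1.comp (f := fun x : E n => (x, (0 : E n), (h : ℝ))) (s := univ) (by fun_prop)
      fun x _ => mem_kernelDomain h.2.1 h.2.2
    simp only [Function.comp_def, compK, mul_one] at h2
    exact (hφ.contDiff_extE he).mul (contDiffOn_univ.1 h2)
  have hs : ∀ h u, tsupport (G h u) ⊆ tsupport (extE e φ.1) := fun h u =>
    closure_mono fun x hx => left_ne_zero_of_mul hx
  have key : ∀ h u p, extX e (G h u) p = φ.1 p * ∫ y, F (e p, y, h) * extE e' (ψ * u).1 y := by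
    intro h u p
    by_cases hp : p ∈ e.source
    · rw [extX_apply hp]; simp only [G, extE_map hp]
    · rw [extX, if_neg hp, show φ.1 p = 0 from
        by_contra fun h0 => hp (hφ.2 (subset_tsupport _ h0)), zero_mul]
  have hi : ∀ (h : Ioo (0 : ℝ) 1) u x, Integrable fun y => F (x, y, h) * extE e' (ψ * u).1 y :=
    fun h u x => by
      have h1 := compK_integrable ((hψu u).contDiff_extE he') (hψu u).hasCompactSupport_extE hF
        (contDiffOn_const (c := (1 : ℂ))) (mem_kernelDomain (x := x) (y := 0) h.2.1 h.2.2)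
      simpa only [mul_one] using h1
  refine ⟨fun h => ⟨⟨fun u => ⟨extX e (G h u), contMDiff_extX he (hG h u)
    (hφ.hasCompactSupport_extE.of_isClosed_subset (isClosed_tsupport _) (hs h u))
    ((hs h u).trans (hφ.tsupport_extE.trans hφ.image_subset))⟩, fun u v => Subtype.ext (funext
      fun p => ?_)⟩, fun z u => Subtype.ext (funext fun p => ?_)⟩, fun h u p => key h u p⟩
  · change extX e (G h (u + v)) p = extX e (G h u) p + extX e (G h v) p
    rw [key, key, key, ← mul_add, ← integral_add (hi h u _) (hi h v _)]
    congr 2; funext y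
    rw [← mul_add]
    congr 1
    by_cases hy : y ∈ e'.target
    · simp only [extE_apply hy]; exact mul_add _ _ _
    · simp [extE, hy]
  · change extX e (G h (z • u)) p = z * extX e (G h u) p
    rw [key, key, mul_left_comm z, ← integral_const_mul z]
    congr 2; funext y
    rw [mul_left_comm]
    congr 1
    by_cases hy : y ∈ e'.target
    · simp only [extE_apply hy]; exact mul_left_comm _ _ _
    · simp [extE, hy]

lemma IsKernelOp.isLocalKernel (hD : IsKernelOp D e e' φ ψ F) (he : IsChart e) (he' : IsChart e')
    (hφ : IsCutoff e φ) (hψ : IsCutoff e' ψ) (hF : SmoothOn F (KD n)) (h1 : χ * φ = φ) (h2 : χ' * ψ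
    = ψ) : IsLocalKernel D e e' χ χ' fun q => (extE e φ.1 q.1 * extE e' ψ.1 q.2.1) * F q where
  smooth := ((extE_prod_contDiff he he' hφ hψ).comp (g := fun p : E n × E n =>
    extE e φ.1 p.1 * extE e' ψ.1 p.2) (f := fun q : KPt n => (q.1, q.2.1))
    (by fun_prop)).contDiffOn.mul hF
  supp x y t h0 ht hne := ⟨image_mono (tsupport_subset_of_mul_eq h1) (extE_ne_zero_mem
    (left_ne_zero_of_mul (left_ne_zero_of_mul hne))), image_mono (tsupport_subset_of_mul_eq h2)
    (extE_ne_zero_mem (right_ne_zero_of_mul (left_ne_zero_of_mul hne)))⟩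
  eq h u p hp := by
    have h3 : χ.1 p * φ.1 p = φ.1 p := congrFun (congrArg Subtype.val h1) p
    rw [hD, ← mul_assoc (χ.1 p), h3, ← mul_assoc ψ, mul_comm ψ, h2, ← integral_const_mul]
    congr 1; funext y
    by_cases hy : y ∈ e'.target
    · simp only [extE_map hp, extE_apply hy, MulMemClass.coe_mul, Pi.mul_apply]; ring
    · simp [extE, hy]

section
variable (he₀ : IsChart e₀) (hρ : IsCutoff e₀ ρ) (hF : HasSym r l F f)
  (hD : IsKernelOp D e₀ e₀ ρ ρ F)

include hD in
lemma IsKernelOp.apply_eq_zero (h : Ioo (0 : ℝ) 1) (hu : ρ * u = 0) : D h u = 0 := by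
  refine Subtype.ext (funext fun p => ?_)
  rw [hD, hu]
  simp [extE]

include hρ hD in
lemma IsKernelOp.properlySupported : ProperlySupported D := fun _ _ _ _ =>
  ⟨_, hρ.1, fun h _ u => ⟨fun _ x hx => by rw [hD, image_eq_zero_of_notMem_tsupport hx, zero_mul],
    fun hu x _ => by
      rw [IsKernelOp.apply_eq_zero hD h]
      · rfl
      · refine Subtype.ext (funext fun y => ?_)
        by_cases hy : y ∈ tsupport ρ.1
        · simp [hu y hy]
        · simp [image_eq_zero_of_notMem_tsupport hy]⟩⟩

include he₀ hρ hF hD in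
/-- An operator given by a kernel in a chart is pseudodifferential. -/
lemma IsKernelOp.exists_cutoffs : ∃ η η' : smoothFn n X, IsCutoff e₀ η ∧ IsCutoff e₀ η' ∧ (∀ x ∈
    tsupport ρ.1, ∀ᶠ y in 𝓝 x, η'.1 y = 1) ∧ η' * η = η ∧ (SymAt r l D e₀ η' η' fun p => (extE e₀
    ρ.1 p.1 * extE e₀ ρ.1 p.1) * f p) ∧ ∀ (φ ψ : smoothFn n X) (h : Ioo (0 : ℝ) 1) (u : smoothFn n
    X) (p : X), φ.1 p * (D h (ψ * u)).1 p = (φ * η).1 p * (D h ((η * ψ) * u)).1 p := by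
  obtain ⟨η, hη, h1⟩ := exists_large_cutoff hρ hρ
  obtain ⟨η', hη', h2⟩ := exists_large_cutoff hη hη
  have m1 : η * ρ = ρ := mul_eq_of_eq_one fun x hx => (h1 x (Or.inl hx)).self_of_nhds
  have m2 : η' * η = η := mul_eq_of_eq_one fun x hx => (h2 x (Or.inl hx)).self_of_nhds
  have m3 : η' * ρ = ρ := by rw [← m1, ← mul_assoc, m2]
  refine ⟨η, η', hη, hη', fun x hx => h2 x (Or.inl (tsupport_subset_of_mul_eq m1 hx)), m2,
    ⟨_, hD.isLocalKernel he₀ he₀ hρ hρ hF.smooth m3 m3,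
      hF.mul_contDiff (extE_prod_contDiff he₀ he₀ hρ hρ)⟩, fun φ ψ h u p => ?_⟩
  have h3 : η.1 p * ρ.1 p = ρ.1 p := congrFun (congrArg Subtype.val m1) p
  rw [hD, hD, ← mul_assoc ρ, ← mul_assoc ρ, ← mul_assoc ρ, mul_comm ρ η, m1]
  simp only [MulMemClass.coe_mul, Pi.mul_apply]
  rw [mul_assoc (φ.1 p), ← mul_assoc (η.1 p), h3]

include he₀ hρ hF hD in
lemma IsKernelOp.isSymbolic : IsSymbolic r l D := by
  obtain ⟨η, η', hη, hη', -, m, hs, hd⟩ := hD.exists_cutoffs he₀ hρ hF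
  intro e he φ ψ hφ hψ
  by_cases hp : ∃ p, p ∈ e₀.source ∧ p ∈ e.source
  · obtain ⟨p, hp₀, hp⟩ := hp
    obtain ⟨f₁, ⟨κ, hκ, hf⟩, -⟩ := (hs.restrict he₀ (hη.mul_left φ) (hη.mul_right ψ) hη'
      (by rw [mul_assoc, mul_comm η, m]) (by rw [← mul_assoc, m])).transfer he₀ he
      (hη.mul_left φ) (hφ.mul_right η) (hη.mul_right ψ) (hψ.mul_left η) hp₀ hp
    exact ⟨f₁, κ, hκ.congr_op (tsupport_mul_left φ η) (tsupport_mul_right η ψ)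
      fun h u p _ => hd φ ψ h u p, hf⟩
  · refine ⟨_, ResAt.symAt ⟨_, (IsLocalKernel.zero e e φ ψ).congr_op subset_rfl subset_rfl
      fun h u p hp' => ?_, LRes.zero l⟩⟩
    rw [hd, show (φ * η).1 p = 0 from by_contra fun h0 => hp ⟨p,
      (hη.mul_left φ).2 (subset_tsupport _ h0), hp'⟩]
    simp

include he₀ hρ hF hD in
lemma IsKernelOp.isResidualOff : IsResidualOff l D := by
  obtain ⟨η, η', hη, hη', -, m, hs, hd⟩ := hD.exists_cutoffs he₀ hρ hF
  intro e e' he he' φ ψ hφ hψ hdis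
  obtain ⟨κ, hκ, hf⟩ := (hs.restrict_res he₀ (hη.mul_left φ) (hη.mul_right ψ) hη'
      (by rw [mul_assoc, mul_comm η, m]) (by rw [← mul_assoc, m])
      (hdis.mono (tsupport_mul_left φ η) (tsupport_mul_right η ψ))).transfer he₀ he₀ he he'
      (hη.mul_left φ) (hφ.mul_right η) (hη.mul_right ψ) (hψ.mul_left η)
  exact ⟨κ, hκ.congr_op (tsupport_mul_left φ η) (tsupport_mul_right η ψ)
    fun h u p _ => hd φ ψ h u p, hf⟩

include he₀ hρ hF hD in
lemma IsKernelOp.symbolOf (h0 : ∀ P : PuncturedCotangent n X, P.1.1 ∉ tsupport ρ.1 → t P = 0) (h1 :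
    ∀ p ∈ tsupport ρ.1, ∀ ξ ≠ 0, inCoords e₀ t (e₀ p, ξ) = (ρ.1 p * ρ.1 p) * f (e₀ p, ξ)) : SymbolOf
    r l D t := by
  obtain ⟨η, η', hη, hη', hη1, -, hs, -⟩ := hD.exists_cutoffs he₀ hρ hF
  obtain ⟨t₀, ht₀⟩ := exists_symbolOf (hD.isSymbolic he₀ hρ hF)
  suffices t = t₀ from this ▸ ht₀
  funext P
  by_cases hP : P.1.1 ∈ tsupport ρ.1
  · have hp := hρ.2 hP
    obtain ⟨ξ, hξ, hξP⟩ := exists_covector_eq he₀ P hp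
    rw [← inCoords_eq hξP t, ← inCoords_eq hξP t₀, h1 _ hP ξ hξ, ht₀ e₀ he₀ η' hη' _ hs _
      (e₀.map_source hp) (by rw [e₀.left_inv hp]; exact hη1 _ hP) ξ hξ]
    simp only [extE_map hp]
  · have hp := mem_chart_source (E n) P.1.1
    obtain ⟨φ, hφ, hφs, hφ1⟩ := exists_isCutoff (e := chartAt (E n) P.1.1) (K := {P.1.1})
      isCompact_singleton ((chartAt (E n) P.1.1).open_source.inter
        (isClosed_tsupport ρ.1).isOpen_compl) (singleton_subset_iff.2 ⟨hp, hP⟩) inter_subset_left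
    obtain ⟨ξ, hξ, hξP⟩ := exists_covector_eq (isChart_chartAt P.1.1) P hp
    have hz : ResAt l D (chartAt (E n) P.1.1) (chartAt (E n) P.1.1) φ φ :=
      ⟨_, (IsLocalKernel.zero _ _ φ φ).congr_op subset_rfl subset_rfl fun h u p _ => by
        rw [hD.apply_eq_zero]
        · simp
        · rw [← mul_assoc]
          refine Subtype.ext (funext fun q => ?_)
          by_cases hq : q ∈ tsupport φ.1
          · simp [image_eq_zero_of_notMem_tsupport (hφs hq).2]
          · simp [image_eq_zero_of_notMem_tsupport hq], LRes.zero l⟩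
    rw [h0 P hP, ← inCoords_eq hξP t₀, ht₀ _ (isChart_chartAt P.1.1) φ hφ _ hz.symAt _
      ((chartAt (E n) P.1.1).map_source hp)
      (by rw [(chartAt (E n) P.1.1).left_inv hp]; exact hφ1 _ rfl) ξ hξ]

end

/-! ## Surjectivity of the principal symbol -/

lemma sum_op_apply {ι : Type*} (S : Finset ι) (D : ι → OpFamily n X) (h : Ioo (0 : ℝ) 1)
    (u : smoothFn n X) (p : X) : ((∑ i ∈ S, D i) h u).1 p = ∑ i ∈ S, (D i h u).1 p := by
  rw [Finset.sum_apply, LinearMap.sum_apply, AddSubmonoidClass.coe_finsetSum, Finset.sum_apply]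

lemma SymbolOf.sum {ι : Type*} (S : Finset ι) {D : ι → OpFamily n X} {t : ι → PuncturedCotangent n X
    → ℂ} (h : ∀ i, D i ∈ Psi n X k l) (ht : ∀ i, SymbolOf (k - l) l (D i) (t i)) : SymbolOf (k - l)
    l (∑ i ∈ S, D i) (∑ i ∈ S, t i) := by
  classical
  induction S using Finset.induction_on with
  | empty => exact .of_resid (Submodule.zero_mem _)
  | insert i S hi ih =>
    rw [Finset.sum_insert hi, Finset.sum_insert hi]
    exact (ht i).add (mem_psi_iff.1 (h i)).2.1
      (mem_psi_iff.1 (Submodule.sum_mem _ fun j _ => h j)).2.1 ih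

theorem exists_mem_psi_symbolOf (hs : s ∈ Sym n X (l - k)) :
    ∃ A ∈ Psi n X k l, SymbolOf (k - l) l A s := by
  obtain ⟨ρ, hρ, hlf, hK, v, hv⟩ := exists_partition n X
  have hc : ∀ i : X, ∃ D, ∃ F f, HasSym (k - l) l F f ∧
      IsKernelOp D (chartAt (E n) i) (chartAt (E n) i) (ρ i) (ρ i) F ∧
      ∀ p ∈ tsupport (ρ i).1, ∀ ξ ≠ 0, f (chartAt (E n) i p, ξ) =
        v.1 p * inCoords (chartAt (E n) i) s (chartAt (E n) i p, ξ) := fun i => by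
    obtain ⟨χ, hχ, h1⟩ := exists_large_cutoff (hρ i) (hρ i)
    obtain ⟨b, hb, hbc, h2⟩ := hs _ (isChart_chartAt i) _ (hχ.mul_left v)
    obtain ⟨F, hF⟩ := exists_hasSym (k - l) l hb hbc
    obtain ⟨D, hD⟩ := exists_kernelOp (isChart_chartAt i) (isChart_chartAt i) (hρ i) (hρ i)
      hF.smooth
    refine ⟨D, F, _, hF, hD, fun p hp ξ hξ => ?_⟩
    have hp' := (hρ i).2 hp
    have h3 := h2 _ ((chartAt (E n) i).map_source hp') ξ hξ
    rw [(chartAt (E n) i).left_inv hp', neg_sub] at h3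
    rw [← h3]
    simp [(h1 p (Or.inl hp)).self_of_nhds]
  choose D F f hF hD hf using hc
  let t : X → PuncturedCotangent n X → ℂ := fun i P =>
    ((ρ i).1 P.1.1 * (ρ i).1 P.1.1) * (v.1 P.1.1 * s P)
  have ht : ∀ i, SymbolOf (k - l) l (D i) (t i) := fun i => by
    refine (hD i).symbolOf (isChart_chartAt i) (hρ i) (hF i) (fun P hP => ?_) fun p hp ξ hξ => ?_
    · simp only [t, image_eq_zero_of_notMem_tsupport hP, zero_mul]
    · have hp' := (hρ i).2 hp
      obtain ⟨P, hP, hPs⟩ := exists_inCoords_eq (isChart_chartAt i)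
        ((chartAt (E n) i).map_source hp') hξ
      have h1 : P.1.1 = p := (congrArg Sigma.fst hP).trans ((chartAt (E n) i).left_inv hp')
      rw [hf i p hp ξ hξ, hPs, hPs]
      simp only [t, h1]
  have hpsi : ∀ i, D i ∈ Psi n X k l := fun i => mem_psi_iff.2 ⟨(hD i).properlySupported (hρ i),
    (hD i).isSymbolic (isChart_chartAt i) (hρ i) (hF i),
    (hD i).isResidualOff (isChart_chartAt i) (hρ i) (hF i)⟩
  have hz : ∀ i h (u : smoothFn n X) p, (D i h u).1 p ≠ 0 → (ρ i).1 p ≠ 0 ∧ ρ i * u ≠ 0 :=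
    fun i h u p hne => ⟨fun h0 => hne (by rw [hD i, h0, zero_mul]), fun h0 => hne (by
      rw [(hD i).apply_eq_zero h h0]; rfl)⟩
  have hfin : ∀ h (u : smoothFn n X) p, (Function.support fun i => (D i h u).1 p).Finite :=
    fun h u p => (hlf.point_finite p).subset fun i hi => subset_tsupport _ (hz i h u p hi).1
  let A : OpFamily n X := fun h =>
    ⟨⟨fun u => ⟨fun p => ∑ᶠ i, (D i h u).1 p, contMDiff_finsum (fun i => contMDiff_coe _)
      (hlf.subset fun i p hp => subset_tsupport _ (hz i h u p hp).1)⟩, fun u w =>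
      Subtype.ext (funext fun p => by
        simp only [map_add]
        exact finsum_add_distrib (hfin h u p) (hfin h w p))⟩,
      fun z u => Subtype.ext (funext fun p => by
        simp only [map_smul]
        exact (smul_finsum z fun i => (D i h u).1 p).symm)⟩
  have hA : ∀ h (u : smoothFn n X) p, (A h u).1 p = ∑ᶠ i, (D i h u).1 p := fun _ _ _ => rfl
  have hsum : ∀ K, IsCompact K → ∃ S : Finset X, (∀ p ∈ K, ∀ i ∉ S, (ρ i).1 p = 0) ∧
      (∀ p ∈ K, ∀ h (u : smoothFn n X), (A h u).1 p = ((∑ i ∈ S, D i) h u).1 p) := fun K hKc => by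
    obtain ⟨S, -, hS⟩ := hK K hKc
    have h0 : ∀ p ∈ K, ∀ i ∉ S, (ρ i).1 p = 0 := fun p hp i hi => by_contra fun hne =>
      Set.disjoint_left.1 (hS i hi) (subset_tsupport _ hne) hp
    refine ⟨S, h0, fun p hp h u => ?_⟩
    rw [hA, sum_op_apply]
    exact finsum_eq_sum_of_support_subset _ fun i hi => by_contra fun hi' =>
      (hz i h u p hi).1 (h0 p hp i hi')
  have hloc : ∀ φ : smoothFn n X, CSupp φ.1 → ∃ S : Finset X,
      (∀ p ∈ tsupport φ.1, ∀ i ∉ S, (ρ i).1 p = 0) ∧ ∀ (ψ : smoothFn n X) h (u : smoothFn n X) p,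
        φ.1 p * (A h (ψ * u)).1 p = φ.1 p * ((∑ i ∈ S, D i) h (ψ * u)).1 p := fun φ hφ => by
    obtain ⟨S, h0, hS⟩ := hsum _ hφ.isCompact
    refine ⟨S, h0, fun ψ h u p => ?_⟩
    by_cases hp : p ∈ tsupport φ.1
    · rw [hS p hp]
    · rw [image_eq_zero_of_notMem_tsupport hp, zero_mul, zero_mul]
  have hmem : ∀ S : Finset X, ∑ i ∈ S, D i ∈ Psi n X k l := fun S =>
    Submodule.sum_mem _ fun i _ => hpsi i
  refine ⟨A, mem_psi_iff.2 ⟨fun K hKc h₀ _ => ?_, fun e he φ ψ hφ hψ => ?_,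
    fun e e' he he' φ ψ hφ hψ hd => ?_⟩, .of_forall fun e he φ hφ => ?_⟩
  · obtain ⟨S, h0, -⟩ := hsum K hKc
    refine ⟨⋃ i ∈ S, tsupport (ρ i).1, S.isCompact_biUnion fun i _ => (hρ i).1, fun h _ u =>
      ⟨fun hu x hx => finsum_eq_zero_of_forall_eq_zero fun i => by_contra fun hne => ?_,
      fun hu x hx => finsum_eq_zero_of_forall_eq_zero fun i => by_contra fun hne => ?_⟩⟩
    · obtain ⟨h1, h2⟩ := hz i h u x hne
      refine h2 (Subtype.ext (funext fun y => ?_))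
      by_cases hy : y ∈ K
      · have hi : i ∉ S := fun hi => hx (mem_biUnion hi (subset_tsupport _ h1))
        simp [h0 y hy i hi]
      · simp [hu y hy]
    · obtain ⟨h1, h2⟩ := hz i h u x hne
      have hi : i ∈ S := by_contra fun hi => h1 (h0 x hx i hi)
      refine h2 (Subtype.ext (funext fun y => ?_))
      by_cases hy : y ∈ tsupport (ρ i).1
      · simp [hu y (mem_biUnion hi hy)]
      · simp [image_eq_zero_of_notMem_tsupport hy]
  · obtain ⟨S, -, hS⟩ := hloc φ hφ.1
    obtain ⟨g, κ, hκ, hg⟩ := (mem_psi_iff.1 (hmem S)).2.1 e he φ ψ hφ hψ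
    exact ⟨g, κ, hκ.congr_op subset_rfl subset_rfl fun h u p _ => hS ψ h u p, hg⟩
  · obtain ⟨S, -, hS⟩ := hloc φ hφ.1
    obtain ⟨κ, hκ, hg⟩ := (mem_psi_iff.1 (hmem S)).2.2 e e' he he' φ ψ hφ hψ hd
    exact ⟨κ, hκ.congr_op subset_rfl subset_rfl fun h u p _ => hS ψ h u p, hg⟩
  · obtain ⟨S, h0, hS⟩ := hloc φ hφ.1
    obtain ⟨g, κ, hκ, hg⟩ := (mem_psi_iff.1 (hmem S)).2.1 e he φ φ hφ hφ
    refine ⟨g, ⟨κ, hκ.congr_op subset_rfl subset_rfl fun h u p _ => hS φ h u p, hg⟩,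
      fun x hx h1 ξ hξ => ?_⟩
    rw [← SymbolOf.sum S hpsi ht e he φ hφ g ⟨κ, hκ, hg⟩ x hx h1 ξ hξ]
    obtain ⟨P, hP, hPs⟩ := exists_inCoords_eq he hx hξ
    have hPx : P.1.1 = e.symm x := congrArg Sigma.fst hP
    have h2 := hv P.1.1
    rw [finsum_eq_sum_of_support_subset (s := S) _ fun i hi => by_contra fun hi' =>
      left_ne_zero_of_mul (show (ρ i).1 P.1.1 * (ρ i).1 P.1.1 ≠ 0 from hi) (h0 _ (hPx ▸ mem_tsupport_of_eventually h1) i hi')] at h2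
    rw [hPs, hPs, Finset.sum_apply]
    simp only [t]
    rw [← Finset.sum_mul]
    linear_combination (-s P) * h2

/-! ## Densities -/

/-- The complex conjugate function. -/
def conjFn (u : smoothFn n X) : smoothFn n X :=
  ⟨fun p => (starRingEnd ℂ) (u.1 p), conjCLE.contDiff.contMDiff.comp u.2⟩

lemma tsupport_conjFn (u : smoothFn n X) : tsupport (conjFn u).1 = tsupport u.1 :=
  congrArg closure (Set.ext fun p => (map_ne_zero _ : (starRingEnd ℂ) (u.1 p) ≠ 0 ↔ _))

lemma IsCutoff.conj (h : IsCutoff e φ) : IsCutoff e (conjFn φ) :=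
  h.of_subset (tsupport_conjFn φ).subset

lemma conjFn_conjFn (u : smoothFn n X) : conjFn (conjFn u) = u :=
  Subtype.ext (funext fun _ => conj_conj _)

variable [MeasurableSpace X] [BorelSpace X] {μ : Measure X} {w w' : E n → ℝ}

/-- The density of `μ` in the chart `e` is `w`. -/
def IsDensityIn (μ : Measure X) (e : OpenPartialHomeomorph X (E n)) (w : E n → ℝ) : Prop :=
  SmoothOn w e.target ∧ (∀ x ∈ e.target, 0 < w x) ∧ (μ.restrict e.source).map e =
    (volume.restrict e.target).withDensity (fun x => ENNReal.ofReal (w x))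

/-- The `L²` pairing. -/
def pair (μ : Measure X) (u v : smoothFn n X) : ℂ := ∫ x, u.1 x * (starRingEnd ℂ) (v.1 x) ∂μ

lemma IsDensityIn.pair (hw : IsDensityIn μ e w)
    (h0 : ∀ p ∉ e.source, u.1 p * (starRingEnd ℂ) (v.1 p) = 0) :
    TwoMicro.pair μ u v = ∫ x, extE e (fun p => u.1 p * (starRingEnd ℂ) (v.1 p)) x * w x := by
  let g : X → ℂ := fun p => u.1 p * (starRingEnd ℂ) (v.1 p)
  have hm : AEMeasurable e (μ.restrict e.source) :=
    e.continuousOn.aemeasurable e.open_source.measurableSet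
  have hc : ContinuousOn (extE e g) e.target :=
    (((contMDiff_coe u).continuous.mul (contMDiff_coe (conjFn v)).continuous).comp_continuousOn
      e.continuousOn_symm).congr fun x hx => extE_apply hx g
  rw [TwoMicro.pair, ← setIntegral_eq_integral_of_forall_compl_eq_zero h0,
    ← setIntegral_congr_fun e.open_source.measurableSet fun p hp => extE_map hp g,
    ← integral_map (f := extE e g) hm, hw.2.2, integral_withDensity_eq_integral_toReal_smul₀,
    setIntegral_congr_fun (g := fun x => extE e g x * w x) e.open_target.measurableSet
      fun x hx => ?_, setIntegral_eq_integral_of_forall_compl_eq_zero fun x hx => ?_]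
  · rw [extE, if_neg hx, zero_mul]
  · simp only [ENNReal.toReal_ofReal (hw.2.1 x hx).le, real_smul]
    exact mul_comm _ _
  · exact ENNReal.measurable_ofReal.comp_aemeasurable
      (hw.1.continuousOn.aemeasurable e.open_target.measurableSet)
  · exact Eventually.of_forall fun x => ENNReal.ofReal_lt_top
  · rw [hw.2.2]
    exact (hc.aestronglyMeasurable e.open_target.measurableSet).mono_ac
      (withDensity_absolutelyContinuous _ _)

lemma IsSmoothDensity.isLocallyFiniteMeasure (hμ : IsSmoothDensity n μ) :
    IsLocallyFiniteMeasure μ := ⟨fun p => by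
  let e := chartAt (E n) p
  have hp : p ∈ e.source := mem_chart_source (E n) p
  obtain ⟨w, hw⟩ := hμ e (isChart_chartAt p)
  obtain ⟨K, hK, hpK, hKe⟩ := exists_compact_subset e.open_target (e.map_source hp)
  refine ⟨e ⁻¹' K ∩ e.source, inter_mem (e.continuousAt hp (mem_interior_iff_mem_nhds.1 hpK))
    (e.open_source.mem_nhds hp), ?_⟩
  rw [← Measure.restrict_apply' e.open_source.measurableSet, ← Measure.map_apply_of_aemeasurable
    (e.continuousOn.aemeasurable e.open_source.measurableSet) hK.measurableSet, hw.2.2,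
    withDensity_apply _ hK.measurableSet, Measure.restrict_restrict hK.measurableSet,
    inter_eq_left.2 hKe]
  exact ((hw.1.continuousOn.mono hKe).integrableOn_compact hK).lintegral_lt_top⟩

lemma pair_mul (χ u v : smoothFn n X) : pair μ (χ * u) v = pair μ u (conjFn χ * v) := by
  simp only [pair]
  congr 1; funext x
  simp only [MulMemClass.coe_mul, Pi.mul_apply, conjFn, map_mul, conj_conj]
  ring

lemma pair_integrable (hμ : IsSmoothDensity n μ) (hu : CSupp u.1) :
    Integrable (fun x => u.1 x * (starRingEnd ℂ) (v.1 x)) μ := by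
  have := hμ.isLocallyFiniteMeasure
  exact ((contMDiff_coe u).continuous.mul (contMDiff_coe (conjFn v)).continuous)
    |>.integrable_of_hasCompactSupport (hu.mul_right)

lemma exists_pair_linear (hμ : IsSmoothDensity n μ) (hu : CSupp u.1) :
    ∃ L : smoothFn n X →ₗ⋆[ℂ] ℂ, ∀ v, L v = pair μ u v :=
  ⟨⟨⟨pair μ u, fun v v' => by
    simp only [pair]
    rw [← integral_add (pair_integrable hμ hu) (pair_integrable hμ hu)]
    simp [mul_add]⟩, fun z v => by
    simp only [pair, smul_eq_mul]
    rw [← integral_const_mul]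
    simp [mul_left_comm]⟩, fun _ => rfl⟩

lemma pair_sum {ι : Type*} (hμ : IsSmoothDensity n μ) (S : Finset ι) {u : ι → smoothFn n X} (hu : ∀
    i, CSupp (u i).1) : pair μ (∑ i ∈ S, u i) v = ∑ i ∈ S, pair μ (u i) v := by
  simp only [pair]
  rw [← integral_finsetSum S fun i _ => pair_integrable hμ (hu i)]
  simp [Finset.sum_mul]

lemma eq_zero_of_pair (hμ : IsSmoothDensity n μ) {U : Set X} (hU : IsOpen U) (H : ∀ u : smoothFn n
    X, CSupp u.1 → tsupport u.1 ⊆ U → pair μ u v = 0) {p : X} (hpU : p ∈ U) : v.1 p = 0 := by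
  let e := chartAt (E n) p
  have he : IsChart e := isChart_chartAt p
  have hp : p ∈ e.source := mem_chart_source (E n) p
  obtain ⟨w, hw⟩ := hμ e he
  obtain ⟨χ, hχ, hχU, h1⟩ := exists_isCutoff (e := e) (K := {p}) isCompact_singleton
    (e.open_source.inter hU) (singleton_subset_iff.2 ⟨hp, hpU⟩) inter_subset_left
  have hc := hχ.mul_right (conjFn v)
  have hs := hc.tsupport_extE.trans hc.image_subset
  have h2 := eq_of_integral_eq he (contDiff_mul_of_tsupport e.open_target
    (ofRealCLM.contDiff.comp_contDiffOn hw.1) (hc.contDiff_extE he) hs)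
    (hc.hasCompactSupport_extE.mul_right) (tsupport_mul_subset_left.trans hs) (fun u => ?_) (e p)
  · rw [extE_map hp] at h2
    have h3 := (mul_eq_zero.1 h2).resolve_right
      (ofReal_ne_zero.2 (hw.2.1 _ (e.map_source hp)).ne')
    simpa [(h1 p rfl).self_of_nhds, conjFn] using h3
  · have hsu := tsupport_mul_left χ u
    rw [← H (χ * u) (hχ.mul_right u).1 (hsu.trans (hχU.trans inter_subset_right)),
      IsDensityIn.pair hw fun p hp => by
        rw [image_eq_zero_of_notMem_tsupport fun h => hp (hχ.2 (hsu h)), zero_mul]]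
    congr 1; funext y
    by_cases hy : y ∈ e.target
    · simp only [extE_apply hy, MulMemClass.coe_mul, Pi.mul_apply, conjFn,
        Function.comp_apply, Complex.ofRealCLM_apply]; ring
    · simp [extE, hy]

lemma eq_of_pair (hμ : IsSmoothDensity n μ) {v v' : smoothFn n X}
    (H : ∀ u : smoothFn n X, CSupp u.1 → pair μ u v = pair μ u v') : v = v' := by
  refine Subtype.ext (funext fun p => sub_eq_zero.1 ?_)
  refine eq_zero_of_pair (v := v - v') hμ isOpen_univ (fun u hu _ => ?_) (mem_univ p)
  obtain ⟨L, hL⟩ := exists_pair_linear hμ hu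
  rw [← hL, map_sub, hL, hL, H u hu, sub_self]

/-! ## Adjoints of local kernels -/

/-- The ratio of two densities. -/
def adjWeight (e e' : OpenPartialHomeomorph X (E n)) (χ χ' : smoothFn n X) (w w' : E n → ℝ) :
    E n × E n → ℂ := fun p =>
  (extE e χ.1 p.1 * (((w p.1)⁻¹ : ℝ) : ℂ)) * (extE e' χ'.1 p.2 * ((w' p.2 : ℝ) : ℂ))

lemma adjWeight_contDiff (he : IsChart e) (he' : IsChart e') (hw : IsDensityIn μ e w)
    (hw' : IsDensityIn μ e' w') (hχ : IsCutoff e χ) (hχ' : IsCutoff e' χ') :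
    Smooth (adjWeight e e' χ χ' w w') :=
  ((contDiff_mul_of_tsupport e.open_target (ofRealCLM.contDiff.comp_contDiffOn
    (hw.1.inv fun x hx => (hw.2.1 x hx).ne')) (hχ.contDiff_extE he)
    (hχ.tsupport_extE.trans hχ.image_subset)).comp contDiff_fst).mul
  ((contDiff_mul_of_tsupport e'.open_target (ofRealCLM.contDiff.comp_contDiffOn
    hw'.1) (hχ'.contDiff_extE he')
    (hχ'.tsupport_extE.trans hχ'.image_subset)).comp contDiff_snd)

lemma IsLocalKernel.pair_eq (hκ : IsLocalKernel A e e' φ ψ κ) (he : IsChart e) (he' : IsChart e')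
    (hφ : IsCutoff e φ) (hψ : IsCutoff e' ψ) (hw : IsDensityIn μ e w) (hw' : IsDensityIn μ e' w')
    (hχ : IsCutoff e χ) (hχ' : IsCutoff e' χ') (h1 : χ * φ = φ) (h2 : χ' * ψ = ψ) (hC : IsKernelOp C
    e' e χ' χ fun q => adjWeight e' e χ' χ w' w (q.1, q.2.1) * conjK (swapK κ) q) (h : Ioo (0 : ℝ)
    1) (u v : smoothFn n X) : pair μ (φ * A h (ψ * u)) v = pair μ u (C h v) := by
  have hcu := hχ'.mul_right u
  have hcv := hχ.mul_right (conjFn v)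
  let V : E n → ℂ := fun x => extE e (χ * conjFn v).1 x * ((w x : ℝ) : ℂ)
  have hV : Smooth V := contDiff_mul_of_tsupport e.open_target
    (ofRealCLM.contDiff.comp_contDiffOn hw.1) (hcv.contDiff_extE he)
    (hcv.tsupport_extE.trans hcv.image_subset)
  let J : E n → E n → ℂ := fun x y => κ (x, y, h) * (extE e' (χ' * u).1 y * V x)
  have hsupp : ∀ x y, κ (x, y, h) ≠ 0 → (x ∈ e.target ∧ χ.1 (e.symm x) = 1) ∧
      y ∈ e'.target ∧ χ'.1 (e'.symm y) = 1 := by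
    intro x y hne
    obtain ⟨⟨p, hp, rfl⟩, q, hq, rfl⟩ := hκ.supp x y h h.2.1 h.2.2 hne
    rw [e.left_inv (hφ.2 hp), e'.left_inv (hψ.2 hq)]
    exact ⟨⟨e.map_source (hφ.2 hp), eq_one_of_mul_eq h1 p hp⟩, e'.map_source (hψ.2 hq),
      eq_one_of_mul_eq h2 q hq⟩
  have hJ : Integrable (Function.uncurry J) (volume.prod volume) := by
    refine Continuous.integrable_of_hasCompactSupport ?_ (HasCompactSupport.intro
      (hcv.isCompact_image.prod hcu.isCompact_image) fun z hz => by_contra fun hne => hz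
        ⟨extE_ne_zero_mem (left_ne_zero_of_mul (right_ne_zero_of_mul (right_ne_zero_of_mul hne))),
        extE_ne_zero_mem (left_ne_zero_of_mul (right_ne_zero_of_mul hne))⟩)
    have c1 : Continuous fun z : E n × E n => κ (z.1, z.2, h) :=
      hκ.smooth.continuousOn.comp_continuous (by fun_prop) fun _ => mem_kernelDomain h.2.1 h.2.2
    exact c1.mul (((hcu.contDiff_extE he').continuous.comp continuous_snd).mul
      (hV.continuous.comp continuous_fst))
  rw [hw.pair, hw'.pair]
  · trans ∫ x, ∫ y, J x y
    · congr 1; funext x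
      by_cases hx : x ∈ e.target
      · have h3 := hκ.eq h u (e.symm x) (e.map_target hx)
        rw [e.right_inv hx] at h3
        rw [extE_apply hx, MulMemClass.coe_mul, Pi.mul_apply, h3, mul_assoc, ← integral_mul_const]
        congr 1; funext y
        by_cases hne : κ (x, y, h) = 0
        · simp [J, hne]
        · obtain ⟨⟨-, k1⟩, hy, k2⟩ := hsupp x y hne
          simp only [J, V, extE_apply hx, extE_apply hy, MulMemClass.coe_mul, Pi.mul_apply, k1, k2,
            conjFn]
          ring
      · simp [J, V, extE, hx]
    · rw [integral_integral_swap hJ]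
      congr 1; funext y
      by_cases hy : y ∈ e'.target
      · rw [extE_apply hy, hC, e'.right_inv hy, map_mul, ← integral_conj, ← integral_const_mul,
          ← integral_const_mul, ← integral_mul_const]
        congr 1; funext x
        by_cases hne : κ (x, y, h) = 0
        · simp [J, hne, conjK, swapK]
        · obtain ⟨⟨hx, k1⟩, -, k2⟩ := hsupp x y hne
          have h0 : ((w' y : ℝ) : ℂ) ≠ 0 := ofReal_ne_zero.2 (hw'.2.1 y hy).ne'
          simp only [J, V, adjWeight, conjK, swapK, extE_apply hx, extE_apply hy,
            MulMemClass.coe_mul, Pi.mul_apply, k1, k2, conjFn, map_mul, map_one,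
            conj_conj, conj_ofReal, Complex.ofReal_inv, map_inv₀]
          field_simp
      · simp [J, extE, hy]
  · intro p hp
    rw [hC, image_eq_zero_of_notMem_tsupport fun h => hp (hχ'.2 h)]
    simp
  · intro p hp
    simp [image_eq_zero_of_notMem_tsupport fun h => hp (hφ.2 h)]

/-! ## Formal adjoints -/

lemma IsLocalKernel.exists_adjoint (hκ : IsLocalKernel A e e' φ ψ κ) (he : IsChart e) (he' : IsChart
    e') (hφ : IsCutoff e φ) (hψ : IsCutoff e' ψ) (hw : IsDensityIn μ e w) (hw' : IsDensityIn μ e'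
    w') : ∃ (χ χ' : smoothFn n X) (C : OpFamily n X), IsCutoff e χ ∧ IsCutoff e' χ' ∧ χ * φ = φ ∧ χ'
    * ψ = ψ ∧ (∀ h u v, pair μ (φ * A h (ψ * u)) v = pair μ u (C h v)) ∧ IsKernelOp C e' e χ' χ fun
    q => adjWeight e' e χ' χ w' w (q.1, q.2.1) * conjK (swapK κ) q := by
  obtain ⟨χ, hχ, h1⟩ := exists_large_cutoff hφ hφ
  obtain ⟨χ', hχ', h2⟩ := exists_large_cutoff hψ hψ
  have m1 := mul_eq_of_eq_one fun x hx => (h1 x (Or.inl hx)).self_of_nhds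
  have m2 := mul_eq_of_eq_one fun x hx => (h2 x (Or.inl hx)).self_of_nhds
  obtain ⟨C, hC⟩ := exists_kernelOp he' he hχ' hχ (((adjWeight_contDiff he' he hw' hw hχ' hχ).comp
    (f := fun q : KPt n => (q.1, q.2.1)) (by fun_prop)).contDiffOn.mul
    (conjK_smooth (swapK_smooth hκ.smooth)))
  exact ⟨χ, χ', C, hχ, hχ', m1, m2, hκ.pair_eq he he' hφ hψ hw hw' hχ hχ' m1 m2 hC, hC⟩

lemma exists_adjoint_cutoff (hμ : IsSmoothDensity n μ) (hA : A ∈ Psi n X k l) (he' : IsChart e') (hψ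
    : IsCutoff e' ψ) (h : Ioo (0 : ℝ) 1) (v : smoothFn n X) : ∃ w, ∀ u : smoothFn n X, CSupp u.1 →
    pair μ (A h (ψ * u)) v = pair μ u w := by
  obtain ⟨a1, a2, a3⟩ := mem_psi_iff.1 hA
  obtain ⟨K, hK, hAK⟩ := a1 _ hψ.1 h h.2.2
  obtain ⟨ρ, hρ, -, hS, -⟩ := exists_partition n X
  obtain ⟨S, hS, -⟩ := hS K hK
  obtain ⟨η, hη, h1⟩ := exists_large_cutoff hψ hψ
  let g : Option X → smoothFn n X := fun o => o.elim η fun i => ρ i * (1 - η)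
  let c : Option X → OpenPartialHomeomorph X (E n) := fun o => o.elim e' (chartAt (E n))
  have hg : ∀ o, IsCutoff (c o) (g o) := fun o => by
    cases o with
    | none => exact hη
    | some i => exact (hρ i).mul_right _
  have key : ∀ o, ∃ w, ∀ u : smoothFn n X, pair μ (g o * A h (ψ * u)) v = pair μ u w := fun o => by
    have hc : IsChart (c o) ∧ ∃ κ, IsLocalKernel A (c o) e' (g o) ψ κ := by
      cases o with
      | none =>
        obtain ⟨f, κ, hκ, -⟩ := a2 e' he' η ψ hη hψ
        exact ⟨he', κ, hκ⟩
      | some i =>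
        obtain ⟨κ, hκ, -⟩ := a3 _ e' (isChart_chartAt i) he' (g (some i)) ψ (hg (some i)) hψ
          ((disjoint_of_eventually_zero (θ := 1 - η) fun x hx => by
            filter_upwards [h1 x (Or.inl hx)] with y hy
            simp [hy]).mono_left (tsupport_mul_right _ _))
        exact ⟨isChart_chartAt i, κ, hκ⟩
    obtain ⟨hc, κ, hκ⟩ := hc
    obtain ⟨w, hw⟩ := hμ _ hc
    obtain ⟨w', hw'⟩ := hμ _ he'
    obtain ⟨-, -, C, -, -, -, -, hC, -⟩ := hκ.exists_adjoint hc he' (hg o) hψ hw hw'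
    exact ⟨C h v, fun u => hC h u v⟩
  choose w hw using key
  refine ⟨∑ o ∈ Finset.insertNone S, w o, fun u hu => ?_⟩
  obtain ⟨L, hL⟩ := exists_pair_linear hμ hu
  rw [← hL, map_sum]
  simp only [hL, ← hw]
  rw [← pair_sum hμ _ fun o => ((hg o).mul_right _).1, ← Finset.sum_mul]
  congr 1
  refine (Subtype.ext (funext fun p => ?_)).symm
  by_cases hp : p ∈ K
  · have h2 := hS p hp
    simp only [Finset.sum_insertNone, g, Option.elim, ← Finset.sum_mul, MulMemClass.coe_mul,
      Pi.mul_apply, AddMemClass.coe_add, Pi.add_apply, AddSubmonoidClass.coe_finsetSum,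
      Finset.sum_apply, h2]
    simp
  · have h2 := (hAK h le_rfl (ψ * u)).1 (fun x hx => by
      simp [image_eq_zero_of_notMem_tsupport hx]) p hp
    simp [h2]

theorem exists_adjoint (hμ : IsSmoothDensity n μ) (hA : A ∈ Psi n X k l) : ∃ B : OpFamily n X,
    ∀ h u v, CSupp u.1 → pair μ (A h u) v = pair μ u (B h v) := by
  obtain ⟨ρ, hρ, hlf, hK, q, hq⟩ := exists_partition n X
  have key : ∀ (h : Ioo (0 : ℝ) 1) (v : smoothFn n X), ∃ w, ∀ u : smoothFn n X,
      CSupp u.1 → pair μ (A h u) v = pair μ u w := fun h v => by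
    choose w hw using fun i => exists_adjoint_cutoff hμ hA (isChart_chartAt i) (hρ i) h v
    let b : X → smoothFn n X := fun i => conjFn (ρ i * q) * w i
    have hb : ∀ i p, (b i).1 p ≠ 0 → (ρ i).1 p ≠ 0 := fun i p hne h0 => hne (by
      simp [b, conjFn, h0])
    refine ⟨⟨fun p => ∑ᶠ i, (b i).1 p, contMDiff_finsum (fun i => contMDiff_coe _)
      (hlf.subset fun i p hp => subset_tsupport _ (hb i p hp))⟩, fun u hu => ?_⟩
    obtain ⟨S, -, hS⟩ := hK _ hu.isCompact
    have h0 : ∀ p ∈ tsupport u.1, ∀ i, (ρ i).1 p ≠ 0 → i ∈ S := fun p hp i hi => by_contra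
      fun hi' => Set.disjoint_left.1 (hS i hi') (subset_tsupport _ hi) hp
    obtain ⟨L, hL⟩ := exists_pair_linear (μ := μ) hμ hu
    have h1 : u = ∑ i ∈ S, ρ i * (ρ i * q * u) := Subtype.ext (funext fun p => by
      by_cases hp : p ∈ tsupport u.1
      · have h2 := hq p
        rw [finsum_eq_sum_of_support_subset (s := S) _ fun i hi => h0 p hp i
          (left_ne_zero_of_mul (show (ρ i).1 p * (ρ i).1 p ≠ 0 from hi))] at h2
        simp only [← mul_assoc, ← Finset.sum_mul]
        simp only [MulMemClass.coe_mul, Pi.mul_apply, AddSubmonoidClass.coe_finsetSum,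
          Finset.sum_apply]
        linear_combination (-u.1 p) * h2
      · simp [image_eq_zero_of_notMem_tsupport hp])
    have hc : ∀ i, CSupp (ρ i * q * u).1 := fun i => ((hρ i).mul_right q |>.mul_right u).1
    trans pair μ u (∑ i ∈ S, b i)
    · conv_lhs => rw [h1]
      rw [map_sum, pair_sum hμ, ← hL, map_sum]
      · refine Finset.sum_congr rfl fun i _ => ?_
        rw [hw i _ (hc i), pair_mul, hL]
      · intro i
        obtain ⟨K, hK, hAK⟩ := hA.1 _ (hρ i).1 h h.2.2
        exact .intro hK fun p hp => (hAK h le_rfl _).1 (fun x hx => by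
          simp [image_eq_zero_of_notMem_tsupport hx]) p hp
    · simp only [pair]
      congr 1; funext p
      by_cases hp : p ∈ tsupport u.1
      · rw [finsum_eq_sum_of_support_subset (s := S) _ fun i hi => h0 p hp i (hb i p hi),
          AddSubmonoidClass.coe_finsetSum, Finset.sum_apply]
      · simp [image_eq_zero_of_notMem_tsupport hp]
  choose w hw using key
  refine ⟨fun h => ⟨⟨w h, fun v v' => eq_of_pair hμ fun u hu => ?_⟩, fun z v =>
    eq_of_pair hμ fun u hu => ?_⟩, fun h u v hu => hw h v u hu⟩
  all_goals
    obtain ⟨K, hK, hAK⟩ := hA.1 _ hu.isCompact h h.2.2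
    obtain ⟨L, hL⟩ := exists_pair_linear hμ hu
    obtain ⟨L', hL'⟩ := exists_pair_linear (u := A h u) hμ (.intro hK fun p hp =>
      (hAK h le_rfl _).1 (fun x hx => image_eq_zero_of_notMem_tsupport hx) p hp)
  · rw [← hw h _ u hu, ← hL', ← hL, map_add, map_add, hL', hL', hL, hL, hw h v u hu, hw h v' u hu]
  · simp only [RingHom.id_apply]
    rw [← hw h _ u hu, ← hL', ← hL, map_smulₛₗ, map_smulₛₗ, hL', hL, hw h v u hu]

section

variable (hμ : IsSmoothDensity n μ)
  (hAB : ∀ h u v, CSupp u.1 → pair μ (A h u) v = pair μ u (B h v))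

lemma pair_eq_zero (H : ∀ p, u.1 p = 0 ∨ v.1 p = 0) : pair μ u v = 0 := by
  simp only [pair]
  rw [integral_congr_ae (Eventually.of_forall fun p => ?_), integral_zero]
  rcases H p with h | h <;> simp [h]

include hμ hAB in
lemma ProperlySupported.adjoint (hA : ProperlySupported A) : ProperlySupported B := by
  intro K hK h₀ h1
  have : LocallyCompactSpace X := ChartedSpace.locallyCompactSpace (E n) X
  obtain ⟨K₂, hK₂, hKK⟩ := exists_compact_superset hK
  obtain ⟨K₁, hK₁, H₁⟩ := hA K hK h₀ h1
  obtain ⟨K₃, hK₃, H₃⟩ := hA K₂ hK₂ h₀ h1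
  refine ⟨K₁ ∪ K₃, hK₁.union hK₃, fun h hh v => ⟨fun hv p hp => ?_, fun hv p hp => ?_⟩⟩
  · refine eq_zero_of_pair hμ hK₁.isClosed.isOpen_compl (fun u hu hus => ?_) fun h => hp (Or.inl h)
    rw [← hAB h u v hu]
    refine pair_eq_zero fun x => (em (x ∈ K)).imp (fun hx => (H₁ h hh u).2 (fun y hy => ?_) x hx)
      (hv x)
    exact image_eq_zero_of_notMem_tsupport fun h' => hus h' hy
  · refine eq_zero_of_pair hμ isOpen_interior (fun u hu hus => ?_) (hKK hp)
    rw [← hAB h u v hu]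
    refine pair_eq_zero fun x => or_iff_not_imp_right.2 fun hx => (H₃ h hh u).1 (fun y hy => ?_) x
      fun h' => hx (hv x (Or.inr h'))
    exact image_eq_zero_of_notMem_tsupport fun h' => hy (interior_subset (hus h'))

include hμ hAB in
lemma IsLocalKernel.adjoint (hκ : IsLocalKernel A e' e (conjFn ψ) (conjFn φ) κ) (he : IsChart e)
    (he' : IsChart e') (hφ : IsCutoff e φ) (hψ : IsCutoff e' ψ) (hw : IsDensityIn μ e w) (hw' :
    IsDensityIn μ e' w') : ∃ Θ : E n × E n → ℂ, Smooth Θ ∧ (∀ x ∈ e.target, ∀ y ∈ e'.target, φ.1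
    (e.symm x) = 1 → ψ.1 (e'.symm y) = 1 → Θ (x, y) = (((w x)⁻¹ : ℝ) : ℂ) * ((w' y : ℝ) : ℂ)) ∧
    IsLocalKernel B e e' φ ψ fun q => Θ (q.1, q.2.1) * conjK (swapK κ) q := by
  obtain ⟨χ', χ, C, hχ', hχ, m1, m2, hC, hCk⟩ := hκ.exists_adjoint he' he hψ.conj hφ.conj hw' hw
  obtain ⟨η, -, h1⟩ := exists_large_cutoff hχ hχ
  obtain ⟨η', -, h2⟩ := exists_large_cutoff hχ' hχ'
  have k1 : η * χ = χ := mul_eq_of_eq_one fun x hx => (h1 x (Or.inl hx)).self_of_nhds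
  have k2 : η' * χ' = χ' := mul_eq_of_eq_one fun x hx => (h2 x (Or.inl hx)).self_of_nhds
  have hone : ∀ {α β : smoothFn n X}, α * conjFn β = conjFn β → ∀ p ∈ tsupport β.1, α.1 p = 1 :=
    fun {_ β} hm p hp => eq_one_of_mul_eq hm p ((tsupport_conjFn β).symm ▸ hp)
  have hw1 := adjWeight_contDiff he he' hw hw' hχ hχ'
  have hF : SmoothOn (fun q : KPt n => adjWeight e e' χ χ' w w' (q.1, q.2.1) *
      conjK (swapK κ) q) (KD n) := (hw1.comp (f := fun q : KPt n => (q.1, q.2.1))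
    (by fun_prop)).contDiffOn.mul (conjK_smooth (swapK_smooth hκ.smooth))
  have hCl := hCk.isLocalKernel he he' hχ hχ' hF k1 k2
  have hBC : ∀ h v, φ * B h (ψ * v) = C h v := fun h v => eq_of_pair hμ fun u hu => by
    have h3 := pair_mul (μ := μ) (conjFn φ) u (B h (ψ * v))
    have h4 := pair_mul (μ := μ) (conjFn ψ) (A h (conjFn φ * u)) v
    rw [conjFn_conjFn] at h3 h4
    rw [← h3, ← hAB h _ _ (hφ.conj.mul_right u).1, ← h4, hC]
  refine ⟨fun p => (extE e χ.1 p.1 * extE e' χ'.1 p.2) * adjWeight e e' χ χ' w w' p,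
    (extE_prod_contDiff he he' hχ hχ').mul hw1, fun x hx y hy hφx hψy => ?_,
    (hCl.congr fun q _ => by ring).smooth, fun x y t h0 ht hne => ?_, fun h u p hp => ?_⟩
  · have n1 : χ.1 (e.symm x) = 1 := hone m2 _ (subset_tsupport _ (hφx ▸ one_ne_zero :))
    have n2 : χ'.1 (e'.symm y) = 1 := hone m1 _ (subset_tsupport _ (hψy ▸ one_ne_zero :))
    simp only [adjWeight, extE_apply hx, extE_apply hy, n1, n2, one_mul]
  · have h3 := hκ.supp y x t h0 ht fun h0 => hne (by simp [conjK, swapK, h0])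
    rw [tsupport_conjFn, tsupport_conjFn] at h3
    exact h3.symm
  · have h3 := hCl.eq h u p hp
    have h5 : ψ * (η' * u) = ψ * u := by
      rw [← mul_assoc, mul_comm ψ, mul_eq_of_eq_one fun x hx => eq_one_of_mul_eq k2 x
        (tsupport_subset_of_mul_eq m1 ((tsupport_conjFn ψ).symm ▸ hx))]
    have h6 : η * φ = φ := mul_eq_of_eq_one fun x hx => eq_one_of_mul_eq k1 x
        (tsupport_subset_of_mul_eq m2 ((tsupport_conjFn φ).symm ▸ hx))
    rw [← hBC, h5, MulMemClass.coe_mul, Pi.mul_apply, ← mul_assoc,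
      show η.1 p * φ.1 p = φ.1 p from congrFun (congrArg Subtype.val h6) p] at h3
    rw [h3]
    congr 1; funext y; ring

include hμ hAB in
theorem adjoint_mem_psi (hA : A ∈ Psi n X k l) : B ∈ Psi n X k l := by
  obtain ⟨a1, a2, a3⟩ := mem_psi_iff.1 hA
  refine mem_psi_iff.2 ⟨a1.adjoint hμ hAB, fun e he φ ψ hφ hψ => ?_,
    fun e e' he he' φ ψ hφ hψ hd => ?_⟩
  · obtain ⟨f, κ, hκ, hf⟩ := a2 e he _ _ hψ.conj hφ.conj
    obtain ⟨w, hw⟩ := hμ e he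
    obtain ⟨Θ, hΘ, -, hB⟩ := hκ.adjoint hμ hAB he he hφ hψ hw hw
    exact ⟨_, _, hB, hf.star.mul_contDiff hΘ⟩
  · obtain ⟨κ, hκ, hf⟩ := a3 e' e he' he _ _ hψ.conj hφ.conj
      (by rw [tsupport_conjFn, tsupport_conjFn]; exact hd.symm)
    obtain ⟨w, hw⟩ := hμ e he
    obtain ⟨w', hw'⟩ := hμ e' he'
    obtain ⟨Θ, hΘ, -, hB⟩ := hκ.adjoint hμ hAB he he' hφ hψ hw hw'
    exact ⟨_, hB, hf.swapK.conjK.mul_contDiff (g := fun q => Θ (q.1, q.2.1))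
      (hΘ.comp (by fun_prop))⟩

include hμ hAB in
theorem SymbolOf.adjoint (hA : A ∈ Psi n X k l) (hs : SymbolOf (k - l) l A s) :
    SymbolOf (k - l) l B fun P => (starRingEnd ℂ) (s P) := by
  refine .of_forall fun e he φ hφ => ?_
  obtain ⟨f, κ, hκ, hf⟩ := (mem_psi_iff.1 hA).2.1 e he _ _ hφ.conj hφ.conj
  obtain ⟨w, hw⟩ := hμ e he
  obtain ⟨Θ, hΘ, hΘ1, hB⟩ := hκ.adjoint hμ hAB he he hφ hφ hw hw
  refine ⟨_, ⟨_, hB, hf.star.mul_contDiff hΘ⟩, fun x hx h1 ξ hξ => ?_⟩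
  have h2 := hs e he _ hφ.conj f ⟨κ, hκ, hf⟩ x hx (h1.mono fun p hp => by simp [conjFn, hp]) ξ hξ
  obtain ⟨P, -, hP⟩ := exists_inCoords_eq he hx hξ
  rw [hP, ← h2, hP, hΘ1 x hx x hx h1.self_of_nhds h1.self_of_nhds, ← ofReal_mul,
    inv_mul_cancel₀ (hw.2.1 x hx).ne', ofReal_one, one_mul]

end

/-! ## The principal symbol map -/

variable (n X) in
lemma exists_principalSymbol (k l : ℝ) : ∃ σ : Psi n X k l →ₗ[ℂ] Sym n X (l - k),
    ∀ A : Psi n X k l, SymbolOf (k - l) l A.1 (σ A).1 := by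
  have hA : ∀ A : Psi n X k l, IsSymbolic (k - l) l (A : OpFamily n X) := fun A =>
    (mem_psi_iff.1 A.2).2.1
  choose s hs using fun A => exists_symbolOf (hA A)
  refine ⟨⟨⟨fun A => ⟨s A, (hs A).mem_sym (hA A)⟩, fun A B => Subtype.ext ?_⟩,
    fun z A => Subtype.ext ?_⟩, hs⟩
  · exact (hs (A + B)).unique (hA (A + B)) ((hs A).add (hA A) (hA B) (hs B))
  · exact (hs (z • A)).unique (hA (z • A)) ((hs A).smul z (hA A))

end TwoMicro

end

theorem mainTheorem7 (n : ℕ) (X : Type*) [TopologicalSpace X] [ChartedSpace (TwoMicro.E n) X]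
    [IsManifold 𝓘(ℝ, TwoMicro.E n) ∞ X] [T2Space X] [SecondCountableTopology X]
    [MeasurableSpace X] [BorelSpace X] :
    ∃ σ : ∀ k l : ℝ, TwoMicro.Psi n X k l →ₗ[ℂ] TwoMicro.Sym n X (l - k),
      -- `σ` is the principal symbol, which is well defined
      (∀ (k l : ℝ) (A : TwoMicro.Psi n X k l) (s : TwoMicro.PuncturedCotangent n X → ℂ),
        TwoMicro.IsPrincipalSymbol k l (A : TwoMicro.OpFamily n X) s ↔ s = σ k l A) ∧
      -- it does not see residual operators
      (∀ k l : ℝ, ∃ hR : TwoMicro.Resid n X l ≤ TwoMicro.Psi n X k l,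
        ∀ (A : TwoMicro.Psi n X k l) (R : TwoMicro.Resid n X l),
          σ k l (A + Submodule.inclusion hR R) = σ k l A) ∧
      -- the principal symbol sequence is exact
      (∀ k l : ℝ, ∃ hle : TwoMicro.Psi n X (k - 1) l ≤ TwoMicro.Psi n X k l,
        Function.Injective (Submodule.inclusion hle) ∧
        Function.Exact (Submodule.inclusion hle) (σ k l) ∧
        Function.Surjective (σ k l)) ∧
      -- products
      (∀ (k l k' l' : ℝ) (A : TwoMicro.Psi n X k l) (B : TwoMicro.Psi n X k' l'),
        ∃ hAB : (A : TwoMicro.OpFamily n X) * (B : TwoMicro.OpFamily n X) ∈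
            TwoMicro.Psi n X (k + k') (l + l'),
          ∀ p : TwoMicro.PuncturedCotangent n X,
            (σ (k + k') (l + l') ⟨_, hAB⟩ : TwoMicro.PuncturedCotangent n X → ℂ) p =
              (σ k l A : TwoMicro.PuncturedCotangent n X → ℂ) p *
                (σ k' l' B : TwoMicro.PuncturedCotangent n X → ℂ) p) ∧
      -- adjoints
      (∀ (μ : Measure X), TwoMicro.IsSmoothDensity n μ →
        ∀ (k l : ℝ) (A : TwoMicro.Psi n X k l), ∃ B : TwoMicro.Psi n X k l,
          TwoMicro.IsFormalAdjoint μ (A : TwoMicro.OpFamily n X) (B : TwoMicro.OpFamily n X) ∧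
          ∀ p : TwoMicro.PuncturedCotangent n X,
            (σ k l B : TwoMicro.PuncturedCotangent n X → ℂ) p =
              (starRingEnd ℂ) ((σ k l A : TwoMicro.PuncturedCotangent n X → ℂ) p)) ∧
      -- commutators
      (∀ (k l k' l' : ℝ) (A : TwoMicro.Psi n X k l) (B : TwoMicro.Psi n X k' l'),
        ∃ hAB : Complex.I • ((A : TwoMicro.OpFamily n X) * (B : TwoMicro.OpFamily n X) -
            (B : TwoMicro.OpFamily n X) * (A : TwoMicro.OpFamily n X)) ∈
            TwoMicro.Psi n X (k + k' - 1) (l + l'),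
          TwoMicro.IsPoissonBracket (σ k l A : TwoMicro.PuncturedCotangent n X → ℂ)
            (σ k' l' B : TwoMicro.PuncturedCotangent n X → ℂ)
            (σ (k + k' - 1) (l + l') ⟨_, hAB⟩)) := by
  choose σ hσ using TwoMicro.exists_principalSymbol n X
  have hsym : ∀ k l (A : TwoMicro.Psi n X k l), TwoMicro.IsSymbolic (k - l) l
      (A : TwoMicro.OpFamily n X) := fun k l A => (TwoMicro.mem_psi_iff.1 A.2).2.1
  have huniq : ∀ k l (A : TwoMicro.Psi n X k l) s,
      TwoMicro.SymbolOf (k - l) l (A : TwoMicro.OpFamily n X) s → s = σ k l A :=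
    fun k l A s hs => hs.unique (hsym k l A) (hσ k l A)
  refine ⟨σ, fun k l A s => ?_, fun k l => ⟨TwoMicro.resid_le_psi, fun A R => ?_⟩,
    fun k l => ⟨TwoMicro.psi_mono, Submodule.inclusion_injective _, fun A => ?_, fun s => ?_⟩,
    fun k l k' l' A B => ⟨TwoMicro.mul_mem_psi A.2 B.2, fun p => ?_⟩, fun μ hμ k l A => ?_,
    fun k l k' l' A B => ⟨TwoMicro.commutator_mem_psi A.2 B.2, ?_⟩⟩
  · rw [TwoMicro.isPrincipalSymbol_iff (hsym k l A)]
    exact ⟨huniq k l A s, fun h => h ▸ hσ k l A⟩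
  · rw [map_add, ← (Subtype.ext (huniq k l (Submodule.inclusion _ R) 0 (.of_resid R.2)) :
      (0 : TwoMicro.Sym n X (l - k)) = _), add_zero]
  · refine ⟨fun h => ⟨⟨A, TwoMicro.mem_psi_sub_one A.2 ?_⟩, rfl⟩, ?_⟩
    · have h1 := hσ k l A
      rwa [h] at h1
    · rintro ⟨B, rfl⟩
      exact (Subtype.ext (huniq k l (Submodule.inclusion _ B) 0
        (.of_mem_psi_sub_one B.2))).symm
  · obtain ⟨A, hA, hs⟩ := TwoMicro.exists_mem_psi_symbolOf s.2
    exact ⟨⟨A, hA⟩, (Subtype.ext (huniq k l ⟨A, hA⟩ s hs)).symm⟩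
  · exact (congrFun (huniq _ _ ⟨_, TwoMicro.mul_mem_psi A.2 B.2⟩ _
      (.mul A.2 B.2 (hσ k l A) (hσ k' l' B))) p).symm
  · obtain ⟨B, hB⟩ := TwoMicro.exists_adjoint hμ A.2
    have hB' := TwoMicro.adjoint_mem_psi hμ hB A.2
    exact ⟨⟨B, hB'⟩, fun h u v hu _ => hB h u v hu, fun p => (congrFun (huniq k l ⟨B, hB'⟩ _
      (.adjoint hμ hB A.2 (hσ k l A))) p).symm⟩
  · exact TwoMicro.SymbolOf.commutator A.2 B.2 (hσ k l A) (hσ k' l' B) (hσ _ _ ⟨_, _⟩)
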